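/- **Theorem (feasibility of funnel control).** *Notation.* Let $q,p,s,k\in\mathbb N_0$, $m=q+p$, $h\ge 0$, $r_1,\dots,r_q\in\mathbb N$ (all $\ge 1$), $\bar r=r_1+\dots+r_q$, $\mathbb R_{\ge0}=[0,\infty)$. $\|\cdot\|$ is the Euclidean norm, and for matrices the induced norm. Elements of $W^{n,\infty}(\mathbb R_{\ge0})$, $n\ge1$, are identified with their continuous representatives. *Operators.* $\mathbb T_{n,k,h}$ is the class of operators $T:C([-h,\infty)\to\mathbb R^n)\to L^\infty_{\rm loc}(\mathbb R_{\ge0}\to\mathbb R^k)$ such that (a) $T$ is causal: for all $t\ge0$, $\zeta|_{[-h,t)}=\xi|_{[-h,t)}$ implies $T(\zeta)|_{[0,t)}=T(\xi)|_{[0,t)}$; (b) for all $t\ge0$ and $\xi\in C([-h,t]\to\mathbb R^n)$ there are $\tau,\delta,c>0$ such that for all $\zeta_1,\zeta_2\in C([-h,\infty)\to\mathbb R^n)$ with $\zeta_i|_{[-h,t]}=\xi$ and $\|\zeta_i(u)-\xi(t)\|<\delta$ for $u\in[t,t+\tau]$, $i=1,2$, we have $\|(T(\zeta_1)-T(\zeta_2))|_{[t,t+\tau]}\|_\infty\le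 c\,\|(\zeta_1-\zeta_2)|_{[t,t+\tau]}\|_\infty$; (c) for every $c_1>0$ there is $c_2>0$ such that $\|\zeta\|_\infty\le c_1$ implies $\|T(\zeta)\|_\infty\le c_2$. $\mathbb T^{\rm DAE}_{n,k,h}$ is the class of $T\in\mathbb T_{n,k,h}$ with values in $C^1(\mathbb R_{\ge0}\to\mathbb R^k)$ for which there are $z\in C(\mathbb R^n\times\mathbb R^k\to\mathbb R^k)$ and $\tilde T\in\mathbb T_{n,k,h}$ with $\frac{d}{dt}(T\zeta)(t)=z(\zeta(t),(\tilde T\zeta)(t))$ for all $\zeta$ and all $t\ge0$. By causality these operators are also applied to functions that are only defined on $[-h,\omega)$, or on $[-h,0]$ (in the latter case $T\in\mathbb T^{\rm DAE}_{n,k,h}$ yields the value at $t=0$). *System.* For $y=(y_1,\dots,y_m)$ write $Y(t)=(y_1,\dots,y_1^{(r_1-1)},\dots,y_q,\dots,y_q^{(r_q-1)},y_{q+1},\dots,y_m)(t)\in\mathbb R^{\bar r+p}$. Consider the system with inputs $u_I(t)\in\mathbb R^q$, $u_{II}(t)\in\mathbb R^p$ $$\begin{aligned}\big(y_1^{(r_1)}(t),\dots,y_q^{(r_q)}(t)\big)^\top&=f_1\big(d_1(t),(T_1Y)(t)\big)+\Gamma_I\big(d_2(t),(T_1Y)(t)\big)u_I(t),\\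 0&=f_2(Y(t))+f_3\big(d_3(t),(T_2y)(t)\big)+\Gamma_{II}\big(d_4(t),(T_2y)(t)\big)u_I(t)+f_4\big(d_5(t),(T_2y)(t)\big)u_{II}(t),\end{aligned}$$ $y|_{[-h,0]}=y^0$, where (i) $\Gamma_I\in C(\mathbb R^s\times\mathbb R^k\to\mathbb R^{q\times q})$, $\Gamma_I+\Gamma_I^\top$ is pointwise positive definite, and $\Gamma_{II}\in C^1(\mathbb R^s\times\mathbb R^k\to\mathbb R^{p\times q})$; (ii) $d_1,d_2\in L^\infty(\mathbb R_{\ge0}\to\mathbb R^s)$ and $d_3,d_4,d_5\in W^{1,\infty}(\mathbb R_{\ge0}\to\mathbb R^s)$; (iii) $f_1\in C(\mathbb R^s\times\mathbb R^k\to\mathbb R^q)$, $f_2\in C^1(\mathbb R^{\bar r+p}\to\mathbb R^p)$, $f_3\in C^1(\mathbb R^s\times\mathbb R^k\to\mathbb R^p)$, and $f_2'\left[\begin{smallmatrix}0\\I_p\end{smallmatrix}\right]$ is bounded; (iv) $f_4\in C^1(\mathbb R^s\times\mathbb R^k\to\mathbb R)$ and $f_4\ge\alpha$ for some $\alpha>0$;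 (v) $T_1\in\mathbb T_{\bar r+p,k,h}$ and $T_2\in\mathbb T^{\rm DAE}_{m,k,h}$. The initial data satisfy $y_i^0\in C^{r_i-1}([-h,0]\to\mathbb R)$ for $i\le q$ and $y_i^0\in C([-h,0]\to\mathbb R)$ for $i>q$; if $h=0$, then $y^0$ is a value at $t=0$ and the initial values of $\dot y_i,\dots,y_i^{(r_i-1)}$, $i\le q$, at $0$ are prescribed in addition. *Controller.* Let $\Phi_n$ be the set of $\varphi\in C^n(\mathbb R_{\ge0}\to\mathbb R)$ such that $\varphi,\dots,\varphi^{(n)}$ are bounded, $\varphi(t)>0$ for $t>0$ and $\liminf_{t\to\infty}\varphi(t)>0$, and let $\mathcal F^n_\varphi=\{(t,e)\in\mathbb R_{\ge0}\times\mathbb R^n:\varphi(t)\|e\|<1\}$. Let $y_{{\rm ref},i}\in W^{r_i,\infty}(\mathbb R_{\ge0}\to\mathbb R)$ for $i\le q$, $y_{{\rm ref},i}\in W^{1,\infty}(\mathbb R_{\ge0}\to\mathbb R)$ for $i>q$, $\varphi_I,\varphi_{II}\in\Phi_1$, $\varphi_{ij}\in\Phi_{r_i-j}$ for $1\le i\le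 q$, $0\le j\le r_i-2$, and let $\hat k>0$ satisfy $$\hat k>\alpha^{-1}\sup_{Y\in\mathbb R^{\bar r+p}}\Big\|f_2'(Y)\left[\begin{smallmatrix}0\\I_p\end{smallmatrix}\right]\Big\|.$$ Put $e_i=y_i-y_{{\rm ref},i}$; for $i\le q$ put $e_{i0}=e_i$ and, for $0\le j\le r_i-2$, $k_{ij}=\frac1{1-\varphi_{ij}^2|e_{ij}|^2}$ and $e_{i,j+1}=\dot e_{ij}+k_{ij}e_{ij}$; further $e_I=(e_{1,r_1-1},\dots,e_{q,r_q-1})^\top$, $e_{II}=(e_{q+1},\dots,e_m)^\top$, $k_I=\frac1{1-\varphi_I^2\|e_I\|^2}$, $k_{II}=\frac{\hat k}{1-\varphi_{II}^2\|e_{II}\|^2}$, and let the feedback be $u_I=-k_Ie_I$, $u_{II}=-k_{II}e_{II}$, $u=(u_I^\top,u_{II}^\top)^\top$. At $t=0$ these quantities are determined by the initial data. *Solutions.* A solution of the closed loop on $[-h,\omega)$, $\omega\in(0,\infty]$, is a function $y$ that attains the initial data, with $y_i\in C^{r_i-1}([-h,\omega))$ and $y_i^{(r_i-1)}|_{[0,\omega)}$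 weakly differentiable for $i\le q$, $y_i\in C([-h,\omega))$ and $y_i|_{[0,\omega)}$ weakly differentiable for $i>q$, such that both equations with the above feedback hold almost everywhere on $[0,\omega)$, $y_i^{(r_i)}$ being the weak derivative. It is global if $\omega=\infty$. *Claim.* Let the initial data be consistent, i.e. let the second equation of the closed loop hold at $t=0$, and let $\varphi_I(0)\|e_I(0)\|<1$, $\varphi_{II}(0)\|e_{II}(0)\|<1$ and $\varphi_{ij}(0)|e_{ij}(0)|<1$ for all $1\le i\le q$, $0\le j\le r_i-2$. Then the closed-loop initial value problem has a solution, and every solution can be extended to a global solution. Moreover, for every global solution: 1. $u$, $k_I$, $k_{II}$ and all $k_{ij}$ are bounded on $\mathbb R_{\ge0}$; 2. for all $t\ge0$, $1\le i\le q$, $0\le j\le r_i-2$: $(t,e_I(t))\in\mathcal F^q_{\varphi_I}$, $(t,e_{II}(t))\in\mathcal F^{p}_{\varphi_{II}}$, $(t,e_{ij}(t))\in\mathcal F^1_{\varphi_{ij}}$; and there are $\varepsilon_I,\varepsilon_{II},\varepsilon_{ij}>0$ such that for all $t>0$ $$\|e_I(t)\|\le\varphi_I(t)^{-1}-\varepsilon_I,\qquad\|e_{II}(t)\|\le\varphi_{II}(t)^{-1}-\varepsilon_{II},\qquad|e_{ij}(t)|\le\varphi_{ij}(t)^{-1}-\varepsilon_{ij}.$$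 In particular, each $e_i$ evolves in $\mathcal F^1_{\varphi_{i0}}$ if $i\le q$ and $r_i\ge2$, in $\mathcal F^1_{\varphi_I}$ if $i\le q$ and $r_i=1$, and in $\mathcal F^1_{\varphi_{II}}$ if $i>q$, uniformly away from its boundary. -/

import Mathlib

open MeasureTheory Set Filter Topology
open scoped Matrix

namespace FunnelControl

/-! ### Intervals, weak derivatives and Sobolev regularity on the half-line -/

/-- The interval `[a, ω)` with `ω ∈ (-∞, ∞]`. -/
def ivl (a : ℝ) (ω : EReal) : Set ℝ := {t : ℝ | a ≤ t ∧ (t : EReal) < ω}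

/-- `g` is the weak derivative of `f` on the interval `U`: both functions are locally integrable
on `U`, and integration by parts holds against all smooth test functions with compact support in
the interior of `U`. -/
structure HasWeakDeriv {E : Type*} [NormedAddCommGroup E] [NormedSpace ℝ E]
    (U : Set ℝ) (f g : ℝ → E) : Prop where
  left : LocallyIntegrableOn f U
  right : LocallyIntegrableOn g U
  parts : ∀ θ : ℝ → ℝ, ContDiff ℝ ((⊤ : ℕ∞) : WithTop ℕ∞) θ → HasCompactSupport θ →
    tsupport θ ⊆ interior U → ∫ t, deriv θ t • f t = - ∫ t, θ t • g t

/-- `f ∈ L^∞(ℝ≥0 → E)`. -/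
def MemLinf {E : Type*} [NormedAddCommGroup E] (f : ℝ → E) : Prop :=
  MemLp f ⊤ (volume.restrict (Ici (0 : ℝ)))

/-- `f ∈ W^{n,∞}(ℝ≥0 → E)`: the weak derivatives of order at most `n` exist and lie in `L^∞`. -/
def MemWinf {E : Type*} [NormedAddCommGroup E] [NormedSpace ℝ E] (n : ℕ) (f : ℝ → E) : Prop :=
  ∃ g : ℕ → ℝ → E, g 0 = f ∧ (∀ j ≤ n, MemLinf (g j)) ∧
    ∀ j < n, HasWeakDeriv (Ici (0 : ℝ)) (g j) (g (j + 1))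

/-! ### Operator classes

An operator `C([-h,∞) → E) → L^∞_loc(ℝ≥0 → F)` is given by a map `T` on functions `ℝ → E`, of which
only the values `T ζ` with `ζ` continuous on `[-h,∞)` matter. The function `T ζ` is a representative
of an element of `L^∞_loc`, and two such functions are compared almost everywhere. (By causality,
`T ζ` does not depend, up to a null set, on the values of `ζ` outside `[-h,∞)`.) -/

/-- The operator class `𝕋_{m,k,h}`, where `E = ℝ^m` and `F = ℝ^k`. -/
structure OpClass {E F : Type*} [NormedAddCommGroup E] [NormedAddCommGroup F]
    (h : ℝ) (T : (ℝ → E) → ℝ → F) : Prop where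
  /-- `T ζ` is measurable -/
  measurable : ∀ ζ : ℝ → E, ContinuousOn ζ (Ici (-h)) →
    AEStronglyMeasurable (T ζ) (volume.restrict (Ici (0 : ℝ)))
  /-- `T ζ` is locally essentially bounded -/
  locallyBounded : ∀ ζ : ℝ → E, ContinuousOn ζ (Ici (-h)) → ∀ τ : ℝ, ∃ c : ℝ,
    ∀ᵐ t ∂(volume.restrict (Icc 0 τ)), ‖T ζ t‖ ≤ c
  /-- causality -/
  causal : ∀ t : ℝ, 0 ≤ t → ∀ ζ ξ : ℝ → E,
    ContinuousOn ζ (Ici (-h)) → ContinuousOn ξ (Ici (-h)) → EqOn ζ ξ (Ico (-h) t) →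
    ∀ᵐ u ∂(volume.restrict (Ico 0 t)), T ζ u = T ξ u
  /-- local Lipschitz continuity; the inner condition says
  `‖(T ζ₁ - T ζ₂)|_{[t,t+τ]}‖_∞ ≤ c ‖(ζ₁ - ζ₂)|_{[t,t+τ]}‖_∞` -/
  locallyLipschitz : ∀ t : ℝ, 0 ≤ t → ∀ ξ : ℝ → E, ContinuousOn ξ (Icc (-h) t) →
    ∃ τ > 0, ∃ δ > 0, ∃ c > 0, ∀ ζ₁ ζ₂ : ℝ → E,
      ContinuousOn ζ₁ (Ici (-h)) → ContinuousOn ζ₂ (Ici (-h)) →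
      EqOn ζ₁ ξ (Icc (-h) t) → EqOn ζ₂ ξ (Icc (-h) t) →
      (∀ u ∈ Icc t (t + τ), ‖ζ₁ u - ξ t‖ < δ) → (∀ u ∈ Icc t (t + τ), ‖ζ₂ u - ξ t‖ < δ) →
      ∀ M : ℝ, (∀ u ∈ Icc t (t + τ), ‖ζ₁ u - ζ₂ u‖ ≤ M) →
        ∀ᵐ u ∂(volume.restrict (Icc t (t + τ))), ‖T ζ₁ u - T ζ₂ u‖ ≤ c * M
  /-- bounded trajectories are mapped to bounded trajectories -/
  bounded : ∀ c₁ > 0, ∃ c₂ > 0, ∀ ζ : ℝ → E, ContinuousOn ζ (Ici (-h)) →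
    (∀ t ∈ Ici (-h), ‖ζ t‖ ≤ c₁) → ∀ᵐ t ∂(volume.restrict (Ici (0 : ℝ))), ‖T ζ t‖ ≤ c₂

/-- The operator class `𝕋^DAE_{m,k,h}`. -/
structure OpClassDAE {E F : Type*} [NormedAddCommGroup E] [NormedAddCommGroup F] [NormedSpace ℝ F]
    (h : ℝ) (T : (ℝ → E) → ℝ → F) : Prop where
  opClass : OpClass h T
  contDiff : ∀ ζ : ℝ → E, ContinuousOn ζ (Ici (-h)) → ContDiffOn ℝ 1 (T ζ) (Ici 0)
  derivative : ∃ (z : E × F → F) (T' : (ℝ → E) → ℝ → F), Continuous z ∧ OpClass h T' ∧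
    ∀ ζ : ℝ → E, ContinuousOn ζ (Ici (-h)) → ∀ t : ℝ, 0 ≤ t →
      HasDerivWithinAt (T ζ) (z (ζ t, T' ζ t)) (Ici 0) t

/-- A trajectory stopped at time `τ`. It is used to evaluate a causal operator along a function `y`
which is only defined on `[-h, ω)`: on `[0, τ)` with `τ < ω`, the localization of `T` at `y` is
`T (stopAt τ y)`; by causality every other continuous extension of `y|_{[-h,τ]}` gives the same
function. -/
def stopAt {E : Type*} (τ : ℝ) (y : ℝ → E) : ℝ → E := fun t => y (min t τ)

/-! ### The system class

There are `m = q + p` outputs and inputs, indexed by `Fin q ⊕ Fin p`. The vector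
`(y_1, …, y_1^{(r_1-1)}, …, y_q^{(r_q-1)}, y_{q+1}, …, y_m)` is indexed by
`(Σ i : Fin q, Fin (r i)) ⊕ Fin p`. -/

/-- `ℝ^m` with `m = q + p`. -/
abbrev OutputSpace (q p : ℕ) := EuclideanSpace ℝ (Fin q ⊕ Fin p)

/-- `ℝ^{r_1 + ⋯ + r_q + p}`. -/
abbrev StateSpace {q : ℕ} (r : Fin q → ℕ) (p : ℕ) :=
  EuclideanSpace ℝ ((Σ i : Fin q, Fin (r i)) ⊕ Fin p)

/-- The domain `ℝ^s × ℝ^k` of the coefficient functions. -/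
abbrev CoeffSpace (s k : ℕ) := EuclideanSpace ℝ (Fin s) × EuclideanSpace ℝ (Fin k)

/-- The linear map `[0; I] : ℝ^p → ℝ^{r_1 + ⋯ + r_q + p}`. -/
noncomputable def inclII {q : ℕ} (r : Fin q → ℕ) (p : ℕ) :
    EuclideanSpace ℝ (Fin p) →L[ℝ] StateSpace r p :=
  LinearMap.toContinuousLinearMap
    { toFun := fun v => WithLp.toLp 2 (Sum.elim (fun _ => 0) (fun i => v i))
      map_add' := by
        intro v w
        ext x
        cases x <;> simp
      map_smul' := by
        intro c v
        ext x
        cases x <;> simp }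

/-- The data of a nonlinear functional differential-algebraic system with truncated vector relative
degree `(r_1, …, r_q, 0, …, 0)`. -/
structure System {q : ℕ} (r : Fin q → ℕ) (p s k : ℕ) where
  h : ℝ
  f₁ : CoeffSpace s k → EuclideanSpace ℝ (Fin q)
  f₂ : StateSpace r p → EuclideanSpace ℝ (Fin p)
  f₃ : CoeffSpace s k → EuclideanSpace ℝ (Fin p)
  f₄ : CoeffSpace s k → ℝ
  ΓI : CoeffSpace s k → Matrix (Fin q) (Fin q) ℝ
  ΓII : CoeffSpace s k → Matrix (Fin p) (Fin q) ℝ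
  d₁ : ℝ → EuclideanSpace ℝ (Fin s)
  d₂ : ℝ → EuclideanSpace ℝ (Fin s)
  d₃ : ℝ → EuclideanSpace ℝ (Fin s)
  d₄ : ℝ → EuclideanSpace ℝ (Fin s)
  d₅ : ℝ → EuclideanSpace ℝ (Fin s)
  T₁ : (ℝ → StateSpace r p) → ℝ → EuclideanSpace ℝ (Fin k)
  T₂ : (ℝ → OutputSpace q p) → ℝ → EuclideanSpace ℝ (Fin k)

/-- The norm of `f₂'(Y) [0; I]` (the operator norm induced by the Euclidean norms). -/
noncomputable def System.partialNorm {q : ℕ} {r : Fin q → ℕ} {p s k : ℕ} (S : System r p s k)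
    (Y : StateSpace r p) : ℝ :=
  ‖(fderiv ℝ S.f₂ Y).comp (inclII r p)‖

/-- The standing assumptions on the system; `α` is the lower bound of `f₄`.
Elements of `W^{1,∞}` are given by their continuous representatives. -/
structure System.Admissible {q : ℕ} {r : Fin q → ℕ} {p s k : ℕ} (S : System r p s k)
    (α : ℝ) : Prop where
  h_nonneg : 0 ≤ S.h
  r_pos : ∀ i, 0 < r i
  ΓI_cont : Continuous S.ΓI
  ΓI_pos : ∀ x, (S.ΓI x + (S.ΓI x)ᵀ).PosDef
  ΓII_contDiff : ∀ i j, ContDiff ℝ 1 (fun x => S.ΓII x i j)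
  d₁_mem : MemLinf S.d₁
  d₂_mem : MemLinf S.d₂
  d₃_mem : MemWinf 1 S.d₃
  d₃_cont : ContinuousOn S.d₃ (Ici 0)
  d₄_mem : MemWinf 1 S.d₄
  d₄_cont : ContinuousOn S.d₄ (Ici 0)
  d₅_mem : MemWinf 1 S.d₅
  d₅_cont : ContinuousOn S.d₅ (Ici 0)
  f₁_cont : Continuous S.f₁
  f₂_contDiff : ContDiff ℝ 1 S.f₂
  f₂_bounded : BddAbove (range S.partialNorm)
  f₃_contDiff : ContDiff ℝ 1 S.f₃
  f₄_contDiff : ContDiff ℝ 1 S.f₄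
  α_pos : 0 < α
  f₄_lower : ∀ x, α ≤ S.f₄ x
  T₁_mem : OpClass S.h S.T₁
  T₂_mem : OpClassDAE S.h S.T₂

/-! ### The funnel controller -/

/-- The class `Φ_n` of funnel functions. -/
structure FunnelFunction (n : ℕ) (φ : ℝ → ℝ) : Prop where
  contDiff : ContDiffOn ℝ n φ (Ici 0)
  bounded : ∀ j ≤ n, ∃ c : ℝ, ∀ t ∈ Ici (0 : ℝ), |iteratedDerivWithin j φ (Ici 0) t| ≤ c
  pos : ∀ t > 0, 0 < φ t
  liminf_pos : 0 < liminf φ atTop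

/-- The performance funnel determined by `φ`. -/
def performanceFunnel (E : Type*) [NormedAddCommGroup E] (φ : ℝ → ℝ) : Set (ℝ × E) :=
  {z | 0 ≤ z.1 ∧ φ z.1 * ‖z.2‖ < 1}

/-- The data of the controller: the reference signal, the funnel functions and the gain `k̂`.
Only the functions `φ i j` with `j ≤ r_i - 2` are used. -/
structure Controller (q p : ℕ) where
  yref : ℝ → OutputSpace q p
  φI : ℝ → ℝ
  φII : ℝ → ℝ
  φ : Fin q → ℕ → ℝ → ℝ
  kHat : ℝ

/-- The conditions on the reference signal (given by its continuous representative) and on the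
funnel functions. -/
structure Controller.Admissible {q p : ℕ} (C : Controller q p) (r : Fin q → ℕ) : Prop where
  yref_cont : ContinuousOn C.yref (Ici 0)
  yrefI_mem : ∀ i : Fin q, MemWinf (r i) (fun t => C.yref t (Sum.inl i))
  yrefII_mem : ∀ i : Fin p, MemWinf 1 (fun t => C.yref t (Sum.inr i))
  φI_mem : FunnelFunction 1 C.φI
  φII_mem : FunnelFunction 1 C.φII
  φ_mem : ∀ i j, j + 2 ≤ r i → FunnelFunction (r i - j) (C.φ i j)
  kHat_pos : 0 < C.kHat

/-- The gain condition `k̂ > α⁻¹ sup_Y ‖f₂'(Y) [0; I]‖`. -/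
def GainCondition {q : ℕ} {r : Fin q → ℕ} {p s k : ℕ} (S : System r p s k) (C : Controller q p)
    (α : ℝ) : Prop :=
  α⁻¹ * (⨆ Y, S.partialNorm Y) < C.kHat

namespace Controller

/-- The signals `e_{ij}` generated by the output `y`: `e_{i0} = y_i - y_{ref,i}` and
`e_{i,j+1} = ė_{ij} + k_{ij} e_{ij}`, with one-sided derivatives at `t = 0`. -/
noncomputable def err {q p : ℕ} (C : Controller q p) (y : ℝ → OutputSpace q p) (i : Fin q) :
    ℕ → ℝ → ℝ
  | 0 => fun t => y t (Sum.inl i) - C.yref t (Sum.inl i)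
  | j + 1 => fun t => derivWithin (C.err y i j) (Ici 0) t
      + 1 / (1 - C.φ i j t ^ 2 * |C.err y i j t| ^ 2) * C.err y i j t

/-- The gains `k_{ij}`. -/
noncomputable def gain {q p : ℕ} (C : Controller q p) (y : ℝ → OutputSpace q p) (i : Fin q)
    (j : ℕ) (t : ℝ) : ℝ :=
  1 / (1 - C.φ i j t ^ 2 * |C.err y i j t| ^ 2)

/-- `e_I = (e_{1,r_1-1}, …, e_{q,r_q-1})`. -/
noncomputable def errI {q p : ℕ} (C : Controller q p) (r : Fin q → ℕ)
    (y : ℝ → OutputSpace q p) (t : ℝ) :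
    EuclideanSpace ℝ (Fin q) :=
  WithLp.toLp 2 (fun i => C.err y i (r i - 1) t)

/-- `e_II = (e_{q+1}, …, e_m)`. -/
noncomputable def errII {q p : ℕ} (C : Controller q p) (y : ℝ → OutputSpace q p)
    (t : ℝ) : EuclideanSpace ℝ (Fin p) :=
  WithLp.toLp 2 (fun i => y t (Sum.inr i) - C.yref t (Sum.inr i))

/-- The gain `k_I`. -/
noncomputable def gainI {q p : ℕ} (C : Controller q p) (r : Fin q → ℕ)
    (y : ℝ → OutputSpace q p) (t : ℝ) : ℝ :=
  1 / (1 - C.φI t ^ 2 * ‖C.errI r y t‖ ^ 2)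

/-- The gain `k_II`. -/
noncomputable def gainII {q p : ℕ} (C : Controller q p) (y : ℝ → OutputSpace q p) (t : ℝ) : ℝ :=
  C.kHat / (1 - C.φII t ^ 2 * ‖C.errII y t‖ ^ 2)

/-- The input component `u_I = - k_I e_I`. -/
noncomputable def inputI {q p : ℕ} (C : Controller q p) (r : Fin q → ℕ)
    (y : ℝ → OutputSpace q p) (t : ℝ) :
    EuclideanSpace ℝ (Fin q) :=
  -(C.gainI r y t • C.errI r y t)

/-- The input component `u_II = - k_II e_II`. -/
noncomputable def inputII {q p : ℕ} (C : Controller q p) (y : ℝ → OutputSpace q p)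
    (t : ℝ) : EuclideanSpace ℝ (Fin p) :=
  -(C.gainII y t • C.errII y t)

/-- The input `u = (u_I, u_II)`. -/
noncomputable def input {q p : ℕ} (C : Controller q p) (r : Fin q → ℕ)
    (y : ℝ → OutputSpace q p) (t : ℝ) : OutputSpace q p :=
  WithLp.toLp 2 (Sum.elim (fun i => C.inputI r y t i) (fun i => C.inputII y t i))

end Controller

/-! ### Initial data and solutions of the closed-loop system -/

/-- Initial data: the function `y⁰` on `[-h,0]` and the values `jet i j = (y_i⁰)^{(j)}(0)`. The latter
are separate data only in the case `h = 0`, where `y⁰` is a function on the one-point set `{0}`, and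
the initial values of the derivatives have to be prescribed. -/
structure InitialData (q p : ℕ) where
  y₀ : ℝ → OutputSpace q p
  jet : Fin q → ℕ → ℝ

/-- `y_i⁰ ∈ C^{r_i-1}([-h,0])` for `i ≤ q`, and `y_i⁰ ∈ C([-h,0])` for `i > q`. -/
structure InitialData.Admissible {q p : ℕ} (D : InitialData q p) (h : ℝ) (r : Fin q → ℕ) :
    Prop where
  contDiffI : ∀ i : Fin q,
    ContDiffOn ℝ ((r i - 1 : ℕ) : ℕ∞) (fun t => D.y₀ t (Sum.inl i)) (Icc (-h) 0)
  contII : ∀ i : Fin p, ContinuousOn (fun t => D.y₀ t (Sum.inr i)) (Icc (-h) 0)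
  jet_eq : ∀ i j, j < r i → (h = 0 → j = 0) →
    D.jet i j = iteratedDerivWithin j (fun t => D.y₀ t (Sum.inl i)) (Icc (-h) 0) 0

/-- The value at `t = 0` of `(y_1, …, y_1^{(r_1-1)}, …, y_q^{(r_q-1)}, y_{q+1}, …, y_m)`. -/
noncomputable def InitialData.state {q p : ℕ} (D : InitialData q p) (r : Fin q → ℕ) :
    StateSpace r p :=
  WithLp.toLp 2 (Sum.elim (fun ij => D.jet ij.1 ij.2) (fun i => D.y₀ 0 (Sum.inr i)))

/-- An extension of the initial data to `t ≥ 0` by Taylor polynomials. The values at `t = 0` of the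
signals of the controller depend on the output only through its derivatives at `0` of order
at most `r_i - 1`, so they may be computed from this extension. -/
noncomputable def InitialData.taylor {q p : ℕ} (D : InitialData q p) (r : Fin q → ℕ) (t : ℝ) :
    OutputSpace q p :=
  WithLp.toLp 2 (Sum.elim
    (fun i => ∑ j ∈ Finset.range (r i), D.jet i j * t ^ j / (j.factorial : ℝ))
    (fun i => D.y₀ 0 (Sum.inr i)))

/-- Consistency of the initial data for the closed-loop system: the algebraic equation holds
at `t = 0`. -/
def Consistent {q : ℕ} {r : Fin q → ℕ} {p s k : ℕ} (S : System r p s k) (C : Controller q p)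
    (D : InitialData q p) : Prop :=
  S.f₂ (D.state r) + S.f₃ (S.d₃ 0, S.T₂ (stopAt 0 D.y₀) 0)
    + WithLp.toLp 2 (S.ΓII (S.d₄ 0, S.T₂ (stopAt 0 D.y₀) 0) *ᵥ ⇑(C.inputI r (D.taylor r) 0))
    + S.f₄ (S.d₅ 0, S.T₂ (stopAt 0 D.y₀) 0) • C.inputII (D.taylor r) 0 = 0

/-- The initial errors lie in the performance funnels. -/
structure InitiallyInFunnel {q p : ℕ} (r : Fin q → ℕ) (C : Controller q p) (D : InitialData q p) :
    Prop where
  errI : C.φI 0 * ‖C.errI r (D.taylor r) 0‖ < 1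
  errII : C.φII 0 * ‖C.errII (D.taylor r) 0‖ < 1
  err : ∀ i j, j + 2 ≤ r i → C.φ i j 0 * |C.err (D.taylor r) i j 0| < 1

/-- The function `(y_1, …, y_1^{(r_1-1)}, …, y_q^{(r_q-1)}, y_{q+1}, …, y_m)` for an output `y`
on `[-h, ω)`. -/
noncomputable def stateOf {q p : ℕ} (r : Fin q → ℕ) (h : ℝ) (ω : EReal) (y : ℝ → OutputSpace q p)
    (t : ℝ) : StateSpace r p :=
  WithLp.toLp 2 (Sum.elim
    (fun ij => iteratedDerivWithin ij.2 (fun u => y u (Sum.inl ij.1)) (ivl (-h) ω) t)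
    (fun i => y t (Sum.inr i)))

/-- `y` is a solution on `[-h, ω)`, `ω ∈ (0, ∞]`, of the closed-loop initial value problem formed by
the system `S`, the controller `C` and the initial data `D`. The values of `y` outside `[-h, ω)` are
irrelevant. -/
structure IsSolution {q : ℕ} {r : Fin q → ℕ} {p s k : ℕ} (S : System r p s k) (C : Controller q p)
    (D : InitialData q p) (ω : EReal) (y : ℝ → OutputSpace q p) : Prop where
  pos : 0 < ω
  initial : ∀ t ∈ Icc (-S.h) 0, y t = D.y₀ t
  initial_jet : ∀ i j, j < r i →
    iteratedDerivWithin j (fun t => y t (Sum.inl i)) (ivl (-S.h) ω) 0 = D.jet i j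
  contDiffI : ∀ i : Fin q,
    ContDiffOn ℝ ((r i - 1 : ℕ) : ℕ∞) (fun t => y t (Sum.inl i)) (ivl (-S.h) ω)
  contII : ∀ i : Fin p, ContinuousOn (fun t => y t (Sum.inr i)) (ivl (-S.h) ω)
  /-- `y_i` is weakly differentiable on `[0, ω)` for `i > q` -/
  weakII : ∀ i : Fin p, ∃ g : ℝ → ℝ, HasWeakDeriv (ivl 0 ω) (fun t => y t (Sum.inr i)) g
  /-- `y_i^{(r_i-1)}` is weakly differentiable on `[0, ω)` for `i ≤ q`, and the differential
  equation holds for its weak derivative -/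
  differential : ∀ i : Fin q, ∃ g : ℝ → ℝ,
    HasWeakDeriv (ivl 0 ω)
      (iteratedDerivWithin (r i - 1) (fun t => y t (Sum.inl i)) (ivl (-S.h) ω)) g ∧
    ∀ τ : ℝ, 0 < τ → (τ : EReal) < ω → ∀ᵐ t ∂(volume.restrict (Ico 0 τ)),
      g t = S.f₁ (S.d₁ t, S.T₁ (stopAt τ (stateOf r S.h ω y)) t) i
        + (S.ΓI (S.d₂ t, S.T₁ (stopAt τ (stateOf r S.h ω y)) t) *ᵥ ⇑(C.inputI r y t)) i
  algebraic : ∀ τ : ℝ, 0 < τ → (τ : EReal) < ω → ∀ᵐ t ∂(volume.restrict (Ico 0 τ)),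
    0 = S.f₂ (stateOf r S.h ω y t) + S.f₃ (S.d₃ t, S.T₂ (stopAt τ y) t)
      + WithLp.toLp 2 (S.ΓII (S.d₄ t, S.T₂ (stopAt τ y) t) *ᵥ ⇑(C.inputI r y t))
      + S.f₄ (S.d₅ t, S.T₂ (stopAt τ y) t) • C.inputII y t

end FunnelControl

namespace FunnelControl

/-! ### Intervals -/

/-! The feedback makes the algebraic equation uniquely solvable for `e_II`. Inside the funnel it
reads `e_II / (1 - φII² ‖e_II‖²) = (k̂ f₄)⁻¹ (f₂ + f₃ + ΓII u_I)`. The map `e ↦ e / (1 - φ² ‖e‖²)`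
is the identity plus a monotone map, so its inverse `gainInv` is nonexpansive; it is defined on the
whole space and takes values in the funnel. For given time, value of `T₂` and outputs `y_i`, `i ≤
q`, the right-hand side depends on `e_II` only through `f₂`. The gain condition therefore turns the
equation into a fixed point problem for a contraction (`lipschitzWith_algMap`), and `e_II` is a
continuous function `algErr` of the other data (`continuousOn_algErr`).

The signals `e_ij` involve derivatives of earlier gains, but by induction they are continuous
functions of the time and the jet of the error (`errS_jet_aux`). The closed loop thus becomes a
functional differential equation for the jets, with right-hand side measurable in time, in which the
remaining components of the state are supplied by `algErr`. Local existence is a Peano argument: a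
causal continuous operator with equicontinuous values has a fixed point
(`exists_fixedPoint_of_causal`). Equicontinuity of the algebraic components needs no differentiation
of the algebraic equation; it follows from the uniform Lipschitz bound that the DAE class gives for
`T₂` along bounded trajectories (`OpClassDAE.exists_lipschitz`). Uniqueness is neither claimed nor
needed.

The a priori bounds come from a barrier argument: if `⟨e, ė⟩ ≤ B ‖e‖ - γ ‖e‖² / (1 - φ² ‖e‖²)`, the
damping dominates near the boundary of the funnel, and `φ² ‖e‖² ≤ 1 - ε` on the whole interval of
existence (`funnel_barrier`). It applies to `e_ij` because `ė_ij = e_{i,j+1} - k_ij e_ij` and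
`e_{i,j+1}` is bounded, being in a funnel. Bounded gains bound the whole state, hence `T₁`. Then
`Γ_I` is uniformly coercive along the trajectory, and the barrier applies to `e_I`. So `u_I` is
bounded, the argument of `gainInv` is bounded, and `e_II` stays away from its boundary by an
explicit formula.

With these margins a solution on `[-h, b)` closes up at `b` inside the funnels
(`OpenSol.exists_closure`), and Zorn's lemma with local continuation yields a global solution
(`PartialSol.exists_global`). The same margins exclude a first exit time, so every solution in the
weak sense stays in the funnels (`IsSolution.mem_safe`) and is a solution in terms of the state.
Conversely, weak differentiability of `y_II` holds because `e_II` is the fixed point of a `C¹`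
contraction whose parameters are Lipschitz in time. -/

lemma ivl_top (a : ℝ) : ivl a ⊤ = Ici a := by
  ext t; simp [ivl, EReal.coe_lt_top]

lemma ordConnected_ivl (a : ℝ) (ω : EReal) : (ivl a ω).OrdConnected :=
  ⟨fun _ hx _ hy _ hz => ⟨hx.1.trans hz.1, (EReal.coe_le_coe hz.2).trans_lt hy.2⟩⟩

lemma Icc_subset_ivl {a b t : ℝ} {ω : EReal} (hab : a ≤ b) (ht : (t : EReal) < ω) :
    Icc b t ⊆ ivl a ω :=
  fun _ hu => ⟨hab.trans hu.1, (EReal.coe_le_coe hu.2).trans_lt ht⟩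

lemma isOpen_lt_coe (ω : EReal) : IsOpen {t : ℝ | (t : EReal) < ω} :=
  isOpen_lt continuous_coe_real_ereal continuous_const

lemma ivl_eq_inter (a : ℝ) (ω : EReal) : ivl a ω = Ici a ∩ {t : ℝ | (t : EReal) < ω} := rfl

lemma measurableSet_ivl (a : ℝ) (ω : EReal) : MeasurableSet (ivl a ω) :=
  measurableSet_Ici.inter (isOpen_lt_coe ω).measurableSet

lemma interior_ivl (a : ℝ) (ω : EReal) :
    interior (ivl a ω) = Ioi a ∩ {t : ℝ | (t : EReal) < ω} := by
  rw [ivl_eq_inter, interior_inter, interior_Ici, (isOpen_lt_coe ω).interior_eq]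

/-- A compact subset of `{t | t < ω}` has an upper bound in this set. -/
lemma exists_bound_lt {ω : EReal} {a : ℝ} (ha : (a : EReal) < ω) {K : Set ℝ} (hK : IsCompact K)
    (hKω : K ⊆ {t : ℝ | (t : EReal) < ω}) :
    ∃ b : ℝ, a < b ∧ (b : EReal) < ω ∧ ∀ t ∈ K, t < b := by
  obtain ⟨M, hM, hMub⟩ : ∃ M : ℝ, (M : EReal) < ω ∧ ∀ t ∈ insert a K, t ≤ M := by
    obtain ⟨M, hM, hle⟩ := (hK.insert a).exists_isMaxOn ⟨a, mem_insert _ _⟩ continuousOn_id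
    refine ⟨M, ?_, hle⟩
    rcases hM with rfl | h
    exacts [ha, hKω h]
  obtain ⟨b, hb, hbω⟩ := EReal.exists_between_coe_real hM
  have hb' : M < b := EReal.coe_lt_coe_iff.1 hb
  exact ⟨b, (hMub a (mem_insert _ _)).trans_lt hb', hbω,
    fun t ht => (hMub t (mem_insert_of_mem _ ht)).trans_lt hb'⟩

lemma intervalIntegrable_of_ivl {E : Type*} [NormedAddCommGroup E] {a : ℝ} {ω : EReal} {g : ℝ → E}
    (hg : LocallyIntegrableOn g (ivl a ω)) {s t : ℝ} (hs : s ∈ ivl a ω) (ht : t ∈ ivl a ω) :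
    IntervalIntegrable g volume s t := by
  rw [intervalIntegrable_iff]
  exact (hg.integrableOn_compact_subset ((ordConnected_ivl a ω).uIcc_subset hs ht)
    isCompact_uIcc).mono_set uIoc_subset_uIcc

lemma locallyIntegrableOn_ivl {E : Type*} [NormedAddCommGroup E] {a : ℝ} {ω : EReal} {g : ℝ → E}
    (hg : ∀ t, a ≤ t → (t : EReal) < ω → IntervalIntegrable g volume a t) :
    LocallyIntegrableOn g (ivl a ω) := by
  intro t ht
  obtain ⟨b, htb, hb, -⟩ := exists_bound_lt ht.2 (K := ∅) isCompact_empty (by simp)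
  refine ⟨Icc a b, ?_, ?_⟩
  · filter_upwards [self_mem_nhdsWithin, mem_nhdsWithin_of_mem_nhds (Iio_mem_nhds htb)] with u hu hu'
    exact ⟨hu.1, le_of_lt hu'⟩
  · have := hg b (ht.1.trans htb.le) hb
    rw [intervalIntegrable_iff_integrableOn_Icc_of_le (ht.1.trans htb.le)] at this
    exact this

/-! ### Weak derivatives -/

/-- Integration by parts against a primitive of a locally integrable function. -/
lemma integral_deriv_mul_primitive {ω : EReal} {a : ℝ} {g : ℝ → ℝ}
    (hg : LocallyIntegrableOn g (ivl a ω)) {θ : ℝ → ℝ} (hθ : ContDiff ℝ ((⊤ : ℕ∞) : WithTop ℕ∞) θ)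
    (hc : HasCompactSupport θ) (hsupp : tsupport θ ⊆ interior (ivl a ω)) :
    ∫ t, deriv θ t * (∫ u in a..t, g u) = - ∫ t, θ t * g t := by
  by_cases hω : (a : EReal) < ω
  swap
  · have : θ = 0 := by
      have h0 : tsupport θ = ∅ := by
        refine eq_empty_of_forall_notMem fun t ht => hω ?_
        have := hsupp ht
        rw [interior_ivl] at this
        exact (EReal.coe_lt_coe_iff.2 this.1).trans this.2
      rwa [tsupport_eq_empty_iff] at h0
    simp [this]
  rw [interior_ivl] at hsupp
  obtain ⟨b, hab, hb, hbK⟩ := exists_bound_lt hω hc (hsupp.trans inter_subset_right)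
  have hθa : θ a = 0 := by
    by_contra h
    exact lt_irrefl a (hsupp (subset_tsupport _ h)).1
  have hθb : θ b = 0 := by
    by_contra h
    exact lt_irrefl b (hbK b (subset_tsupport _ h))
  have hsub : tsupport θ ⊆ Ioc a b := fun t ht => ⟨(hsupp ht).1, (hbK t ht).le⟩
  have hgi : IntervalIntegrable g volume a b :=
    intervalIntegrable_of_ivl hg ⟨le_rfl, hω⟩ ⟨hab.le, hb⟩
  -- Integration by parts for absolutely continuous functions; the boundary terms vanish since the
  -- support of `θ` lies strictly between `a` and `b`.
  have hF : AbsolutelyContinuousOnInterval (fun t => ∫ u in a..t, g u) a b :=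
    hgi.absolutelyContinuousOnInterval_intervalIntegral (by simp)
  have hθac : AbsolutelyContinuousOnInterval θ a b :=
    (hθ.contDiffOn.of_le (by exact_mod_cast le_top)).absolutelyContinuousOnInterval
  have key := hF.integral_mul_deriv_eq_deriv_mul hθac
  rw [hθa, hθb] at key
  rw [← intervalIntegral.integral_eq_integral_of_support_subset (a := a) (b := b)
      (((Function.support_mul_subset_left _ _).trans (support_deriv_subset)).trans hsub),
    ← intervalIntegral.integral_eq_integral_of_support_subset (a := a) (b := b)
      (((Function.support_mul_subset_left _ _).trans (subset_tsupport _)).trans hsub)]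
  calc ∫ t in a..b, deriv θ t * (∫ u in a..t, g u)
      = ∫ t in a..b, (∫ u in a..t, g u) * deriv θ t := by simp_rw [mul_comm]
    _ = - ∫ t in a..b, deriv (fun t => ∫ u in a..t, g u) t * θ t := by rw [key]; simp
    _ = - ∫ t in a..b, θ t * g t := by
      congr 1
      refine intervalIntegral.integral_congr_ae ?_
      filter_upwards [hgi.ae_hasDerivAt_integral] with t ht htm
      rw [(ht (uIoc_subset_uIcc htm) a (by simp)).deriv, mul_comm]

/-- A locally integrable function with vanishing weak derivative is constant. -/
lemma ae_const_of_integral_deriv_mul_eq_zero {ω : EReal} {a : ℝ} (haω : (a : EReal) < ω) {f : ℝ → ℝ}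
    (hf : LocallyIntegrableOn f (interior (ivl a ω)))
    (h : ∀ θ : ℝ → ℝ, ContDiff ℝ ((⊤ : ℕ∞) : WithTop ℕ∞) θ → HasCompactSupport θ →
      tsupport θ ⊆ interior (ivl a ω) → ∫ t, deriv θ t * f t = 0) :
    ∃ c, ∀ᵐ t, t ∈ interior (ivl a ω) → f t = c := by
  have hU : IsOpen (interior (ivl a ω)) := isOpen_interior
  obtain ⟨b, hab, hbω, -⟩ := exists_bound_lt haω (K := ∅) isCompact_empty (by simp)
  have hmid : (a + b) / 2 ∈ interior (ivl a ω) := by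
    rw [interior_ivl]
    refine ⟨by simp only [mem_Ioi]; linarith, lt_trans (EReal.coe_lt_coe_iff.2 ?_) hbω⟩
    linarith
  obtain ⟨ε, hε, hball⟩ := Metric.isOpen_iff.1 hU _ hmid
  let B : ContDiffBump ((a + b) / 2 : ℝ) := ⟨ε / 4, ε / 2, by positivity, by linarith⟩
  set ψ₀ : ℝ → ℝ := B.normed volume with hψ₀
  have hψ₀s : ContDiff ℝ ((⊤ : ℕ∞) : WithTop ℕ∞) ψ₀ := B.contDiff_normed
  have hψ₀c : HasCompactSupport ψ₀ := B.hasCompactSupport_normed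
  have hψ₀U : tsupport ψ₀ ⊆ interior (ivl a ω) := by
    rw [hψ₀, B.tsupport_normed_eq]
    exact (Metric.closedBall_subset_ball (by simp only [B]; linarith)).trans hball
  have hψ₀i : ∫ t, ψ₀ t = 1 := B.integral_normed
  have hint : ∀ ψ : ℝ → ℝ, Continuous ψ → HasCompactSupport ψ → tsupport ψ ⊆ interior (ivl a ω) →
      Integrable (fun t => ψ t * f t) := by
    intro ψ hψ hψc hψU
    have : IntegrableOn (fun t => ψ t * f t) (tsupport ψ) :=
      (hf.integrableOn_compact_subset hψU hψc).continuousOn_mul hψ.continuousOn hψc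
    rwa [integrableOn_iff_integrable_of_support_subset] at this
    exact (Function.support_mul_subset_left _ _).trans (subset_tsupport _)
  refine ⟨∫ t, ψ₀ t * f t, ?_⟩
  set c := ∫ t, ψ₀ t * f t with hc
  have hfin : ∀ᵐ t, t ∈ interior (ivl a ω) → f t - c = 0 := by
    refine hU.ae_eq_zero_of_integral_contDiff_smul_eq_zero
      (hf.sub ((locallyIntegrable_const c).locallyIntegrableOn _)) ?_
    intro ψ hψ hψc hψU
    set m := ∫ t, ψ t with hm
    -- Subtracting a multiple of the unit-mass bump `ψ₀` makes the integral of `χ` vanish. Its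
    -- primitive `θ` then has compact support and is admissible in `h`, which gives `∫ ψ f = c ∫ ψ`.
    set χ : ℝ → ℝ := fun t => ψ t - m * ψ₀ t with hχ
    have hχs : ContDiff ℝ ((⊤ : ℕ∞) : WithTop ℕ∞) χ := hψ.sub (contDiff_const.mul hψ₀s)
    have hψi : Integrable ψ := hψ.continuous.integrable_of_hasCompactSupport hψc
    have hψ₀int : Integrable ψ₀ := hψ₀s.continuous.integrable_of_hasCompactSupport hψ₀c
    have hχi : ∫ t, χ t = 0 := by
      rw [hχ, integral_sub hψi (hψ₀int.const_mul m), integral_const_mul, hψ₀i, ← hm]; ring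
    have hKc : IsCompact (tsupport ψ ∪ tsupport ψ₀) := hψc.isCompact.union hψ₀c.isCompact
    have hKU : tsupport ψ ∪ tsupport ψ₀ ⊆ interior (ivl a ω) := union_subset hψU hψ₀U
    have hχK : Function.support χ ⊆ tsupport ψ ∪ tsupport ψ₀ := by
      intro t ht
      by_contra hn
      rw [mem_union, not_or] at hn
      exact ht (by simp [hχ, image_eq_zero_of_notMem_tsupport hn.1,
        image_eq_zero_of_notMem_tsupport hn.2])
    have hKne : (tsupport ψ ∪ tsupport ψ₀).Nonempty := by
      by_contra hn
      have hn' := (union_empty_iff.1 (not_nonempty_iff_eq_empty.1 hn)).2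
      rw [tsupport_eq_empty_iff] at hn'
      rw [hn'] at hψ₀i
      simp at hψ₀i
    obtain ⟨l, hl, hlK⟩ := hKc.exists_isMinOn hKne continuousOn_id
    obtain ⟨r, hr, hrK⟩ := hKc.exists_isMaxOn hKne continuousOn_id
    set θ : ℝ → ℝ := fun u => ∫ t in l..u, χ t with hθ
    have hθd : ∀ t, HasDerivAt θ (χ t) t := fun t =>
      intervalIntegral.integral_hasDerivAt_right (hχs.continuous.intervalIntegrable _ _)
        (hχs.continuous.stronglyMeasurableAtFilter _ _) hχs.continuous.continuousAt
    have hθder : deriv θ = χ := funext fun t => (hθd t).deriv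
    have hθs : ContDiff ℝ ((⊤ : ℕ∞) : WithTop ℕ∞) θ := by
      rw [contDiff_infty_iff_deriv]
      exact ⟨fun t => (hθd t).differentiableAt, hθder ▸ hχs⟩
    have hθsupp : Function.support θ ⊆ Icc l r := by
      intro u hu
      by_contra hn
      rw [mem_Icc, not_and_or, not_le, not_le] at hn
      refine hu ?_
      rcases hn with hul | hru
      · refine (intervalIntegral.integral_zero_ae ?_)
        have : ∀ᵐ t : ℝ, t ≠ l := by simp [ae_iff, measure_singleton]
        filter_upwards [this] with t htl ht
        rw [uIoc_of_ge hul.le] at ht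
        by_contra hne
        exact absurd (hlK (hχK hne)) (not_le.2 (lt_of_le_of_ne ht.2 htl))
      -- The integral is started at `l - 1` because intervals of integration are open on the left
      -- and the support of `χ` may contain `l`.
      · have : θ u = ∫ t in (l-1)..u, χ t := by
          rw [hθ, ← intervalIntegral.integral_add_adjacent_intervals
            (hχs.continuous.intervalIntegrable (l-1) l) (hχs.continuous.intervalIntegrable l u)]
          refine left_eq_add.2 ?_ |>.trans (add_comm _ _)
          refine (intervalIntegral.integral_zero_ae ?_)
          have : ∀ᵐ t : ℝ, t ≠ l := by simp [ae_iff, measure_singleton]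
          filter_upwards [this] with t htl ht
          rw [uIoc_of_le (by linarith)] at ht
          by_contra hne
          exact absurd (hlK (hχK hne)) (not_le.2 (lt_of_le_of_ne ht.2 htl))
        rw [this, intervalIntegral.integral_eq_integral_of_support_subset, hχi]
        intro t ht
        have h1 : l ≤ t := hlK (hχK ht)
        have h2 : t ≤ r := hrK (hχK ht)
        exact ⟨by linarith, by linarith⟩
    have hθt : tsupport θ ⊆ Icc l r := closure_minimal hθsupp isClosed_Icc
    have hIcc : Icc l r ⊆ interior (ivl a ω) := by
      rw [interior_ivl]
      have h1 := hKU hl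
      have h2 := hKU hr
      rw [interior_ivl] at h1 h2
      exact fun t ht => ⟨h1.1.trans_le ht.1, (EReal.coe_le_coe ht.2).trans_lt h2.2⟩
    have := h θ hθs (HasCompactSupport.intro isCompact_Icc fun t ht => by
      by_contra hne; exact ht (hθsupp hne)) (hθt.trans hIcc)
    rw [hθder] at this
    have h1 := hint ψ hψ.continuous hψc hψU
    have h2 := hint ψ₀ hψ₀s.continuous hψ₀c hψ₀U
    have h3 : ∫ t, χ t * f t = (∫ t, ψ t * f t) - m * c := by
      rw [hc, ← integral_const_mul, ← integral_sub h1 (h2.const_mul m)]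
      congr 1; ext t; simp only [hχ]; ring
    simp only [smul_eq_mul, mul_sub]
    rw [integral_sub h1 (hψi.mul_const c), integral_mul_const, ← hm]
    linarith
  filter_upwards [hfin] with t ht htU
  exact sub_eq_zero.1 (ht htU)

lemma ae_mem_interior_ivl (a : ℝ) (ω : EReal) :
    ∀ᵐ t : ℝ, t ∈ ivl a ω → t ∈ interior (ivl a ω) := by
  have : ∀ᵐ t : ℝ, t ≠ a := by simp [ae_iff, measure_singleton]
  filter_upwards [this] with t hta ht
  rw [interior_ivl]
  exact ⟨lt_of_le_of_ne ht.1 (Ne.symm hta), ht.2⟩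

lemma continuousOn_primitive_ivl {E : Type*} [NormedAddCommGroup E] [NormedSpace ℝ E]
    {a : ℝ} {ω : EReal} {g : ℝ → E} (hg : LocallyIntegrableOn g (ivl a ω)) :
    ContinuousOn (fun t => ∫ u in a..t, g u) (ivl a ω) := by
  intro t ht
  have haω : (a : EReal) < ω := (EReal.coe_le_coe ht.1).trans_lt ht.2
  obtain ⟨b, htb, hb, -⟩ := exists_bound_lt ht.2 (K := ∅) isCompact_empty (by simp)
  have h1 := intervalIntegrable_of_ivl hg ⟨le_rfl, haω⟩ (t := b) ⟨ht.1.trans htb.le, hb⟩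
  have h2 := intervalIntegral.continuousOn_primitive_interval
    ((intervalIntegrable_iff_integrableOn_Icc_of_le (ht.1.trans htb.le)).1 h1 |>.mono_set
      (uIcc_of_le (ht.1.trans htb.le)).subset)
  rw [uIcc_of_le (ht.1.trans htb.le)] at h2
  refine (h2 t ⟨ht.1, htb.le⟩).mono_of_mem_nhdsWithin ?_
  filter_upwards [self_mem_nhdsWithin, mem_nhdsWithin_of_mem_nhds (Iio_mem_nhds htb)] with u hu hu'
  exact ⟨hu.1, le_of_lt hu'⟩

/-- The difference of `f` and the primitive of `g` has vanishing weak derivative, hence is constant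
almost everywhere. -/
lemma HasWeakDeriv.ae_eq_primitive {ω : EReal} {a : ℝ} (haω : (a : EReal) < ω) {f g : ℝ → ℝ}
    (h : HasWeakDeriv (ivl a ω) f g) :
    ∃ c, ∀ᵐ t, t ∈ ivl a ω → f t = c + ∫ u in a..t, g u := by
  have hFc := continuousOn_primitive_ivl h.right
  have hFl : LocallyIntegrableOn (fun t => ∫ u in a..t, g u) (ivl a ω) :=
    hFc.locallyIntegrableOn (measurableSet_ivl a ω)
  have hl : LocallyIntegrableOn (fun t => f t - ∫ u in a..t, g u) (interior (ivl a ω)) :=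
    (h.left.sub hFl).mono_set interior_subset
  obtain ⟨c, hc⟩ := ae_const_of_integral_deriv_mul_eq_zero haω hl (by
    intro θ hθ hθc hθU
    have hint : ∀ F : ℝ → ℝ, LocallyIntegrableOn F (ivl a ω) →
        Integrable (fun t => deriv θ t * F t) := by
      intro F hF
      have : IntegrableOn (fun t => deriv θ t * F t) (tsupport θ) :=
        (hF.integrableOn_compact_subset (hθU.trans interior_subset) hθc).continuousOn_mul
          (hθ.continuous_deriv (by exact_mod_cast le_top)).continuousOn hθc
      rwa [integrableOn_iff_integrable_of_support_subset] at this
      exact (Function.support_mul_subset_left _ _).trans support_deriv_subset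
    simp_rw [mul_sub]
    rw [integral_sub (hint _ h.left) (hint _ hFl), integral_deriv_mul_primitive h.right hθ hθc hθU]
    have := h.parts θ hθ hθc hθU
    simp only [smul_eq_mul] at this
    rw [this]; simp)
  refine ⟨c, ?_⟩
  filter_upwards [hc, ae_mem_interior_ivl a ω] with t ht ht' htU
  have := ht (ht' htU)
  linarith

/-- Functions that are continuous on an interval and agree almost everywhere agree everywhere. -/
lemma eqOn_ivl_of_ae_eq {E : Type*} [NormedAddCommGroup E] {ω : EReal} {a : ℝ} {f g : ℝ → E}
    (hf : ContinuousOn f (ivl a ω)) (hg : ContinuousOn g (ivl a ω))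
    (h : ∀ᵐ t, t ∈ ivl a ω → f t = g t) : EqOn f g (ivl a ω) := by
  intro t ht
  obtain ⟨b, htb, hb, -⟩ := exists_bound_lt ht.2 (K := ∅) isCompact_empty (by simp)
  have hsub : Icc t b ⊆ ivl a ω := Icc_subset_ivl ht.1 hb
  have h1 : ∀ᵐ u ∂(volume.restrict (Icc t b)), f u = g u := by
    rw [ae_restrict_iff' measurableSet_Icc]
    filter_upwards [h] with u hu hu'
    exact hu (hsub hu')
  exact Measure.eqOn_Icc_of_ae_eq volume htb.ne h1 (hf.mono hsub) (hg.mono hsub)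
    (left_mem_Icc.2 htb.le)

lemma HasWeakDeriv.eq_primitive {ω : EReal} {a : ℝ} {f g : ℝ → ℝ}
    (h : HasWeakDeriv (ivl a ω) f g) (hf : ContinuousOn f (ivl a ω)) {t : ℝ} (ht : t ∈ ivl a ω) :
    f t = f a + ∫ u in a..t, g u := by
  have haω : (a : EReal) < ω := (EReal.coe_le_coe ht.1).trans_lt ht.2
  obtain ⟨c, hc⟩ := h.ae_eq_primitive haω
  have := eqOn_ivl_of_ae_eq hf (continuousOn_const.add (continuousOn_primitive_ivl h.right)) hc
  rw [this ht, this ⟨le_rfl, haω⟩]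
  simp

lemma hasWeakDeriv_of_eq_primitive {ω : EReal} {a : ℝ} {f g : ℝ → ℝ} {c : ℝ}
    (hg : LocallyIntegrableOn g (ivl a ω))
    (h : ∀ t ∈ ivl a ω, f t = c + ∫ u in a..t, g u) : HasWeakDeriv (ivl a ω) f g := by
  have hf : ContinuousOn f (ivl a ω) :=
    (continuousOn_const.add (continuousOn_primitive_ivl hg)).congr h
  refine ⟨hf.locallyIntegrableOn (measurableSet_ivl a ω), hg, ?_⟩
  intro θ hθ hθc hθU
  simp only [smul_eq_mul]
  rw [← integral_deriv_mul_primitive hg hθ hθc hθU]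
  have hd : ∫ t, deriv θ t * c = 0 := by
    rw [integral_mul_const, integral_eq_zero_of_hasDerivAt_of_integrable (f := θ)
      (fun t => (hθ.differentiable (by simp) t).hasDerivAt), zero_mul]
    · exact (hθ.continuous_deriv (by exact_mod_cast le_top)).integrable_of_hasCompactSupport hθc.deriv
    · exact hθ.continuous.integrable_of_hasCompactSupport hθc
  have hFi : Integrable (fun t => deriv θ t * ∫ u in a..t, g u) := by
    have : IntegrableOn (fun t => deriv θ t * ∫ u in a..t, g u) (tsupport θ) :=
      (((continuousOn_primitive_ivl hg).locallyIntegrableOn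
        (measurableSet_ivl a ω)).integrableOn_compact_subset (hθU.trans interior_subset)
          hθc).continuousOn_mul
        (hθ.continuous_deriv (by exact_mod_cast le_top)).continuousOn hθc
    rwa [integrableOn_iff_integrable_of_support_subset] at this
    exact (Function.support_mul_subset_left _ _).trans support_deriv_subset
  have : ∀ t, deriv θ t * f t = deriv θ t * c + deriv θ t * ∫ u in a..t, g u := by
    intro t
    by_cases ht : t ∈ tsupport θ
    · rw [h t (interior_subset (hθU ht))]; ring
    · have : deriv θ t = 0 := by
        by_contra hne; exact ht (support_deriv_subset hne)
      simp [this]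
  simp_rw [this]
  rw [integral_add _ hFi, hd, zero_add]
  exact ((hθ.continuous_deriv (by exact_mod_cast le_top)).integrable_of_hasCompactSupport
    hθc.deriv).mul_const c


/-! ### Primitives and `W^{n,∞}` -/

lemma hasDerivWithinAt_Icc_of_eq_primitive {E : Type*} [NormedAddCommGroup E] [NormedSpace ℝ E]
    [CompleteSpace E] {a b : ℝ} {f k : ℝ → E} {c : E}
    (hk : ContinuousOn k (Icc a b)) (hf : ∀ t ∈ Icc a b, f t = c + ∫ u in a..t, k u) {t : ℝ}
    (ht : t ∈ Icc a b) : HasDerivWithinAt f (k t) (Icc a b) t := by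
  have hab : a ≤ b := ht.1.trans ht.2
  have : Fact (t ∈ Icc a b) := ⟨ht⟩
  have hi : IntervalIntegrable k volume a t :=
    (hk.mono (by rw [uIcc_of_le ht.1]; exact Icc_subset_Icc_right ht.2)).intervalIntegrable
  have h1 : HasDerivWithinAt (fun u => c + ∫ x in a..u, k x) (k t) (Icc a b) t :=
    (intervalIntegral.integral_hasDerivWithinAt_right hi
      (hk.stronglyMeasurableAtFilter_nhdsWithin measurableSet_Icc t) (hk t ht)).const_add c
  exact h1.congr hf (hf t ht)

lemma hasDerivWithinAt_ivl_of_eq_primitive {E : Type*} [NormedAddCommGroup E] [NormedSpace ℝ E]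
    [CompleteSpace E] {a : ℝ} {ω : EReal} {f k : ℝ → E} {c : E}
    (hk : ContinuousOn k (ivl a ω)) (hf : ∀ t ∈ ivl a ω, f t = c + ∫ u in a..t, k u) {t : ℝ}
    (ht : t ∈ ivl a ω) : HasDerivWithinAt f (k t) (Ici a) t := by
  obtain ⟨b, htb, hb, -⟩ := exists_bound_lt ht.2 (K := ∅) isCompact_empty (by simp)
  have hsub : Icc a b ⊆ ivl a ω := Icc_subset_ivl le_rfl hb
  refine (hasDerivWithinAt_Icc_of_eq_primitive (hk.mono hsub) (fun u hu => hf u (hsub hu))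
    (t := t) ⟨ht.1, htb.le⟩).mono_of_mem_nhdsWithin ?_
  filter_upwards [self_mem_nhdsWithin, mem_nhdsWithin_of_mem_nhds (Iio_mem_nhds htb)] with u hu hu'
  exact ⟨hu, le_of_lt hu'⟩

lemma MemLinf.ae_bound {E : Type*} [NormedAddCommGroup E] {f : ℝ → E} (hf : MemLinf f) :
    ∃ M : ℝ, 0 ≤ M ∧ ∀ᵐ t, t ∈ Ici (0 : ℝ) → ‖f t‖ ≤ M := by
  refine ⟨(eLpNorm f ⊤ (volume.restrict (Ici (0 : ℝ)))).toReal, ENNReal.toReal_nonneg, ?_⟩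
  have h : ∀ᵐ t ∂(volume.restrict (Ici (0 : ℝ))),
      ‖f t‖ₑ ≤ eLpNorm f ⊤ (volume.restrict (Ici (0 : ℝ))) := by
    rw [eLpNorm_exponent_top]
    exact ae_le_eLpNormEssSup
  rw [ae_restrict_iff' measurableSet_Ici] at h
  filter_upwards [h] with t ht ht0
  rw [← toReal_enorm]
  exact ENNReal.toReal_mono hf.2.ne (ht ht0)

lemma MemLinf.locallyIntegrableOn {E : Type*} [NormedAddCommGroup E] {f : ℝ → E}
    (hf : MemLinf f) : LocallyIntegrableOn f (Ici 0) := by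
  apply locallyIntegrableOn_of_locallyIntegrable_restrict
  exact MemLp.locallyIntegrable hf le_top

lemma MemLinf.bound {E : Type*} [NormedAddCommGroup E] {f : ℝ → E} (hf : MemLinf f)
    (hc : ContinuousOn f (Ici 0)) : ∃ M : ℝ, 0 ≤ M ∧ ∀ t ∈ Ici (0 : ℝ), ‖f t‖ ≤ M := by
  obtain ⟨M, hM0, hM⟩ := hf.ae_bound
  refine ⟨M, hM0, fun t ht => ?_⟩
  -- `max ‖f‖ M` is continuous and equal to `M` almost everywhere, hence everywhere.
  have h1 : ContinuousOn (fun t => max (‖f t‖) M) (ivl 0 ⊤) := by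
    rw [ivl_top]; exact hc.norm.sup continuousOn_const
  have := eqOn_ivl_of_ae_eq h1 (continuousOn_const (c := M)) (by
    filter_upwards [hM] with t ht ht'
    rw [ivl_top] at ht'
    exact max_eq_right (ht ht'))
  rw [ivl_top] at this
  have h2 : max ‖f t‖ M = M := this ht
  exact (le_max_left _ _).trans h2.le

/-- A continuous function in `W^{n+1,∞}` has bounded continuous derivatives of order at most `n`,
and the derivative of order `n` is the primitive of a function in `L^∞`. -/
lemma MemWinf.exists_derivs (n : ℕ) : ∀ {f : ℝ → ℝ}, MemWinf (n + 1) f → ContinuousOn f (Ici 0) →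
    ∃ (G : ℕ → ℝ → ℝ) (g : ℝ → ℝ), G 0 = f ∧
      (∀ l < n, ∀ t ∈ Ici (0 : ℝ), HasDerivWithinAt (G l) (G (l + 1) t) (Ici 0) t) ∧
      (∀ l ≤ n, ContinuousOn (G l) (Ici 0)) ∧
      (∀ l ≤ n, ∃ M : ℝ, ∀ t ∈ Ici (0 : ℝ), |G l t| ≤ M) ∧
      MemLinf g ∧ ∀ t ∈ Ici (0 : ℝ), G n t = G n 0 + ∫ u in 0..t, g u := by
  induction n with
  | zero =>
    rintro f ⟨g, rfl, hmem, hder⟩ hc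
    refine ⟨fun _ => g 0, g 1, rfl, by simp, fun _ _ => hc, fun _ _ => ?_, hmem 1 le_rfl, ?_⟩
    · obtain ⟨M, -, hM⟩ := (hmem 0 (by simp)).bound hc
      exact ⟨M, hM⟩
    · intro t ht
      have := hder 0 (by simp)
      rw [← ivl_top] at this hc ht
      exact this.eq_primitive hc ht
  | succ n ih =>
    rintro f ⟨g, rfl, hmem, hder⟩ hc
    have h1 := hder 1 (by omega)
    rw [← ivl_top] at h1
    obtain ⟨c, hk⟩ := h1.ae_eq_primitive (EReal.coe_lt_top 0)
    -- `g 1` is determined only up to a null set. The induction hypothesis requires continuity and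
    -- is applied to the continuous representative `k`.
    set k : ℝ → ℝ := fun t => c + ∫ u in (0 : ℝ)..t, g 2 u with hkdef
    have hkc : ContinuousOn k (Ici 0) := by
      rw [← ivl_top]
      exact continuousOn_const.add (continuousOn_primitive_ivl h1.right)
    have hae : g 1 =ᵐ[volume.restrict (Ici 0)] k := by
      rw [Filter.EventuallyEq, ae_restrict_iff' measurableSet_Ici]
      filter_upwards [hk] with t ht ht0
      rw [← ivl_top] at ht0
      exact ht ht0
    have hkW : MemWinf (n + 1) k := by
      refine ⟨fun j => if j = 0 then k else g (j + 1), by simp, ?_, ?_⟩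
      · intro j hj
        by_cases h0 : j = 0
        · simp only [h0, if_true]
          exact (memLp_congr_ae hae).1 (hmem 1 (by omega))
        · simp only [h0, if_false]
          exact hmem (j + 1) (by omega)
      · intro j hj
        by_cases h0 : j = 0
        · simp only [h0, if_true, zero_add, one_ne_zero, if_false]
          rw [← ivl_top]
          exact hasWeakDeriv_of_eq_primitive h1.right (fun t _ => rfl)
        · simp only [h0, if_false, Nat.add_eq_zero_iff, one_ne_zero, and_false]
          exact hder (j + 1) (by omega)
    obtain ⟨G, w, hG0, hGd, hGc, hGb, hw, hGw⟩ := ih hkW hkc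
    refine ⟨fun j => Nat.casesOn j (g 0) G, w, rfl, ?_, ?_, ?_, hw, hGw⟩
    · rintro (_ | l) hl t ht
      · simp only [hG0]
        have hg0 := hder 0 (by omega)
        rw [← ivl_top] at hg0 ht
        have hkc' : ContinuousOn k (ivl 0 ⊤) := by rwa [ivl_top]
        refine hasDerivWithinAt_ivl_of_eq_primitive (c := g 0 0) hkc' (fun t ht => ?_) ht
        refine (hg0.eq_primitive (by rwa [ivl_top]) ht).trans ?_
        congr 1
        refine intervalIntegral.integral_congr_ae ?_
        filter_upwards [hk] with u hu hu'
        rw [uIoc_of_le ht.1] at hu'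
        exact hu (by rw [ivl_top]; exact hu'.1.le)
      · exact hGd l (by omega) t ht
    · rintro (_ | l) hl
      · exact hc
      · exact hGc l (by omega)
    · rintro (_ | l) hl
      · obtain ⟨M, -, hM⟩ := (hmem 0 (by simp)).bound hc
        exact ⟨M, hM⟩
      · exact hGb l (by omega)

/-! ### Funnel functions -/

lemma FunnelFunction.continuousOn {n : ℕ} {φ : ℝ → ℝ} (hφ : FunnelFunction n φ) :
    ContinuousOn φ (Ici 0) := hφ.contDiff.continuousOn

lemma FunnelFunction.exists_bound {n : ℕ} {φ : ℝ → ℝ} (hφ : FunnelFunction n φ) :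
    ∃ c > 0, ∀ t ∈ Ici (0 : ℝ), |φ t| ≤ c := by
  obtain ⟨c, hc⟩ := hφ.bounded 0 (Nat.zero_le _)
  refine ⟨max c 1, by positivity, fun t ht => ?_⟩
  have := hc t ht
  rw [iteratedDerivWithin_zero] at this
  exact this.trans (le_max_left _ _)

/-- Positivity is assumed for `t > 0` only; the case `φ 0 = 0`, a funnel without initial
restriction, is reached by continuity. -/
lemma FunnelFunction.nonneg {n : ℕ} {φ : ℝ → ℝ} (hφ : FunnelFunction n φ) {t : ℝ} (ht : 0 ≤ t) :
    0 ≤ φ t := by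
  have h : closure (Ioi (0 : ℝ)) ⊆ {t | t ∈ Ici (0 : ℝ) ∧ 0 ≤ φ t} := by
    refine closure_minimal (fun s hs => ⟨mem_Ici.2 (le_of_lt hs), (hφ.pos s hs).le⟩) ?_
    exact (hφ.continuousOn.preimage_isClosed_of_isClosed isClosed_Ici isClosed_Ici)
  rw [closure_Ioi] at h
  exact (h ht).2

/-- The limit inferior controls large times and compactness the rest. The restriction to `t ≥ δ` is
necessary since `φ 0` may vanish. -/
lemma FunnelFunction.exists_lower {n : ℕ} {φ : ℝ → ℝ} (hφ : FunnelFunction n φ) {δ : ℝ}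
    (hδ : 0 < δ) : ∃ l > 0, ∀ t, δ ≤ t → l ≤ φ t := by
  obtain ⟨l, hl0, hl⟩ := exists_between hφ.liminf_pos
  have hev : ∀ᶠ t in atTop, l < φ t := by
    refine eventually_lt_of_lt_liminf hl ?_
    refine ⟨0, ?_⟩
    rw [eventually_map]
    filter_upwards [eventually_gt_atTop 0] with t ht
    exact (hφ.pos t ht).le
  obtain ⟨T, hT⟩ := eventually_atTop.1 hev
  obtain ⟨m, hm, hmin⟩ := (isCompact_Icc (a := δ) (b := max T δ)).exists_isMinOn
    ⟨δ, ⟨le_rfl, le_max_right _ _⟩⟩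
    (hφ.continuousOn.mono (fun t ht => hδ.le.trans ht.1))
  refine ⟨min l (φ m), lt_min hl0 (hφ.pos m (hδ.trans_le hm.1)), fun t ht => ?_⟩
  rcases le_total t (max T δ) with h | h
  · exact (min_le_right _ _).trans (hmin ⟨ht, h⟩)
  · exact (min_le_left _ _).trans (hT t ((le_max_left _ _).trans h)).le

lemma FunnelFunction.exists_deriv {n : ℕ} {φ : ℝ → ℝ} (hφ : FunnelFunction n φ) (hn : 1 ≤ n) :
    ∃ c > 0, ∀ t ∈ Ici (0 : ℝ), HasDerivWithinAt φ (derivWithin φ (Ici 0) t) (Ici 0) t ∧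
      |derivWithin φ (Ici 0) t| ≤ c := by
  obtain ⟨c, hc⟩ := hφ.bounded 1 hn
  refine ⟨max c 1, by positivity, fun t ht => ⟨?_, ?_⟩⟩
  · exact ((hφ.contDiff.differentiableOn (by exact_mod_cast (by omega : n ≠ 0))) t ht).hasDerivWithinAt
  · have := hc t ht
    rw [iteratedDerivWithin_one] at this
    exact this.trans (le_max_left _ _)

/-- The barrier argument of funnel control. -/
lemma funnel_barrier {E : Type*} [NormedAddCommGroup E] [InnerProductSpace ℝ E]
    {ω : EReal} (hω : 0 < ω) {n : ℕ} (hn : 1 ≤ n) {φ : ℝ → ℝ} (hφ : FunnelFunction n φ) {e G : ℝ → E}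
    (hfun : ∀ t ∈ ivl 0 ω, φ t * ‖e t‖ < 1)
    (hlip : ∀ t ∈ ivl 0 ω, ∃ K, LipschitzOnWith K e (Icc 0 t))
    (hder : ∀ᵐ s, s ∈ ivl 0 ω → HasDerivAt e (G s) s) {B γ : ℝ} (hγ : 0 < γ)
    (hineq : ∀ᵐ s, s ∈ ivl 0 ω → inner ℝ (e s) (G s) ≤
      B * ‖e s‖ - γ * (‖e s‖ ^ 2 / (1 - φ s ^ 2 * ‖e s‖ ^ 2))) :
    ∃ ε > 0, ∀ t ∈ ivl 0 ω, φ t ^ 2 * ‖e t‖ ^ 2 ≤ 1 - ε := by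
  -- A positive lower bound for `φ` is available only on `[δ, ∞)`. On `[0, δ]` the margin comes from
  -- compactness.
  obtain ⟨δ, hδ, hδω⟩ := EReal.exists_between_coe_real hω
  have hδ0 : 0 < δ := by exact_mod_cast hδ
  obtain ⟨c, hc0, hc⟩ := hφ.exists_bound
  obtain ⟨c', hc'0, hc'⟩ := hφ.exists_deriv hn
  obtain ⟨l, hl0, hl⟩ := hφ.exists_lower hδ0
  set η : ℝ → ℝ := fun t => φ t ^ 2 * ‖e t‖ ^ 2 with hη
  have hη1 : ∀ t ∈ ivl 0 ω, η t < 1 := by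
    intro t ht
    have h0 : 0 ≤ φ t * ‖e t‖ := mul_nonneg (hφ.nonneg ht.1) (norm_nonneg _)
    have h1 := hfun t ht
    simp only [hη, ← mul_pow]
    nlinarith
  -- Differentiability of `e` is given only almost everywhere, so the monotonicity argument rests on
  -- the fundamental theorem for absolutely continuous functions.
  have hac : ∀ s ∈ ivl 0 ω, AbsolutelyContinuousOnInterval η 0 s := by
    intro s hs
    obtain ⟨K, hK⟩ := hlip s hs
    have hI : uIcc 0 s = Icc 0 s := uIcc_of_le hs.1
    have h1 : AbsolutelyContinuousOnInterval (fun t => ‖e t‖) 0 s := by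
      have : LipschitzOnWith (1 * K) (fun t => ‖e t‖) (Icc 0 s) :=
        lipschitzWith_one_norm.comp_lipschitzOnWith hK
      rw [← hI] at this
      exact this.absolutelyContinuousOnInterval
    have h2 : AbsolutelyContinuousOnInterval φ 0 s := by
      refine ContDiffOn.absolutelyContinuousOnInterval ?_
      rw [hI]
      exact (hφ.contDiff.of_le (by exact_mod_cast hn)).mono Icc_subset_Ici_self
    have := (h2.mul h2).mul (h1.mul h1)
    convert this using 1
    ext t; simp [hη]; ring
  have hηc : ∀ s ∈ ivl 0 ω, ContinuousOn η (Icc 0 s) := by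
    intro s hs
    have := (hac s hs).continuousOn
    rwa [uIcc_of_le hs.1] at this
  have hδm : δ ∈ ivl 0 ω := ⟨hδ0.le, hδω⟩
  obtain ⟨m₀, hm₀, hmax⟩ := (isCompact_Icc (a := (0:ℝ)) (b := δ)).exists_isMaxOn
    ⟨0, ⟨le_rfl, hδ0.le⟩⟩ (hηc δ hδm)
  have hm₀' : m₀ ∈ ivl 0 ω := Icc_subset_ivl le_rfl hδω hm₀
  -- Up to a factor 2, the derivative of `η` beyond `δ` is at most `c' / l + c |B| - γ η / (1 - η)`.
  -- This is nonpositive once `η / (1 - η) ≥ M`; the threshold `ηs` satisfies `ηs / (1 - ηs) = M +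
  -- 1`.
  set M : ℝ := (c' / l + c * |B|) / γ with hM
  have hM0 : 0 ≤ M := by positivity
  set ηs : ℝ := (M + 1) / (M + 2) with hηs
  have hηs1 : ηs < 1 := by rw [hηs, div_lt_one (by positivity)]; linarith
  have hηs0 : 0 < ηs := by positivity
  set m : ℝ := max (η m₀) ηs with hm
  have hm1 : m < 1 := max_lt (hη1 m₀ hm₀') hηs1
  refine ⟨1 - m, by linarith, fun t₁ ht₁ => ?_⟩
  rw [sub_sub_cancel]
  rcases le_total t₁ δ with htδ | htδ
  · exact (hmax ⟨ht₁.1, htδ⟩).trans (le_max_left _ _)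
  by_contra hcon
  rw [not_le] at hcon
  have hcon' : m < η t₁ := hcon
  -- Let `s` be the last time before `t₁` with `η s ≤ m`. Afterwards `η > m` forces a nonpositive
  -- derivative, so `η t₁ ≤ η s ≤ m`, a contradiction.
  set A : Set ℝ := {u ∈ Icc δ t₁ | η u ≤ m} with hA
  have hδt : Icc δ t₁ ⊆ Icc 0 t₁ := Icc_subset_Icc_left hδ0.le
  have hAcl : IsClosed A :=
    ((hηc t₁ ht₁).mono hδt).preimage_isClosed_of_isClosed isClosed_Icc isClosed_Iic
  have hAc : IsCompact A := isCompact_Icc.of_isClosed_subset hAcl (sep_subset _ _)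
  have hAne : A.Nonempty := ⟨δ, ⟨le_rfl, htδ⟩, (hmax ⟨hδ0.le, le_rfl⟩).trans (le_max_left _ _)⟩
  obtain ⟨s, hs, hsmax⟩ := hAc.exists_isMaxOn hAne continuousOn_id
  have hst : s < t₁ := lt_of_le_of_ne hs.1.2 (by rintro rfl; exact absurd hs.2 (not_le.2 hcon'))
  have hbig : ∀ u ∈ Ioc s t₁, m < η u := by
    intro u hu
    by_contra hn
    exact absurd (hsmax (⟨⟨hs.1.1.trans hu.1.le, hu.2⟩, not_lt.1 hn⟩ : u ∈ A)) (not_le.2 hu.1)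
  have hacs : AbsolutelyContinuousOnInterval η s t₁ := (hac t₁ ht₁).mono (by
    rw [uIcc_of_le hst.le, uIcc_of_le ht₁.1]
    exact Icc_subset_Icc_left (hδ0.le.trans hs.1.1))
  have hint := hacs.integral_deriv_eq_sub
  have hneg : ∫ u in s..t₁, deriv η u ≤ 0 := by
    rw [intervalIntegral.integral_of_le hst.le]
    refine integral_nonpos_of_ae ?_
    rw [Filter.EventuallyLE, ae_restrict_iff' measurableSet_Ioc]
    filter_upwards [hder, hineq] with u hu1 hu2 hu
    have hu0 : 0 < u := hδ0.trans_le (hs.1.1.trans hu.1.le)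
    have huω : u ∈ ivl 0 ω := ⟨hu0.le, (EReal.coe_le_coe hu.2).trans_lt ht₁.2⟩
    have hlu : l ≤ φ u := hl u (hs.1.1.trans hu.1.le)
    have hφd : HasDerivAt φ (derivWithin φ (Ici 0) u) u :=
      (hc' u hu0.le).1.hasDerivAt (Ici_mem_nhds hu0)
    have hed := (hu1 huω).norm_sq
    have hηd := (hφd.fun_pow 2).fun_mul hed
    have hd : deriv η u = 2 * (φ u * derivWithin φ (Ici 0) u * ‖e u‖ ^ 2
        + φ u ^ 2 * inner ℝ (e u) (G u)) := by
      rw [hηd.deriv]; simp; ring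
    rw [hd]
    have hφu : φ u ≤ c := (le_abs_self _).trans (hc u hu0.le)
    have hφu0 : 0 < φ u := hl0.trans_le hlu
    have hmη := hbig u hu
    have hη1u := hη1 u huω
    have hηu : η u = φ u ^ 2 * ‖e u‖ ^ 2 := rfl
    have hpos : 0 < 1 - η u := by linarith
    -- the three terms
    have t1 : φ u * derivWithin φ (Ici 0) u * ‖e u‖ ^ 2 ≤ c' / l := by
      have h1 : φ u * ‖e u‖ ^ 2 ≤ 1 / l := by
        rw [le_div_iff₀ hl0]
        have : φ u * ‖e u‖ ^ 2 * l ≤ φ u * ‖e u‖ ^ 2 * φ u := by gcongr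
        nlinarith
      calc φ u * derivWithin φ (Ici 0) u * ‖e u‖ ^ 2
          = derivWithin φ (Ici 0) u * (φ u * ‖e u‖ ^ 2) := by ring
        _ ≤ c' * (1 / l) := by
            apply mul_le_mul _ h1 (by positivity) hc'0.le
            exact (le_abs_self _).trans (hc' u hu0.le).2
        _ = c' / l := by ring
    have t2 : φ u ^ 2 * (B * ‖e u‖) ≤ c * |B| := by
      have h1 : φ u * ‖e u‖ ≤ 1 := (hfun u huω).le
      calc φ u ^ 2 * (B * ‖e u‖) ≤ φ u ^ 2 * (|B| * ‖e u‖) := by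
            gcongr; exact le_abs_self B
        _ = φ u * |B| * (φ u * ‖e u‖) := by ring
        _ ≤ φ u * |B| * 1 := by gcongr
        _ ≤ c * |B| := by rw [mul_one]; gcongr
    have t3 : c' / l + c * |B| ≤ γ * (η u / (1 - η u)) := by
      have : M ≤ η u / (1 - η u) := by
        rw [le_div_iff₀ hpos]
        have h1 : ηs < η u := (le_max_right _ _).trans_lt hmη
        have h2 : ηs * (M + 2) = M + 1 := by rw [hηs]; field_simp
        nlinarith
      have h3 : γ * M = c' / l + c * |B| := by rw [hM]; field_simp
      rw [← h3]; gcongr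
    have t4 : φ u ^ 2 * inner ℝ (e u) (G u) ≤ c * |B| - γ * (η u / (1 - η u)) := by
      calc φ u ^ 2 * inner ℝ (e u) (G u)
          ≤ φ u ^ 2 * (B * ‖e u‖ - γ * (‖e u‖ ^ 2 / (1 - φ u ^ 2 * ‖e u‖ ^ 2))) := by
            gcongr; exact hu2 huω
        _ = φ u ^ 2 * (B * ‖e u‖) - γ * (η u / (1 - η u)) := by rw [hηu]; ring
        _ ≤ _ := by linarith
    simp only [Pi.zero_apply]
    linarith
  have := hs.2
  linarith


/-! ### A fixed point theorem for causal operators -/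

/-- The continuous functions on `[a, b]` that start in `x₀` and stay in a closed ball. -/
def tube {X : Type*} [PseudoMetricSpace X] (a b : ℝ) (x₀ : X) (δ : ℝ) : Set (ℝ → X) :=
  {x | ContinuousOn x (Icc a b) ∧ x a = x₀ ∧ ∀ t ∈ Icc a b, dist (x t) x₀ ≤ δ}

/-- A causal and continuous operator with equicontinuous values has a fixed point; the
proof uses Tonelli's approximation by operators with delay. -/
theorem exists_fixedPoint_of_causal {X : Type*} [MetricSpace X] [ProperSpace X] {a b : ℝ}
    (hab : a < b) {x₀ : X} {δ : ℝ} (hδ : 0 ≤ δ) (P : (ℝ → X) → ℝ → X)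
    (hmaps : ∀ x ∈ tube a b x₀ δ, P x ∈ tube a b x₀ δ)
    (hequi : ∀ ε > 0, ∃ η > 0, ∀ x ∈ tube a b x₀ δ, ∀ s ∈ Icc a b, ∀ t ∈ Icc a b,
      |s - t| < η → dist (P x s) (P x t) < ε)
    (hcausal : ∀ x ∈ tube a b x₀ δ, ∀ y ∈ tube a b x₀ δ, ∀ t ∈ Icc a b,
      EqOn x y (Icc a t) → P x t = P y t)
    (hcont : ∀ (xs : ℕ → ℝ → X) (x : ℝ → X), (∀ n, xs n ∈ tube a b x₀ δ) → x ∈ tube a b x₀ δ →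
      TendstoUniformlyOn xs x atTop (Icc a b) →
      ∀ t ∈ Icc a b, Tendsto (fun n => P (xs n) t) atTop (𝓝 (P x t))) :
    ∃ x ∈ tube a b x₀ δ, EqOn x (P x) (Icc a b) := by
  set d : ℕ → ℝ := fun n => (b - a) / (n + 1) with hd
  have hd0 : ∀ n, 0 < d n := fun n => div_pos (sub_pos.2 hab) (by positivity)
  have hsh : ∀ n, ∀ t ∈ Icc a b, max a (t - d n) ∈ Icc a b := fun n t ht =>
    ⟨le_max_left _ _, max_le hab.le (by linarith [ht.2, hd0 n])⟩
  set Q : ℕ → (ℝ → X) → ℝ → X := fun n x t => P x (max a (t - d n)) with hQ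
  have hQmaps : ∀ n, ∀ x ∈ tube a b x₀ δ, Q n x ∈ tube a b x₀ δ := by
    intro n x hx
    obtain ⟨h1, h2, h3⟩ := hmaps x hx
    refine ⟨h1.comp (by fun_prop) (hsh n), ?_, fun t ht => h3 _ (hsh n t ht)⟩
    simp only [hQ]
    rw [max_eq_left (by linarith [hd0 n]), h2]
  have hz : ∀ n k, (Q n)^[k] (fun _ => x₀) ∈ tube a b x₀ δ := by
    intro n k
    induction k with
    | zero => exact ⟨continuousOn_const, rfl, fun t _ => by simpa using hδ⟩
    | succ k ih => rw [Function.iterate_succ_apply']; exact hQmaps n _ ih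
  -- With the delay `d n`, values on `[a, a + (k + 1) d n]` use only values on `[a, a + k d n]`, so
  -- each iteration settles one more step of length `d n`. Since `(n + 1) d n = b - a`, the iterate
  -- of index `n + 1` solves the delayed equation on all of `[a, b]`.
  have hstat : ∀ n (k : ℕ), ∀ t ∈ Icc a b, t ≤ a + k * d n →
      (Q n)^[k + 1] (fun _ => x₀) t = (Q n)^[k] (fun _ => x₀) t := by
    intro n k
    induction k with
    | zero =>
      intro t ht hta
      have : t = a := le_antisymm (by simpa using hta) ht.1
      rw [this, (hz n 1).2.1, (hz n 0).2.1]
    | succ k ih =>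
      intro t ht hta
      rw [congrFun (Function.iterate_succ_apply' (Q n) (k + 1) fun _ => x₀) t,
        congrFun (Function.iterate_succ_apply' (Q n) k fun _ => x₀) t]
      refine hcausal _ (hz n _) _ (hz n _) _ (hsh n t ht) ?_
      intro u hu
      refine ih u ⟨hu.1, hu.2.trans (hsh n t ht).2⟩ (hu.2.trans ?_)
      push_cast at hta
      refine max_le ?_ (by linarith)
      have := hd0 n
      nlinarith [(Nat.cast_nonneg k : (0:ℝ) ≤ k)]
  set xs : ℕ → ℝ → X := fun n => (Q n)^[n + 1] (fun _ => x₀) with hxs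
  have hxsm : ∀ n, xs n ∈ tube a b x₀ δ := fun n => hz n _
  have hxseq : ∀ n, ∀ t ∈ Icc a b, xs n t = P (xs n) (max a (t - d n)) := by
    intro n t ht
    have h1 := hstat n (n + 1) t ht (by
      have : ((n + 1 : ℕ) : ℝ) * d n = b - a := by
        simp only [hd]; push_cast; field_simp
      rw [this]; linarith [ht.2])
    rw [hxs]
    simp only
    rw [← h1, Function.iterate_succ_apply']
  -- compactness
  let F : ℕ → BoundedContinuousFunction (Icc a b) X := fun n =>
    BoundedContinuousFunction.mkOfCompact ⟨fun t => xs n t, (hxsm n).1.domRestrict⟩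
  have hF : ∀ n (t : Icc a b), F n t = xs n t := fun n t => rfl
  have hcomp : IsCompact (closure (range F)) := by
    refine BoundedContinuousFunction.arzela_ascoli (Metric.closedBall x₀ δ)
      (isCompact_closedBall _ _) _ ?_ ?_
    · rintro _ t ⟨n, rfl⟩
      rw [hF, Metric.mem_closedBall]
      exact (hxsm n).2.2 t t.2
    · apply UniformEquicontinuous.equicontinuous
      rw [Metric.uniformEquicontinuous_iff]
      intro ε hε
      obtain ⟨η, hη, h⟩ := hequi ε hε
      refine ⟨η, hη, ?_⟩
      rintro s t hst ⟨_, n, rfl⟩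
      change dist (F n s) (F n t) < ε
      rw [hF, hF, hxseq n s s.2, hxseq n t t.2]
      refine h _ (hxsm n) _ (hsh n s s.2) _ (hsh n t t.2) (lt_of_le_of_lt ?_ hst)
      rw [Subtype.dist_eq, Real.dist_eq]
      rw [max_comm a, max_comm a]
      refine (abs_max_sub_max_le_abs _ _ _).trans (le_of_eq ?_)
      congr 1; ring
  obtain ⟨y, -, σ, hσ, hlim⟩ := hcomp.tendsto_subseq (x := F) (fun n => subset_closure ⟨n, rfl⟩)
  set x : ℝ → X := IccExtend hab.le y with hx
  have hxy : ∀ t (ht : t ∈ Icc a b), x t = y ⟨t, ht⟩ := fun t ht => IccExtend_of_mem _ _ ht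
  have hunif : TendstoUniformlyOn (fun n => xs (σ n)) x atTop (Icc a b) := by
    rw [Metric.tendstoUniformlyOn_iff]
    intro ε hε
    filter_upwards [(Metric.tendsto_nhds.1 hlim) ε hε] with n hn t ht
    rw [hxy t ht, dist_comm]
    exact (BoundedContinuousFunction.dist_coe_le_dist (f := F (σ n)) (g := y) ⟨t, ht⟩).trans_lt hn
  have hpt : ∀ t ∈ Icc a b, Tendsto (fun n => xs (σ n) t) atTop (𝓝 (x t)) := fun t ht =>
    hunif.tendsto_at ht
  have hxm : x ∈ tube a b x₀ δ := by
    refine ⟨?_, ?_, fun t ht => ?_⟩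
    · exact (y.continuous.Icc_extend' ).continuousOn
    · refine tendsto_nhds_unique (hpt a (left_mem_Icc.2 hab.le)) ?_
      simp_rw [(hxsm _).2.1]
      exact tendsto_const_nhds
    · exact le_of_tendsto ((hpt t ht).dist tendsto_const_nhds)
        (Eventually.of_forall fun n => (hxsm _).2.2 t ht)
  refine ⟨x, hxm, fun t ht => ?_⟩
  have hP := hcont _ x (fun n => hxsm (σ n)) hxm hunif t ht
  refine tendsto_nhds_unique (hpt t ht) ?_
  -- `xs (σ n) t` is `P (xs (σ n))` at a time earlier by at most `d (σ n)`; equicontinuity makes the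
  -- delay negligible in the limit.
  refine (tendsto_iff_of_dist ?_).2 hP
  rw [Metric.tendsto_nhds]
  intro ε hε
  obtain ⟨η, hη, h⟩ := hequi ε hε
  have hdlim : Tendsto (fun n => d (σ n)) atTop (𝓝 0) := by
    have : Tendsto d atTop (𝓝 0) := tendsto_const_div_atTop_nhds_zero_nat (b - a) |>.comp
      (tendsto_add_atTop_nat 1) |>.congr (fun n => by simp [hd])
    exact this.comp hσ.tendsto_atTop
  filter_upwards [hdlim.eventually (gt_mem_nhds hη)] with n hn
  rw [Real.dist_eq, sub_zero, abs_of_nonneg dist_nonneg, hxseq _ t ht]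
  refine h _ (hxsm _) _ (hsh _ t ht) _ ht ?_
  have h1 : max a (t - d (σ n)) ≤ t := max_le ht.1 (by linarith [hd0 (σ n)])
  have h2 : t - d (σ n) ≤ max a (t - d (σ n)) := le_max_right _ _
  rw [abs_sub_comm, abs_of_nonneg (by linarith)]
  linarith


/-! ### Towers of derivatives -/

/-- `Tower P D n f`: the family of functions `f c` and its derivatives of order at most `n` at the
points of `D c` have the property `P`. -/
def Tower {κ : Type*} (P : (κ → ℝ → ℝ) → Prop) (D : κ → Set ℝ) : ℕ → (κ → ℝ → ℝ) → Prop
  | 0, f => P f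
  | n + 1, f => P f ∧ ∃ g, Tower P D n g ∧
      ∀ c, ∀ t ∈ D c, HasDerivWithinAt (f c) (g c t) (Ici 0) t

/-- Stability of a property of families of functions under algebraic operations. -/
structure AlgebraicProperty {κ : Type*} (P : (κ → ℝ → ℝ) → Prop) (D : κ → Set ℝ) : Prop where
  const : ∀ r : ℝ, P fun _ _ => r
  add : ∀ f g, P f → P g → P fun c t => f c t + g c t
  mul : ∀ f g, P f → P g → P fun c t => f c t * g c t
  congr : ∀ f g, P f → (∀ c, ∀ t ∈ D c, g c t = f c t) → P g
  nonneg : ∀ c, D c ⊆ Ici 0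

namespace Tower

variable {κ : Type*} {P : (κ → ℝ → ℝ) → Prop} {D : κ → Set ℝ}

lemma base : ∀ {n : ℕ} {f : κ → ℝ → ℝ}, Tower P D n f → P f
  | 0, _, h => h
  | _ + 1, _, h => h.1

lemma pred : ∀ {n : ℕ} {f : κ → ℝ → ℝ}, Tower P D (n + 1) f → Tower P D n f
  | 0, _, h => h.1
  | _ + 1, _, ⟨h, g, hg, hd⟩ => ⟨h, g, pred hg, hd⟩

lemma of_le {m n : ℕ} (hmn : m ≤ n) {f : κ → ℝ → ℝ} (h : Tower P D n f) : Tower P D m f := by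
  induction hmn with
  | refl => exact h
  | step _ ih => exact ih (pred h)

lemma mono {P' : (κ → ℝ → ℝ) → Prop} {D' : κ → Set ℝ} (hP : ∀ f, P f → P' f)
    (hD : ∀ c, D' c ⊆ D c) : ∀ {n : ℕ} {f : κ → ℝ → ℝ}, Tower P D n f → Tower P' D' n f
  | 0, _, h => hP _ h
  | _ + 1, _, ⟨h, g, hg, hd⟩ => ⟨hP _ h, g, mono hP hD hg, fun c t ht => hd c t (hD c ht)⟩

lemma const (hA : AlgebraicProperty P D) (r : ℝ) : ∀ n, Tower P D n fun _ _ => r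
  | 0 => hA.const r
  | n + 1 => ⟨hA.const r, fun _ _ => 0, const hA 0 n, fun _ _ _ => hasDerivWithinAt_const _ _ _⟩

lemma add (hA : AlgebraicProperty P D) : ∀ {n : ℕ} {f g : κ → ℝ → ℝ}, Tower P D n f →
    Tower P D n g → Tower P D n fun c t => f c t + g c t
  | 0, _, _, hf, hg => hA.add _ _ hf hg
  | _ + 1, _, _, ⟨hf, f', hf', hfd⟩, ⟨hg, g', hg', hgd⟩ =>
    ⟨hA.add _ _ hf hg, fun c t => f' c t + g' c t, add hA hf' hg',
      fun c t ht => (hfd c t ht).add (hgd c t ht)⟩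

lemma mul (hA : AlgebraicProperty P D) : ∀ {n : ℕ} {f g : κ → ℝ → ℝ}, Tower P D n f →
    Tower P D n g → Tower P D n fun c t => f c t * g c t
  | 0, _, _, hf, hg => hA.mul _ _ hf hg
  | _ + 1, f, g, hf, hg => by
    obtain ⟨hf0, f', hf', hfd⟩ := hf
    obtain ⟨hg0, g', hg', hgd⟩ := hg
    have hf1 : Tower P D _ f := pred ⟨hf0, f', hf', hfd⟩
    have hg1 : Tower P D _ g := pred ⟨hg0, g', hg', hgd⟩
    exact ⟨hA.mul _ _ hf0 hg0, fun c t => f' c t * g c t + f c t * g' c t,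
      add hA (mul hA hf' hg1) (mul hA hf1 hg'), fun c t ht => (hfd c t ht).mul (hgd c t ht)⟩

/-- A property such as boundedness does not pass to reciprocals, so `P` is required of `f⁻¹` itself.
For the derivatives this suffices, since `(f⁻¹)' = - f' f⁻¹ f⁻¹` is polynomial in `f⁻¹` and `f'`. -/
lemma inv (hA : AlgebraicProperty P D) {f : κ → ℝ → ℝ} (hne : ∀ c, ∀ t ∈ D c, f c t ≠ 0)
    (hi : P fun c t => (f c t)⁻¹) : ∀ {n : ℕ}, Tower P D n f → Tower P D n fun c t => (f c t)⁻¹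
  | 0, _ => hi
  | n + 1, hf => by
    have h1 : Tower P D n fun c t => (f c t)⁻¹ := inv hA hne hi (pred hf)
    obtain ⟨hf0, f', hf', hfd⟩ := hf
    refine ⟨hi, fun c t => (-1) * (f' c t * ((f c t)⁻¹ * (f c t)⁻¹)),
      mul hA (const hA _ _) (mul hA hf' (mul hA h1 h1)), fun c t ht => ?_⟩
    refine ((hfd c t ht).fun_inv (hne c t ht)).congr_deriv ?_
    rw [div_eq_mul_inv, pow_two, mul_inv]; ring

/-- Derivatives transfer only between functions that agree near each point, hence the openness
hypothesis `hD`. -/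
lemma congr (hA : AlgebraicProperty P D) (hD : ∀ c, ∀ t ∈ D c, D c ∈ 𝓝[Ici 0] t)
    {f g : κ → ℝ → ℝ} (h : ∀ c, ∀ t ∈ D c, g c t = f c t) :
    ∀ {n : ℕ}, Tower P D n f → Tower P D n g
  | 0, hf => hA.congr _ _ hf h
  | _ + 1, ⟨hf, f', hf', hfd⟩ => ⟨hA.congr _ _ hf h, f', hf', fun c t ht =>
      (hfd c t ht).congr_of_eventuallyEq (by filter_upwards [hD c t ht] with s hs using h c s hs)
        (h c t ht)⟩

lemma of_contDiffOn (hA : AlgebraicProperty P D) {n : ℕ} {φ : ℝ → ℝ}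
    (hφ : ContDiffOn ℝ n φ (Ici 0))
    (hP : ∀ l ≤ n, P fun _ t => iteratedDerivWithin l φ (Ici 0) t) :
    ∀ m l, l + m ≤ n → Tower P D m fun _ t => iteratedDerivWithin l φ (Ici 0) t
  | 0, l, hl => hP l hl
  | m + 1, l, hl => by
    refine ⟨hP l (by omega), _, of_contDiffOn hA hφ hP m (l + 1) (by omega), fun c t ht => ?_⟩
    rw [iteratedDerivWithin_succ]
    refine DifferentiableWithinAt.hasDerivWithinAt ?_
    exact hφ.differentiableOn_iteratedDerivWithin (by exact_mod_cast (by omega : l < n))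
      (uniqueDiffOn_Ici 0) t (hA.nonneg c ht)

/-- The product of a signal with its funnel gain. -/
lemma gain_mul (hA : AlgebraicProperty P D) {n : ℕ} {φ : ℝ → ℝ} {f : κ → ℝ → ℝ}
    (hφ : Tower P D n fun _ => φ) (hf : Tower P D n f)
    (hne : ∀ c, ∀ t ∈ D c, 1 - φ t ^ 2 * |f c t| ^ 2 ≠ 0)
    (hi : P fun c t => (1 - φ t ^ 2 * |f c t| ^ 2)⁻¹) :
    Tower P D n fun c t => 1 / (1 - φ t ^ 2 * |f c t| ^ 2) * f c t := by
  have h1 : Tower P D n fun c t => 1 - φ t ^ 2 * |f c t| ^ 2 := by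
    have := add hA (const hA 1 n) (mul hA (const hA (-1) n) (mul hA (mul hA hφ hφ) (mul hA hf hf)))
    convert this using 3 with c t
    rw [sq_abs]; ring
  have := mul hA (inv hA hne hi h1) hf
  simpa only [one_div] using this

end Tower

/-! ### The error signals of a scalar output as functions of its jets -/

/-- The signals `e_j` generated by a scalar error `e`. -/
noncomputable def errS (φ : ℕ → ℝ → ℝ) (e : ℝ → ℝ) : ℕ → ℝ → ℝ
  | 0 => e
  | j + 1 => fun t => derivWithin (errS φ e j) (Ici 0) t
      + 1 / (1 - φ j t ^ 2 * |errS φ e j t| ^ 2) * errS φ e j t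

lemma err_eq_errS {q p : ℕ} (C : Controller q p) (y : ℝ → OutputSpace q p) (i : Fin q) (j : ℕ) :
    C.err y i j = errS (C.φ i) (fun t => y t (Sum.inl i) - C.yref t (Sum.inl i)) j := by
  induction j with
  | zero => rfl
  | succ j ih => unfold Controller.err errS; rw [ih]

/-- A curve of jets of order `n` on the interval `[0, ω)`. -/
structure JetCurve (n : ℕ) where
  a : ℝ → ℕ → ℝ
  ω : EReal
  cont : ∀ l, ContinuousOn (fun t => a t l) (ivl 0 ω)
  deriv : ∀ l < n, ∀ t ∈ ivl 0 ω, HasDerivWithinAt (fun t => a t l) (a t (l + 1)) (Ici 0) t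
  zero : ∀ t l, n < l → a t l = 0

/-- The Taylor polynomial with jet `a` at `t₀`, and its derivatives. -/
noncomputable def taylorJet (n : ℕ) (a : ℕ → ℝ) (t₀ s : ℝ) (l : ℕ) : ℝ :=
  ∑ m ∈ Finset.range (n + 1 - l), a (l + m) * (s - t₀) ^ m / (m.factorial : ℝ)

lemma hasDerivAt_taylorJet {n : ℕ} (a : ℕ → ℝ) (t₀ s : ℝ) {l : ℕ} (hl : l ≤ n) :
    HasDerivAt (fun s => taylorJet n a t₀ s l) (taylorJet n a t₀ s (l + 1)) s := by
  unfold taylorJet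
  obtain ⟨M, hM⟩ : ∃ M, n + 1 - l = M + 1 := ⟨n - l, by omega⟩
  have hM' : n + 1 - (l + 1) = M := by omega
  rw [hM, hM']
  have h : ∀ m ∈ Finset.range (M + 1), HasDerivAt
      (fun s => a (l + m) * (s - t₀) ^ m / (m.factorial : ℝ))
      (a (l + m) * (m * (s - t₀) ^ (m - 1)) / (m.factorial : ℝ)) s := by
    intro m _
    have := ((((hasDerivAt_id s).sub_const t₀).fun_pow m).const_mul (a (l + m))).div_const
      (m.factorial : ℝ)
    simpa using this
  refine (HasDerivAt.fun_sum h).congr_deriv ?_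
  rw [Finset.sum_range_succ']
  simp only [Nat.cast_zero, zero_mul, mul_zero, zero_div, add_zero]
  refine Finset.sum_congr rfl fun m _ => ?_
  rw [show l + (m + 1) = l + 1 + m by ring, Nat.factorial_succ, Nat.add_sub_cancel]
  push_cast
  have : (m.factorial : ℝ) ≠ 0 := by positivity
  have h2 : (m : ℝ) + 1 ≠ 0 := by positivity
  field_simp

lemma taylorJet_self (n : ℕ) (a : ℕ → ℝ) (t₀ : ℝ) (l : ℕ) :
    taylorJet n a t₀ t₀ l = if l ≤ n then a l else 0 := by
  unfold taylorJet
  split_ifs with h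
  · rw [show n + 1 - l = (n - l) + 1 by omega, Finset.sum_range_succ']
    simp
  · rw [show n + 1 - l = 0 by omega]; simp

lemma taylorJet_of_lt {n l : ℕ} (a : ℕ → ℝ) (t₀ s : ℝ) (hl : n < l) :
    taylorJet n a t₀ s l = 0 := by
  unfold taylorJet
  rw [show n + 1 - l = 0 by omega]; simp

/-- The curve of jets of a Taylor polynomial. -/
noncomputable def taylorCurve (n : ℕ) (a : ℕ → ℝ) (t₀ : ℝ) : JetCurve n where
  a s l := taylorJet n a t₀ s l
  ω := ⊤
  cont l := by
    rcases le_or_gt l n with h | h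
    · exact fun s _ => (hasDerivAt_taylorJet a t₀ s h).continuousAt.continuousWithinAt
    · simp_rw [taylorJet_of_lt a t₀ _ h]; exact continuousOn_const
  deriv l hl t _ := (hasDerivAt_taylorJet a t₀ t hl.le).hasDerivWithinAt
  zero t l hl := taylorJet_of_lt a t₀ t hl

/-- The signal `e_j` as a function of the time and the jet of the error. -/
noncomputable def jetErr (φ : ℕ → ℝ → ℝ) (n j : ℕ) (z : ℝ × (ℕ → ℝ)) : ℝ :=
  errS φ (fun s => taylorJet n z.2 z.1 s 0) j z.1

/-- The times and jets of order `n`. -/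
def jetBase (n : ℕ) : Set (ℝ × (ℕ → ℝ)) := {z | 0 ≤ z.1 ∧ ∀ l, n < l → z.2 l = 0}

/-- The times and jets for which the first `j` signals are in their funnels. -/
def jetDomain (φ : ℕ → ℝ → ℝ) (n j : ℕ) : Set (ℝ × (ℕ → ℝ)) :=
  {z | z ∈ jetBase n ∧ ∀ l < j, φ l z.1 * |jetErr φ n l z| < 1}

lemma jetDomain_succ_subset (φ : ℕ → ℝ → ℝ) (n j : ℕ) :
    jetDomain φ n (j + 1) ⊆ jetDomain φ n j := fun _ hz => ⟨hz.1, fun l hl => hz.2 l (by omega)⟩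

/-- The times at which a jet curve is in a set. -/
def JetCurve.times {n : ℕ} (Ω : Set (ℝ × (ℕ → ℝ))) (c : JetCurve n) : Set ℝ :=
  {t | t ∈ ivl 0 c.ω ∧ (t, c.a t) ∈ Ω}

/-- The functionals of jet curves that are continuous functions of the time and the jet. -/
def IsJetFunction {n : ℕ} (Ω : Set (ℝ × (ℕ → ℝ))) (f : JetCurve n → ℝ → ℝ) : Prop :=
  ∃ E : ℝ × (ℕ → ℝ) → ℝ, ContinuousOn E Ω ∧ ∀ c, ∀ t ∈ c.times Ω, f c t = E (t, c.a t)

/-- The calculus of towers is used twice: here for continuous dependence on time and jet, over all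
jet curves at once, and in `errS_remainder` for boundedness along a single curve. -/
lemma algebraicProperty_isJetFunction (n : ℕ) (Ω : Set (ℝ × (ℕ → ℝ))) :
    AlgebraicProperty (IsJetFunction (n := n) Ω) (JetCurve.times Ω) where
  const r := ⟨fun _ => r, continuousOn_const, fun _ _ _ => rfl⟩
  add := by
    rintro f g ⟨E, hE, h⟩ ⟨F, hF, h'⟩
    exact ⟨fun z => E z + F z, hE.add hF, fun c t ht => by beta_reduce; rw [h c t ht, h' c t ht]⟩
  mul := by
    rintro f g ⟨E, hE, h⟩ ⟨F, hF, h'⟩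
    exact ⟨fun z => E z * F z, hE.mul hF, fun c t ht => by beta_reduce; rw [h c t ht, h' c t ht]⟩
  congr := by
    rintro f g ⟨E, hE, h⟩ h'
    exact ⟨E, hE, fun c t ht => by rw [h' c t ht, h c t ht]⟩
  nonneg _ _ ht := ht.1.1

lemma IsJetFunction.mono {n : ℕ} {Ω Ω' : Set (ℝ × (ℕ → ℝ))} (h : Ω' ⊆ Ω) {f : JetCurve n → ℝ → ℝ}
    (hf : IsJetFunction Ω f) : IsJetFunction Ω' f := by
  obtain ⟨E, hE, he⟩ := hf
  exact ⟨E, hE.mono h, fun c t ht => he c t ⟨ht.1, h ht.2⟩⟩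

lemma JetCurve.ivl_mem_nhdsWithin {n : ℕ} (c : JetCurve n) {t : ℝ} (ht : t ∈ ivl 0 c.ω) :
    ivl 0 c.ω ∈ 𝓝[Ici 0] t := by
  filter_upwards [self_mem_nhdsWithin, mem_nhdsWithin_of_mem_nhds
    ((isOpen_lt_coe c.ω).mem_nhds ht.2)] with s hs hs'
  exact ⟨hs, hs'⟩

lemma JetCurve.mem_jetBase {n : ℕ} (c : JetCurve n) {t : ℝ} (ht : t ∈ ivl 0 c.ω) :
    (t, c.a t) ∈ jetBase n := ⟨ht.1, fun l hl => c.zero t l hl⟩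

lemma JetCurve.continuousOn {n : ℕ} (c : JetCurve n) :
    ContinuousOn (fun t => (t, c.a t)) (ivl 0 c.ω) :=
  continuousOn_id.prodMk (continuousOn_pi.2 c.cont)

lemma one_sub_ne_zero_of_funnel {a b : ℝ} (ha : 0 ≤ a) (h : a * |b| < 1) :
    0 < 1 - a ^ 2 * |b| ^ 2 := by
  have : 0 ≤ a * |b| := mul_nonneg ha (abs_nonneg _)
  rw [← mul_pow]
  nlinarith

/-- Induction on `j`. If `e_j` and its derivatives up to order `n - j` are continuous functions of
time and jet, then so are those of `ė_j + k_j e_j` up to order `n - j - 1`, as long as `e_j` is in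
its funnel. The four claims are proved together because the domain for `e_{j+1}` is cut out by
`e_j`: its openness needs the continuity of `e_j`, and the passage to the derivative needs the
openness. -/
lemma errS_jet_aux {n : ℕ} {φ : ℕ → ℝ → ℝ} (hφ : ∀ j < n, FunnelFunction (n + 1 - j) (φ j)) :
    ∀ j ≤ n, (∀ c : JetCurve n, ∀ t ∈ c.times (jetDomain φ n j),
        c.times (jetDomain φ n j) ∈ 𝓝[Ici 0] t) ∧
      Tower (IsJetFunction (n := n) (jetDomain φ n j)) (JetCurve.times (jetDomain φ n j)) (n - j)
        (fun c t => errS φ (fun s => c.a s 0) j t) ∧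
      ContinuousOn (jetErr φ n j) (jetDomain φ n j) ∧
      (∀ c : JetCurve n, ∀ t ∈ c.times (jetDomain φ n j),
        errS φ (fun s => c.a s 0) j t = jetErr φ n j (t, c.a t)) := by
  have hrep : ∀ j, IsJetFunction (n := n) (jetDomain φ n j)
      (fun c t => errS φ (fun s => c.a s 0) j t) →
      ContinuousOn (jetErr φ n j) (jetDomain φ n j) ∧
      (∀ c : JetCurve n, ∀ t ∈ c.times (jetDomain φ n j),
        errS φ (fun s => c.a s 0) j t = jetErr φ n j (t, c.a t)) := by
    rintro j ⟨E, hE, h⟩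
    -- Every admissible time and jet lies on a jet curve, namely that of its Taylor polynomial. This
    -- forces the representing function `E` to be `jetErr`.
    have key : ∀ z ∈ jetDomain φ n j, jetErr φ n j z = E z := by
      intro z hz
      have hself : (taylorCurve n z.2 z.1).a z.1 = z.2 := by
        ext l
        simp only [taylorCurve, taylorJet_self]
        split_ifs with hl
        · rfl
        · exact (hz.1.2 l (not_le.1 hl)).symm
      have hm : z.1 ∈ (taylorCurve n z.2 z.1).times (jetDomain φ n j) :=
        ⟨⟨hz.1.1, EReal.coe_lt_top _⟩, by rw [hself]; exact hz⟩
      have := h _ _ hm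
      rw [hself] at this
      exact this
    exact ⟨hE.congr key, fun c t ht => (h c t ht).trans (key _ ht.2).symm⟩
  intro j
  induction j with
  | zero =>
    intro _
    have hdom : ∀ z, z ∈ jetDomain φ n 0 ↔ z ∈ jetBase n := fun z => by simp [jetDomain]
    have hT : ∀ m l, l + m ≤ n → Tower (IsJetFunction (n := n) (jetDomain φ n 0))
        (JetCurve.times (jetDomain φ n 0)) m (fun c t => c.a t l) := by
      intro m
      induction m with
      | zero =>
        intro l _
        exact ⟨fun z => z.2 l, by fun_prop, fun c t _ => rfl⟩
      | succ m ih =>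
        intro l hl
        exact ⟨⟨fun z => z.2 l, by fun_prop, fun c t _ => rfl⟩, _, ih (l + 1) (by omega),
          fun c t ht => c.deriv l (by omega) t ht.1⟩
    refine ⟨fun c t ht => ?_, ?_, hrep 0 ?_⟩
    · filter_upwards [c.ivl_mem_nhdsWithin ht.1] with s hs
      exact ⟨hs, (hdom _).2 (c.mem_jetBase hs)⟩
    · exact hT n 0 (by omega)
    · exact (hT n 0 (by omega)).base
  | succ j ih =>
    intro hj
    obtain ⟨hopen, htow, hcont, heq⟩ := ih (by omega)
    have hφj := hφ j (by omega)
    have hsub := jetDomain_succ_subset φ n j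
    have hDsub : ∀ c : JetCurve n, c.times (jetDomain φ n (j + 1)) ⊆ c.times (jetDomain φ n j) :=
      fun c t ht => ⟨ht.1, hsub ht.2⟩
    have hpos : ∀ z ∈ jetDomain φ n (j + 1), 0 < 1 - φ j z.1 ^ 2 * |jetErr φ n j z| ^ 2 :=
      fun z hz => one_sub_ne_zero_of_funnel (hφj.nonneg hz.1.1) (hz.2 j (by omega))
    have hφc : ContinuousOn (fun z : ℝ × (ℕ → ℝ) => φ j z.1) (jetBase n) :=
      hφj.continuousOn.comp continuousOn_fst (fun z hz => hz.1)
    have hopen' : ∀ c : JetCurve n, ∀ t ∈ c.times (jetDomain φ n (j + 1)),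
        c.times (jetDomain φ n (j + 1)) ∈ 𝓝[Ici 0] t := by
      intro c t ht
      have h1 : ContinuousWithinAt (fun s => φ j s * |jetErr φ n j (s, c.a s)|)
          (c.times (jetDomain φ n j)) t := by
        have hc : ContinuousOn (fun z => φ j z.1 * |jetErr φ n j z|) (jetDomain φ n j) :=
          (hφc.mono fun z hz => hz.1).mul hcont.abs
        exact (hc.comp (c.continuousOn.mono fun s hs => hs.1) fun s hs => hs.2) t (hDsub c ht)
      have h2 : ContinuousWithinAt (fun s => φ j s * |jetErr φ n j (s, c.a s)|) (Ici 0) t :=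
        h1.mono_of_mem_nhdsWithin (hopen c t (hDsub c ht))
      filter_upwards [h2.eventually_lt continuousWithinAt_const (ht.2.2 j (by omega)),
        hopen c t (hDsub c ht)] with s hs hs'
      refine ⟨hs'.1, hs'.2.1, fun l hl => ?_⟩
      rcases Nat.lt_succ_iff_lt_or_eq.1 hl with h | rfl
      · exact hs'.2.2 l h
      · exact hs
    have hA := algebraicProperty_isJetFunction n (jetDomain φ n (j + 1))
    have htow1 : Tower (IsJetFunction (n := n) (jetDomain φ n (j + 1)))
        (JetCurve.times (jetDomain φ n (j + 1))) (n - (j + 1) + 1)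
        (fun c t => errS φ (fun s => c.a s 0) j t) := by
      -- The tower of `e_j` is one level longer than the tower wanted for `e_{j+1}`; the surplus
      -- level is spent on the derivative `ė_j`.
      rw [show n - (j + 1) + 1 = n - j by omega]
      exact htow.mono (fun f hf => hf.mono hsub) hDsub
    have hφt : Tower (IsJetFunction (n := n) (jetDomain φ n (j + 1)))
        (JetCurve.times (jetDomain φ n (j + 1))) (n - (j + 1)) (fun _ => φ j) := by
      have := Tower.of_contDiffOn hA hφj.contDiff (fun l hl => ⟨fun z =>
        iteratedDerivWithin l (φ j) (Ici 0) z.1, ?_, fun _ _ _ => rfl⟩) (n - (j + 1)) 0 (by omega)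
      · simpa only [iteratedDerivWithin_zero] using this
      · exact (hφj.contDiff.continuousOn_iteratedDerivWithin (by exact_mod_cast hl)
          (uniqueDiffOn_Ici 0)).comp continuousOn_fst fun z hz => hz.1.1
    have hgain := Tower.gain_mul hA hφt htow1.pred
      (fun c t ht => by rw [heq c t (hDsub c ht)]; exact (hpos _ ht.2).ne')
      ⟨fun z => (1 - φ j z.1 ^ 2 * |jetErr φ n j z| ^ 2)⁻¹, by
        refine ContinuousOn.inv₀ ?_ fun z hz => (hpos z hz).ne'
        exact continuousOn_const.sub (((hφc.mono fun z hz => hz.1).pow 2).mul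
          ((hcont.mono hsub).abs.pow 2)), fun c t ht => by beta_reduce; rw [heq c t (hDsub c ht)]⟩
    obtain ⟨-, g, hg, hgd⟩ := htow1
    have hnew : Tower (IsJetFunction (n := n) (jetDomain φ n (j + 1)))
        (JetCurve.times (jetDomain φ n (j + 1))) (n - (j + 1))
        (fun c t => errS φ (fun s => c.a s 0) (j + 1) t) := by
      refine Tower.congr hA hopen' (fun c t ht => ?_) (Tower.add hA hg hgain)
      simp only [errS]
      rw [(hgd c t ht).derivWithin (uniqueDiffOn_Ici 0 t ht.1.1)]
    exact ⟨hopen', hnew, hrep (j + 1) hnew.base⟩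

section JetErr

variable {n : ℕ} {φ : ℕ → ℝ → ℝ}

lemma continuousOn_jetErr (hφ : ∀ j < n, FunnelFunction (n + 1 - j) (φ j))
    {j : ℕ} (hj : j ≤ n) :
    ContinuousOn (jetErr φ n j) (jetDomain φ n j) := (errS_jet_aux hφ j hj).2.2.1

lemma errS_eq_jetErr (hφ : ∀ j < n, FunnelFunction (n + 1 - j) (φ j))
    {j : ℕ} (hj : j ≤ n) (c : JetCurve n) {t : ℝ} (ht : t ∈ ivl 0 c.ω)
    (hd : (t, c.a t) ∈ jetDomain φ n j) :
    errS φ (fun s => c.a s 0) j t = jetErr φ n j (t, c.a t) :=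
  (errS_jet_aux hφ j hj).2.2.2 c t ⟨ht, hd⟩

/-- For `j < n` the tower has a level left, so `e_j` is differentiable, and the recursion for
`e_{j+1}` can be solved for `ė_j`. -/
lemma hasDerivWithinAt_errS (hφ : ∀ j < n, FunnelFunction (n + 1 - j) (φ j))
    {j : ℕ} (hj : j < n) (c : JetCurve n) {t : ℝ} (ht : t ∈ ivl 0 c.ω)
    (hd : (t, c.a t) ∈ jetDomain φ n j) :
    HasDerivWithinAt (errS φ (fun s => c.a s 0) j) (errS φ (fun s => c.a s 0) (j + 1) t
      - 1 / (1 - φ j t ^ 2 * |errS φ (fun s => c.a s 0) j t| ^ 2) * errS φ (fun s => c.a s 0) j t)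
      (Ici 0) t := by
  have h := (errS_jet_aux hφ j hj.le).2.1
  rw [show n - j = n - (j + 1) + 1 by omega] at h
  obtain ⟨-, g, -, hgd⟩ := h
  have h1 := hgd c t ⟨ht, hd⟩
  refine h1.congr_deriv ?_
  simp only [errS]
  rw [h1.derivWithin (uniqueDiffOn_Ici 0 t ht.1)]; ring

/-- The conditions are open one after the other: `e_j` is known to be continuous only where the
signals of lower index are in their funnels. -/
lemma jetDomain_mem_nhdsWithin (hφ : ∀ j < n, FunnelFunction (n + 1 - j) (φ j))
    {j : ℕ} (hj : j ≤ n) {z : ℝ × (ℕ → ℝ)}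
    (hz : z ∈ jetDomain φ n j) : jetDomain φ n j ∈ 𝓝[jetBase n] z := by
  induction j with
  | zero => exact mem_of_superset self_mem_nhdsWithin fun z hz => ⟨hz, by simp⟩
  | succ j ih =>
    have hz' := jetDomain_succ_subset φ n j hz
    have h1 := ih (by omega) hz'
    have hφj := hφ j (by omega)
    have hc : ContinuousWithinAt (fun z : ℝ × (ℕ → ℝ) => φ j z.1 * |jetErr φ n j z|) (jetBase n)
        z := by
      refine ContinuousWithinAt.mul ?_ ?_
      · exact (hφj.continuousOn.comp continuousOn_fst (fun z hz => hz.1)) z hz.1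
      · exact ((continuousOn_jetErr hφ (by omega)).abs z hz').mono_of_mem_nhdsWithin h1
    filter_upwards [hc.eventually_lt continuousWithinAt_const (hz.2 j (by omega)), h1] with w hw hw'
    refine ⟨hw'.1, fun l hl => ?_⟩
    rcases Nat.lt_succ_iff_lt_or_eq.1 hl with h | rfl
    · exact hw'.2 l h
    · exact hw

/-- If the signals and the gains are bounded, then `e_n` differs from the `n`-th derivative of the
error by a function with bounded derivative. -/
lemma errS_remainder (hφ : ∀ j < n, FunnelFunction (n + 1 - j) (φ j))
    (c : JetCurve n) (hd : ∀ t ∈ ivl 0 c.ω, (t, c.a t) ∈ jetDomain φ n n)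
    (hb : ∀ j ≤ n, ∃ M, ∀ t ∈ ivl 0 c.ω, |errS φ (fun s => c.a s 0) j t| ≤ M)
    (hk : ∀ j < n, ∃ M, ∀ t ∈ ivl 0 c.ω,
      |(1 - φ j t ^ 2 * |errS φ (fun s => c.a s 0) j t| ^ 2)⁻¹| ≤ M) :
    (∀ j ≤ n, ∃ M, ∀ t ∈ ivl 0 c.ω, |c.a t j| ≤ M) ∧
    ∃ R R' : ℝ → ℝ, (∀ t ∈ ivl 0 c.ω, errS φ (fun s => c.a s 0) n t = c.a t n + R t) ∧
      (∀ t ∈ ivl 0 c.ω, HasDerivWithinAt R (R' t) (Ici 0) t) ∧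
      ∃ M, ∀ t ∈ ivl 0 c.ω, |R' t| ≤ M := by
  -- Towers for boundedness: bounds on the signals and on the gains propagate to all derivatives.
  set P : (Unit → ℝ → ℝ) → Prop := fun f => ∃ M, ∀ t ∈ ivl 0 c.ω, |f () t| ≤ M with hP
  set D : Unit → Set ℝ := fun _ => ivl 0 c.ω with hD
  set e : ℕ → ℝ → ℝ := errS φ (fun s => c.a s 0) with he
  have hA : AlgebraicProperty P D := by
    refine ⟨fun r => ⟨|r|, fun _ _ => le_rfl⟩, ?_, ?_, ?_, fun _ t ht => ht.1⟩
    · rintro f g ⟨M, hM⟩ ⟨N, hN⟩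
      exact ⟨M + N, fun t ht => (abs_add_le _ _).trans (add_le_add (hM t ht) (hN t ht))⟩
    · rintro f g ⟨M, hM⟩ ⟨N, hN⟩
      refine ⟨M * N, fun t ht => ?_⟩
      rw [abs_mul]
      exact mul_le_mul (hM t ht) (hN t ht) (abs_nonneg _) ((abs_nonneg _).trans (hM t ht))
    · rintro f g ⟨M, hM⟩ h
      exact ⟨M, fun t ht => by rw [h () t ht]; exact hM t ht⟩
  have hdom : ∀ j ≤ n, ∀ t ∈ ivl 0 c.ω, (t, c.a t) ∈ jetDomain φ n j := fun j hj t ht =>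
    ⟨(hd t ht).1, fun l hl => (hd t ht).2 l (by omega)⟩
  have hφt : ∀ j < n, Tower P D (n + 1 - j) fun _ => φ j := by
    intro j hj
    have := Tower.of_contDiffOn hA (hφ j hj).contDiff (fun l hl => ?_) (n + 1 - j) 0 (by omega)
    · simpa only [iteratedDerivWithin_zero] using this
    · obtain ⟨M, hM⟩ := (hφ j hj).bounded l hl
      exact ⟨M, fun t ht => hM t ht.1⟩
  have hne : ∀ j < n, ∀ t ∈ ivl 0 c.ω, 1 - φ j t ^ 2 * |e j t| ^ 2 ≠ 0 := by
    intro j hj t ht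
    rw [he, errS_eq_jetErr hφ hj.le c ht (hdom j hj.le t ht)]
    exact (one_sub_ne_zero_of_funnel ((hφ j hj).nonneg ht.1) ((hd t ht).2 j hj)).ne'
  have hgain : ∀ j < n, ∀ l ≤ n + 1 - j, Tower P D l (fun _ => e j) →
      Tower P D l fun _ t => 1 / (1 - φ j t ^ 2 * |e j t| ^ 2) * e j t := by
    intro j hj l hl ht
    exact Tower.gain_mul (f := fun _ => e j) hA ((hφt j hj).of_le hl) ht (fun _ t ht => hne j hj t ht)
      (hk j hj)
  have hed : ∀ j < n, ∀ t ∈ ivl 0 c.ω, HasDerivWithinAt (e j) (e (j + 1) t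
      - 1 / (1 - φ j t ^ 2 * |e j t| ^ 2) * e j t) (Ici 0) t := fun j hj t ht =>
    hasDerivWithinAt_errS hφ hj c ht (hdom j hj.le t ht)
  -- Since `ė_j = e_{j+1} - k_j e_j`, bounds of order `l` for `e_j` and `e_{j+1}` give bounds of
  -- order `l + 1` for `e_j`.
  have het : ∀ l j, j + l ≤ n → Tower P D l fun _ => e j := by
    intro l
    induction l with
    | zero => intro j hj; exact hb j (by omega)
    | succ l ih =>
      intro j hj
      refine ⟨hb j (by omega), fun _ t => e (j + 1) t
        + (-1) * (1 / (1 - φ j t ^ 2 * |e j t| ^ 2) * e j t), ?_, fun _ t ht => ?_⟩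
      · exact Tower.add hA (ih (j + 1) (by omega)) (Tower.mul hA (Tower.const hA _ _)
          (hgain j (by omega) l (by omega) (ih j (by omega))))
      · exact (hed j (by omega) t ht).congr_deriv (by ring)
  -- The remainders obey `R_0 = 0` and `R_{j+1} = Ṙ_j + k_j e_j`. The one of index `j` has `n + 1 -
  -- j` bounded derivatives, which leaves one for `j = n`.
  have hR : ∀ j ≤ n, ∃ R : ℝ → ℝ, (∀ t ∈ ivl 0 c.ω, e j t = c.a t j + R t) ∧
      Tower P D (n + 1 - j) fun _ => R := by
    intro j
    induction j with
    | zero =>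
      intro _
      exact ⟨fun _ => 0, fun t _ => by simp [he, errS], Tower.const hA _ _⟩
    | succ j ih =>
      intro hj
      obtain ⟨R, hR, hRt⟩ := ih (by omega)
      rw [show n + 1 - j = (n - j) + 1 by omega] at hRt
      obtain ⟨-, R', hR't, hR'd⟩ := hRt
      refine ⟨fun t => R' () t + 1 / (1 - φ j t ^ 2 * |e j t| ^ 2) * e j t, fun t ht => ?_, ?_⟩
      · have h1 : HasDerivWithinAt (e j) (c.a t (j + 1) + R' () t) (Ici 0) t := by
          refine ((c.deriv j (by omega) t ht).add (hR'd () t ht)).congr_of_eventuallyEq ?_ (hR t ht)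
          filter_upwards [c.ivl_mem_nhdsWithin ht] with s hs using hR s hs
        have h2 := (h1.derivWithin (uniqueDiffOn_Ici 0 t ht.1)).symm.trans
          ((hed j (by omega) t ht).derivWithin (uniqueDiffOn_Ici 0 t ht.1))
        linarith
      · rw [show n + 1 - (j + 1) = n - j by omega]
        exact Tower.add hA hR't (hgain j (by omega) _ (by omega) (het (n - j) j (by omega)))
  refine ⟨fun j hj => ?_, ?_⟩
  · obtain ⟨R, hR1, hR2⟩ := hR j hj
    obtain ⟨M, hM⟩ := hR2.base
    obtain ⟨N, hN⟩ := hb j hj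
    refine ⟨N + M, fun t ht => ?_⟩
    have h1 : c.a t j = e j t - R t := by rw [hR1 t ht]; ring
    rw [h1]
    exact (abs_sub _ _).trans (add_le_add (hN t ht) (hM t ht))
  · obtain ⟨R, hR1, hR2⟩ := hR n le_rfl
    rw [show n + 1 - n = 0 + 1 by omega] at hR2
    obtain ⟨-, R', hR't, hR'd⟩ := hR2
    exact ⟨R, R' (), hR1, fun t ht => hR'd () t ht, hR't⟩

end JetErr


/-! ### The funnel gain as a homeomorphism -/

section GainMap

variable {E : Type*} [NormedAddCommGroup E] [InnerProductSpace ℝ E]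

/-- The map `e ↦ e / (1 - φ² ‖e‖²)`. -/
noncomputable def gainMap (φ : ℝ) (e : E) : E := (1 / (1 - φ ^ 2 * ‖e‖ ^ 2)) • e

/-- The inverse of `gainMap φ` on the funnel. -/
noncomputable def gainInv (φ : ℝ) (w : E) : E := (2 / (1 + √(1 + 4 * φ ^ 2 * ‖w‖ ^ 2))) • w

/-- With `x = φ² ‖e‖²` and `w = gainMap φ e`, the radicand `1 + 4 φ² ‖w‖²` is the square of `(1 + x)
/ (1 - x)`, so the factor in `gainInv` equals `1 - x`. -/
lemma gainInv_gainMap {φ : ℝ} {e : E} (h : φ ^ 2 * ‖e‖ ^ 2 < 1) :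
    gainInv φ (gainMap φ e) = e := by
  have h1 : 0 < 1 - φ ^ 2 * ‖e‖ ^ 2 := by linarith
  have h2 : 1 + 4 * φ ^ 2 * ‖gainMap φ e‖ ^ 2
      = ((1 + φ ^ 2 * ‖e‖ ^ 2) / (1 - φ ^ 2 * ‖e‖ ^ 2)) ^ 2 := by
    rw [gainMap, norm_smul, Real.norm_of_nonneg (by positivity)]
    field_simp; ring
  rw [gainInv, h2, Real.sqrt_sq (by positivity), gainMap, smul_smul]
  have : 2 / (1 + (1 + φ ^ 2 * ‖e‖ ^ 2) / (1 - φ ^ 2 * ‖e‖ ^ 2)) * (1 / (1 - φ ^ 2 * ‖e‖ ^ 2)) = 1 := by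
    have h3 : 1 + (1 + φ ^ 2 * ‖e‖ ^ 2) / (1 - φ ^ 2 * ‖e‖ ^ 2) = 2 / (1 - φ ^ 2 * ‖e‖ ^ 2) := by
      field_simp; ring
    rw [h3]; field_simp
  rw [this, one_smul]

/-- Besides proving that `gainInv` is a right inverse with values in the funnel, this is the
quantitative margin for `e_II`: it is bounded below when `φ` and `w` are bounded. -/
lemma one_sub_gainInv (φ : ℝ) (w : E) :
    1 - φ ^ 2 * ‖gainInv φ w‖ ^ 2 = 2 / (1 + √(1 + 4 * φ ^ 2 * ‖w‖ ^ 2)) := by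
  have hs : √(1 + 4 * φ ^ 2 * ‖w‖ ^ 2) ^ 2 = 1 + 4 * φ ^ 2 * ‖w‖ ^ 2 := Real.sq_sqrt (by positivity)
  have h0 := Real.sqrt_nonneg (1 + 4 * φ ^ 2 * ‖w‖ ^ 2)
  rw [gainInv, norm_smul, Real.norm_of_nonneg (by positivity)]
  set ρ := √(1 + 4 * φ ^ 2 * ‖w‖ ^ 2)
  have h1 : φ ^ 2 * (2 / (1 + ρ) * ‖w‖) ^ 2 = (4 * φ ^ 2 * ‖w‖ ^ 2) / (1 + ρ) ^ 2 := by
    field_simp; ring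
  have h2 : 4 * φ ^ 2 * ‖w‖ ^ 2 = (ρ - 1) * (ρ + 1) := by linarith
  rw [h1, h2]
  field_simp; ring

lemma gainInv_mem (φ : ℝ) (w : E) : φ ^ 2 * ‖gainInv φ w‖ ^ 2 < 1 := by
  have := one_sub_gainInv φ w
  have h : 0 < 2 / (1 + √(1 + 4 * φ ^ 2 * ‖w‖ ^ 2)) := by positivity
  linarith

lemma gainMap_gainInv (φ : ℝ) (w : E) : gainMap φ (gainInv φ w) = w := by
  rw [gainMap, one_sub_gainInv, gainInv, smul_smul]
  have : 1 / (2 / (1 + √(1 + 4 * φ ^ 2 * ‖w‖ ^ 2))) * (2 / (1 + √(1 + 4 * φ ^ 2 * ‖w‖ ^ 2))) = 1 := by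
    field_simp
  rw [this, one_smul]

/-- The excess `gainMap φ e - e` is radial with nonnegative factor increasing in `‖e‖`, hence
monotone. Thus the inner product of the difference of the images with `e - e'` is at least `‖e -
e'‖²`, and Cauchy–Schwarz concludes. -/
lemma norm_sub_le_norm_gainMap_sub {φ : ℝ} {e e' : E} (h : φ ^ 2 * ‖e‖ ^ 2 < 1)
    (h' : φ ^ 2 * ‖e'‖ ^ 2 < 1) : ‖e - e'‖ ≤ ‖gainMap φ e - gainMap φ e'‖ := by
  set a := 1 / (1 - φ ^ 2 * ‖e‖ ^ 2) with ha
  set b := 1 / (1 - φ ^ 2 * ‖e'‖ ^ 2) with hb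
  have ha1 : 1 ≤ a := by
    rw [ha, le_div_iff₀ (by linarith)]; nlinarith [mul_nonneg (sq_nonneg φ) (sq_nonneg ‖e‖)]
  have hb1 : 1 ≤ b := by
    rw [hb, le_div_iff₀ (by linarith)]; nlinarith [mul_nonneg (sq_nonneg φ) (sq_nonneg ‖e'‖)]
  have hmono : 0 ≤ (‖e‖ - ‖e'‖) * ((a - 1) * ‖e‖ - (b - 1) * ‖e'‖) := by
    rcases le_total ‖e‖ ‖e'‖ with hle | hle
    · have hab : a ≤ b := by
        rw [ha, hb]
        apply one_div_le_one_div_of_le (by linarith)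
        gcongr
      apply mul_nonneg_of_nonpos_of_nonpos (by linarith)
      have : (a - 1) * ‖e‖ ≤ (b - 1) * ‖e'‖ := by
        apply mul_le_mul (by linarith) hle (norm_nonneg _) (by linarith)
      linarith
    · have hab : b ≤ a := by
        rw [ha, hb]
        apply one_div_le_one_div_of_le (by linarith)
        gcongr
      apply mul_nonneg (by linarith)
      have : (b - 1) * ‖e'‖ ≤ (a - 1) * ‖e‖ := by
        apply mul_le_mul (by linarith) hle (norm_nonneg _) (by linarith)
      linarith
  have hin : ‖e - e'‖ ^ 2 ≤ inner ℝ (gainMap φ e - gainMap φ e') (e - e') := by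
    rw [← real_inner_self_eq_norm_sq]
    simp only [gainMap, ← ha, ← hb, inner_sub_left, inner_sub_right, inner_smul_left,
      RCLike.conj_to_real]
    rw [real_inner_comm e' e, real_inner_self_eq_norm_sq, real_inner_self_eq_norm_sq]
    have hcs := real_inner_le_norm e' e
    rw [real_inner_comm] at hcs ⊢
    nlinarith
  have hcs := real_inner_le_norm (gainMap φ e - gainMap φ e') (e - e')
  rcases eq_or_lt_of_le (norm_nonneg (e - e')) with h0 | h0
  · rw [← h0]; exact norm_nonneg _
  · nlinarith

lemma lipschitzWith_gainInv (φ : ℝ) : LipschitzWith 1 (gainInv φ : E → E) := by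
  refine LipschitzWith.of_dist_le_mul fun w w' => ?_
  have := norm_sub_le_norm_gainMap_sub (gainInv_mem φ w) (gainInv_mem φ w')
  rw [gainMap_gainInv, gainMap_gainInv] at this
  simpa [dist_eq_norm] using this

lemma contDiff_gainInv : ContDiff ℝ 1 fun z : ℝ × E => gainInv z.1 z.2 := by
  unfold gainInv
  refine ContDiff.smul ?_ contDiff_snd
  refine contDiff_const.div (contDiff_const.add ?_) fun z => by positivity
  refine ContDiff.sqrt ?_ fun z => by positivity
  exact contDiff_const.add ((contDiff_const.mul (contDiff_fst.pow 2)).mul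
    (contDiff_snd.norm_sq ℝ))

end GainMap

/-! ### Parametrized contractions -/

section Contraction

variable {E : Type*} [NormedAddCommGroup E]

lemma dist_fixed_le {q : NNReal} (hq : q < 1) {K : E → E} (hK : LipschitzWith q K) {e : E}
    (he : K e = e) (x : E) : dist x e ≤ dist x (K x) / (1 - q) :=
  ContractingWith.dist_le_of_fixedPoint (show ContractingWith q K from ⟨hq, hK⟩) x he

variable [CompleteSpace E]

/-- The fixed point of a map, if the map is a contraction. -/
noncomputable def fixedPt (K : E → E) : E :=
  open Classical in if h : ∃ e, K e = e then h.choose else 0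

lemma fixedPt_eq {q : NNReal} (hq : q < 1) {K : E → E} (hK : LipschitzWith q K) :
    K (fixedPt K) = fixedPt K := by
  have h : ∃ e, K e = e := ⟨_, ContractingWith.fixedPoint_isFixedPt (show ContractingWith q K from ⟨hq, hK⟩)⟩
  rw [fixedPt, dif_pos h]
  exact h.choose_spec

lemma eq_fixedPt {q : NNReal} (hq : q < 1) {K : E → E} (hK : LipschitzWith q K) {e : E}
    (he : K e = e) : e = fixedPt K := by
  have := dist_fixed_le hq hK (fixedPt_eq hq hK) e
  rw [he, dist_self, zero_div] at this
  exact dist_le_zero.1 this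

/-- The a posteriori estimate `dist e₀ e_z ≤ dist e₀ (K z e₀) / (1 - q)` shows that continuity in
the parameter is needed at the single point `e₀` only. -/
lemma continuousWithinAt_fixedPt {Z : Type*} [TopologicalSpace Z] {q : NNReal} (hq : q < 1)
    {K : Z → E → E} (hK : ∀ z, LipschitzWith q (K z)) {s : Set Z} {z₀ : Z}
    (hc : ContinuousWithinAt (fun z => K z (fixedPt (K z₀))) s z₀) :
    ContinuousWithinAt (fun z => fixedPt (K z)) s z₀ := by
  set e₀ := fixedPt (K z₀) with he₀
  have h1 : ∀ z, dist (fixedPt (K z)) e₀ ≤ dist e₀ (K z e₀) / (1 - q) := fun z => by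
    rw [dist_comm]; exact dist_fixed_le hq (hK z) (fixedPt_eq hq (hK z)) e₀
  have h2 : Tendsto (fun z => dist e₀ (K z e₀) / (1 - q)) (𝓝[s] z₀) (𝓝 0) := by
    have := (tendsto_const_nhds (x := e₀)).dist hc |>.div_const (1 - (q : ℝ))
    have h3 : K z₀ e₀ = e₀ := fixedPt_eq hq (hK z₀)
    beta_reduce at this
    rwa [h3, dist_self, zero_div] at this
  exact tendsto_iff_dist_tendsto_zero.2 (squeeze_zero (fun _ => dist_nonneg) h1 h2)

end Contraction


/-! ### Causal operators -/

lemma continuousOn_stopAt {E : Type*} [TopologicalSpace E] {h τ : ℝ} {y : ℝ → E} (hτ : -h ≤ τ)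
    (hy : ContinuousOn y (Icc (-h) τ)) : ContinuousOn (stopAt τ y) (Ici (-h)) :=
  hy.comp (by fun_prop) fun _ ht => ⟨le_min ht hτ, min_le_right _ _⟩

lemma stopAt_of_le {E : Type*} {τ t : ℝ} {y : ℝ → E} (h : t ≤ τ) : stopAt τ y t = y t := by
  simp [stopAt, h]

lemma le_on_Icc_of_ae_le {a b M : ℝ} (hab : a < b) {f : ℝ → ℝ} (hf : ContinuousOn f (Icc a b))
    (h : ∀ᵐ t ∂(volume.restrict (Icc a b)), f t ≤ M) : ∀ t ∈ Icc a b, f t ≤ M := by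
  intro t ht
  have := Measure.eqOn_Icc_of_ae_eq volume hab.ne (f := fun t => max (f t) M) (g := fun _ => M)
    (by filter_upwards [h] with t ht using max_eq_right ht) (hf.sup continuousOn_const)
    continuousOn_const ht
  exact (le_max_left _ _).trans this.le

section Operators

variable {E F : Type*} [NormedAddCommGroup E] [NormedAddCommGroup F] {h : ℝ}
  {T : (ℝ → E) → ℝ → F}

lemma OpClass.ae_eq_of_eqOn (hT : OpClass h T) {t : ℝ} (ht : 0 ≤ t) {ζ ξ : ℝ → E}
    (hζ : ContinuousOn ζ (Ici (-h))) (hξ : ContinuousOn ξ (Ici (-h)))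
    (he : EqOn ζ ξ (Icc (-h) t)) : ∀ᵐ u, u ∈ Icc 0 t → T ζ u = T ξ u := by
  have := hT.causal t ht ζ ξ hζ hξ (he.mono Ico_subset_Icc_self)
  rw [ae_restrict_iff' measurableSet_Ico] at this
  have h2 : ∀ᵐ u : ℝ, u ≠ t := by simp [ae_iff, measure_singleton]
  filter_upwards [this, h2] with u hu hut hu'
  exact hu ⟨hu'.1, lt_of_le_of_ne hu'.2 hut⟩

lemma OpClass.ae_eq_of_eqOn_Ici (hT : OpClass h T) {ζ ξ : ℝ → E}
    (hζ : ContinuousOn ζ (Ici (-h))) (hξ : ContinuousOn ξ (Ici (-h)))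
    (he : EqOn ζ ξ (Ici (-h))) : ∀ᵐ u, 0 ≤ u → T ζ u = T ξ u := by
  have : ∀ᵐ u, ∀ n : ℕ, u ∈ Icc (0 : ℝ) n → T ζ u = T ξ u := ae_all_iff.2 fun n =>
    hT.ae_eq_of_eqOn (Nat.cast_nonneg n) hζ hξ (he.mono Icc_subset_Ici_self)
  filter_upwards [this] with u hu hu0
  obtain ⟨n, hn⟩ := exists_nat_ge u
  exact hu n ⟨hu0, hn⟩

variable [NormedSpace ℝ F]

lemma OpClassDAE.continuousOn (hT : OpClassDAE h T) {ζ : ℝ → E}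
    (hζ : ContinuousOn ζ (Ici (-h))) : ContinuousOn (T ζ) (Ici 0) :=
  (hT.contDiff ζ hζ).continuousOn

lemma OpClassDAE.eqOn_of_pos (hT : OpClassDAE h T) {t : ℝ} (ht : 0 < t) {ζ ξ : ℝ → E}
    (hζ : ContinuousOn ζ (Ici (-h))) (hξ : ContinuousOn ξ (Ici (-h)))
    (he : EqOn ζ ξ (Icc (-h) t)) : EqOn (T ζ) (T ξ) (Icc 0 t) := by
  refine Measure.eqOn_Icc_of_ae_eq volume ht.ne ?_
    ((hT.continuousOn hζ).mono Icc_subset_Ici_self) ((hT.continuousOn hξ).mono Icc_subset_Ici_self)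
  rw [Filter.EventuallyEq, ae_restrict_iff' measurableSet_Icc]
  exact hT.opClass.ae_eq_of_eqOn ht.le hζ hξ he

lemma OpClassDAE.norm_sub_le (hT : OpClassDAE h T) {t τ : ℝ} (ht : 0 ≤ t) (hτ : 0 < τ)
    {ζ ξ : ℝ → E} (hζ : ContinuousOn ζ (Ici (-h))) (hξ : ContinuousOn ξ (Ici (-h))) {M : ℝ}
    (hM : ∀ᵐ u ∂(volume.restrict (Icc t (t + τ))), ‖T ζ u - T ξ u‖ ≤ M) :
    ∀ u ∈ Icc t (t + τ), ‖T ζ u - T ξ u‖ ≤ M := by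
  have hsub : Icc t (t + τ) ⊆ Ici 0 := fun u hu => ht.trans hu.1
  exact le_on_Icc_of_ae_le (by linarith)
    (((hT.continuousOn hζ).mono hsub).sub ((hT.continuousOn hξ).mono hsub)).norm hM

/-- Causality at `t = 0` is void, since it concerns `[0, 0)`. There the local Lipschitz condition
replaces it: stopped at a small time `ρ`, the two trajectories are `ε`-close, so the images at `0`
differ by at most `c ε`, while stopping at `ρ > 0` does not change the value at `0`. This makes the
value of `T` at `0` a function of the history alone, as consistency of the initial data requires. -/
lemma OpClassDAE.eqOn (hT : OpClassDAE h T) (hh : 0 ≤ h) {t : ℝ} (ht : 0 ≤ t) {ζ ξ : ℝ → E}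
    (hζ : ContinuousOn ζ (Ici (-h))) (hξ : ContinuousOn ξ (Ici (-h)))
    (he : EqOn ζ ξ (Icc (-h) t)) : EqOn (T ζ) (T ξ) (Icc 0 t) := by
  rcases ht.eq_or_lt with rfl | ht
  swap
  · exact hT.eqOn_of_pos ht hζ hξ he
  intro s hs
  obtain rfl : s = 0 := le_antisymm hs.2 hs.1
  obtain ⟨τ, hτ, δ, hδ, c, hc, hlip⟩ := hT.opClass.locallyLipschitz 0 le_rfl ζ
    (hζ.mono Icc_subset_Ici_self)
  have h0 : (0 : ℝ) ∈ Ici (-h) := by simp [hh]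
  have hsmall : ∀ ε > 0, ‖T ζ 0 - T ξ 0‖ ≤ c * ε := by
    intro ε hε
    have hev : ∀ᶠ u in 𝓝[Ici (-h)] (0:ℝ), dist (ζ u) (ζ 0) < min δ (ε / 2) ∧
        dist (ξ u) (ζ 0) < min δ (ε / 2) := by
      have hm : 0 < min δ (ε / 2) := lt_min hδ (by positivity)
      have h1 := (hζ 0 h0).tendsto.eventually (Metric.ball_mem_nhds _ hm)
      have h2 := (hξ 0 h0).tendsto.eventually (Metric.ball_mem_nhds _ hm)
      rw [← he ⟨by simpa using hh, le_rfl⟩] at h2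
      exact h1.and h2
    obtain ⟨σ, hσ, hball⟩ := Metric.mem_nhdsWithin_iff.1 hev
    set ρ := min (σ / 2) τ with hρ
    have hρ0 : 0 < ρ := lt_min (by positivity) hτ
    have hnear : ∀ u ∈ Icc 0 ρ, dist (ζ u) (ζ 0) < min δ (ε / 2) ∧
        dist (ξ u) (ζ 0) < min δ (ε / 2) := by
      intro u hu
      refine hball ⟨?_, ?_⟩
      · rw [Metric.mem_ball, Real.dist_eq, sub_zero, abs_of_nonneg hu.1]
        exact hu.2.trans_lt ((min_le_left _ _).trans_lt (by linarith))
      · simp only [mem_Ici]; linarith [hu.1]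
    have hcz : ContinuousOn (stopAt ρ ζ) (Ici (-h)) :=
      continuousOn_stopAt (by linarith) (hζ.mono Icc_subset_Ici_self)
    have hcx : ContinuousOn (stopAt ρ ξ) (Ici (-h)) :=
      continuousOn_stopAt (by linarith) (hξ.mono Icc_subset_Ici_self)
    have e1 : T ζ 0 = T (stopAt ρ ζ) 0 := hT.eqOn_of_pos hρ0 hζ hcz
      (fun u hu => (stopAt_of_le hu.2).symm) ⟨le_rfl, hρ0.le⟩
    have e2 : T ξ 0 = T (stopAt ρ ξ) 0 := hT.eqOn_of_pos hρ0 hξ hcx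
      (fun u hu => (stopAt_of_le hu.2).symm) ⟨le_rfl, hρ0.le⟩
    have hmin : ∀ u ∈ Icc (0 : ℝ) (0 + τ), min u ρ ∈ Icc 0 ρ := fun u hu =>
      ⟨le_min hu.1 hρ0.le, min_le_right _ _⟩
    have := hlip (stopAt ρ ζ) (stopAt ρ ξ) hcz hcx
      (fun u hu => stopAt_of_le (hu.2.trans hρ0.le))
      (fun u hu => (stopAt_of_le (hu.2.trans hρ0.le)).trans (he hu).symm)
      (fun u hu => by
        rw [← dist_eq_norm]; exact (hnear _ (hmin u hu)).1.trans_le (min_le_left _ _))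
      (fun u hu => by
        rw [← dist_eq_norm]; exact (hnear _ (hmin u hu)).2.trans_le (min_le_left _ _))
      ε (fun u hu => by
        rw [← dist_eq_norm]
        have h1 := (hnear _ (hmin u hu)).1.trans_le (min_le_right _ _)
        have h2 := (hnear _ (hmin u hu)).2.trans_le (min_le_right _ _)
        have := dist_triangle_right (stopAt ρ ζ u) (stopAt ρ ξ u) (ζ 0)
        simp only [stopAt] at this ⊢
        linarith)
    rw [e1, e2]
    exact hT.norm_sub_le le_rfl hτ hcz hcx this 0 ⟨le_rfl, by linarith⟩
  have : ‖T ζ 0 - T ξ 0‖ ≤ 0 := by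
    refine le_of_forall_pos_le_add fun ε hε => ?_
    have := hsmall (ε / c) (by positivity)
    rw [mul_div_cancel₀ _ hc.ne'] at this
    linarith
  exact sub_eq_zero.1 (norm_le_zero_iff.1 this)

variable [ProperSpace E] [ProperSpace F]

/-- The derivative is `z (ζ, T' ζ)` with both arguments in fixed compact sets, so the Lipschitz
constant is common to all trajectories with the same bound. This is the source of equicontinuity in
local existence and of the limit at a finite endpoint. -/
lemma OpClassDAE.exists_lipschitz (hT : OpClassDAE h T) {c₁ : ℝ} (hc₁ : 0 < c₁) :
    ∃ (K : NNReal) (M : ℝ), ∀ ζ : ℝ → E, ContinuousOn ζ (Ici (-h)) →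
      (∀ t ∈ Ici (-h), ‖ζ t‖ ≤ c₁) → 0 ≤ h →
      LipschitzOnWith K (T ζ) (Ici 0) ∧ ∀ t, 0 ≤ t → ‖T ζ t‖ ≤ M := by
  obtain ⟨M, hM0, hM⟩ := hT.opClass.bounded c₁ hc₁
  obtain ⟨z, T', hz, hT', hd⟩ := hT.derivative
  obtain ⟨M', hM'0, hM'⟩ := hT'.bounded c₁ hc₁
  obtain ⟨K, hK⟩ := ((isCompact_closedBall (0 : E) c₁).prod
    (isCompact_closedBall (0 : F) M')).exists_bound_of_continuousOn hz.continuousOn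
  have hall : ∀ (f : ℝ → F) (B : ℝ), ContinuousOn f (Ici 0) →
      (∀ᵐ t ∂(volume.restrict (Ici (0 : ℝ))), ‖f t‖ ≤ B) → ∀ t, 0 ≤ t → ‖f t‖ ≤ B := by
    intro f B hf hB t ht
    refine le_on_Icc_of_ae_le (a := t) (b := t + 1) (by linarith)
      (hf.mono fun u hu => ht.trans hu.1).norm ?_ t ⟨le_rfl, by linarith⟩
    exact ae_restrict_of_ae_restrict_of_subset (fun u hu => ht.trans hu.1) hB
  refine ⟨K.toNNReal, M, fun ζ hζ hb hh => ⟨?_, hall _ _ (hT.continuousOn hζ) (hM ζ hζ hb)⟩⟩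
  have hcd := hT.contDiff ζ hζ
  have hdc : ContinuousOn (derivWithin (T ζ) (Ici 0)) (Ici 0) :=
    hcd.continuousOn_derivWithin (uniqueDiffOn_Ici 0) le_rfl
  have hbd := hall _ K hdc (by
    filter_upwards [hM' ζ hζ hb, ae_restrict_mem measurableSet_Ici] with t ht ht0
    rw [(hd ζ hζ t ht0).derivWithin (uniqueDiffOn_Ici 0 t ht0)]
    refine hK _ ⟨?_, ?_⟩
    · simpa using hb t ((neg_nonpos.2 hh).trans ht0)
    · simpa using ht)
  refine (convex_Ici 0).lipschitzOnWith_of_nnnorm_derivWithin_le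
    (hcd.differentiableOn (by simp)) fun t ht => ?_
  rw [← NNReal.coe_le_coe, coe_nnnorm]
  exact (hbd t ht).trans (Real.le_coe_toNNReal K)

end Operators


/-! ### Chains of derivatives -/

lemma eqOn_iteratedDerivWithin_of_chain {s : Set ℝ} (hs : UniqueDiffOn ℝ s) {n : ℕ}
    {G : ℕ → ℝ → ℝ} (hG : ∀ l < n, ∀ t ∈ s, HasDerivWithinAt (G l) (G (l + 1) t) s t) :
    ∀ l ≤ n, EqOn (iteratedDerivWithin l (G 0) s) (G l) s := by
  intro l
  induction l with
  | zero => intro _ t _; rw [iteratedDerivWithin_zero]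
  | succ l ih =>
    intro hl t ht
    rw [iteratedDerivWithin_succ, derivWithin_congr (ih (by omega)) (ih (by omega) ht)]
    exact (hG l (by omega) t ht).derivWithin (hs t ht)

lemma contDiffOn_of_chain {s : Set ℝ} (hs : UniqueDiffOn ℝ s) {n : ℕ}
    {G : ℕ → ℝ → ℝ} (hG : ∀ l < n, ∀ t ∈ s, HasDerivWithinAt (G l) (G (l + 1) t) s t)
    (hc : ∀ l ≤ n, ContinuousOn (G l) s) : ContDiffOn ℝ n (G 0) s := by
  have h := eqOn_iteratedDerivWithin_of_chain hs hG
  refine contDiffOn_of_continuousOn_differentiableOn_deriv (fun l hl => ?_) (fun l hl => ?_)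
  · have hl' : l ≤ n := by exact_mod_cast hl
    exact (hc l hl').congr (h l hl')
  · have hl' : l < n := by exact_mod_cast hl
    intro t ht
    exact (hG l hl' t ht).differentiableWithinAt.congr (h l hl'.le) (h l hl'.le ht)

lemma errS_congr (φ : ℕ → ℝ → ℝ) {e e' : ℝ → ℝ} {ω : EReal} (h : EqOn e e' (ivl 0 ω)) :
    ∀ j, EqOn (errS φ e j) (errS φ e' j) (ivl 0 ω)
  | 0 => h
  | j + 1 => by
    intro t ht
    have ih := errS_congr φ h j
    have hd : derivWithin (errS φ e j) (Ici 0) t = derivWithin (errS φ e' j) (Ici 0) t := by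
      refine Filter.EventuallyEq.derivWithin_eq ?_ (ih ht)
      filter_upwards [self_mem_nhdsWithin, mem_nhdsWithin_of_mem_nhds
        ((isOpen_lt_coe ω).mem_nhds ht.2)] with s hs hs'
      exact ih ⟨hs, hs'⟩
    simp only [errS]
    rw [hd, ih ht]

/-! ### The signals of the controller as functions of time and state -/

variable {q p s k : ℕ} {r : Fin q → ℕ}

/-- The standing assumptions on the system and the controller. -/
structure Feasible (S : System r p s k) (C : Controller q p) (α : ℝ) : Prop where
  sys : S.Admissible α
  ctrl : C.Admissible r
  gain : GainCondition S C α

/-- The derivatives of the `i`-th component of the reference signal. -/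
noncomputable def Controller.refJet (C : Controller q p) (i : Fin q) (l : ℕ) (t : ℝ) : ℝ :=
  iteratedDerivWithin l (fun t => C.yref t (Sum.inl i)) (Ici 0) t

/-- The jet of the `i`-th error at time `t` and state `Y`. -/
noncomputable def errJet (C : Controller q p) (t : ℝ) (Y : StateSpace r p) (i : Fin q) (l : ℕ) : ℝ :=
  if h : l < r i then Y (Sum.inl ⟨i, ⟨l, h⟩⟩) - C.refJet i l t else 0

/-- The signal `e_{ij}` at time `t` and state `Y`. -/
noncomputable def stErr (C : Controller q p) (i : Fin q) (j : ℕ) (z : ℝ × StateSpace r p) : ℝ :=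
  jetErr (C.φ i) (r i - 1) j (z.1, errJet C z.1 z.2 i)

/-- The signal `e_I` at time `t` and state `Y`. -/
noncomputable def stErrI (C : Controller q p) (z : ℝ × StateSpace r p) :
    EuclideanSpace ℝ (Fin q) := WithLp.toLp 2 fun i => stErr C i (r i - 1) z

/-- The signal `e_II` at time `t` and state `Y`. -/
noncomputable def stErrII (C : Controller q p) (z : ℝ × StateSpace r p) :
    EuclideanSpace ℝ (Fin p) := WithLp.toLp 2 fun i => z.2 (Sum.inr i) - C.yref z.1 (Sum.inr i)

/-- The input `u_I` at time `t` and state `Y`. -/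
noncomputable def stInputI (C : Controller q p) (z : ℝ × StateSpace r p) :
    EuclideanSpace ℝ (Fin q) := -gainMap (C.φI z.1) (stErrI C z)

/-- The times and states for which the signals `e_{ij}` are in their funnels. -/
def errDomain (r : Fin q → ℕ) (p : ℕ) (C : Controller q p) : Set (ℝ × StateSpace r p) :=
  {z | 0 ≤ z.1 ∧ ∀ i j, j + 2 ≤ r i → C.φ i j z.1 * |stErr C i j z| < 1}

/-- The times and states for which moreover `e_I` is in its funnel. -/
def safeI (r : Fin q → ℕ) (p : ℕ) (C : Controller q p) : Set (ℝ × StateSpace r p) :=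
  {z | z ∈ errDomain r p C ∧ C.φI z.1 * ‖stErrI C z‖ < 1}

/-- The times and states for which all signals are in their funnels. -/
def safe (r : Fin q → ℕ) (p : ℕ) (C : Controller q p) : Set (ℝ × StateSpace r p) :=
  {z | z ∈ safeI r p C ∧ C.φII z.1 * ‖stErrII C z‖ < 1}

/-- Functions on `[0, ω)` whose components are chains of derivatives. -/
structure IsJetState (r : Fin q → ℕ) (p : ℕ) (ω : EReal) (Y : ℝ → StateSpace r p) : Prop where
  cont : ContinuousOn Y (ivl 0 ω)
  chain : ∀ i j (hj : j + 1 < r i), ∀ t ∈ ivl 0 ω,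
    HasDerivWithinAt (fun t => Y t (Sum.inl ⟨i, ⟨j, by omega⟩⟩)) (Y t (Sum.inl ⟨i, ⟨j + 1, hj⟩⟩))
      (Ici 0) t

lemma mul_lt_one_iff_sq {a b : ℝ} (ha : 0 ≤ a) (hb : 0 ≤ b) : a * b < 1 ↔ a ^ 2 * b ^ 2 < 1 := by
  rw [← mul_pow, sq_lt_one_iff₀ (mul_nonneg ha hb)]

namespace Feasible

variable {S : System r p s k} {C : Controller q p} {α : ℝ}

lemma funnel (H : Feasible S C α) (i : Fin q) :
    ∀ j < r i - 1, FunnelFunction (r i - 1 + 1 - j) (C.φ i j) := by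
  intro j hj
  have := H.ctrl.φ_mem i j (by omega)
  rwa [show r i - 1 + 1 - j = r i - j by omega]

lemma refJet_spec (H : Feasible S C α) (i : Fin q) :
    (∀ l, l + 1 < r i → ∀ t ∈ Ici (0 : ℝ),
      HasDerivWithinAt (C.refJet i l) (C.refJet i (l + 1) t) (Ici 0) t) ∧
    (∀ l < r i, ContinuousOn (C.refJet i l) (Ici 0)) ∧
    (∀ l < r i, ∃ M : ℝ, ∀ t ∈ Ici (0 : ℝ), |C.refJet i l t| ≤ M) ∧
    ∃ g : ℝ → ℝ, MemLinf g ∧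
      ∀ t ∈ Ici (0 : ℝ), C.refJet i (r i - 1) t = C.refJet i (r i - 1) 0 + ∫ u in 0..t, g u := by
  obtain ⟨n, hn⟩ : ∃ n, r i = n + 1 := ⟨r i - 1, by have := H.sys.r_pos i; omega⟩
  have hmem := H.ctrl.yrefI_mem i
  rw [hn] at hmem
  have hc : ContinuousOn (fun t => C.yref t (Sum.inl i)) (Ici 0) :=
    (EuclideanSpace.proj (𝕜 := ℝ) (Sum.inl i : Fin q ⊕ Fin p)).continuous.comp_continuousOn
      H.ctrl.yref_cont
  obtain ⟨G, g, hG0, hGd, hGc, hGb, hg, hGg⟩ := hmem.exists_derivs n hc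
  have heq : ∀ l ≤ n, EqOn (C.refJet i l) (G l) (Ici 0) := by
    have := eqOn_iteratedDerivWithin_of_chain (uniqueDiffOn_Ici 0) hGd
    rwa [hG0] at this
  refine ⟨fun l hl t ht => ?_, fun l hl => (hGc l (by omega)).congr (heq l (by omega)),
    fun l hl => ?_, g, hg, fun t ht => ?_⟩
  · rw [heq (l + 1) (by omega) ht]
    exact (hGd l (by omega) t ht).congr (heq l (by omega)) (heq l (by omega) ht)
  · obtain ⟨M, hM⟩ := hGb l (by omega)
    exact ⟨M, fun t ht => by rw [heq l (by omega) ht]; exact hM t ht⟩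
  · rw [show r i - 1 = n by omega, heq n le_rfl ht, heq n le_rfl self_mem_Ici]
    exact hGg t ht

lemma continuousOn_errJet (H : Feasible S C α) (i : Fin q) :
    ContinuousOn (fun z : ℝ × StateSpace r p => (z.1, errJet C z.1 z.2 i)) {z | 0 ≤ z.1} := by
  refine continuousOn_fst.prodMk (continuousOn_pi.2 fun l => ?_)
  unfold errJet
  split_ifs with h
  · refine ContinuousOn.sub (by fun_prop) ?_
    exact ((H.refJet_spec i).2.1 l h).comp continuousOn_fst fun z hz => hz
  · exact continuousOn_const

lemma errJet_mem_jetBase (H : Feasible S C α) {z : ℝ × StateSpace r p} (hz : 0 ≤ z.1) (i : Fin q) :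
    (z.1, errJet C z.1 z.2 i) ∈ jetBase (r i - 1) := by
  refine ⟨hz, fun l hl => ?_⟩
  have := H.sys.r_pos i
  simp only [errJet, dif_neg (show ¬ l < r i by omega)]

lemma mem_jetDomain (H : Feasible S C α) {z : ℝ × StateSpace r p} (hz : 0 ≤ z.1) (i : Fin q) (j : ℕ)
    (h : ∀ l < j, C.φ i l z.1 * |stErr C i l z| < 1) :
    (z.1, errJet C z.1 z.2 i) ∈ jetDomain (C.φ i) (r i - 1) j :=
  ⟨H.errJet_mem_jetBase hz i, h⟩

lemma mem_jetDomain_of_errDomain (H : Feasible S C α) {z : ℝ × StateSpace r p}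
    (hz : z ∈ errDomain r p C) (i : Fin q) {j : ℕ} (hj : j ≤ r i - 1) :
    (z.1, errJet C z.1 z.2 i) ∈ jetDomain (C.φ i) (r i - 1) j :=
  H.mem_jetDomain hz.1 i j fun l hl => hz.2 i l (by omega)

/-- The set restricts only the signals of lower index than `j`. At the endpoint of a trajectory,
membership in the funnels is recovered one index at a time, and continuity on this larger set is
what is available. -/
lemma continuousOn_stErr (H : Feasible S C α) (i : Fin q) {j : ℕ} (hj : j ≤ r i - 1) :
    ContinuousOn (stErr (r := r) C i j) {z | 0 ≤ z.1 ∧ ∀ l < j, C.φ i l z.1 * |stErr C i l z| < 1} :=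
  (continuousOn_jetErr (H.funnel i) hj).comp
    ((H.continuousOn_errJet i).mono fun _ hz => hz.1) fun _ hz => H.mem_jetDomain hz.1 i j hz.2

lemma continuousOn_stErr' (H : Feasible S C α) (i : Fin q) {j : ℕ} (hj : j ≤ r i - 1) :
    ContinuousOn (stErr (r := r) C i j) (errDomain r p C) :=
  (H.continuousOn_stErr i hj).mono fun z hz => ⟨hz.1, fun l hl => hz.2 i l (by omega)⟩

lemma continuousOn_stErrI (H : Feasible S C α) :
    ContinuousOn (stErrI (r := r) C) (errDomain r p C) :=
  (PiLp.continuous_toLp 2 _).comp_continuousOn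
    (continuousOn_pi.2 fun i => H.continuousOn_stErr' i le_rfl)

lemma errDomain_mem_nhdsWithin (H : Feasible S C α) {z : ℝ × StateSpace r p}
    (hz : z ∈ errDomain r p C) : errDomain r p C ∈ 𝓝[{z | 0 ≤ z.1}] z := by
  have h1 : ∀ i, {w : ℝ × StateSpace r p | (w.1, errJet C w.1 w.2 i) ∈
      jetDomain (C.φ i) (r i - 1) (r i - 1)} ∈ 𝓝[{z | 0 ≤ z.1}] z := by
    intro i
    have ht : Tendsto (fun z : ℝ × StateSpace r p => (z.1, errJet C z.1 z.2 i)) (𝓝[{z | 0 ≤ z.1}] z)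
        (𝓝[jetBase (r i - 1)] (z.1, errJet C z.1 z.2 i)) :=
      tendsto_nhdsWithin_iff.2 ⟨H.continuousOn_errJet i z hz.1,
        by filter_upwards [self_mem_nhdsWithin] with w hw using H.errJet_mem_jetBase hw i⟩
    exact ht (jetDomain_mem_nhdsWithin (H.funnel i) le_rfl (H.mem_jetDomain_of_errDomain hz i le_rfl))
  filter_upwards [self_mem_nhdsWithin, (Filter.eventually_all (l := 𝓝[{z | 0 ≤ z.1}] z)).2 h1]
    with w hw hw'
  exact ⟨hw, fun i j hj => (hw' i).2 j (by omega)⟩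

lemma φI_comp (H : Feasible S C α) {A : Set (ℝ × StateSpace r p)} (hA : ∀ z ∈ A, 0 ≤ z.1) :
    ContinuousOn (fun z : ℝ × StateSpace r p => C.φI z.1) A :=
  H.ctrl.φI_mem.continuousOn.comp continuousOn_fst hA

lemma safeI_mem_nhdsWithin (H : Feasible S C α) {z : ℝ × StateSpace r p}
    (hz : z ∈ safeI r p C) : safeI r p C ∈ 𝓝[{z | 0 ≤ z.1}] z := by
  have h1 := H.errDomain_mem_nhdsWithin hz.1
  have hc : ContinuousWithinAt (fun z : ℝ × StateSpace r p => C.φI z.1 * ‖stErrI C z‖)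
      {z | 0 ≤ z.1} z :=
    (H.φI_comp (fun _ h => h) z hz.1.1).mul
      ((H.continuousOn_stErrI.norm z hz.1).mono_of_mem_nhdsWithin h1)
  filter_upwards [h1, hc.eventually_lt continuousWithinAt_const hz.2] with w hw hw'
  exact ⟨hw, hw'⟩

lemma continuousOn_yrefII (H : Feasible S C α) :
    ContinuousOn (fun t => WithLp.toLp 2 fun i : Fin p => C.yref t (Sum.inr i)) (Ici 0) := by
  refine (PiLp.continuous_toLp 2 _).comp_continuousOn (continuousOn_pi.2 fun i => ?_)
  exact (EuclideanSpace.proj (𝕜 := ℝ) (Sum.inr i : Fin q ⊕ Fin p)).continuous.comp_continuousOn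
      H.ctrl.yref_cont

lemma continuousOn_stErrII (H : Feasible S C α) :
    ContinuousOn (stErrII (r := r) C) {z | 0 ≤ z.1} := by
  refine (PiLp.continuous_toLp 2 _).comp_continuousOn (continuousOn_pi.2 fun i => ?_)
  refine ContinuousOn.sub (by fun_prop) ?_
  exact ((EuclideanSpace.proj (𝕜 := ℝ) (Sum.inr i : Fin q ⊕ Fin p)).continuous.comp_continuousOn
      H.ctrl.yref_cont).comp continuousOn_fst fun z hz => hz

lemma safe_mem_nhdsWithin (H : Feasible S C α) {z : ℝ × StateSpace r p}
    (hz : z ∈ safe r p C) : safe r p C ∈ 𝓝[{z | 0 ≤ z.1}] z := by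
  have hc : ContinuousWithinAt (fun z : ℝ × StateSpace r p => C.φII z.1 * ‖stErrII C z‖)
      {z | 0 ≤ z.1} z :=
    ((H.ctrl.φII_mem.continuousOn.comp continuousOn_fst fun z hz => hz) z hz.1.1.1).mul
      (H.continuousOn_stErrII.norm z hz.1.1.1)
  filter_upwards [H.safeI_mem_nhdsWithin hz.1, hc.eventually_lt continuousWithinAt_const hz.2]
    with w hw hw'
  exact ⟨hw, hw'⟩

lemma one_sub_pos_of_safeI (H : Feasible S C α) {z : ℝ × StateSpace r p} (hz : z ∈ safeI r p C) :
    0 < 1 - C.φI z.1 ^ 2 * ‖stErrI C z‖ ^ 2 := by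
  have := (mul_lt_one_iff_sq (H.ctrl.φI_mem.nonneg hz.1.1) (norm_nonneg _)).1 hz.2
  linarith

lemma continuousOn_stInputI (H : Feasible S C α) :
    ContinuousOn (stInputI (r := r) C) (safeI r p C) := by
  have h1 : ContinuousOn (stErrI (r := r) C) (safeI r p C) :=
    H.continuousOn_stErrI.mono fun z hz => hz.1
  refine ContinuousOn.neg (ContinuousOn.smul (f := fun z : ℝ × StateSpace r p =>
    1 / (1 - C.φI z.1 ^ 2 * ‖stErrI C z‖ ^ 2)) ?_ h1)
  refine continuousOn_const.div ?_ fun z hz => (H.one_sub_pos_of_safeI hz).ne'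
  exact continuousOn_const.sub (((H.φI_comp fun z hz => hz.1.1).pow 2).mul (h1.norm.pow 2))

/-- The curve of jets of the `i`-th error. -/
noncomputable def errCurve (H : Feasible S C α) {ω : EReal} {Y : ℝ → StateSpace r p}
    (hY : IsJetState r p ω Y) (i : Fin q) : JetCurve (r i - 1) where
  a t := errJet C t (Y t) i
  ω := ω
  cont l := by
    have h1 : ContinuousOn (fun t => (t, Y t)) (ivl 0 ω) := continuousOn_id.prodMk hY.cont
    exact continuousOn_pi.1 (continuousOn_snd.comp ((H.continuousOn_errJet i).comp h1
      fun t ht => ht.1) (mapsTo_univ _ _)) l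
  deriv l hl t ht := by
    have h1 : l < r i := by omega
    have h2 : l + 1 < r i := by omega
    simp only [errJet, dif_pos h1, dif_pos h2]
    exact (hY.chain i l h2 t ht).sub ((H.refJet_spec i).1 l h2 t ht.1)
  zero t l hl := by
    have := H.sys.r_pos i
    simp only [errJet, dif_neg (show ¬ l < r i by omega)]

lemma errCurve_zero (H : Feasible S C α) {ω : EReal} {Y : ℝ → StateSpace r p}
    (hY : IsJetState r p ω Y) (i : Fin q) (t : ℝ) :
    (H.errCurve hY i).a t 0
      = Y t (Sum.inl ⟨i, ⟨0, H.sys.r_pos i⟩⟩) - C.yref t (Sum.inl i) := by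
  simp [errCurve, errJet, H.sys.r_pos i, Controller.refJet]

lemma err_eqOn_errS (H : Feasible S C α) {ω : EReal} {Y : ℝ → StateSpace r p}
    (hY : IsJetState r p ω Y) {y : ℝ → OutputSpace q p} (i : Fin q)
    (hy : ∀ t ∈ ivl 0 ω, y t (Sum.inl i) = Y t (Sum.inl ⟨i, ⟨0, H.sys.r_pos i⟩⟩)) (j : ℕ) :
    EqOn (C.err y i j) (errS (C.φ i) (fun t => (H.errCurve hY i).a t 0) j) (ivl 0 ω) := by
  rw [err_eq_errS]
  refine errS_congr _ (fun t ht => ?_) j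
  beta_reduce
  rw [errCurve_zero, hy t ht]

/-- The signals generated by an output are functions of the time and the state. -/
lemma err_eq_stErr (H : Feasible S C α) {ω : EReal} {Y : ℝ → StateSpace r p}
    (hY : IsJetState r p ω Y) {y : ℝ → OutputSpace q p} {i : Fin q}
    (hy : ∀ t ∈ ivl 0 ω, y t (Sum.inl i) = Y t (Sum.inl ⟨i, ⟨0, H.sys.r_pos i⟩⟩)) {j : ℕ}
    (hj : j ≤ r i - 1) {t : ℝ} (ht : t ∈ ivl 0 ω)
    (h : ∀ l < j, C.φ i l t * |stErr C i l (t, Y t)| < 1) :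
    C.err y i j t = stErr C i j (t, Y t) := by
  rw [H.err_eqOn_errS hY i hy j ht]
  exact errS_eq_jetErr (H.funnel i) hj (H.errCurve hY i) ht
    (H.mem_jetDomain (z := (t, Y t)) ht.1 i j h)

end Feasible

/-! ### The algebraic equation -/

/-- Replacing the last `p` components of a state. -/
noncomputable def withII (Y : StateSpace r p) (v : EuclideanSpace ℝ (Fin p)) : StateSpace r p :=
  WithLp.toLp 2 (Sum.elim (fun ij => Y (Sum.inl ij)) (fun i => v i))

lemma withII_eq (Y : StateSpace r p) (v : EuclideanSpace ℝ (Fin p)) :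
    withII Y v = withII Y 0 + inclII r p v := by
  ext x
  cases x <;> simp [withII, inclII]

lemma continuous_withII : Continuous fun w : StateSpace r p × EuclideanSpace ℝ (Fin p) =>
    withII w.1 w.2 := by
  refine (PiLp.continuous_toLp 2 _).comp (continuous_pi fun x => ?_)
  cases x <;> simp only [Sum.elim_inl, Sum.elim_inr] <;> fun_prop

/-- The reference signal for the outputs `y_i`, `i > q`. -/
noncomputable def Controller.refII (C : Controller q p) (t : ℝ) : EuclideanSpace ℝ (Fin p) :=
  WithLp.toLp 2 fun i => C.yref t (Sum.inr i)

/-- The part of the algebraic equation without `u_II`. -/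
noncomputable def algRhs (S : System r p s k) (C : Controller q p) (z : ℝ × StateSpace r p)
    (θ : EuclideanSpace ℝ (Fin k)) (e : EuclideanSpace ℝ (Fin p)) : EuclideanSpace ℝ (Fin p) :=
  S.f₂ (withII z.2 (e + C.refII z.1)) + S.f₃ (S.d₃ z.1, θ)
    + WithLp.toLp 2 (S.ΓII (S.d₄ z.1, θ) *ᵥ ⇑(stInputI C z))

/-- The contraction whose fixed point is the solution `e_II` of the algebraic equation. -/
noncomputable def algMap (S : System r p s k) (C : Controller q p) (z : ℝ × StateSpace r p)
    (θ : EuclideanSpace ℝ (Fin k)) (e : EuclideanSpace ℝ (Fin p)) : EuclideanSpace ℝ (Fin p) :=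
  gainInv (C.φII z.1) ((C.kHat * S.f₄ (S.d₅ z.1, θ))⁻¹ • algRhs S C z θ e)

/-- The solution `e_II` of the algebraic equation. -/
noncomputable def algErr (S : System r p s k) (C : Controller q p) (z : ℝ × StateSpace r p)
    (θ : EuclideanSpace ℝ (Fin k)) : EuclideanSpace ℝ (Fin p) := fixedPt (algMap S C z θ)

/-- The Lipschitz constant of `algMap`. -/
noncomputable def algConst (S : System r p s k) (C : Controller q p) (α : ℝ) : NNReal :=
  ((⨆ Y, S.partialNorm Y) / (C.kHat * α)).toNNReal

/-- The algebraic equation. -/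
def AlgEq (S : System r p s k) (C : Controller q p) (z : ℝ × StateSpace r p)
    (θ : EuclideanSpace ℝ (Fin k)) : Prop :=
  0 = S.f₂ z.2 + S.f₃ (S.d₃ z.1, θ) + WithLp.toLp 2 (S.ΓII (S.d₄ z.1, θ) *ᵥ ⇑(stInputI C z))
    + S.f₄ (S.d₅ z.1, θ) • (-((C.kHat / (1 - C.φII z.1 ^ 2 * ‖stErrII C z‖ ^ 2)) • stErrII C z))

namespace Feasible

variable {S : System r p s k} {C : Controller q p} {α : ℝ}

/-- This is the gain condition, multiplied out. -/
lemma algConst_lt_one (H : Feasible S C α) : algConst S C α < 1 := by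
  have h1 := H.gain
  have h2 := H.sys.α_pos
  have h3 := H.ctrl.kHat_pos
  rw [algConst, ← NNReal.coe_lt_coe, NNReal.coe_one, Real.coe_toNNReal', max_lt_iff]
  refine ⟨?_, one_pos⟩
  rw [div_lt_one (by positivity)]
  unfold GainCondition at h1
  rwa [inv_mul_lt_iff₀ h2, mul_comm] at h1

/-- By the chain rule the derivative in `e` is `f₂' ∘ [0; I]`, whose norm is bounded by the supremum
in the gain condition. -/
lemma lipschitzWith_f₂ (H : Feasible S C α) (Y : StateSpace r p) (w : EuclideanSpace ℝ (Fin p)) :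
    LipschitzWith (⨆ Y, S.partialNorm Y).toNNReal fun e => S.f₂ (withII Y (e + w)) := by
  have hd : ∀ e, HasFDerivAt (fun e => S.f₂ (withII Y (e + w)))
      ((fderiv ℝ S.f₂ (withII Y (e + w))).comp (inclII r p)) e := by
    intro e
    have h1 : HasFDerivAt (fun e => withII Y (e + w)) (inclII r p) e := by
      have : (fun e => withII Y (e + w)) = fun e => inclII r p (e + w) + withII Y 0 := by
        ext1 e; rw [withII_eq, add_comm]
      rw [this]
      exact (((inclII r p).hasFDerivAt (x := e + w)).comp e
        ((hasFDerivAt_id e).add_const w)).add_const _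
    exact ((H.sys.f₂_contDiff.differentiable (by simp) _).hasFDerivAt).comp e h1
  refine lipschitzWith_of_nnnorm_fderiv_le (fun e => (hd e).differentiableAt) fun e => ?_
  rw [(hd e).fderiv, ← NNReal.coe_le_coe, coe_nnnorm]
  exact (le_ciSup H.sys.f₂_bounded (withII Y (e + w))).trans (Real.le_coe_toNNReal _)

lemma kf₄_pos (H : Feasible S C α) (x : CoeffSpace s k) : 0 < C.kHat * S.f₄ x :=
  mul_pos H.ctrl.kHat_pos (H.sys.α_pos.trans_le (H.sys.f₄_lower x))

/-- `gainInv` is nonexpansive, the scalar factor is at most `(k̂ α)⁻¹`, and of the summands only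
`f₂` depends on `e`; the others, including the one with `u_I`, cancel in differences. -/
lemma lipschitzWith_algMap (H : Feasible S C α) (z : ℝ × StateSpace r p)
    (θ : EuclideanSpace ℝ (Fin k)) : LipschitzWith (algConst S C α) (algMap S C z θ) := by
  refine LipschitzWith.of_dist_le_mul fun e e' => ?_
  have hk := H.ctrl.kHat_pos
  have hα := H.sys.α_pos
  have h1 := (lipschitzWith_gainInv (C.φII z.1)).dist_le_mul
    ((C.kHat * S.f₄ (S.d₅ z.1, θ))⁻¹ • algRhs S C z θ e)
    ((C.kHat * S.f₄ (S.d₅ z.1, θ))⁻¹ • algRhs S C z θ e')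
  have h2 := (H.lipschitzWith_f₂ z.2 (C.refII z.1)).dist_le_mul e e'
  have hsup : 0 ≤ ⨆ Y, S.partialNorm Y := Real.iSup_nonneg fun Y => norm_nonneg _
  rw [Real.coe_toNNReal _ hsup] at h2
  rw [algConst, Real.coe_toNNReal _ (by positivity)]
  refine h1.trans ?_
  rw [NNReal.coe_one, one_mul, dist_smul₀, Real.norm_of_nonneg (inv_pos.2 (H.kf₄_pos _)).le]
  have h3 : dist (algRhs S C z θ e) (algRhs S C z θ e') =
      dist (S.f₂ (withII z.2 (e + C.refII z.1))) (S.f₂ (withII z.2 (e' + C.refII z.1))) := by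
    simp only [algRhs, dist_add_right]
  rw [h3]
  have h4 : (C.kHat * S.f₄ (S.d₅ z.1, θ))⁻¹ ≤ (C.kHat * α)⁻¹ := by
    gcongr
    exact H.sys.f₄_lower _
  calc _ ≤ (C.kHat * α)⁻¹ * ((⨆ Y, S.partialNorm Y) * dist e e') := by gcongr
    _ = _ := by field_simp

lemma algErr_eq (H : Feasible S C α) (z : ℝ × StateSpace r p) (θ : EuclideanSpace ℝ (Fin k)) :
    algMap S C z θ (algErr S C z θ) = algErr S C z θ :=
  fixedPt_eq H.algConst_lt_one (H.lipschitzWith_algMap z θ)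

lemma withII_stErrII (z : ℝ × StateSpace r p) : withII z.2 (stErrII C z + C.refII z.1) = z.2 := by
  ext x
  cases x <;> simp [withII, stErrII, Controller.refII]

lemma algEq_iff (z : ℝ × StateSpace r p) (θ : EuclideanSpace ℝ (Fin k)) :
    AlgEq S C z θ ↔ algRhs S C z θ (stErrII C z)
      = (C.kHat * S.f₄ (S.d₅ z.1, θ)) • gainMap (C.φII z.1) (stErrII C z) := by
  rw [AlgEq, algRhs, withII_stErrII, gainMap, eq_comm, smul_neg, ← sub_eq_add_neg, sub_eq_zero,
    smul_smul, smul_smul]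
  have : S.f₄ (S.d₅ z.1, θ) * (C.kHat / (1 - C.φII z.1 ^ 2 * ‖stErrII C z‖ ^ 2)) =
    C.kHat * S.f₄ (S.d₅ z.1, θ) * (1 / (1 - C.φII z.1 ^ 2 * ‖stErrII C z‖ ^ 2)) := by ring
  rw [this]

/-- Apply `gainInv` to the algebraic equation. The funnel condition enters because `gainInv` inverts
`gainMap` only inside the funnel. -/
lemma stErrII_eq_algErr (H : Feasible S C α) {z : ℝ × StateSpace r p} (hz0 : 0 ≤ z.1)
    {θ : EuclideanSpace ℝ (Fin k)} (hz : C.φII z.1 * ‖stErrII C z‖ < 1) (h : AlgEq S C z θ) :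
    stErrII C z = algErr S C z θ := by
  refine eq_fixedPt H.algConst_lt_one (H.lipschitzWith_algMap z θ) ?_
  rw [algMap, (algEq_iff z θ).1 h, smul_smul, inv_mul_cancel₀ (H.kf₄_pos _).ne', one_smul]
  exact gainInv_gainMap
    ((mul_lt_one_iff_sq (H.ctrl.φII_mem.nonneg hz0) (norm_nonneg _)).1 hz)

/-- The funnel condition comes for free: a fixed point of `algMap` is in the range of `gainInv`. -/
lemma algEq_of_eq_algErr (H : Feasible S C α) {z : ℝ × StateSpace r p} (hz0 : 0 ≤ z.1)
    {θ : EuclideanSpace ℝ (Fin k)} (h : stErrII C z = algErr S C z θ) :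
    C.φII z.1 * ‖stErrII C z‖ < 1 ∧ AlgEq S C z θ := by
  have h1 := H.algErr_eq z θ
  rw [← h, algMap] at h1
  refine ⟨(mul_lt_one_iff_sq (H.ctrl.φII_mem.nonneg hz0) (norm_nonneg _)).2 ?_, ?_⟩
  · rw [← h1]; exact gainInv_mem _ _
  · rw [algEq_iff]
    conv_rhs => rw [← h1]
    rw [gainMap_gainInv, smul_smul, mul_inv_cancel₀ (H.kf₄_pos _).ne', one_smul]

lemma continuousOn_mulVec {X : Type*} [TopologicalSpace X] {m n : ℕ} {A : Set X}
    {M : X → Matrix (Fin m) (Fin n) ℝ} {v : X → EuclideanSpace ℝ (Fin n)} (hM : ContinuousOn M A)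
    (hv : ContinuousOn v A) : ContinuousOn (fun x => (WithLp.toLp 2 (M x *ᵥ ⇑(v x)) :
      EuclideanSpace ℝ (Fin m))) A := by
  refine (PiLp.continuous_toLp 2 _).comp_continuousOn (continuousOn_pi.2 fun i => ?_)
  simp only [Matrix.mulVec, dotProduct]
  refine continuousOn_finsetSum _ fun j _ => ContinuousOn.mul ?_ ?_
  · exact (continuous_apply_apply i j).comp_continuousOn hM
  · exact (EuclideanSpace.proj (𝕜 := ℝ) j).continuous.comp_continuousOn hv

lemma continuous_ΓII (H : Feasible S C α) : Continuous S.ΓII :=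
  continuous_matrix fun i j => (H.sys.ΓII_contDiff i j).continuous

lemma continuousOn_coeff {d : ℝ → EuclideanSpace ℝ (Fin s)} (hd : ContinuousOn d (Ici 0)) :
    ContinuousOn (fun w : (ℝ × StateSpace r p) × EuclideanSpace ℝ (Fin k) => (d w.1.1, w.2))
      {w | w.1 ∈ safeI r p C} := by
  refine ContinuousOn.prodMk ?_ continuousOn_snd
  exact hd.comp (continuous_fst.comp continuous_fst).continuousOn fun w hw => hw.1.1

lemma continuousOn_algRhs (H : Feasible S C α) (e : EuclideanSpace ℝ (Fin p)) :
    ContinuousOn (fun w : (ℝ × StateSpace r p) × EuclideanSpace ℝ (Fin k) => algRhs S C w.1 w.2 e)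
      {w | w.1 ∈ safeI r p C} := by
  unfold algRhs
  refine (ContinuousOn.add ?_ ?_).add ?_
  · refine H.sys.f₂_contDiff.continuous.comp_continuousOn ?_
    refine continuous_withII.comp_continuousOn
      (ContinuousOn.prodMk (continuous_snd.comp continuous_fst).continuousOn ?_)
    refine continuousOn_const.add ?_
    exact H.continuousOn_yrefII.comp (continuous_fst.comp continuous_fst).continuousOn
      fun w hw => hw.1.1
  · exact H.sys.f₃_contDiff.continuous.comp_continuousOn (continuousOn_coeff H.sys.d₃_cont)
  · refine continuousOn_mulVec
      (H.continuous_ΓII.comp_continuousOn (continuousOn_coeff H.sys.d₄_cont)) ?_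
    exact H.continuousOn_stInputI.comp continuousOn_fst fun w hw => hw

lemma continuousOn_gainInv {X : Type*} [TopologicalSpace X] {A : Set X} {φ : X → ℝ}
    {w : X → EuclideanSpace ℝ (Fin p)} (hφ : ContinuousOn φ A) (hw : ContinuousOn w A) :
    ContinuousOn (fun x => gainInv (φ x) (w x)) A := by
  have hc : Continuous fun z : ℝ × EuclideanSpace ℝ (Fin p) => gainInv z.1 z.2 :=
    contDiff_gainInv.continuous
  exact Continuous.comp_continuousOn' (f := fun x => (φ x, w x)) hc (hφ.prodMk hw)

lemma continuousOn_algMap (H : Feasible S C α) (e : EuclideanSpace ℝ (Fin p)) :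
    ContinuousOn (fun w : (ℝ × StateSpace r p) × EuclideanSpace ℝ (Fin k) => algMap S C w.1 w.2 e)
      {w | w.1 ∈ safeI r p C} := by
  have h1 : ContinuousOn (fun w : (ℝ × StateSpace r p) × EuclideanSpace ℝ (Fin k) => C.φII w.1.1)
      {w | w.1 ∈ safeI r p C} :=
    H.ctrl.φII_mem.continuousOn.comp (continuous_fst.comp continuous_fst).continuousOn
      fun w hw => hw.1.1
  have h2 : ContinuousOn (fun w : (ℝ × StateSpace r p) × EuclideanSpace ℝ (Fin k) =>
      C.kHat * S.f₄ (S.d₅ w.1.1, w.2)) {w | w.1 ∈ safeI r p C} :=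
    continuousOn_const.mul
      (H.sys.f₄_contDiff.continuous.comp_continuousOn (continuousOn_coeff H.sys.d₅_cont))
  exact continuousOn_gainInv h1
    ((h2.inv₀ fun w _ => (H.kf₄_pos _).ne').smul (H.continuousOn_algRhs e))

/-- The solution of the algebraic equation depends continuously on the data. -/
lemma continuousOn_algErr (H : Feasible S C α) :
    ContinuousOn (fun w : (ℝ × StateSpace r p) × EuclideanSpace ℝ (Fin k) => algErr S C w.1 w.2)
      {w | w.1 ∈ safeI r p C} := by
  intro w₀ hw₀
  exact continuousWithinAt_fixedPt (K := fun w : (ℝ × StateSpace r p) × EuclideanSpace ℝ (Fin k) =>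
    algMap S C w.1 w.2) H.algConst_lt_one (fun w => H.lipschitzWith_algMap w.1 w.2)
    (H.continuousOn_algMap (algErr S C w₀.1 w₀.2) w₀ hw₀)

end Feasible


/-! ### Solutions in terms of the state -/

section States

variable {q p s k : ℕ} {r : Fin q → ℕ}

/-- The output belonging to a state. -/
noncomputable def outOf (hr : ∀ i, 0 < r i) : StateSpace r p →L[ℝ] OutputSpace q p :=
  LinearMap.toContinuousLinearMap
    { toFun := fun Y => WithLp.toLp 2
        (Sum.elim (fun i => Y (Sum.inl ⟨i, ⟨0, hr i⟩⟩)) (fun i => Y (Sum.inr i)))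
      map_add' := by
        intro v w
        ext x
        cases x <;> simp
      map_smul' := by
        intro c v
        ext x
        cases x <;> simp }

@[simp] lemma outOf_inl (hr : ∀ i, 0 < r i) (Y : StateSpace r p) (i : Fin q) :
    outOf hr Y (Sum.inl i) = Y (Sum.inl ⟨i, ⟨0, hr i⟩⟩) := rfl

@[simp] lemma outOf_inr (hr : ∀ i, 0 < r i) (Y : StateSpace r p) (i : Fin p) :
    outOf hr Y (Sum.inr i) = Y (Sum.inr i) := rfl

/-- The shift of a state along its chains of derivatives. -/
noncomputable def shiftMap (r : Fin q → ℕ) (p : ℕ) : StateSpace r p →L[ℝ] StateSpace r p :=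
  LinearMap.toContinuousLinearMap
    { toFun := fun Y => WithLp.toLp 2 (Sum.elim
        (fun ij => if h : ij.2.1 + 1 < r ij.1 then Y (Sum.inl ⟨ij.1, ⟨ij.2.1 + 1, h⟩⟩) else 0)
        (fun _ => 0))
      map_add' := by
        intro v w
        ext x
        rcases x with x | x
        · by_cases h : x.2.1 + 1 < r x.1 <;> simp [h]
        · simp
      map_smul' := by
        intro c v
        ext x
        rcases x with x | x
        · by_cases h : x.2.1 + 1 < r x.1 <;> simp [h]
        · simp }

/-- The embedding of the derivatives of highest order. -/
noncomputable def topMap (r : Fin q → ℕ) (p : ℕ) : EuclideanSpace ℝ (Fin q) →L[ℝ] StateSpace r p :=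
  LinearMap.toContinuousLinearMap
    { toFun := fun v => WithLp.toLp 2 (Sum.elim
        (fun ij => if ij.2.1 + 1 = r ij.1 then v ij.1 else 0) (fun _ => 0))
      map_add' := by
        intro v w
        ext x
        rcases x with x | x
        · by_cases h : x.2.1 + 1 = r x.1 <;> simp [h]
        · simp
      map_smul' := by
        intro c v
        ext x
        rcases x with x | x
        · by_cases h : x.2.1 + 1 = r x.1 <;> simp [h]
        · simp }

lemma shiftMap_inl (Y : StateSpace r p) (i : Fin q) (j : Fin (r i)) :
    shiftMap r p Y (Sum.inl ⟨i, j⟩) =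
      if h : j.1 + 1 < r i then Y (Sum.inl ⟨i, ⟨j.1 + 1, h⟩⟩) else 0 := rfl

lemma topMap_inl (v : EuclideanSpace ℝ (Fin q)) (i : Fin q) (j : Fin (r i)) :
    topMap r p v (Sum.inl ⟨i, j⟩) = if j.1 + 1 = r i then v i else 0 := rfl

/-- The right-hand side of the differential equation. -/
noncomputable def rhs (S : System r p s k) (C : Controller q p) (ζ : ℝ → StateSpace r p) (t : ℝ) :
    EuclideanSpace ℝ (Fin q) :=
  S.f₁ (S.d₁ t, S.T₁ ζ t)
    + WithLp.toLp 2 (S.ΓI (S.d₂ t, S.T₁ ζ t) *ᵥ ⇑(stInputI C (t, ζ t)))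

/-- The state on `[-h, 0]` given by the initial data. -/
noncomputable def InitialData.history (D : InitialData q p) (r : Fin q → ℕ) (h t : ℝ) :
    StateSpace r p :=
  WithLp.toLp 2 (Sum.elim
    (fun ij => if t = 0 then D.jet ij.1 ij.2 else
      iteratedDerivWithin ij.2 (fun u => D.y₀ u (Sum.inl ij.1)) (Icc (-h) 0) t)
    (fun i => D.y₀ t (Sum.inr i)))

/-- `Y` is a solution on `[-h, t₀]` which evolves in the funnels. -/
structure PartialSol (hr : ∀ i, 0 < r i) (S : System r p s k) (C : Controller q p)
    (D : InitialData q p) (t₀ : ℝ) (Y : ℝ → StateSpace r p) : Prop where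
  nonneg : 0 ≤ t₀
  cont : ContinuousOn Y (Icc (-S.h) t₀)
  init : EqOn Y (D.history r S.h) (Icc (-S.h) 0)
  chain : ∀ i j (hj : j + 1 < r i), ∀ t ∈ Icc (-S.h) t₀,
    HasDerivWithinAt (fun t => Y t (Sum.inl ⟨i, ⟨j, by omega⟩⟩)) (Y t (Sum.inl ⟨i, ⟨j + 1, hj⟩⟩))
      (Icc (-S.h) t₀) t
  safe : ∀ t ∈ Icc 0 t₀, (t, Y t) ∈ safe r p C
  top : ∀ i (j : Fin (r i)), j.1 + 1 = r i → ∀ t ∈ Icc 0 t₀,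
    Y t (Sum.inl ⟨i, j⟩) = Y 0 (Sum.inl ⟨i, j⟩) + ∫ u in 0..t, rhs S C (stopAt t₀ Y) u i
  alg : ∀ t ∈ Icc 0 t₀, AlgEq S C (t, Y t) (S.T₂ (fun u => outOf hr (stopAt t₀ Y u)) t)

/-! ### Bounds for the right-hand side -/

namespace Feasible

variable {S : System r p s k} {C : Controller q p} {α : ℝ}

/-- The exceptional times come from `d₁` and `d₂` alone, so one null set serves all `θ` and `u`, and
the bound applies along any trajectory. -/
lemma exists_rhs_bound (H : Feasible S C α) (M U : ℝ) :
    ∃ B : ℝ, 0 ≤ B ∧ ∀ᵐ t, 0 ≤ t → ∀ (θ : EuclideanSpace ℝ (Fin k)) (u : EuclideanSpace ℝ (Fin q)),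
      ‖θ‖ ≤ M → ‖u‖ ≤ U →
      ‖S.f₁ (S.d₁ t, θ) + WithLp.toLp 2 (S.ΓI (S.d₂ t, θ) *ᵥ ⇑u)‖ ≤ B := by
  obtain ⟨M₁, -, hM₁⟩ := H.sys.d₁_mem.ae_bound
  obtain ⟨M₂, -, hM₂⟩ := H.sys.d₂_mem.ae_bound
  obtain ⟨B₁, hB₁⟩ := ((isCompact_closedBall (0 : EuclideanSpace ℝ (Fin s)) M₁).prod
    (isCompact_closedBall (0 : EuclideanSpace ℝ (Fin k)) M)).exists_bound_of_continuousOn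
    H.sys.f₁_cont.continuousOn
  have hΓ : ContinuousOn (fun w : (CoeffSpace s k) × EuclideanSpace ℝ (Fin q) =>
      (WithLp.toLp 2 (S.ΓI w.1 *ᵥ ⇑w.2) : EuclideanSpace ℝ (Fin q))) univ :=
    continuousOn_mulVec (H.sys.ΓI_cont.comp continuous_fst).continuousOn continuous_snd.continuousOn
  obtain ⟨B₂, hB₂⟩ := (((isCompact_closedBall (0 : EuclideanSpace ℝ (Fin s)) M₂).prod
    (isCompact_closedBall (0 : EuclideanSpace ℝ (Fin k)) M)).prod
    (isCompact_closedBall (0 : EuclideanSpace ℝ (Fin q)) U)).exists_bound_of_continuousOn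
    (hΓ.mono (subset_univ _))
  refine ⟨max (B₁ + B₂) 0, le_max_right _ _, ?_⟩
  filter_upwards [hM₁, hM₂] with t h1 h2 ht θ u hθ hu
  refine (norm_add_le _ _).trans ((add_le_add ?_ ?_).trans (le_max_left _ _))
  · exact hB₁ (S.d₁ t, θ) ⟨by simpa using h1 ht, by simpa using hθ⟩
  · exact hB₂ ((S.d₂ t, θ), u) ⟨⟨by simpa using h2 ht, by simpa using hθ⟩, by simpa using hu⟩

lemma aestronglyMeasurable_rhs (H : Feasible S C α) {ζ : ℝ → StateSpace r p}
    (hζ : ContinuousOn ζ (Ici (-S.h))) {A : Set ℝ} (hA : A ⊆ Ici 0) (hAm : MeasurableSet A)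
    (hs : ∀ t ∈ A, (t, ζ t) ∈ safeI r p C) :
    AEStronglyMeasurable (rhs S C ζ) (volume.restrict A) := by
  have hle : volume.restrict A ≤ volume.restrict (Ici (0 : ℝ)) := Measure.restrict_mono hA le_rfl
  have hT : AEStronglyMeasurable (S.T₁ ζ) (volume.restrict A) :=
    (H.sys.T₁_mem.measurable ζ hζ).mono_measure hle
  have h1 := H.sys.f₁_cont.comp_aestronglyMeasurable
    ((H.sys.d₁_mem.1.mono_measure hle).prodMk hT)
  have hu : AEStronglyMeasurable (fun t => stInputI C (t, ζ t)) (volume.restrict A) := by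
    refine ContinuousOn.aestronglyMeasurable ?_ hAm
    refine H.continuousOn_stInputI.comp (continuousOn_id.prodMk (hζ.mono fun t ht => ?_)) hs
    exact (neg_nonpos.2 H.sys.h_nonneg).trans (hA ht)
  have hΓ : Continuous (fun w : (CoeffSpace s k) × EuclideanSpace ℝ (Fin q) =>
      (WithLp.toLp 2 (S.ΓI w.1 *ᵥ ⇑w.2) : EuclideanSpace ℝ (Fin q))) := by
    rw [← continuousOn_univ]
    exact continuousOn_mulVec (H.sys.ΓI_cont.comp continuous_fst).continuousOn
      continuous_snd.continuousOn
  have h2 := hΓ.comp_aestronglyMeasurable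
    ((((H.sys.d₂_mem.1.mono_measure hle).prodMk hT)).prodMk hu)
  exact h1.add h2

lemma bddOn_stInputI (H : Feasible S C α) {ζ : ℝ → StateSpace r p} {a b : ℝ}
    (hζ : ContinuousOn ζ (Icc a b)) (hs : ∀ t ∈ Icc a b, (t, ζ t) ∈ safeI r p C) :
    ∃ U : ℝ, ∀ t ∈ Icc a b, ‖stInputI C (t, ζ t)‖ ≤ U :=
  isCompact_Icc.exists_bound_of_continuousOn
    (H.continuousOn_stInputI.comp (continuousOn_id.prodMk hζ) hs)

/-- Along continuous trajectories in the funnels, the right-hand side is locally bounded. -/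
lemma rhs_bound_Icc (H : Feasible S C α) {ζ : ℝ → StateSpace r p}
    (hζ : ContinuousOn ζ (Ici (-S.h))) {b : ℝ}
    (hs : ∀ t ∈ Icc 0 b, (t, ζ t) ∈ safeI r p C) :
    ∃ B : ℝ, 0 ≤ B ∧ ∀ᵐ t, t ∈ Icc 0 b → ‖rhs S C ζ t‖ ≤ B := by
  have hz : ContinuousOn ζ (Icc 0 b) := hζ.mono fun t ht =>
    (neg_nonpos.2 H.sys.h_nonneg).trans ht.1
  obtain ⟨U, hU⟩ := H.bddOn_stInputI hz hs
  obtain ⟨M, hM⟩ := H.sys.T₁_mem.locallyBounded ζ hζ b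
  obtain ⟨B, hB0, hB⟩ := H.exists_rhs_bound M U
  rw [ae_restrict_iff' measurableSet_Icc] at hM
  refine ⟨B, hB0, ?_⟩
  filter_upwards [hB, hM] with t h1 h2 ht
  exact h1 ht.1 _ _ (h2 ht) (hU t ht)

lemma intervalIntegrable_rhs (H : Feasible S C α) {ζ : ℝ → StateSpace r p}
    (hζ : ContinuousOn ζ (Ici (-S.h))) {b : ℝ}
    (hs : ∀ t ∈ Icc 0 b, (t, ζ t) ∈ safeI r p C) {a c : ℝ} (ha : a ∈ Icc 0 b) (hc : c ∈ Icc 0 b) :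
    IntervalIntegrable (rhs S C ζ) volume a c := by
  obtain ⟨B, -, hB⟩ := H.rhs_bound_Icc hζ hs
  have : IntegrableOn (rhs S C ζ) (Icc 0 b) := by
    refine Integrable.of_bound
      (H.aestronglyMeasurable_rhs hζ (fun t ht => ht.1) measurableSet_Icc hs) B ?_
    rwa [ae_restrict_iff' measurableSet_Icc]
  rw [intervalIntegrable_iff]
  exact this.mono_set (uIoc_subset_uIcc.trans (ordConnected_Icc.uIcc_subset ha hc))

end Feasible

/-! ### Gluing -/

/-- The continuation of `Y` by `x` beyond `t₀`, constant beyond `t₁`. -/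
noncomputable def glue {X : Type*} (Y : ℝ → X) (t₀ t₁ : ℝ) (x : ℝ → X) : ℝ → X :=
  open Classical in fun t => if t ≤ t₀ then Y t else x (min t t₁)

section Glue

variable {X : Type*} {Y x : ℝ → X} {t₀ t₁ : ℝ}

lemma glue_of_le {t : ℝ} (h : t ≤ t₀) : glue Y t₀ t₁ x t = Y t := by simp [glue, h]

lemma glue_of_ge (hx : x t₀ = Y t₀) (h01 : t₀ ≤ t₁) {t : ℝ} (h : t₀ ≤ t) :
    glue Y t₀ t₁ x t = x (min t t₁) := by
  rcases h.eq_or_lt with rfl | h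
  · simp [glue, h01, hx]
  · simp [glue, not_le.2 h]

lemma glue_of_mem (hx : x t₀ = Y t₀) {t : ℝ} (h : t ∈ Icc t₀ t₁) :
    glue Y t₀ t₁ x t = x t := by
  rw [glue_of_ge hx (h.1.trans h.2) h.1, min_eq_left h.2]

lemma continuousOn_glue [TopologicalSpace X] {a : ℝ} (hx : x t₀ = Y t₀)
    (h01 : t₀ ≤ t₁) (hY : ContinuousOn Y (Icc a t₀)) (hxc : ContinuousOn x (Icc t₀ t₁)) :
    ContinuousOn (glue Y t₀ t₁ x) (Ici a) := by
  have h1 : ContinuousOn (glue Y t₀ t₁ x) (Icc a t₀) := hY.congr fun t ht => glue_of_le ht.2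
  have h2 : ContinuousOn (glue Y t₀ t₁ x) (Ici t₀) := by
    refine ContinuousOn.congr (f := fun t => x (min t t₁)) ?_ fun t ht => glue_of_ge hx h01 ht
    exact hxc.comp (by fun_prop) fun t ht => ⟨le_min ht h01, min_le_right _ _⟩
  refine (h1.union_of_isClosed h2 isClosed_Icc isClosed_Ici).mono fun t ht => ?_
  rcases le_total t t₀ with h | h
  exacts [Or.inl ⟨ht, h⟩, Or.inr h]

lemma glue_eqOn_of_eqOn {x' : ℝ → X} {t : ℝ} (hx : x t₀ = Y t₀) (hx' : x' t₀ = Y t₀)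
    (ht : t ∈ Icc t₀ t₁) (h : EqOn x x' (Icc t₀ t)) :
    EqOn (glue Y t₀ t₁ x) (glue Y t₀ t₁ x') (Iic t) := by
  intro u hu
  rcases le_total u t₀ with h' | h'
  · rw [glue_of_le h', glue_of_le h']
  · rw [glue_of_mem hx ⟨h', le_trans hu ht.2⟩, glue_of_mem hx' ⟨h', le_trans hu ht.2⟩]
    exact h ⟨h', hu⟩

end Glue

end States


/-! ### Local existence -/

lemma hasDerivWithinAt_Icc_concat {f f' : ℝ → ℝ} {a b c : ℝ}
    (h1 : ∀ t ∈ Icc a b, HasDerivWithinAt f (f' t) (Icc a b) t)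
    (h2 : ∀ t ∈ Icc b c, HasDerivWithinAt f (f' t) (Icc b c) t) :
    ∀ t ∈ Icc a c, HasDerivWithinAt f (f' t) (Icc a c) t := by
  intro t ht
  rcases lt_trichotomy t b with h | h | h
  · refine (h1 t ⟨ht.1, h.le⟩).mono_of_mem_nhdsWithin ?_
    filter_upwards [self_mem_nhdsWithin, mem_nhdsWithin_of_mem_nhds (Iic_mem_nhds h)] with u hu hu'
    exact ⟨hu.1, hu'⟩
  · subst h
    refine ((h1 t ⟨ht.1, le_rfl⟩).union (h2 t ⟨le_rfl, ht.2⟩)).mono fun u hu => ?_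
    rcases le_total u t with h | h
    exacts [Or.inl ⟨hu.1, h⟩, Or.inr ⟨h, hu.2⟩]
  · refine (h2 t ⟨h.le, ht.2⟩).mono_of_mem_nhdsWithin ?_
    filter_upwards [self_mem_nhdsWithin, mem_nhdsWithin_of_mem_nhds (Ici_mem_nhds h)] with u hu hu'
    exact ⟨hu', hu.2⟩

lemma intervalIntegral_euclidean_apply {ι : Type*} [Fintype ι] {f : ℝ → EuclideanSpace ℝ ι}
    {a b : ℝ} (hf : IntervalIntegrable f volume a b) (i : ι) :
    (∫ u in a..b, f u) i = ∫ u in a..b, f u i :=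
  ((EuclideanSpace.proj (𝕜 := ℝ) i).intervalIntegral_comp_comm hf).symm

section States

variable {q p s k : ℕ} {r : Fin q → ℕ}

/-- The errors of the first `q` outputs, hence `u_I`, are read off from the jet components only, and
`f₂` is evaluated with the last `p` components overwritten. Therefore the algebraic equation can be
solved after the jets have been integrated. -/
lemma algErr_withII (S : System r p s k) (C : Controller q p) (t : ℝ) (Y : StateSpace r p)
    (v : EuclideanSpace ℝ (Fin p)) (θ : EuclideanSpace ℝ (Fin k)) :
    algErr S C (t, withII Y v) θ = algErr S C (t, Y) θ := by
  have : algMap S C (t, withII Y v) θ = algMap S C (t, Y) θ := rfl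
  rw [algErr, this, algErr]

lemma stErrII_withII (C : Controller q p) (t : ℝ) (Y : StateSpace r p)
    (e : EuclideanSpace ℝ (Fin p)) : stErrII C (t, withII Y (e + C.refII t)) = e := by
  ext i
  simp [stErrII, withII, Controller.refII]

/-- The velocity of the state (without the components which are given by the algebraic
equation). -/
noncomputable def vel (S : System r p s k) (C : Controller q p) (ζ : ℝ → StateSpace r p) (t : ℝ) :
    StateSpace r p := shiftMap r p (ζ t) + topMap r p (rhs S C ζ t)

/-- The state with components `y_i`, `i > q`, determined by the algebraic equation. -/
noncomputable def algState (S : System r p s k) (C : Controller q p)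
    (w : (ℝ × StateSpace r p) × EuclideanSpace ℝ (Fin k)) : StateSpace r p :=
  withII w.1.2 (algErr S C w.1 w.2 + C.refII w.1.1)

lemma rhs_congr (S : System r p s k) (C : Controller q p) {ζ ξ : ℝ → StateSpace r p} {t : ℝ}
    (h1 : S.T₁ ζ t = S.T₁ ξ t) (h2 : ζ t = ξ t) : rhs S C ζ t = rhs S C ξ t := by
  rw [rhs, rhs, h1, h2]

lemma continuousOn_outOf (hr : ∀ i, 0 < r i) {ζ : ℝ → StateSpace r p} {A : Set ℝ}
    (h : ContinuousOn ζ A) : ContinuousOn (fun u => outOf hr (ζ u)) A :=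
  (outOf hr).continuous.comp_continuousOn h

namespace Feasible

variable {S : System r p s k} {C : Controller q p} {α : ℝ}

lemma rhs_ae_eq (H : Feasible S C α) {ζ ξ : ℝ → StateSpace r p} (hζ : ContinuousOn ζ (Ici (-S.h)))
    (hξ : ContinuousOn ξ (Ici (-S.h))) {t : ℝ} (ht : 0 ≤ t) (he : EqOn ζ ξ (Icc (-S.h) t)) :
    ∀ᵐ u, u ∈ Icc 0 t → rhs S C ζ u = rhs S C ξ u := by
  filter_upwards [H.sys.T₁_mem.ae_eq_of_eqOn ht hζ hξ he] with u hu hu'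
  exact rhs_congr S C (hu hu') (he ⟨(neg_nonpos.2 H.sys.h_nonneg).trans hu'.1, hu'.2⟩)

lemma integral_rhs_eq (H : Feasible S C α) {ζ ξ : ℝ → StateSpace r p}
    (hζ : ContinuousOn ζ (Ici (-S.h))) (hξ : ContinuousOn ξ (Ici (-S.h))) {t : ℝ} (ht : 0 ≤ t)
    (he : EqOn ζ ξ (Icc (-S.h) t)) {a : ℝ} (ha : a ∈ Icc 0 t) (i : Fin q) :
    ∫ u in a..t, rhs S C ζ u i = ∫ u in a..t, rhs S C ξ u i := by
  refine intervalIntegral.integral_congr_ae ?_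
  filter_upwards [H.rhs_ae_eq hζ hξ ht he] with u hu hu'
  rw [uIoc_of_le ha.2] at hu'
  rw [hu ⟨ha.1.trans hu'.1.le, hu'.2⟩]

lemma T₂_eqOn (H : Feasible S C α) {ζ ξ : ℝ → StateSpace r p} (hζ : ContinuousOn ζ (Ici (-S.h)))
    (hξ : ContinuousOn ξ (Ici (-S.h))) {t : ℝ} (ht : 0 ≤ t) (he : EqOn ζ ξ (Icc (-S.h) t)) :
    EqOn (S.T₂ fun u => outOf H.sys.r_pos (ζ u)) (S.T₂ fun u => outOf H.sys.r_pos (ξ u))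
      (Icc 0 t) :=
  H.sys.T₂_mem.eqOn H.sys.h_nonneg ht (continuousOn_outOf _ hζ) (continuousOn_outOf _ hξ)
    fun u hu => by simp only [he hu]

variable {D : InitialData q p} {Y : ℝ → StateSpace r p} {t₀ : ℝ}

lemma neg_h_le (H : Feasible S C α) {t : ℝ} (ht : 0 ≤ t) : -S.h ≤ t :=
  (neg_nonpos.2 H.sys.h_nonneg).trans ht

lemma Icc_subset_of_neg_h (H : Feasible S C α) {b : ℝ} : Icc 0 b ⊆ Icc (-S.h) b :=
  Icc_subset_Icc_left (neg_nonpos.2 H.sys.h_nonneg)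

end Feasible

namespace PartialSol

variable {S : System r p s k} {C : Controller q p} {α : ℝ} {D : InitialData q p}
  {Y ζ : ℝ → StateSpace r p} {t₀ b : ℝ} {hr : ∀ i, 0 < r i}

lemma continuousOn_stopped (h : PartialSol hr S C D t₀ Y) (H : Feasible S C α) :
    ContinuousOn (stopAt t₀ Y) (Ici (-S.h)) :=
  continuousOn_stopAt (H.neg_h_le h.nonneg) h.cont

lemma top_of (h : PartialSol hr S C D t₀ Y) (H : Feasible S C α) (hb : b ≤ t₀)
    (hζ : ContinuousOn ζ (Ici (-S.h))) (he : EqOn ζ Y (Icc (-S.h) b)) (i : Fin q) (j : Fin (r i))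
    (hj : j.1 + 1 = r i) :
    ∀ t ∈ Icc 0 b, Y t (Sum.inl ⟨i, j⟩) = Y 0 (Sum.inl ⟨i, j⟩) + ∫ u in 0..t, rhs S C ζ u i := by
  intro t ht
  rw [h.top i j hj t ⟨ht.1, ht.2.trans hb⟩, H.integral_rhs_eq hζ (h.continuousOn_stopped H) ht.1
    (fun u hu => ?_) ⟨le_rfl, ht.1⟩]
  rw [stopAt_of_le (hu.2.trans (ht.2.trans hb)), he ⟨hu.1, hu.2.trans ht.2⟩]

lemma alg_of (h : PartialSol hr S C D t₀ Y) (H : Feasible S C α) (hb0 : 0 ≤ b) (hb : b ≤ t₀)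
    (hζ : ContinuousOn ζ (Ici (-S.h))) (he : EqOn ζ Y (Icc (-S.h) b)) :
    ∀ t ∈ Icc 0 b, AlgEq S C (t, Y t) (S.T₂ (fun u => outOf hr (ζ u)) t) := by
  intro t ht
  rw [H.T₂_eqOn hζ (h.continuousOn_stopped H) hb0 (fun u hu => ?_) ht]
  · exact h.alg t ⟨ht.1, ht.2.trans hb⟩
  · rw [stopAt_of_le (hu.2.trans hb), he hu]

/-- By causality the equations may be verified along any continuous extension `ζ` of `Y` in place of
the stopped trajectory. Restriction and gluing of solutions reduce to this. -/
lemma of_extension (H : Feasible S C α) (hb0 : 0 ≤ b) (hζ : ContinuousOn ζ (Ici (-S.h)))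
    (he : EqOn ζ Y (Icc (-S.h) b)) (init : EqOn Y (D.history r S.h) (Icc (-S.h) 0))
    (chain : ∀ i j (hj : j + 1 < r i), ∀ t ∈ Icc (-S.h) b,
      HasDerivWithinAt (fun t => Y t (Sum.inl ⟨i, ⟨j, by omega⟩⟩))
        (Y t (Sum.inl ⟨i, ⟨j + 1, hj⟩⟩)) (Icc (-S.h) b) t)
    (safe : ∀ t ∈ Icc 0 b, (t, Y t) ∈ FunnelControl.safe r p C)
    (top : ∀ i (j : Fin (r i)), j.1 + 1 = r i → ∀ t ∈ Icc 0 b,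
      Y t (Sum.inl ⟨i, j⟩) = Y 0 (Sum.inl ⟨i, j⟩) + ∫ u in 0..t, rhs S C ζ u i)
    (alg : ∀ t ∈ Icc 0 b, AlgEq S C (t, Y t) (S.T₂ (fun u => outOf hr (ζ u)) t)) :
    PartialSol hr S C D b Y := by
  have hc : ContinuousOn Y (Icc (-S.h) b) := (hζ.mono Icc_subset_Ici_self).congr he.symm
  have hc' := continuousOn_stopAt (H.neg_h_le hb0) hc
  have he' : EqOn (stopAt b Y) ζ (Icc (-S.h) b) := fun u hu => by
    rw [stopAt_of_le hu.2, he hu]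
  refine ⟨hb0, hc, init, chain, safe, fun i j hj t ht => ?_, fun t ht => ?_⟩
  · rw [top i j hj t ht, H.integral_rhs_eq hc' hζ ht.1 (he'.mono (Icc_subset_Icc_right ht.2))
      ⟨le_rfl, ht.1⟩]
  · rw [H.T₂_eqOn hc' hζ hb0 he' ht]
    exact alg t ht

lemma mono (h : PartialSol hr S C D t₀ Y) (H : Feasible S C α) (hb0 : 0 ≤ b) (hb : b ≤ t₀) :
    PartialSol hr S C D b Y := by
  have hsub : Icc (-S.h) b ⊆ Icc (-S.h) t₀ := Icc_subset_Icc_right hb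
  have he : EqOn (stopAt t₀ Y) Y (Icc (-S.h) b) := fun u hu => stopAt_of_le (hu.2.trans hb)
  exact of_extension H hb0 (h.continuousOn_stopped H) he h.init
    (fun i j hj t ht => (h.chain i j hj t (hsub ht)).mono hsub)
    (fun t ht => h.safe t ⟨ht.1, ht.2.trans hb⟩) (h.top_of H hb (h.continuousOn_stopped H) he)
    (h.alg_of H hb0 hb (h.continuousOn_stopped H) he)

lemma congr (h : PartialSol hr S C D t₀ Y) (H : Feasible S C α) {Y' : ℝ → StateSpace r p}
    (he : EqOn Y' Y (Icc (-S.h) t₀)) : PartialSol hr S C D t₀ Y' := by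
  have hm : ∀ {t}, t ∈ Icc 0 t₀ → t ∈ Icc (-S.h) t₀ := fun ht => H.Icc_subset_of_neg_h ht
  have he' : EqOn (stopAt t₀ Y) Y (Icc (-S.h) t₀) := fun u hu => stopAt_of_le hu.2
  refine of_extension H h.nonneg (h.continuousOn_stopped H) (fun u hu => (he' hu).trans (he hu).symm)
    (fun u hu => (he ⟨hu.1, hu.2.trans h.nonneg⟩).trans (h.init hu))
    (fun i j hj t ht => ?_) (fun t ht => ?_) (fun i j hj t ht => ?_) (fun t ht => ?_)
  · rw [he ht]
    exact (h.chain i j hj t ht).congr (fun u hu => by rw [he hu]) (by rw [he ht])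
  · rw [he (hm ht)]; exact h.safe t ht
  · rw [he (hm ht), he (hm ⟨le_rfl, h.nonneg⟩)]
    exact h.top i j hj t ht
  · rw [he (hm ht)]; exact h.alg t ht

lemma stErrII_eq (h : PartialSol hr S C D t₀ Y) (H : Feasible S C α) {t : ℝ} (ht : t ∈ Icc 0 t₀) :
    stErrII C (t, Y t)
      = algErr S C (t, Y t) (S.T₂ (fun u => outOf hr (stopAt t₀ Y u)) t) :=
  H.stErrII_eq_algErr ht.1 (h.safe t ht).2 (h.alg t ht)

lemma eq_algState (h : PartialSol hr S C D t₀ Y) (H : Feasible S C α) {t : ℝ} (ht : t ∈ Icc 0 t₀) :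
    Y t = algState S C ((t, Y t), S.T₂ (fun u => outOf hr (stopAt t₀ Y u)) t) := by
  rw [algState, ← h.stErrII_eq H ht]
  exact (Feasible.withII_stErrII (t, Y t)).symm

end PartialSol

namespace Feasible

variable {S : System r p s k} {C : Controller q p} {α : ℝ}

lemma continuousOn_algState (H : Feasible S C α) :
    ContinuousOn (algState S C) {w | w.1 ∈ safeI r p C} := by
  refine continuous_withII.comp_continuousOn
    ((continuous_snd.comp continuous_fst).continuousOn.prodMk (H.continuousOn_algErr.add ?_))
  exact H.continuousOn_yrefII.comp (continuous_fst.comp continuous_fst).continuousOn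
    fun w hw => hw.1.1

lemma intervalIntegrable_vel (H : Feasible S C α) {ζ : ℝ → StateSpace r p}
    (hζ : ContinuousOn ζ (Ici (-S.h))) {a b : ℝ} (ha : 0 ≤ a)
    (hs : ∀ t ∈ Icc a b, (t, ζ t) ∈ safeI r p C) {B : ℝ}
    (hB : ∀ᵐ t, t ∈ Icc a b → ‖vel S C ζ t‖ ≤ B) {c d : ℝ} (hc : c ∈ Icc a b) (hd : d ∈ Icc a b) :
    IntervalIntegrable (vel S C ζ) volume c d := by
  have hsub : Icc a b ⊆ Ici 0 := fun u hu => ha.trans hu.1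
  have hm : AEStronglyMeasurable (vel S C ζ) (volume.restrict (Icc a b)) := by
    have h1 : ContinuousOn ζ (Icc a b) := hζ.mono fun u hu => H.neg_h_le (ha.trans hu.1)
    exact (((shiftMap r p).continuous.comp_continuousOn h1).aestronglyMeasurable
      measurableSet_Icc).add ((topMap r p).continuous.comp_aestronglyMeasurable
        (H.aestronglyMeasurable_rhs hζ hsub measurableSet_Icc hs))
  have : IntegrableOn (vel S C ζ) (Icc a b) :=
    Integrable.of_bound hm B (by rwa [ae_restrict_iff' measurableSet_Icc])
  rw [intervalIntegrable_iff]
  exact this.mono_set (uIoc_subset_uIcc.trans (ordConnected_Icc.uIcc_subset hc hd))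

/-- Along a bounded family of continuous trajectories in the funnels, the velocity is bounded. -/
lemma exists_vel_bound (H : Feasible S C α) {A : Set (ℝ × StateSpace r p)} (hA : IsCompact A)
    (hAs : A ⊆ safeI r p C) (c₁ : ℝ) :
    ∃ B : ℝ, 0 ≤ B ∧ ∀ ζ : ℝ → StateSpace r p, ContinuousOn ζ (Ici (-S.h)) →
      (∀ t ∈ Ici (-S.h), ‖ζ t‖ ≤ c₁) → ∀ᵐ t, (t, ζ t) ∈ A → ‖vel S C ζ t‖ ≤ B := by
  obtain ⟨U, hU⟩ := hA.exists_bound_of_continuousOn (H.continuousOn_stInputI.mono hAs)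
  obtain ⟨M, hM0, hM⟩ := H.sys.T₁_mem.bounded (max c₁ 1) (by positivity)
  obtain ⟨B, hB0, hB⟩ := H.exists_rhs_bound M U
  refine ⟨‖shiftMap r p‖ * max c₁ 1 + ‖topMap r p‖ * B, by positivity, fun ζ hζ hc => ?_⟩
  have h1 := hM ζ hζ fun t ht => (hc t ht).trans (le_max_left _ _)
  rw [ae_restrict_iff' measurableSet_Ici] at h1
  filter_upwards [h1, hB] with t h1 h2 ht
  have ht0 : 0 ≤ t := (hAs ht).1.1
  refine (norm_add_le _ _).trans (add_le_add ?_ ?_)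
  · refine ((shiftMap r p).le_opNorm _).trans ?_
    gcongr
    exact (hc t (H.neg_h_le ht0)).trans (le_max_left _ _)
  · refine ((topMap r p).le_opNorm _).trans ?_
    gcongr
    exact h2 ht0 _ _ (h1 ht0) (hU _ ht)

end Feasible

end States


/-! ### Local Lipschitz estimates for continuations -/

section Operators

variable {X E F : Type*} [NormedAddCommGroup X] [NormedSpace ℝ X] [NormedAddCommGroup E]
  [NormedSpace ℝ E] [NormedAddCommGroup F] {h t₀ : ℝ} {T : (ℝ → E) → ℝ → F} {Y : ℝ → X}

/-- The local Lipschitz condition for continuations of a function on `[-h, t₀]`. -/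
lemma OpClass.exists_glue_lipschitz (hT : OpClass h T) (L : X →L[ℝ] E) (ht₀ : 0 ≤ t₀)
    (hY : ContinuousOn Y (Icc (-h) t₀)) :
    ∃ τ₁ > 0, ∃ δ₁ > 0, ∃ c, 0 ≤ c ∧ ∀ τ, 0 < τ → τ ≤ τ₁ → ∀ x ∈ tube t₀ (t₀ + τ) (Y t₀) δ₁,
      ∀ x' ∈ tube t₀ (t₀ + τ) (Y t₀) δ₁, ∀ m, (∀ u ∈ Icc t₀ (t₀ + τ), ‖x u - x' u‖ ≤ m) →
      ∀ᵐ u ∂(volume.restrict (Icc t₀ (t₀ + τ₁))), ‖T (fun u => L (glue Y t₀ (t₀ + τ) x u)) u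
        - T (fun u => L (glue Y t₀ (t₀ + τ) x' u)) u‖ ≤ c * m := by
  obtain ⟨τ₁, hτ₁, δ, hδ, c, hc, hlip⟩ := hT.locallyLipschitz t₀ ht₀ (fun u => L (Y u))
    (L.continuous.comp_continuousOn hY)
  refine ⟨τ₁, hτ₁, δ / (‖L‖ + 1), by positivity, c * ‖L‖, by positivity,
    fun τ hτ hττ x hx x' hx' m hm => ?_⟩
  have hle : t₀ ≤ t₀ + τ := by linarith
  have hcont : ∀ x ∈ tube t₀ (t₀ + τ) (Y t₀) (δ / (‖L‖ + 1)),
      ContinuousOn (fun u => L (glue Y t₀ (t₀ + τ) x u)) (Ici (-h)) := fun x hx =>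
    L.continuous.comp_continuousOn (continuousOn_glue hx.2.1 hle hY hx.1)
  have heq : ∀ x : ℝ → X, EqOn (fun u => L (glue Y t₀ (t₀ + τ) x u)) (fun u => L (Y u))
      (Icc (-h) t₀) := fun x u hu => by simp only [glue_of_le hu.2]
  -- A continuation is frozen beyond `t₀ + τ`, so the Lipschitz condition on the fixed interval of
  -- length `τ₁` applies to every shorter one with the same constants.
  have hmin : ∀ u ∈ Icc t₀ (t₀ + τ₁), min u (t₀ + τ) ∈ Icc t₀ (t₀ + τ) := fun u hu =>
    ⟨le_min hu.1 hle, min_le_right _ _⟩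
  have hclose : ∀ x ∈ tube t₀ (t₀ + τ) (Y t₀) (δ / (‖L‖ + 1)), ∀ u ∈ Icc t₀ (t₀ + τ₁),
      ‖L (glue Y t₀ (t₀ + τ) x u) - L (Y t₀)‖ < δ := by
    intro x hx u hu
    rw [glue_of_ge hx.2.1 hle hu.1, ← map_sub]
    have h1 := hx.2.2 _ (hmin u hu)
    rw [dist_eq_norm] at h1
    calc _ ≤ ‖L‖ * ‖x (min u (t₀ + τ)) - Y t₀‖ := L.le_opNorm _
      _ ≤ ‖L‖ * (δ / (‖L‖ + 1)) := by gcongr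
      _ < δ := by
        rw [← mul_div_assoc, div_lt_iff₀ (by positivity)]
        nlinarith [norm_nonneg L]
  have := hlip _ _ (hcont x hx) (hcont x' hx') (heq x) (heq x') (hclose x hx) (hclose x' hx')
    (‖L‖ * m) fun u hu => ?_
  · filter_upwards [this] with u hu
    rwa [mul_assoc]
  · rw [glue_of_ge hx.2.1 hle hu.1, glue_of_ge hx'.2.1 hle hu.1, ← map_sub]
    exact (L.le_opNorm _).trans (by gcongr; exact hm _ (hmin u hu))

lemma tube_mono {X : Type*} [PseudoMetricSpace X] {a b : ℝ} {x₀ : X} {δ δ' : ℝ} (h : δ ≤ δ') :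
    tube a b x₀ δ ⊆ tube a b x₀ δ' := fun _ hx => ⟨hx.1, hx.2.1, fun t ht => (hx.2.2 t ht).trans h⟩

/-- The estimate is asked only for the countably many moduli `1 / (m + 1)`, so that for an operator
with values given almost everywhere it holds off a single null set. -/
lemma tendsto_of_uniform_bound {X : Type*} [NormedAddCommGroup X] {A : Set ℝ} {xs : ℕ → ℝ → X} {x : ℝ → X}
    (hu : TendstoUniformlyOn xs x atTop A) {f : ℕ → F} {g : F} {c : ℝ}
    (hb : ∀ n m : ℕ, (∀ u ∈ A, ‖xs n u - x u‖ ≤ 1 / ((m : ℝ) + 1)) →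
      ‖f n - g‖ ≤ c * (1 / ((m : ℝ) + 1))) : Tendsto f atTop (𝓝 g) := by
  rw [Metric.tendsto_atTop']
  intro ε hε
  have h1 : Tendsto (fun m : ℕ => c * (1 / ((m : ℝ) + 1))) atTop (𝓝 0) := by
    simpa using tendsto_one_div_add_atTop_nhds_zero_nat.const_mul c
  obtain ⟨m, hm⟩ := (h1.eventually (gt_mem_nhds hε)).exists
  rw [Metric.tendstoUniformlyOn_iff] at hu
  obtain ⟨N, hN⟩ := eventually_atTop.1 (hu (1 / ((m : ℝ) + 1)) Nat.one_div_pos_of_nat)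
  refine ⟨N, fun n hn => ?_⟩
  rw [dist_eq_norm]
  refine (hb n m fun u hu => ?_).trans_lt hm
  rw [← dist_eq_norm, dist_comm]
  exact (hN n hn.le u hu).le

end Operators

/-! ### Uniform estimates for short continuations -/

section States

variable {q p s k : ℕ} {r : Fin q → ℕ} {S : System r p s k} {C : Controller q p} {α : ℝ}
  {D : InitialData q p} {Y : ℝ → StateSpace r p} {t₀ : ℝ} {hr : ∀ i, 0 < r i}

/-- The output of a continuation. -/
noncomputable def glueOut (hr : ∀ i, 0 < r i) (Y : ℝ → StateSpace r p) (t₀ t₁ : ℝ)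
    (x : ℝ → StateSpace r p) (u : ℝ) : OutputSpace q p := outOf hr (glue Y t₀ t₁ x u)

/-- Estimates for the continuations of a solution on `[-h, t₀]` to short intervals. -/
structure ContinuationBounds (hr : ∀ i, 0 < r i) (S : System r p s k) (C : Controller q p)
    (Y : ℝ → StateSpace r p) (t₀ δ τ₀ B M c : ℝ) (K : NNReal) : Prop where
  δ_pos : 0 < δ
  τ_pos : 0 < τ₀
  B_nonneg : 0 ≤ B
  nonneg : 0 ≤ t₀
  cont : ContinuousOn Y (Icc (-S.h) t₀)
  safe : ∀ t ∈ Icc t₀ (t₀ + τ₀), ∀ v, dist v (Y t₀) ≤ δ → (t, v) ∈ safe r p C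
  vel : ∀ τ, 0 < τ → τ ≤ τ₀ → ∀ x ∈ tube t₀ (t₀ + τ) (Y t₀) δ, ∀ᵐ u, u ∈ Icc t₀ (t₀ + τ) →
    ‖vel S C (glue Y t₀ (t₀ + τ) x) u‖ ≤ B
  T₂ : ∀ τ, 0 < τ → τ ≤ τ₀ → ∀ x ∈ tube t₀ (t₀ + τ) (Y t₀) δ,
    LipschitzOnWith K (S.T₂ (glueOut hr Y t₀ (t₀ + τ) x)) (Ici 0) ∧
    ∀ t, 0 ≤ t → ‖S.T₂ (glueOut hr Y t₀ (t₀ + τ) x) t‖ ≤ M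
  lip₁ : ∀ τ, 0 < τ → τ ≤ τ₀ → ∀ x ∈ tube t₀ (t₀ + τ) (Y t₀) δ,
    ∀ x' ∈ tube t₀ (t₀ + τ) (Y t₀) δ, ∀ m, (∀ u ∈ Icc t₀ (t₀ + τ), ‖x u - x' u‖ ≤ m) →
    ∀ᵐ u, u ∈ Icc t₀ (t₀ + τ) →
      ‖S.T₁ (glue Y t₀ (t₀ + τ) x) u - S.T₁ (glue Y t₀ (t₀ + τ) x') u‖ ≤ c * m
  lip₂ : ∀ τ, 0 < τ → τ ≤ τ₀ → ∀ x ∈ tube t₀ (t₀ + τ) (Y t₀) δ,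
    ∀ x' ∈ tube t₀ (t₀ + τ) (Y t₀) δ, ∀ m, (∀ u ∈ Icc t₀ (t₀ + τ), ‖x u - x' u‖ ≤ m) →
    ∀ u ∈ Icc t₀ (t₀ + τ),
      ‖S.T₂ (glueOut hr Y t₀ (t₀ + τ) x) u - S.T₂ (glueOut hr Y t₀ (t₀ + τ) x') u‖ ≤ c * m

lemma Feasible.exists_safe_tube (H : Feasible S C α) {v₀ : StateSpace r p}
    (h : (t₀, v₀) ∈ safe r p C) :
    ∃ δ > 0, ∀ t ∈ Icc t₀ (t₀ + δ), ∀ v, dist v v₀ ≤ δ → (t, v) ∈ safe r p C := by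
  have ht₀ : 0 ≤ t₀ := h.1.1.1
  obtain ⟨ε, hε, hsub⟩ := Metric.mem_nhdsWithin_iff.1 (H.safe_mem_nhdsWithin h)
  refine ⟨ε / 2, by positivity, fun t ht v hv => hsub ⟨?_, ht₀.trans ht.1⟩⟩
  rw [Metric.mem_ball, Prod.dist_eq, max_lt_iff]
  refine ⟨?_, lt_of_le_of_lt hv (by linarith)⟩
  rw [Real.dist_eq, abs_of_nonneg (by linarith [ht.1])]
  linarith [ht.2]

/-- All continuations in the tube share the bound `N + δ'` on `[-h, ∞)`, so the velocity and `T₂`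
are bounded with common constants. The remaining estimates are the local Lipschitz conditions of
`T₁` and `T₂` at the history `Y`. -/
lemma PartialSol.exists_continuationBounds (h : PartialSol hr S C D t₀ Y) (H : Feasible S C α) :
    ∃ δ τ₀ B M c K, ContinuationBounds hr S C Y t₀ δ τ₀ B M c K := by
  have ht₀ := h.nonneg
  obtain ⟨δ, hδ, hsafe⟩ := H.exists_safe_tube (h.safe t₀ ⟨ht₀, le_rfl⟩)
  obtain ⟨τ₁, hτ₁, δ₁, hδ₁, c₁, hc₁, hl₁⟩ := H.sys.T₁_mem.exists_glue_lipschitz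
    (ContinuousLinearMap.id ℝ _) ht₀ h.cont
  obtain ⟨τ₂, hτ₂, δ₂, hδ₂, c₂, hc₂, hl₂⟩ := H.sys.T₂_mem.opClass.exists_glue_lipschitz
    (outOf hr) ht₀ h.cont
  set δ' := min δ (min δ₁ δ₂) with hδ'
  have hδ'0 : 0 < δ' := by positivity
  set τ' := min δ (min τ₁ τ₂) with hτ'
  have hτ'0 : 0 < τ' := by positivity
  obtain ⟨N, hN⟩ := isCompact_Icc.exists_bound_of_continuousOn h.cont
  have hN0 : 0 ≤ N := (norm_nonneg _).trans (hN t₀ ⟨H.neg_h_le ht₀, le_rfl⟩)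
  have hglue : ∀ τ, 0 < τ → ∀ x ∈ tube t₀ (t₀ + τ) (Y t₀) δ',
      ContinuousOn (glue Y t₀ (t₀ + τ) x) (Ici (-S.h)) := fun τ hτ x hx =>
    continuousOn_glue hx.2.1 (by linarith) h.cont hx.1
  have hbound : ∀ τ, 0 < τ → ∀ x ∈ tube t₀ (t₀ + τ) (Y t₀) δ', ∀ u ∈ Ici (-S.h),
      ‖glue Y t₀ (t₀ + τ) x u‖ ≤ N + δ' := by
    intro τ hτ x hx u hu
    rcases le_total u t₀ with hu' | hu'
    · rw [glue_of_le hu']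
      exact (hN u ⟨hu, hu'⟩).trans (by linarith)
    · rw [glue_of_ge hx.2.1 (by linarith) hu']
      have h1 := hx.2.2 (min u (t₀ + τ)) ⟨le_min hu' (by linarith), min_le_right _ _⟩
      rw [dist_eq_norm] at h1
      have h2 := hN t₀ ⟨H.neg_h_le ht₀, le_rfl⟩
      calc _ = ‖x (min u (t₀ + τ)) - Y t₀ + Y t₀‖ := by rw [sub_add_cancel]
        _ ≤ δ' + N := (norm_add_le _ _).trans (add_le_add h1 h2)
        _ = N + δ' := add_comm _ _
  have hAs : Icc t₀ (t₀ + τ') ×ˢ Metric.closedBall (Y t₀) δ' ⊆ safeI r p C := by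
    rintro ⟨t, v⟩ ⟨ht, hv⟩
    exact (hsafe t ⟨ht.1, ht.2.trans (by gcongr; exact min_le_left _ _)⟩ v
      ((Metric.mem_closedBall.1 hv).trans (min_le_left _ _))).1
  obtain ⟨B, hB0, hB⟩ := H.exists_vel_bound
    (isCompact_Icc.prod (isCompact_closedBall (Y t₀) δ')) hAs (N + δ')
  obtain ⟨K, M, hKM⟩ := H.sys.T₂_mem.exists_lipschitz
    (c₁ := (‖(outOf hr : StateSpace r p →L[ℝ] _)‖ + 1) * (N + δ')) (by positivity)
  have hout : ∀ τ, 0 < τ → ∀ x ∈ tube t₀ (t₀ + τ) (Y t₀) δ',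
      ContinuousOn (glueOut hr Y t₀ (t₀ + τ) x) (Ici (-S.h)) := fun τ hτ x hx =>
    continuousOn_outOf hr (hglue τ hτ x hx)
  refine ⟨δ', τ', B, M, max c₁ c₂, K, hδ'0, hτ'0, hB0, ht₀, h.cont, fun t ht v hv =>
    hsafe t ⟨ht.1, ht.2.trans (by gcongr; exact min_le_left _ _)⟩ v (hv.trans (min_le_left _ _)),
    fun τ hτ hτ' x hx => ?_, fun τ hτ _ x hx => ?_, fun τ hτ hττ x hx x' hx' m hm => ?_,
    fun τ hτ hττ x hx x' hx' m hm => ?_⟩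
  · filter_upwards [hB _ (hglue τ hτ x hx) (hbound τ hτ x hx)] with u hu hu'
    refine hu ⟨⟨hu'.1, hu'.2.trans (by linarith)⟩, ?_⟩
    simp only [glue_of_mem hx.2.1 hu']
    exact hx.2.2 u hu'
  · refine hKM _ (hout τ hτ x hx) (fun u hu => ?_) H.sys.h_nonneg
    refine ((outOf hr).le_opNorm _).trans ?_
    gcongr
    · linarith
    · exact hbound τ hτ x hx u hu
  · have hm0 : 0 ≤ m := (norm_nonneg _).trans (hm t₀ ⟨le_rfl, by linarith⟩)
    have hmin : τ' ≤ τ₁ := (min_le_right _ _).trans (min_le_left _ _)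
    have := hl₁ τ hτ (hττ.trans hmin) x
      (tube_mono ((min_le_right _ _).trans (min_le_left _ _)) hx) x'
      (tube_mono ((min_le_right _ _).trans (min_le_left _ _)) hx') m hm
    rw [ae_restrict_iff' measurableSet_Icc] at this
    filter_upwards [this] with u hu hu'
    exact (hu ⟨hu'.1, hu'.2.trans (by linarith)⟩).trans (by gcongr; exact le_max_left _ _)
  · have hm0 : 0 ≤ m := (norm_nonneg _).trans (hm t₀ ⟨le_rfl, by linarith⟩)
    have hmin : τ' ≤ τ₂ := (min_le_right _ _).trans (min_le_right _ _)
    have := hl₂ τ hτ (hττ.trans hmin) x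
      (tube_mono ((min_le_right _ _).trans (min_le_right _ _)) hx) x'
      (tube_mono ((min_le_right _ _).trans (min_le_right _ _)) hx') m hm
    intro u hu
    refine (H.sys.T₂_mem.norm_sub_le ht₀ hτ₂ (hout τ hτ x hx) (hout τ hτ x' hx') this u
      ⟨hu.1, hu.2.trans (by linarith)⟩).trans ?_
    gcongr
    exact le_max_right _ _

/-! ### The fixed point operator -/

/-- The state obtained by integration of the velocity along a continuation. -/
noncomputable def accum (S : System r p s k) (C : Controller q p) (Y : ℝ → StateSpace r p)
    (t₀ t₁ : ℝ) (x : ℝ → StateSpace r p) (t : ℝ) : StateSpace r p :=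
  Y t₀ + ∫ u in t₀..t, vel S C (glue Y t₀ t₁ x) u

/-- Time, integrated state and value of the operator `T₂` along a continuation. -/
noncomputable def accumArg (hr : ∀ i, 0 < r i) (S : System r p s k) (C : Controller q p)
    (Y : ℝ → StateSpace r p) (t₀ t₁ : ℝ) (x : ℝ → StateSpace r p) (t : ℝ) :
    (ℝ × StateSpace r p) × EuclideanSpace ℝ (Fin k) :=
  ((t, accum S C Y t₀ t₁ x t), S.T₂ (glueOut hr Y t₀ t₁ x) t)

namespace ContinuationBounds

variable {δ τ₀ B M c τ : ℝ} {K : NNReal} {x : ℝ → StateSpace r p}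

lemma continuousOn_glue (hb : ContinuationBounds hr S C Y t₀ δ τ₀ B M c K) (hτ : 0 < τ)
    (hx : x ∈ tube t₀ (t₀ + τ) (Y t₀) δ) :
    ContinuousOn (glue Y t₀ (t₀ + τ) x) (Ici (-S.h)) :=
  FunnelControl.continuousOn_glue hx.2.1 (by linarith) hb.cont hx.1

lemma safe_glue (hb : ContinuationBounds hr S C Y t₀ δ τ₀ B M c K) (hτ' : τ ≤ τ₀)
    (hx : x ∈ tube t₀ (t₀ + τ) (Y t₀) δ) :
    ∀ t ∈ Icc t₀ (t₀ + τ), (t, glue Y t₀ (t₀ + τ) x t) ∈ FunnelControl.safe r p C := by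
  intro t ht
  rw [glue_of_mem hx.2.1 ht]
  exact hb.safe t ⟨ht.1, ht.2.trans (by linarith)⟩ _ (hx.2.2 t ht)

lemma intervalIntegrable (hb : ContinuationBounds hr S C Y t₀ δ τ₀ B M c K) (H : Feasible S C α)
    (hτ : 0 < τ) (hτ' : τ ≤ τ₀) (hx : x ∈ tube t₀ (t₀ + τ) (Y t₀) δ) {a b : ℝ}
    (ha : a ∈ Icc t₀ (t₀ + τ)) (hb' : b ∈ Icc t₀ (t₀ + τ)) :
    IntervalIntegrable (FunnelControl.vel S C (glue Y t₀ (t₀ + τ) x)) volume a b :=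
  H.intervalIntegrable_vel (hb.continuousOn_glue hτ hx) hb.nonneg
    (fun t ht => (hb.safe_glue hτ' hx t ht).1) (hb.vel τ hτ hτ' x hx) ha hb'

lemma dist_accum (hb : ContinuationBounds hr S C Y t₀ δ τ₀ B M c K) (H : Feasible S C α)
    (hτ : 0 < τ) (hτ' : τ ≤ τ₀) (hx : x ∈ tube t₀ (t₀ + τ) (Y t₀) δ) {a b : ℝ}
    (ha : a ∈ Icc t₀ (t₀ + τ)) (hb' : b ∈ Icc t₀ (t₀ + τ)) :
    dist (accum S C Y t₀ (t₀ + τ) x a) (accum S C Y t₀ (t₀ + τ) x b) ≤ B * |a - b| := by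
  have h0 : t₀ ∈ Icc t₀ (t₀ + τ) := ⟨le_rfl, by linarith⟩
  rw [accum, accum, dist_add_left, dist_eq_norm, intervalIntegral.integral_interval_sub_left
    (hb.intervalIntegrable H hτ hτ' hx h0 ha) (hb.intervalIntegrable H hτ hτ' hx h0 hb')]
  refine intervalIntegral.norm_integral_le_of_norm_le_const_ae ?_
  filter_upwards [hb.vel τ hτ hτ' x hx] with u hu hu'
  exact hu (ordConnected_Icc.uIcc_subset hb' ha (uIoc_subset_uIcc hu'))

/-- Time contributes `1`, the velocity `B` and the operator `T₂` contributes `K`. The constant does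
not depend on `x`, which yields equicontinuity of the fixed point operator. -/
lemma dist_accumArg (hb : ContinuationBounds hr S C Y t₀ δ τ₀ B M c K) (H : Feasible S C α)
    (hτ : 0 < τ) (hτ' : τ ≤ τ₀) (hx : x ∈ tube t₀ (t₀ + τ) (Y t₀) δ) {a b : ℝ}
    (ha : a ∈ Icc t₀ (t₀ + τ)) (hb' : b ∈ Icc t₀ (t₀ + τ)) :
    dist (accumArg hr S C Y t₀ (t₀ + τ) x a) (accumArg hr S C Y t₀ (t₀ + τ) x b)
      ≤ (1 + B + K) * |a - b| := by
  have hB := hb.B_nonneg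
  have hab := abs_nonneg (a - b)
  have h2 := (hb.T₂ τ hτ hτ' x hx).1.dist_le_mul a (hb.nonneg.trans ha.1) b (hb.nonneg.trans hb'.1)
  rw [Real.dist_eq] at h2
  rw [Prod.dist_eq, Prod.dist_eq]
  refine max_le (max_le ?_ ?_) ?_
  · rw [accumArg, accumArg, Real.dist_eq]
    nlinarith [K.2, mul_nonneg hB hab, mul_nonneg K.2 hab]
  · refine (hb.dist_accum H hτ hτ' hx ha hb').trans ?_
    gcongr
    linarith [K.2]
  · refine h2.trans ?_
    gcongr
    linarith [K.2]

lemma accumArg_mem (hb : ContinuationBounds hr S C Y t₀ δ τ₀ B M c K) (H : Feasible S C α)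
    (hτ : 0 < τ) (hτ' : τ ≤ τ₀) (hBτ : B * τ ≤ δ) (hx : x ∈ tube t₀ (t₀ + τ) (Y t₀) δ) {t : ℝ}
    (ht : t ∈ Icc t₀ (t₀ + τ)) : accumArg hr S C Y t₀ (t₀ + τ) x t ∈
      (Icc t₀ (t₀ + τ₀) ×ˢ Metric.closedBall (Y t₀) δ) ×ˢ Metric.closedBall 0 M := by
  refine ⟨⟨⟨ht.1, ht.2.trans (by linarith)⟩, ?_⟩, ?_⟩
  · have := hb.dist_accum H hτ hτ' hx ht ⟨le_rfl, by linarith⟩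
    have h0 : accum S C Y t₀ (t₀ + τ) x t₀ = Y t₀ := by simp [accum]
    rw [h0, abs_of_nonneg (by linarith [ht.1])] at this
    refine this.trans (le_trans ?_ hBτ)
    have := hb.B_nonneg
    gcongr
    linarith [ht.2]
  · rw [mem_closedBall_zero_iff]
    exact (hb.T₂ τ hτ hτ' x hx).2 t (hb.nonneg.trans ht.1)

lemma subset_safeI (hb : ContinuationBounds hr S C Y t₀ δ τ₀ B M c K) :
    (Icc t₀ (t₀ + τ₀) ×ˢ Metric.closedBall (Y t₀) δ) ×ˢ Metric.closedBall 0 M ⊆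
      {w : (ℝ × StateSpace r p) × EuclideanSpace ℝ (Fin k) | w.1 ∈ safeI r p C} := by
  rintro ⟨⟨t, v⟩, θ⟩ ⟨⟨ht, hv⟩, -⟩
  exact (hb.safe t ht v hv).1

lemma accumArg_congr (hb : ContinuationBounds hr S C Y t₀ δ τ₀ B M c K) (H : Feasible S C α)
    (hτ : 0 < τ) (hx : x ∈ tube t₀ (t₀ + τ) (Y t₀) δ) {x' : ℝ → StateSpace r p}
    (hx' : x' ∈ tube t₀ (t₀ + τ) (Y t₀) δ) {t : ℝ} (ht : t ∈ Icc t₀ (t₀ + τ))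
    (he : EqOn x x' (Icc t₀ t)) :
    accumArg hr S C Y t₀ (t₀ + τ) x t = accumArg hr S C Y t₀ (t₀ + τ) x' t := by
  have ht0 : 0 ≤ t := hb.nonneg.trans ht.1
  have hg : EqOn (glue Y t₀ (t₀ + τ) x) (glue Y t₀ (t₀ + τ) x') (Icc (-S.h) t) :=
    (glue_eqOn_of_eqOn hx.2.1 hx'.2.1 ht he).mono fun u hu => hu.2
  have h1 : accum S C Y t₀ (t₀ + τ) x t = accum S C Y t₀ (t₀ + τ) x' t := by
    rw [accum, accum]
    congr 1
    refine intervalIntegral.integral_congr_ae ?_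
    filter_upwards [H.rhs_ae_eq (hb.continuousOn_glue hτ hx) (hb.continuousOn_glue hτ hx') ht0 hg]
      with u hu hu'
    rw [uIoc_of_le ht.1] at hu'
    have hu0 : 0 ≤ u := hb.nonneg.trans hu'.1.le
    rw [FunnelControl.vel, FunnelControl.vel, hu ⟨hu0, hu'.2⟩, hg ⟨H.neg_h_le hu0, hu'.2⟩]
  have h2 : S.T₂ (glueOut hr Y t₀ (t₀ + τ) x) t = S.T₂ (glueOut hr Y t₀ (t₀ + τ) x') t :=
    H.T₂_eqOn (hb.continuousOn_glue hτ hx) (hb.continuousOn_glue hτ hx') ht0 hg ⟨ht0, le_rfl⟩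
  rw [accumArg, accumArg, h1, h2]

/-- Off one null set the values of `T₁` converge, by its Lipschitz estimate, and with them the
velocities. These are dominated by the constant `B`, so the integrals converge. -/
lemma tendsto_accumArg (hb : ContinuationBounds hr S C Y t₀ δ τ₀ B M c K) (H : Feasible S C α)
    (hτ : 0 < τ) (hτ' : τ ≤ τ₀) {xs : ℕ → ℝ → StateSpace r p}
    (hxs : ∀ n, xs n ∈ tube t₀ (t₀ + τ) (Y t₀) δ) (hx : x ∈ tube t₀ (t₀ + τ) (Y t₀) δ)
    (hu : TendstoUniformlyOn xs x atTop (Icc t₀ (t₀ + τ))) {t : ℝ} (ht : t ∈ Icc t₀ (t₀ + τ)) :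
    Tendsto (fun n => accumArg hr S C Y t₀ (t₀ + τ) (xs n) t) atTop
      (𝓝 (accumArg hr S C Y t₀ (t₀ + τ) x t)) := by
  have h1 : ∀ᵐ u, ∀ n m : ℕ, (∀ u ∈ Icc t₀ (t₀ + τ), ‖xs n u - x u‖ ≤ 1 / ((m : ℝ) + 1)) →
      u ∈ Icc t₀ (t₀ + τ) → ‖S.T₁ (glue Y t₀ (t₀ + τ) (xs n)) u
        - S.T₁ (glue Y t₀ (t₀ + τ) x) u‖ ≤ c * (1 / ((m : ℝ) + 1)) := by
    refine ae_all_iff.2 fun n => ae_all_iff.2 fun m => ?_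
    by_cases h : ∀ u ∈ Icc t₀ (t₀ + τ), ‖xs n u - x u‖ ≤ 1 / ((m : ℝ) + 1)
    · filter_upwards [hb.lip₁ τ hτ hτ' _ (hxs n) _ hx _ h] with u hu _ using hu
    · exact Eventually.of_forall fun u h' => absurd h' h
  have h2 : ∀ᵐ u, u ∈ Icc t₀ (t₀ + τ) →
      Tendsto (fun n => FunnelControl.vel S C (glue Y t₀ (t₀ + τ) (xs n)) u) atTop
        (𝓝 (FunnelControl.vel S C (glue Y t₀ (t₀ + τ) x) u)) := by
    filter_upwards [h1] with u hu1 hu2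
    have hT : Tendsto (fun n => S.T₁ (glue Y t₀ (t₀ + τ) (xs n)) u) atTop
        (𝓝 (S.T₁ (glue Y t₀ (t₀ + τ) x) u)) :=
      tendsto_of_uniform_bound hu fun n m h => hu1 n m h hu2
    have hg : Tendsto (fun n => glue Y t₀ (t₀ + τ) (xs n) u) atTop
        (𝓝 (glue Y t₀ (t₀ + τ) x u)) := by
      simp only [glue_of_mem (hxs _).2.1 hu2, glue_of_mem hx.2.1 hu2]
      exact hu.tendsto_at hu2
    have hI : Tendsto (fun n => stInputI C (u, glue Y t₀ (t₀ + τ) (xs n) u)) atTop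
        (𝓝 (stInputI C (u, glue Y t₀ (t₀ + τ) x u))) := by
      refine (H.continuousOn_stInputI _ (hb.safe_glue hτ' hx u hu2).1).tendsto.comp
        (tendsto_nhdsWithin_iff.2 ⟨tendsto_const_nhds.prodMk_nhds hg,
          Eventually.of_forall fun n => (hb.safe_glue hτ' (hxs n) u hu2).1⟩)
    have hM : Continuous (fun w : (CoeffSpace s k) × EuclideanSpace ℝ (Fin q) =>
        (WithLp.toLp 2 (S.ΓI w.1 *ᵥ ⇑w.2) : EuclideanSpace ℝ (Fin q))) := by
      rw [← continuousOn_univ]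
      exact Feasible.continuousOn_mulVec (H.sys.ΓI_cont.comp continuous_fst).continuousOn
        continuous_snd.continuousOn
    have hR : Tendsto (fun n => rhs S C (glue Y t₀ (t₀ + τ) (xs n)) u) atTop
        (𝓝 (rhs S C (glue Y t₀ (t₀ + τ) x) u)) :=
      ((H.sys.f₁_cont.tendsto _).comp (tendsto_const_nhds.prodMk_nhds hT)).add
        ((hM.tendsto _).comp ((tendsto_const_nhds.prodMk_nhds hT).prodMk_nhds hI))
    exact (((shiftMap r p).continuous.tendsto _).comp hg).add
      (((topMap r p).continuous.tendsto _).comp hR)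
  have hle : t₀ ≤ t₀ + τ := by linarith
  have h3 : Tendsto (fun n => accum S C Y t₀ (t₀ + τ) (xs n) t) atTop
      (𝓝 (accum S C Y t₀ (t₀ + τ) x t)) := by
    refine tendsto_const_nhds.add ?_
    refine intervalIntegral.tendsto_integral_filter_of_dominated_convergence (fun _ => B) ?_ ?_
      intervalIntegrable_const ?_
    · refine Eventually.of_forall fun n => ?_
      have := (hb.intervalIntegrable H hτ hτ' (hxs n) ⟨le_rfl, hle⟩ ht).aestronglyMeasurable_restrict_uIoc
      exact this
    · refine Eventually.of_forall fun n => ?_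
      filter_upwards [hb.vel τ hτ hτ' _ (hxs n)] with u hu hu'
      rw [uIoc_of_le ht.1] at hu'
      exact hu ⟨hu'.1.le, hu'.2.trans ht.2⟩
    · filter_upwards [h2] with u hu hu'
      rw [uIoc_of_le ht.1] at hu'
      exact hu ⟨hu'.1.le, hu'.2.trans ht.2⟩
  have h4 : Tendsto (fun n => S.T₂ (glueOut hr Y t₀ (t₀ + τ) (xs n)) t) atTop
      (𝓝 (S.T₂ (glueOut hr Y t₀ (t₀ + τ) x) t)) :=
    tendsto_of_uniform_bound hu fun n m h => hb.lip₂ τ hτ hτ' _ (hxs n) _ hx _ h t ht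
  exact (tendsto_const_nhds.prodMk_nhds h3).prodMk_nhds h4

end ContinuationBounds

end States


/-! ### Fixed points and continuation of solutions -/

section States

variable {q p s k : ℕ} {r : Fin q → ℕ} {S : System r p s k} {C : Controller q p} {α : ℝ}
  {D : InitialData q p} {Y : ℝ → StateSpace r p} {t₀ : ℝ} {hr : ∀ i, 0 < r i}

lemma IntervalIntegrable.apply_euclidean {ι : Type*} [Fintype ι] {f : ℝ → EuclideanSpace ℝ ι}
    {a b : ℝ} (i : ι) (hf : IntervalIntegrable f volume a b) :
    IntervalIntegrable (fun u => f u i) volume a b :=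
  ⟨(EuclideanSpace.proj (𝕜 := ℝ) i).integrable_comp hf.1,
    (EuclideanSpace.proj (𝕜 := ℝ) i).integrable_comp hf.2⟩

lemma algState_inl (S : System r p s k) (C : Controller q p)
    (w : (ℝ × StateSpace r p) × EuclideanSpace ℝ (Fin k)) (ij : Σ i, Fin (r i)) :
    algState S C w (Sum.inl ij) = w.1.2 (Sum.inl ij) := rfl

/-- On a short interval there is a continuation which is a fixed point. -/
lemma PartialSol.exists_fixedPoint (h : PartialSol hr S C D t₀ Y) (H : Feasible S C α)
    {δ τ₀ B M c : ℝ} {K : NNReal} (hb : ContinuationBounds hr S C Y t₀ δ τ₀ B M c K) :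
    ∃ τ, 0 < τ ∧ τ ≤ τ₀ ∧ ∃ x ∈ tube t₀ (t₀ + τ) (Y t₀) δ,
      EqOn x (fun t => algState S C (accumArg hr S C Y t₀ (t₀ + τ) x t)) (Icc t₀ (t₀ + τ)) := by
  have ht₀ := h.nonneg
  set θ₀ := S.T₂ (fun u => outOf hr (stopAt t₀ Y u)) t₀ with hθ₀
  have hw₀ : ((t₀, Y t₀), θ₀) ∈ {w : (ℝ × StateSpace r p) × EuclideanSpace ℝ (Fin k) |
      w.1 ∈ safeI r p C} := (h.safe t₀ ⟨ht₀, le_rfl⟩).1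
  have hΦ₀ : algState S C ((t₀, Y t₀), θ₀) = Y t₀ := (h.eq_algState H ⟨ht₀, le_rfl⟩).symm
  -- As `Y t₀` solves the algebraic equation, `algState` returns `Y t₀` at the initial argument. Its
  -- continuity there keeps the values of the operator within `δ`.
  obtain ⟨η, hη, hmod⟩ := Metric.continuousOn_iff.1 H.continuousOn_algState _ hw₀ δ hb.δ_pos
  have hL : 0 < 1 + B + (K : ℝ) := by have := hb.B_nonneg; have := K.2; positivity
  -- The three bounds keep the estimates valid, the integrated state within `δ` of `Y t₀`, and the
  -- argument of `algState` within `η` of its initial value.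
  set τ := min τ₀ (min (δ / (B + 1)) (η / (2 * (1 + B + K)))) with hτdef
  have hB := hb.B_nonneg
  have hτ : 0 < τ := by
    have := hb.τ_pos; have := hb.δ_pos
    positivity
  have hτ' : τ ≤ τ₀ := min_le_left _ _
  have hBτ : B * τ ≤ δ := by
    have h1 : τ ≤ δ / (B + 1) := (min_le_right _ _).trans (min_le_left _ _)
    rw [le_div_iff₀ (by positivity)] at h1
    nlinarith
  have hτη : (1 + B + K) * τ < η := by
    have h1 : τ ≤ η / (2 * (1 + B + K)) := (min_le_right _ _).trans (min_le_right _ _)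
    rw [le_div_iff₀ (by positivity)] at h1
    nlinarith
  have hle : t₀ ≤ t₀ + τ := by linarith
  have hinit : ∀ x ∈ tube t₀ (t₀ + τ) (Y t₀) δ,
      accumArg hr S C Y t₀ (t₀ + τ) x t₀ = ((t₀, Y t₀), θ₀) := by
    intro x hx
    have h1 : accum S C Y t₀ (t₀ + τ) x t₀ = Y t₀ := by simp [accum]
    have h2 : S.T₂ (glueOut hr Y t₀ (t₀ + τ) x) t₀ = θ₀ :=
      H.T₂_eqOn (hb.continuousOn_glue hτ hx) (h.continuousOn_stopped H) ht₀
        (fun u hu => by rw [glue_of_le hu.2, stopAt_of_le hu.2]) ⟨ht₀, le_rfl⟩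
    rw [accumArg, h1, h2]
  have hmem : ∀ x ∈ tube t₀ (t₀ + τ) (Y t₀) δ, ∀ t ∈ Icc t₀ (t₀ + τ),
      accumArg hr S C Y t₀ (t₀ + τ) x t ∈
        (Icc t₀ (t₀ + τ₀) ×ˢ Metric.closedBall (Y t₀) δ) ×ˢ Metric.closedBall 0 M :=
    fun x hx t ht => hb.accumArg_mem H hτ hτ' hBτ hx ht
  have hlip : ∀ x ∈ tube t₀ (t₀ + τ) (Y t₀) δ, ∀ a ∈ Icc t₀ (t₀ + τ), ∀ b ∈ Icc t₀ (t₀ + τ),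
      dist (accumArg hr S C Y t₀ (t₀ + τ) x a) (accumArg hr S C Y t₀ (t₀ + τ) x b)
        ≤ (1 + B + K) * |a - b| := fun x hx a ha b hb' => hb.dist_accumArg H hτ hτ' hx ha hb'
  have hcompact : IsCompact ((Icc t₀ (t₀ + τ₀) ×ˢ Metric.closedBall (Y t₀) δ) ×ˢ
      Metric.closedBall (0 : EuclideanSpace ℝ (Fin k)) M) :=
    (isCompact_Icc.prod (isCompact_closedBall _ _)).prod (isCompact_closedBall _ _)
  have hunif := hcompact.uniformContinuousOn_of_continuous
    (H.continuousOn_algState.mono hb.subset_safeI)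
  rw [Metric.uniformContinuousOn_iff] at hunif
  refine ⟨τ, hτ, hτ', exists_fixedPoint_of_causal (by linarith) hb.δ_pos.le _ ?_ ?_ ?_ ?_⟩
  · intro x hx
    refine ⟨?_, ?_, fun t ht => ?_⟩
    · refine H.continuousOn_algState.comp (f := accumArg hr S C Y t₀ (t₀ + τ) x) ?_
        fun t ht => hb.subset_safeI (hmem x hx t ht)
      refine LipschitzOnWith.continuousOn (K := ⟨1 + B + K, hL.le⟩)
        (LipschitzOnWith.of_dist_le_mul fun a ha b hb' => ?_)
      rw [Real.dist_eq]
      exact hlip x hx a ha b hb'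
    · simp only [hinit x hx, hΦ₀]
    · rw [← hΦ₀, ← hinit x hx]
      refine le_of_lt ?_
      have h1 := hmod _ (hb.subset_safeI (hmem x hx t ht))
      rw [hinit x hx]
      refine h1 ?_
      rw [← hinit x hx]
      refine (hlip x hx t ht t₀ ⟨le_rfl, hle⟩).trans_lt (lt_of_le_of_lt ?_ hτη)
      gcongr
      rw [abs_of_nonneg (by linarith [ht.1])]
      linarith [ht.2]
  -- Equicontinuity: the arguments are uniformly Lipschitz in time and range in a compact set, on
  -- which `algState` is uniformly continuous.
  · intro ε hε
    obtain ⟨η', hη', hmod'⟩ := hunif ε hε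
    refine ⟨η' / (1 + B + K), by positivity, fun x hx a ha b hb' hab => ?_⟩
    refine hmod' _ (hmem x hx a ha) _ (hmem x hx b hb') ?_
    refine (hlip x hx a ha b hb').trans_lt ?_
    rwa [lt_div_iff₀ hL, mul_comm] at hab
  · intro x hx x' hx' t ht he
    rw [hb.accumArg_congr H hτ hx hx' ht he]
  · intro xs x hxs hx hu t ht
    refine (H.continuousOn_algState _ (hb.subset_safeI (hmem x hx t ht))).tendsto.comp
      (tendsto_nhdsWithin_iff.2 ⟨hb.tendsto_accumArg H hτ hτ' hxs hx hu ht,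
        Eventually.of_forall fun n => hb.subset_safeI (hmem _ (hxs n) t ht)⟩)

/-- Solutions on compact intervals can be continued. -/
theorem PartialSol.exists_continuation (h : PartialSol hr S C D t₀ Y) (H : Feasible S C α) :
    ∃ t₁ > t₀, ∃ Y', PartialSol hr S C D t₁ Y' ∧ EqOn Y' Y (Icc (-S.h) t₀) := by
  obtain ⟨δ, τ₀, B, M, c, K, hb⟩ := h.exists_continuationBounds H
  obtain ⟨τ, hτ, hτ', x, hx, hfix⟩ := h.exists_fixedPoint H hb
  have ht₀ := h.nonneg
  have hle : t₀ ≤ t₀ + τ := by linarith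
  set t₁ := t₀ + τ with ht₁
  set ζ := glue Y t₀ t₁ x with hζdef
  have hζ : ContinuousOn ζ (Ici (-S.h)) := hb.continuousOn_glue hτ hx
  have heY : EqOn ζ Y (Icc (-S.h) t₀) := fun u hu => glue_of_le hu.2
  have hex : ∀ t ∈ Icc t₀ t₁, ζ t = x t := fun t ht => glue_of_mem hx.2.1 ht
  have hacc : ∀ t ∈ Icc t₀ t₁, ∀ ij, ζ t (Sum.inl ij) =
      Y t₀ (Sum.inl ij) + ∫ u in t₀..t, FunnelControl.vel S C ζ u (Sum.inl ij) := by
    intro t ht ij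
    rw [hex t ht, hfix ht, algState_inl, ← intervalIntegral_euclidean_apply
      (hb.intervalIntegrable H hτ hτ' hx ⟨le_rfl, hle⟩ ht)]
    rfl
  have hsafe : ∀ t ∈ Icc 0 t₁, (t, ζ t) ∈ FunnelControl.safe r p C := by
    intro t ht
    rcases le_total t t₀ with h' | h'
    · rw [heY ⟨H.neg_h_le ht.1, h'⟩]; exact h.safe t ⟨ht.1, h'⟩
    · exact hb.safe_glue hτ' hx t ⟨h', ht.2⟩
  refine ⟨t₁, by linarith, ζ, ?_, heY⟩
  have hII := fun {a c : ℝ} (ha : a ∈ Icc 0 t₁) (hc : c ∈ Icc 0 t₁) =>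
    H.intervalIntegrable_rhs hζ (fun t ht => (hsafe t ht).1) ha hc
  refine PartialSol.of_extension H (ζ := ζ) (ht₀.trans hle) hζ (fun _ _ => rfl)
    (fun u hu => (heY ⟨hu.1, hu.2.trans ht₀⟩).trans (h.init hu)) (fun i j hj => ?_) hsafe
    (fun i j hj t ht => ?_) (fun t ht => ?_)
  · refine hasDerivWithinAt_Icc_concat (b := t₀) (fun t ht => ?_) (fun t ht => ?_)
    · rw [heY ht]
      exact (h.chain i j hj t ht).congr (fun u hu => by rw [heY hu]) (by rw [heY ht])
    · have hv : ∀ u, FunnelControl.vel S C ζ u (Sum.inl ⟨i, ⟨j, by omega⟩⟩)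
          = ζ u (Sum.inl ⟨i, ⟨j + 1, hj⟩⟩) := by
        intro u
        rw [FunnelControl.vel, PiLp.add_apply, shiftMap_inl, topMap_inl, dif_pos hj, if_neg (by simp; omega),
          add_zero]
      refine hasDerivWithinAt_Icc_of_eq_primitive (c := Y t₀ (Sum.inl ⟨i, ⟨j, by omega⟩⟩))
        (f := fun t => ζ t (Sum.inl ⟨i, ⟨j, by omega⟩⟩))
        (k := fun t => ζ t (Sum.inl ⟨i, ⟨j + 1, hj⟩⟩)) ?_ (fun t ht => ?_) ht
      · exact (EuclideanSpace.proj (𝕜 := ℝ) _).continuous.comp_continuousOn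
          (hζ.mono fun u hu => H.neg_h_le (ht₀.trans hu.1))
      · rw [hacc t ht]
        simp only [hv]
  · rcases le_total t t₀ with h' | h'
    · rw [heY ⟨H.neg_h_le ht.1, h'⟩, heY ⟨H.neg_h_le le_rfl, ht₀⟩]
      exact h.top_of H le_rfl hζ heY i j hj t ⟨ht.1, h'⟩
    · have hv : ∀ u, FunnelControl.vel S C ζ u (Sum.inl ⟨i, j⟩) = rhs S C ζ u i := by
        intro u
        rw [FunnelControl.vel, PiLp.add_apply, shiftMap_inl, topMap_inl, dif_neg (by omega),
          if_pos hj, zero_add]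
      rw [hacc t ⟨h', ht.2⟩, h.top_of H le_rfl hζ heY i j hj t₀ ⟨ht₀, le_rfl⟩,
        heY ⟨H.neg_h_le le_rfl, ht₀⟩]
      simp only [hv]
      rw [add_assoc, intervalIntegral.integral_add_adjacent_intervals]
      · exact IntervalIntegrable.apply_euclidean i (hII ⟨le_rfl, ht₀.trans hle⟩ ⟨ht₀, hle⟩)
      · exact IntervalIntegrable.apply_euclidean i (hII ⟨ht₀, hle⟩ ht)
  · rcases le_total t t₀ with h' | h'
    · have h1 := h.alg_of H ht₀ le_rfl hζ heY t ⟨ht.1, h'⟩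
      rwa [← heY ⟨H.neg_h_le ht.1, h'⟩] at h1
    -- On the new interval the last `p` components of the fixed point are given by `algErr`. Since
    -- `algErr` ignores these components of its argument, the fixed point identity is the algebraic
    -- equation.
    · refine (H.algEq_of_eq_algErr ht.1 ?_).2
      have h1 := hfix ⟨h', ht.2⟩
      rw [← hex t ⟨h', ht.2⟩] at h1
      conv_lhs => rw [h1]
      beta_reduce
      rw [h1]
      simp only [algState, accumArg]
      rw [stErrII_withII, algErr_withII]
      rfl

end States


/-! ### The initial state -/

section States

variable {q p s k : ℕ} {r : Fin q → ℕ} {S : System r p s k} {C : Controller q p} {α : ℝ}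
  {D : InitialData q p} {Y : ℝ → StateSpace r p} {t₀ : ℝ} {hr : ∀ i, 0 < r i}

/-- A continuation of the initial state by Taylor polynomials. -/
noncomputable def InitialData.taylorState (D : InitialData q p) (r : Fin q → ℕ) (t : ℝ) :
    StateSpace r p :=
  WithLp.toLp 2 (Sum.elim (fun ij => taylorJet (r ij.1 - 1) (D.jet ij.1) 0 t ij.2)
    (fun i => D.y₀ 0 (Sum.inr i)))

lemma InitialData.taylorState_zero : D.taylorState r 0 = (D.state r : StateSpace r p) := by
  ext x
  rcases x with ⟨i, j⟩ | i
  · have hj := j.2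
    simp only [taylorState, state, Sum.elim_inl, taylorJet_self]
    rw [if_pos (by omega)]
  · rfl

lemma InitialData.history_zero (h : ℝ) : D.history r h 0 = (D.state r : StateSpace r p) := by
  ext x
  cases x <;> simp [history, state]

lemma InitialData.isJetState_taylorState : IsJetState r p ⊤ (D.taylorState r) := by
  have hd : ∀ i (j : ℕ) (hj : j < r i) (t : ℝ), HasDerivAt
      (fun t => D.taylorState r t (Sum.inl ⟨i, ⟨j, hj⟩⟩) : ℝ → ℝ)
      (taylorJet (r i - 1) (D.jet i) 0 t (j + 1)) t := fun i j hj t =>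
    hasDerivAt_taylorJet (D.jet i) 0 t (by omega)
  refine ⟨?_, fun i j hj t _ => (hd i j (by omega) t).hasDerivWithinAt⟩
  refine (PiLp.continuous_toLp 2 _).comp_continuousOn (continuousOn_pi.2 fun x => ?_)
  rcases x with ⟨i, ⟨j, hj⟩⟩ | i
  · exact fun t _ => (hd i j hj t).continuousAt.continuousWithinAt
  · exact continuousOn_const

namespace Feasible

/-- Variant of `err_eq_stErr` with the funnel conditions on the signals of the output instead of the
functions of the state; strong induction replaces one by the other. The initial conditions are given
in this form. -/
lemma err_eq_stErr_of_err (H : Feasible S C α) {ω : EReal} {Y : ℝ → StateSpace r p}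
    (hY : IsJetState r p ω Y) {y : ℝ → OutputSpace q p} {i : Fin q}
    (hy : ∀ t ∈ ivl 0 ω, y t (Sum.inl i) = Y t (Sum.inl ⟨i, ⟨0, H.sys.r_pos i⟩⟩)) {t : ℝ}
    (ht : t ∈ ivl 0 ω) : ∀ j ≤ r i - 1, (∀ l < j, C.φ i l t * |C.err y i l t| < 1) →
      C.err y i j t = stErr C i j (t, Y t) := by
  intro j
  induction j using Nat.strong_induction_on with
  | _ j ih =>
    intro hj h
    refine H.err_eq_stErr hY hy hj ht fun l hl => ?_
    rw [← ih l hl (by omega) fun l' hl' => h l' (by omega)]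
    exact h l hl

lemma errI_eq_stErrI (H : Feasible S C α) {ω : EReal} {Y : ℝ → StateSpace r p}
    (hY : IsJetState r p ω Y) {y : ℝ → OutputSpace q p}
    (hy : ∀ i, ∀ t ∈ ivl 0 ω, y t (Sum.inl i) = Y t (Sum.inl ⟨i, ⟨0, H.sys.r_pos i⟩⟩)) {t : ℝ}
    (ht : t ∈ ivl 0 ω) (h : (t, Y t) ∈ errDomain r p C) : C.errI r y t = stErrI C (t, Y t) := by
  ext i
  exact H.err_eq_stErr hY (hy i) le_rfl ht fun l hl => h.2 i l (by omega)

lemma taylor_inl (H : Feasible S C α) (i : Fin q) (t : ℝ) : D.taylor r t (Sum.inl i) =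
    (D.taylorState r t : StateSpace r p) (Sum.inl ⟨i, ⟨0, H.sys.r_pos i⟩⟩) := by
  have := H.sys.r_pos i
  simp only [InitialData.taylor, InitialData.taylorState, Sum.elim_inl, taylorJet, zero_add,
    sub_zero]
  rw [show r i - 1 + 1 = r i by omega, Nat.sub_zero]

lemma zero_mem_ivl_top : (0 : ℝ) ∈ ivl 0 ⊤ := ⟨le_rfl, EReal.coe_lt_top _⟩

lemma taylor_err (H : Feasible S C α) (hI : InitiallyInFunnel r C D) (i : Fin q) {j : ℕ}
    (hj : j ≤ r i - 1) : C.err (D.taylor r) i j 0 = stErr C i j (0, (D.state r : StateSpace r p)) := by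
  rw [← InitialData.taylorState_zero]
  exact H.err_eq_stErr_of_err InitialData.isJetState_taylorState (fun t _ => H.taylor_inl i t)
    zero_mem_ivl_top j hj fun l hl => hI.err i l (by omega)

lemma state_mem_errDomain (H : Feasible S C α) (hI : InitiallyInFunnel r C D) :
    (0, (D.state r : StateSpace r p)) ∈ errDomain r p C := by
  refine ⟨le_rfl, fun i j hj => ?_⟩
  have := hI.err i j hj
  rwa [H.taylor_err hI i (by omega)] at this

lemma taylor_errI (H : Feasible S C α) (hI : InitiallyInFunnel r C D) :
    C.errI r (D.taylor r) 0 = stErrI C (0, (D.state r : StateSpace r p)) := by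
  ext i
  exact H.taylor_err hI i le_rfl

lemma state_mem_safe (H : Feasible S C α) (hI : InitiallyInFunnel r C D) :
    (0, (D.state r : StateSpace r p)) ∈ safe r p C := by
  refine ⟨⟨H.state_mem_errDomain hI, ?_⟩, hI.errII⟩
  have := hI.errI
  rwa [H.taylor_errI hI] at this

lemma outOf_history (hr : ∀ i, 0 < r i) (hD : D.Admissible S.h r) (t : ℝ) :
    outOf hr (D.history r S.h t) = D.y₀ t := by
  ext x
  rcases x with i | i
  · simp only [outOf_inl, InitialData.history, Sum.elim_inl, iteratedDerivWithin_zero]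
    split_ifs with h
    · rw [hD.jet_eq i 0 (hr i) fun _ => rfl, iteratedDerivWithin_zero, h]
    · rfl
  · rfl

lemma history_inl (hD : D.Admissible S.h r) (i : Fin q) (j : Fin (r i))
    (hh : S.h ≠ 0 ∨ j.1 = 0) (t : ℝ) : (D.history r S.h t : StateSpace r p) (Sum.inl ⟨i, j⟩) =
      iteratedDerivWithin j (fun u => D.y₀ u (Sum.inl i)) (Icc (-S.h) 0) t := by
  simp only [InitialData.history, Sum.elim_inl]
  split_ifs with h
  · rw [hD.jet_eq i j j.2 (fun h' => hh.resolve_left (not_not.2 h')), h]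
  · rfl

/-- The initial data define a solution on `[-h, 0]`. -/
lemma partialSol_history (H : Feasible S C α) (hD : D.Admissible S.h r) (hc : Consistent S C D)
    (hI : InitiallyInFunnel r C D) (hr : ∀ i, 0 < r i) :
    PartialSol hr S C D 0 (D.history r S.h) := by
  have hd : ∀ i (j : ℕ) (hj : j + 1 < r i), S.h ≠ 0 → ∀ t ∈ Icc (-S.h) 0,
      HasDerivWithinAt (iteratedDerivWithin j (fun u => D.y₀ u (Sum.inl i)) (Icc (-S.h) 0))
        (iteratedDerivWithin (j + 1) (fun u => D.y₀ u (Sum.inl i)) (Icc (-S.h) 0) t)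
        (Icc (-S.h) 0) t := by
    intro i j hj hh t ht
    have hpos : 0 < S.h := lt_of_le_of_ne H.sys.h_nonneg hh.symm
    rw [iteratedDerivWithin_succ]
    refine ((hD.contDiffI i).differentiableOn_iteratedDerivWithin ?_
      (uniqueDiffOn_Icc (by linarith)) t ht).hasDerivWithinAt
    exact_mod_cast (show j < r i - 1 by omega)
  have hcont : ContinuousOn (D.history r S.h : ℝ → StateSpace r p) (Icc (-S.h) 0) := by
    by_cases hh : S.h = 0
    · rw [hh, neg_zero, Icc_self]; exact continuousOn_singleton _ _
    have hpos : 0 < S.h := lt_of_le_of_ne H.sys.h_nonneg (Ne.symm hh)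
    refine (PiLp.continuous_toLp 2 _).comp_continuousOn (continuousOn_pi.2 fun x => ?_)
    rcases x with ⟨i, j⟩ | i
    · refine ContinuousOn.congr (f := iteratedDerivWithin j (fun u => D.y₀ u (Sum.inl i))
        (Icc (-S.h) 0)) ?_ fun t _ => history_inl hD i j (Or.inl hh) t
      refine (hD.contDiffI i).continuousOn_iteratedDerivWithin ?_ (uniqueDiffOn_Icc (by linarith))
      have := j.2
      exact_mod_cast (show j.1 ≤ r i - 1 by omega)
    · exact hD.contII i
  have hstp := continuousOn_stopAt (H.neg_h_le le_rfl) hcont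
  have hy : ContinuousOn D.y₀ (Icc (-S.h) 0) :=
    ((outOf hr).continuous.comp_continuousOn hcont).congr fun t _ => (outOf_history hr hD t).symm
  have hzero : ∀ t ∈ Icc (0 : ℝ) 0, t = 0 := fun t ht => le_antisymm ht.2 ht.1
  refine ⟨le_rfl, hcont, fun _ _ => rfl, fun i j hj t ht => ?_, fun t ht => ?_, fun i j hj t ht => ?_,
    fun t ht => ?_⟩
  -- For `h = 0` the interval is a single point, where any value is a derivative; the prescribed jet
  -- is then independent of `y₀`.
  · by_cases hh : S.h = 0
    · have hs : Icc (-S.h) 0 = {t} := by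
        rw [hh, neg_zero, Icc_self, mem_singleton_iff] at ht
        rw [hh, neg_zero, Icc_self, ht]
      rw [hs]
      exact HasFDerivWithinAt.of_subsingleton subsingleton_singleton
    · rw [history_inl hD i ⟨j + 1, hj⟩ (Or.inl hh)]
      exact (hd i j hj hh t ht).congr (fun u _ => history_inl hD i ⟨j, by omega⟩ (Or.inl hh) u)
        (history_inl hD i ⟨j, by omega⟩ (Or.inl hh) t)
  · rw [hzero t ht, InitialData.history_zero]
    exact H.state_mem_safe hI
  · rw [hzero t ht]; simp
  · rw [hzero t ht]
    have hT : S.T₂ (fun u => outOf hr (stopAt 0 (D.history r S.h) u)) 0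
        = S.T₂ (stopAt 0 D.y₀) 0 := by
      refine H.sys.T₂_mem.eqOn H.sys.h_nonneg le_rfl (continuousOn_outOf hr hstp)
        (continuousOn_stopAt (H.neg_h_le le_rfl) hy) (fun u hu => ?_) ⟨le_rfl, le_rfl⟩
      simp only [stopAt]
      exact outOf_history hr hD _
    rw [hT, InitialData.history_zero, AlgEq]
    rw [Consistent] at hc
    have hu : C.inputI r (D.taylor r) 0 = stInputI C (0, (D.state r : StateSpace r p)) := by
      rw [Controller.inputI, Controller.gainI, H.taylor_errI hI]; rfl
    rw [hu] at hc
    exact hc.symm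

end Feasible

end States


/-! ### Real analysis for the a priori bounds -/

/-- The null sets depend on `b`, but rational `b` exhaust the interval. -/
lemma ae_ivl_of_ae_Icc {P : ℝ → Prop} {ω : EReal}
    (h : ∀ b : ℝ, 0 ≤ b → (b : EReal) < ω → ∀ᵐ s, s ∈ Icc 0 b → P s) :
    ∀ᵐ s, s ∈ ivl 0 ω → P s := by
  have h1 : ∀ᵐ s, ∀ b : ℚ, (0 : ℝ) ≤ b → (((b : ℝ)) : EReal) < ω → s ∈ Icc (0 : ℝ) b → P s := by
    refine ae_all_iff.2 fun b => ?_
    by_cases h0 : (0 : ℝ) ≤ b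
    swap
    · exact Eventually.of_forall fun s h' => absurd h' h0
    by_cases h2 : ((b : ℝ) : EReal) < ω
    · filter_upwards [h b h0 h2] with s hs _ _ using hs
    · exact Eventually.of_forall fun s _ h' => absurd h' h2
  filter_upwards [h1] with s hs hsω
  obtain ⟨b, hsb, hbω⟩ := EReal.lt_iff_exists_rat_btwn.1 hsω.2
  have hsb' : s < b := by exact_mod_cast hsb
  exact hs b (hsω.1.trans hsb'.le) hbω ⟨hsω.1, hsb'.le⟩

/-- Beyond `δ` the funnel has bounded width `1 / φ ≤ 1 / l`. Near `0` it may be infinitely wide, and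
continuity takes over. -/
lemma bounded_of_funnel {E : Type*} [NormedAddCommGroup E] {ω : EReal} (hω : 0 < ω) {n : ℕ}
    {φ : ℝ → ℝ} (hφ : FunnelFunction n φ) {e : ℝ → E} (hc : ContinuousOn e (ivl 0 ω))
    (hfun : ∀ t ∈ ivl 0 ω, φ t * ‖e t‖ < 1) : ∃ M, ∀ t ∈ ivl 0 ω, ‖e t‖ ≤ M := by
  obtain ⟨δ, hδ, hδω⟩ := EReal.exists_between_coe_real hω
  have hδ0 : 0 < δ := by exact_mod_cast hδ
  obtain ⟨l, hl0, hl⟩ := hφ.exists_lower hδ0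
  obtain ⟨M, hM⟩ := isCompact_Icc.exists_bound_of_continuousOn
    (hc.mono (Icc_subset_ivl le_rfl hδω))
  refine ⟨max M l⁻¹, fun t ht => ?_⟩
  rcases le_total t δ with h | h
  · exact (hM t ⟨ht.1, h⟩).trans (le_max_left _ _)
  · refine le_trans ?_ (le_max_right _ _)
    rw [← one_div, le_div_iff₀ hl0, mul_comm]
    exact (mul_le_mul_of_nonneg_right (hl t h) (norm_nonneg _)).trans (hfun t ht).le

lemma lipschitzOnWith_of_eq_primitive {f g : ℝ → ℝ} {a b c B : ℝ}
    (hB : ∀ᵐ u, u ∈ Icc a b → ‖g u‖ ≤ B) (hB0 : 0 ≤ B)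
    (hi : ∀ t ∈ Icc a b, IntervalIntegrable g volume a t)
    (hf : ∀ t ∈ Icc a b, f t = c + ∫ u in a..t, g u) :
    LipschitzOnWith B.toNNReal f (Icc a b) := by
  refine LipschitzOnWith.of_dist_le_mul fun s hs t ht => ?_
  rw [hf s hs, hf t ht, dist_add_left, dist_eq_norm,
    intervalIntegral.integral_interval_sub_left (hi s hs) (hi t ht), Real.coe_toNNReal _ hB0,
    Real.dist_eq]
  refine intervalIntegral.norm_integral_le_of_norm_le_const_ae ?_
  filter_upwards [hB] with u hu hu'
  exact hu (ordConnected_Icc.uIcc_subset ht hs (uIoc_subset_uIcc hu'))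

lemma lipschitzOnWith_of_hasDerivWithinAt {f f' : ℝ → ℝ} {ω : EReal}
    (hd : ∀ t ∈ ivl 0 ω, HasDerivWithinAt f (f' t) (Ici 0) t) {b B : ℝ} (hb : (b : EReal) < ω)
    (hB0 : 0 ≤ B) (hB : ∀ t ∈ Icc 0 b, ‖f' t‖ ≤ B) : LipschitzOnWith B.toNNReal f (Icc 0 b) := by
  refine (convex_Icc 0 b).lipschitzOnWith_of_nnnorm_hasDerivWithin_le (f' := f')
    (fun t ht => (hd t (Icc_subset_ivl le_rfl hb ht)).mono Icc_subset_Ici_self) fun t ht => ?_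
  rw [← NNReal.coe_le_coe, coe_nnnorm, Real.coe_toNNReal _ hB0]
  exact hB t ht

lemma ae_hasDerivAt_of_eq_primitive {f g : ℝ → ℝ} {a b c : ℝ} (hab : a ≤ b)
    (hi : IntervalIntegrable g volume a b)
    (hf : ∀ t ∈ Icc a b, f t = c + ∫ u in a..t, g u) :
    ∀ᵐ s, s ∈ Icc a b → HasDerivAt f (g s) s := by
  have h := hi.ae_hasDerivAt_integral
  have h1 : ∀ᵐ s : ℝ, s ≠ a := by simp [ae_iff, measure_singleton]
  have h2 : ∀ᵐ s : ℝ, s ≠ b := by simp [ae_iff, measure_singleton]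
  filter_upwards [h, h1, h2] with s hs hsa hsb hs'
  rw [uIcc_of_le hab] at hs
  have := (hs hs' a (left_mem_Icc.2 hab)).const_add c
  refine this.congr_of_eventuallyEq ?_
  filter_upwards [Icc_mem_nhds (lt_of_le_of_ne hs'.1 hsa.symm) (lt_of_le_of_ne hs'.2 hsb)]
    with t ht using hf t ht

lemma hasDerivAt_of_ivl {E : Type*} [NormedAddCommGroup E] [NormedSpace ℝ E] {f : ℝ → E} {f' : E}
    {t : ℝ} (ht : 0 < t) (h : HasDerivWithinAt f f' (Ici 0) t) : HasDerivAt f f' t :=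
  h.hasDerivAt (Ici_mem_nhds ht)

lemma hasDerivAt_euclidean {ι : Type*} [Fintype ι] {f : ℝ → EuclideanSpace ℝ ι}
    {f' : EuclideanSpace ℝ ι} {t : ℝ} (h : ∀ i, HasDerivAt (fun t => f t i) (f' i) t) :
    HasDerivAt f f' t := by
  have h1 : HasDerivAt (fun t i => f t i) (fun i => f' i) t := hasDerivAt_pi.2 h
  exact ((EuclideanSpace.equiv ι ℝ).symm.toContinuousLinearMap.hasFDerivAt.comp_hasDerivAt t h1)

lemma lipschitzOnWith_euclidean {ι : Type*} [Fintype ι] {f : ℝ → EuclideanSpace ℝ ι} {A : Set ℝ}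
    (h : ∀ i, ∃ K, LipschitzOnWith K (fun t => f t i) A) : ∃ K, LipschitzOnWith K f A := by
  choose K hK using h
  have h1 : LipschitzOnWith (∑ i, K i) (fun t i => f t i) A := by
    refine LipschitzOnWith.of_dist_le_mul fun s hs t ht => ?_
    refine (dist_pi_le_iff (by positivity)).2 fun i => ((hK i).dist_le_mul s hs t ht).trans ?_
    gcongr
    exact Finset.single_le_sum (f := K) (fun _ _ => zero_le) (Finset.mem_univ i)
  exact ⟨_, (EuclideanSpace.equiv ι ℝ).symm.toContinuousLinearMap.lipschitz.comp_lipschitzOnWith h1⟩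

lemma norm_le_sum_norm {ι : Type*} [Fintype ι] (v : EuclideanSpace ℝ ι) : ‖v‖ ≤ ∑ x, ‖v x‖ := by
  classical
  have h : v = ∑ x, EuclideanSpace.single x (v x) := by
    ext y
    simp [Pi.single_apply]
  calc ‖v‖ = ‖∑ x, EuclideanSpace.single x (v x)‖ := by rw [← h]
    _ ≤ _ := (norm_sum_le _ _).trans (by simp)

/-- A continuous family of matrices with positive definite symmetric parts is uniformly positive
definite on compact sets. -/
lemma exists_coercive {X : Type*} [TopologicalSpace X] {n : ℕ} {Γ : X → Matrix (Fin n) (Fin n) ℝ}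
    (hΓ : Continuous Γ) (hpos : ∀ x, (Γ x + (Γ x)ᵀ).PosDef) {A : Set X} (hA : IsCompact A) :
    ∃ γ > 0, ∀ x ∈ A, ∀ e : EuclideanSpace ℝ (Fin n),
      γ * ‖e‖ ^ 2 ≤ inner ℝ e (WithLp.toLp 2 (Γ x *ᵥ ⇑e)) := by
  have hc : Continuous fun w : X × EuclideanSpace ℝ (Fin n) =>
      inner ℝ w.2 (WithLp.toLp 2 (Γ w.1 *ᵥ ⇑w.2)) := by
    refine continuous_snd.inner ?_
    rw [← continuousOn_univ]
    exact Feasible.continuousOn_mulVec (hΓ.comp continuous_fst).continuousOn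
      continuous_snd.continuousOn
  have hq : ∀ x, ∀ e : EuclideanSpace ℝ (Fin n), e ≠ 0 →
      0 < inner ℝ e (WithLp.toLp 2 (Γ x *ᵥ ⇑e)) := by
    intro x e he
    have h0 : (⇑e : Fin n → ℝ) ≠ 0 := fun h => he (by ext i; exact congrFun h i)
    have h1 := (hpos x).dotProduct_mulVec_pos h0
    have h2 : inner ℝ e (WithLp.toLp 2 (Γ x *ᵥ ⇑e)) = ⇑e ⬝ᵥ (Γ x *ᵥ ⇑e) := by
      rw [EuclideanSpace.inner_eq_star_dotProduct]
      simp [dotProduct_comm]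
    -- A matrix and its transpose have the same quadratic form, so positivity of the sum is twice
    -- the positivity for `Γ x`.
    rw [Matrix.add_mulVec, dotProduct_add, Matrix.mulVec_transpose, dotProduct_comm _ (_ ᵥ* _),
      ← Matrix.dotProduct_mulVec] at h1
    simp only [star_trivial] at h1
    rw [h2]
    linarith
  -- By homogeneity a positive minimum over the unit sphere suffices. The product is empty if `A`
  -- is, or if `n = 0`; then any constant works.
  obtain ⟨γ, hγ0, hγ⟩ : ∃ γ > 0, ∀ w ∈ A ×ˢ Metric.sphere (0 : EuclideanSpace ℝ (Fin n)) 1,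
      γ ≤ inner ℝ w.2 (WithLp.toLp 2 (Γ w.1 *ᵥ ⇑w.2)) := by
    rcases (A ×ˢ Metric.sphere (0 : EuclideanSpace ℝ (Fin n)) 1).eq_empty_or_nonempty with h | h
    · exact ⟨1, one_pos, by simp [h]⟩
    · obtain ⟨w, hw, hmin⟩ := (hA.prod (isCompact_sphere _ _)).exists_isMinOn h hc.continuousOn
      refine ⟨_, hq w.1 w.2 ?_, fun w' hw' => hmin hw'⟩
      rintro h0
      have := hw.2
      rw [h0] at this
      simp at this
  refine ⟨γ, hγ0, fun x hx e => ?_⟩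
  rcases eq_or_ne e 0 with rfl | he
  · simp
  have hne := norm_ne_zero_iff.2 he
  have h1 := hγ (x, ‖e‖⁻¹ • e) ⟨hx, by simp [norm_smul, hne]⟩
  have h2 : inner ℝ (‖e‖⁻¹ • e) (WithLp.toLp 2 (Γ x *ᵥ ⇑(‖e‖⁻¹ • e)))
      = ‖e‖⁻¹ ^ 2 * inner ℝ e (WithLp.toLp 2 (Γ x *ᵥ ⇑e)) := by
    have : (WithLp.toLp 2 (Γ x *ᵥ ⇑(‖e‖⁻¹ • e)) : EuclideanSpace ℝ (Fin n))
        = ‖e‖⁻¹ • WithLp.toLp 2 (Γ x *ᵥ ⇑e) := by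
      ext i
      simp [Matrix.mulVec_smul]
    rw [this, inner_smul_left, inner_smul_right]
    simp only [conj_trivial]
    ring
  simp only at h1
  rw [h2, inv_pow, ← div_eq_inv_mul, le_div_iff₀ (by positivity)] at h1
  exact h1


/-! ### Solutions on half-open intervals and a priori bounds -/

section States

variable {q p s k : ℕ} {r : Fin q → ℕ} {S : System r p s k} {C : Controller q p} {α : ℝ}
  {D : InitialData q p} {Y : ℝ → StateSpace r p} {ω : EReal} {hr : ∀ i, 0 < r i}

/-- `Y` is a solution on `[-h, ω)` which evolves in the funnels. -/
structure OpenSol (hr : ∀ i, 0 < r i) (S : System r p s k) (C : Controller q p)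
    (D : InitialData q p) (ω : EReal) (Y : ℝ → StateSpace r p) : Prop where
  pos : 0 < ω
  part : ∀ b : ℝ, 0 ≤ b → (b : EReal) < ω → PartialSol hr S C D b Y

namespace OpenSol

lemma safe (h : OpenSol hr S C D ω Y) {t : ℝ} (ht : t ∈ ivl 0 ω) : (t, Y t) ∈ safe r p C :=
  (h.part t ht.1 ht.2).safe t ⟨ht.1, le_rfl⟩

lemma exists_mem (h : OpenSol hr S C D ω Y) {t : ℝ} (ht : (t : EReal) < ω) :
    ∃ b, t < b ∧ 0 < b ∧ (b : EReal) < ω := by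
  obtain ⟨b, hb, hbω⟩ := EReal.exists_between_coe_real (max_lt ht h.pos)
  exact ⟨b, by exact_mod_cast (le_max_left _ _).trans_lt hb,
    by exact_mod_cast (le_max_right _ _).trans_lt hb, hbω⟩

lemma cont (h : OpenSol hr S C D ω Y) : ContinuousOn Y (ivl (-S.h) ω) := by
  intro t ht
  obtain ⟨b, htb, hb0, hbω⟩ := h.exists_mem ht.2
  refine ((h.part b hb0.le hbω).cont t ⟨ht.1, htb.le⟩).mono_of_mem_nhdsWithin ?_
  filter_upwards [self_mem_nhdsWithin, mem_nhdsWithin_of_mem_nhds (Iic_mem_nhds htb)] with u hu hu'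
  exact ⟨hu.1, hu'⟩

lemma ivl_subset (H : Feasible S C α) : ivl 0 ω ⊆ ivl (-S.h) ω := fun _ ht =>
  ⟨H.neg_h_le ht.1, ht.2⟩

lemma chain' (h : OpenSol hr S C D ω Y) (i : Fin q) (j : ℕ) (hj : j + 1 < r i) {t : ℝ}
    (ht : t ∈ ivl (-S.h) ω) :
    HasDerivWithinAt (fun t => Y t (Sum.inl ⟨i, ⟨j, by omega⟩⟩)) (Y t (Sum.inl ⟨i, ⟨j + 1, hj⟩⟩))
      (Ici (-S.h)) t := by
  obtain ⟨b, htb, hb0, hbω⟩ := h.exists_mem ht.2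
  refine ((h.part b hb0.le hbω).chain i j hj t ⟨ht.1, htb.le⟩).mono_of_mem_nhdsWithin ?_
  filter_upwards [self_mem_nhdsWithin, mem_nhdsWithin_of_mem_nhds (Iic_mem_nhds htb)] with u hu hu'
  exact ⟨hu, hu'⟩

lemma isJetState (h : OpenSol hr S C D ω Y) (H : Feasible S C α) : IsJetState r p ω Y :=
  ⟨h.cont.mono (ivl_subset H), fun i j hj _ ht => (h.chain' i j hj (ivl_subset H ht)).mono
    (Ici_subset_Ici.2 (H.neg_h_le le_rfl))⟩

lemma continuousOn_pair (h : OpenSol hr S C D ω Y) (H : Feasible S C α) :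
    ContinuousOn (fun t => (t, Y t)) (ivl 0 ω) :=
  continuousOn_id.prodMk (h.cont.mono (ivl_subset H))

lemma errS_eq (h : OpenSol hr S C D ω Y) (H : Feasible S C α) (i : Fin q) {j : ℕ}
    (hj : j ≤ r i - 1) : EqOn (errS (C.φ i) (fun t => (H.errCurve (h.isJetState H) i).a t 0) j)
      (fun t => stErr C i j (t, Y t)) (ivl 0 ω) := fun _ ht =>
  errS_eq_jetErr (H.funnel i) hj (H.errCurve (h.isJetState H) i) ht
    (H.mem_jetDomain_of_errDomain (h.safe ht).1.1 i hj)

lemma hasDerivWithinAt_stErr (h : OpenSol hr S C D ω Y) (H : Feasible S C α) (i : Fin q) {j : ℕ}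
    (hj : j < r i - 1) {t : ℝ} (ht : t ∈ ivl 0 ω) :
    HasDerivWithinAt (fun t => stErr C i j (t, Y t)) (stErr C i (j + 1) (t, Y t)
      - 1 / (1 - C.φ i j t ^ 2 * |stErr C i j (t, Y t)| ^ 2) * stErr C i j (t, Y t)) (Ici 0) t := by
  have h1 := hasDerivWithinAt_errS (H.funnel i) hj (H.errCurve (h.isJetState H) i) ht
    (H.mem_jetDomain_of_errDomain (h.safe ht).1.1 i hj.le)
  rw [h.errS_eq H i hj.le ht, h.errS_eq H i (by omega) ht] at h1
  refine h1.congr_of_eventuallyEq ?_ (h.errS_eq H i hj.le ht).symm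
  filter_upwards [self_mem_nhdsWithin, mem_nhdsWithin_of_mem_nhds
    ((isOpen_lt_coe ω).mem_nhds ht.2)] with u hu hu'
  exact (h.errS_eq H i hj.le ⟨hu, hu'⟩).symm

lemma continuousOn_stErr (h : OpenSol hr S C D ω Y) (H : Feasible S C α) (i : Fin q) {j : ℕ}
    (hj : j ≤ r i - 1) : ContinuousOn (fun t => stErr C i j (t, Y t)) (ivl 0 ω) :=
  (H.continuousOn_stErr' i hj).comp (h.continuousOn_pair H) fun _ ht => (h.safe ht).1.1

lemma continuousOn_stErrI (h : OpenSol hr S C D ω Y) (H : Feasible S C α) :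
    ContinuousOn (fun t => stErrI C (t, Y t)) (ivl 0 ω) :=
  H.continuousOn_stErrI.comp (h.continuousOn_pair H) fun _ ht => (h.safe ht).1.1

lemma exists_stErrI_bound (h : OpenSol hr S C D ω Y) (H : Feasible S C α) :
    ∃ M, ∀ t ∈ ivl 0 ω, ‖stErrI C (t, Y t)‖ ≤ M :=
  bounded_of_funnel h.pos H.ctrl.φI_mem (h.continuousOn_stErrI H) fun _ ht => (h.safe ht).1.2

lemma exists_stErr_bound (h : OpenSol hr S C D ω Y) (H : Feasible S C α) (i : Fin q) {j : ℕ}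
    (hj : j ≤ r i - 1) : ∃ M, ∀ t ∈ ivl 0 ω, |stErr C i j (t, Y t)| ≤ M := by
  rcases hj.lt_or_eq with hj' | rfl
  · exact bounded_of_funnel h.pos (H.funnel i j hj') (h.continuousOn_stErr H i hj)
      fun t ht => (h.safe ht).1.1.2 i j (by omega)
  · obtain ⟨M, hM⟩ := h.exists_stErrI_bound H
    exact ⟨M, fun t ht => (PiLp.norm_apply_le (stErrI C (t, Y t)) i).trans (hM t ht)⟩

/-- The signals `e_{ij}` stay away from the boundary of their funnels. -/
lemma exists_stErr_margin (h : OpenSol hr S C D ω Y) (H : Feasible S C α) (i : Fin q) {j : ℕ}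
    (hj : j + 2 ≤ r i) : ∃ ε > 0, ∀ t ∈ ivl 0 ω,
      C.φ i j t ^ 2 * |stErr C i j (t, Y t)| ^ 2 ≤ 1 - ε := by
  have hφ := H.funnel i j (by omega)
  obtain ⟨B, hB⟩ := h.exists_stErr_bound H i (j := j + 1) (by omega)
  have hder := fun t (ht : t ∈ ivl 0 ω) => h.hasDerivWithinAt_stErr H i (j := j) (by omega) ht
  have hlt : ∀ t ∈ ivl 0 ω, C.φ i j t ^ 2 * |stErr C i j (t, Y t)| ^ 2 < 1 := fun t ht =>
    (mul_lt_one_iff_sq (hφ.nonneg ht.1) (abs_nonneg _)).1 ((h.safe ht).1.1.2 i j hj)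
  -- In `ė_j = e_{j+1} - k_j e_j` the first term is the bounded perturbation and the second is the
  -- damping, with `γ = 1`. No margin for `e_{j+1}` is needed, only its bound.
  refine funnel_barrier (B := B) (γ := 1) (G := fun t => stErr C i (j + 1) (t, Y t)
      - 1 / (1 - C.φ i j t ^ 2 * |stErr C i j (t, Y t)| ^ 2) * stErr C i j (t, Y t)) h.pos
    (by omega) hφ (fun t ht => (h.safe ht).1.1.2 i j hj) (fun t ht => ?_) ?_ one_pos ?_
  · have hsub : Icc 0 t ⊆ ivl 0 ω := Icc_subset_ivl le_rfl ht.2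
    have hc : ContinuousOn (fun t => stErr C i (j + 1) (t, Y t)
        - 1 / (1 - C.φ i j t ^ 2 * |stErr C i j (t, Y t)| ^ 2) * stErr C i j (t, Y t)) (Icc 0 t) := by
      have h0 := (h.continuousOn_stErr H i (j := j) (by omega)).mono hsub
      refine ((h.continuousOn_stErr H i (by omega)).mono hsub).sub
        ((continuousOn_const.div ?_ fun u hu => ?_).mul h0)
      · exact continuousOn_const.sub (((hφ.continuousOn.mono fun u hu => hu.1).pow 2).mul
          (h0.abs.pow 2))
      · linarith [hlt u (hsub hu)]
    obtain ⟨M, hM⟩ := isCompact_Icc.exists_bound_of_continuousOn hc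
    have hM0 : 0 ≤ M := (norm_nonneg _).trans (hM 0 ⟨le_rfl, ht.1⟩)
    exact ⟨_, lipschitzOnWith_of_hasDerivWithinAt hder ht.2 hM0 hM⟩
  · have h1 : ∀ᵐ s : ℝ, s ≠ 0 := by simp [ae_iff, measure_singleton]
    filter_upwards [h1] with s hs hs'
    exact hasDerivAt_of_ivl (lt_of_le_of_ne hs'.1 hs.symm) (hder s hs')
  · refine Eventually.of_forall fun t ht => ?_
    have h1 := hB t ht
    have h2 := hlt t ht
    simp only [Real.norm_eq_abs, sq_abs, one_mul, Real.inner_apply] at h2 ⊢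
    have h3 : stErr C i j (t, Y t) * stErr C i (j + 1) (t, Y t)
        ≤ B * |stErr C i j (t, Y t)| := by
      refine (le_abs_self _).trans ?_
      rw [abs_mul, mul_comm]
      gcongr
    have h4 : (stErr C i j (t, Y t)) ^ 2 / (1 - C.φ i j t ^ 2 * stErr C i j (t, Y t) ^ 2)
        = stErr C i j (t, Y t) * (1 / (1 - C.φ i j t ^ 2 * stErr C i j (t, Y t) ^ 2)
          * stErr C i j (t, Y t)) := by ring
    rw [h4]
    linarith [mul_sub (stErr C i j (t, Y t)) (stErr C i (j + 1) (t, Y t))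
      (1 / (1 - C.φ i j t ^ 2 * stErr C i j (t, Y t) ^ 2) * stErr C i j (t, Y t))]

/-- The components `y_i`, `i ≤ q`, of the state are bounded, and `e_I` differs from the derivatives
of highest order by a function with bounded derivative. -/
lemma exists_remainder (h : OpenSol hr S C D ω Y) (H : Feasible S C α) (i : Fin q) :
    (∀ j, ∃ M, ∀ t ∈ ivl 0 ω, |Y t (Sum.inl ⟨i, j⟩)| ≤ M) ∧
    ∃ R R' : ℝ → ℝ, (∀ t ∈ ivl 0 ω, stErr C i (r i - 1) (t, Y t) =
        Y t (Sum.inl ⟨i, ⟨r i - 1, Nat.sub_one_lt (hr i).ne'⟩⟩) - C.refJet i (r i - 1) t + R t) ∧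
      (∀ t ∈ ivl 0 ω, HasDerivWithinAt R (R' t) (Ici 0) t) ∧
      ∃ M, ∀ t ∈ ivl 0 ω, |R' t| ≤ M := by
  have hri := hr i
  obtain ⟨h1, R, R', h2, h3, h4⟩ := errS_remainder (H.funnel i) (H.errCurve (h.isJetState H) i)
    (fun t ht => H.mem_jetDomain_of_errDomain (h.safe ht).1.1 i le_rfl)
    (fun j hj => by
      obtain ⟨M, hM⟩ := h.exists_stErr_bound H i hj
      exact ⟨M, fun t ht => by rw [h.errS_eq H i hj ht]; exact hM t ht⟩)
    (fun j hj => by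
      -- A margin `ε` bounds the gain by `ε⁻¹`.
      obtain ⟨ε, hε, hm⟩ := h.exists_stErr_margin H i (j := j) (by omega)
      refine ⟨ε⁻¹, fun t ht => ?_⟩
      rw [h.errS_eq H i hj.le ht, abs_inv]
      have := hm t ht
      rw [abs_of_nonneg (by linarith)]
      exact inv_anti₀ hε (by linarith))
  refine ⟨fun j => ?_, R, R', fun t ht => ?_, h3, h4⟩
  · obtain ⟨M, hM⟩ := h1 j (by have := j.2; omega)
    obtain ⟨M', hM'⟩ := (H.refJet_spec i).2.2.1 j j.2
    refine ⟨M + M', fun t ht => ?_⟩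
    have h5 : Y t (Sum.inl ⟨i, j⟩) = (H.errCurve (h.isJetState H) i).a t j + C.refJet i j t := by
      simp only [Feasible.errCurve, errJet, dif_pos j.2, Fin.eta, sub_add_cancel]
    rw [h5]
    exact (abs_add_le _ _).trans (add_le_add (hM t ht) (hM' t ht.1))
  · refine (h.errS_eq H i le_rfl ht).symm.trans ((h2 t ht).trans ?_)
    simp only [Feasible.errCurve, errJet, dif_pos (show r i - 1 < r i by omega)]

lemma exists_stErrII_bound (h : OpenSol hr S C D ω Y) (H : Feasible S C α) :
    ∃ M, ∀ t ∈ ivl 0 ω, ‖stErrII C (t, Y t)‖ ≤ M :=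
  bounded_of_funnel h.pos H.ctrl.φII_mem
    (H.continuousOn_stErrII.comp (h.continuousOn_pair H) fun _ ht => ht.1)
    fun _ ht => (h.safe ht).2

/-- The state is bounded. -/
lemma exists_bound (h : OpenSol hr S C D ω Y) (H : Feasible S C α) :
    ∃ N, 0 ≤ N ∧ ∀ t ∈ ivl (-S.h) ω, ‖Y t‖ ≤ N := by
  have hcomp : ∀ x, ∃ M, ∀ t ∈ ivl 0 ω, ‖Y t x‖ ≤ M := by
    rintro (⟨i, j⟩ | i)
    · exact (h.exists_remainder H i).1 j
    · obtain ⟨M, hM⟩ := h.exists_stErrII_bound H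
      obtain ⟨g, hg⟩ := H.ctrl.yrefII_mem i
      have hg0 : MemLinf fun t => C.yref t (Sum.inr i) := hg.1 ▸ hg.2.1 0 (by simp)
      obtain ⟨M', -, hM'⟩ := hg0.bound
        ((EuclideanSpace.proj (𝕜 := ℝ) (Sum.inr i : Fin q ⊕ Fin p)).continuous.comp_continuousOn
          H.ctrl.yref_cont)
      refine ⟨M + M', fun t ht => ?_⟩
      have h5 : Y t (Sum.inr i) = stErrII C (t, Y t) i + C.yref t (Sum.inr i) := by
        simp [stErrII]
      rw [h5]
      exact (norm_add_le _ _).trans (add_le_add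
        ((PiLp.norm_apply_le (stErrII C (t, Y t)) i).trans (hM t ht)) (hM' t ht.1))
  choose M hM using hcomp
  obtain ⟨N, hN⟩ := isCompact_Icc.exists_bound_of_continuousOn
    (h.part 0 le_rfl h.pos).cont
  have hN0 : 0 ≤ N := (norm_nonneg _).trans (hN 0 ⟨H.neg_h_le le_rfl, le_rfl⟩)
  refine ⟨max N (∑ x, M x), hN0.trans (le_max_left _ _), fun t ht => ?_⟩
  rcases le_total t 0 with h0 | h0
  · exact (hN t ⟨ht.1, h0⟩).trans (le_max_left _ _)
  · refine le_trans ?_ (le_max_right _ _)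
    exact (norm_le_sum_norm _).trans (Finset.sum_le_sum fun x _ => hM x t ⟨h0, ht.2⟩)

end OpenSol

end States


/-! ### Margins for `e_I` and `e_II`, and Lipschitz bounds -/

section States

variable {q p s k : ℕ} {r : Fin q → ℕ} {S : System r p s k} {C : Controller q p} {α : ℝ}
  {D : InitialData q p} {Y : ℝ → StateSpace r p} {ω : EReal} {hr : ∀ i, 0 < r i}

lemma stInputI_eq (C : Controller q p) (z : ℝ × StateSpace r p) :
    stInputI C z = -((1 / (1 - C.φI z.1 ^ 2 * ‖stErrI C z‖ ^ 2)) • stErrI C z) := rfl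

namespace OpenSol

lemma norm_stop_le (h : OpenSol hr S C D ω Y) {b : ℝ} (hb0 : 0 ≤ b) (hb : (b : EReal) < ω)
    (H : Feasible S C α) {N : ℝ} (hN : ∀ t ∈ ivl (-S.h) ω, ‖Y t‖ ≤ N) :
    ContinuousOn (stopAt b Y) (Ici (-S.h)) ∧ ∀ t ∈ Ici (-S.h), ‖stopAt b Y t‖ ≤ N :=
  ⟨(h.part b hb0 hb).continuousOn_stopped H, fun _ ht => hN _
    (Icc_subset_ivl le_rfl hb ⟨le_min ht (H.neg_h_le hb0), min_le_right _ _⟩)⟩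

/-- The stopped trajectories share the bound of the state, so boundedness of `T₁` on bounded
trajectories gives a constant independent of the stopping time `b`. -/
lemma exists_T₁_bound (h : OpenSol hr S C D ω Y) (H : Feasible S C α) :
    ∃ M, ∀ b : ℝ, 0 ≤ b → (b : EReal) < ω → ∀ᵐ t, 0 ≤ t → ‖S.T₁ (stopAt b Y) t‖ ≤ M := by
  obtain ⟨N, hN0, hN⟩ := h.exists_bound H
  obtain ⟨M, hM0, hM⟩ := H.sys.T₁_mem.bounded (N + 1) (by positivity)
  refine ⟨M, fun b hb0 hb => ?_⟩
  obtain ⟨h1, h2⟩ := h.norm_stop_le hb0 hb H hN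
  have := hM _ h1 fun t ht => (h2 t ht).trans (by linarith)
  rwa [ae_restrict_iff' measurableSet_Ici] at this

lemma exists_T₂_bound (h : OpenSol hr S C D ω Y) (H : Feasible S C α) :
    ∃ (K : NNReal) (M : ℝ), ∀ b : ℝ, 0 ≤ b → (b : EReal) < ω →
      LipschitzOnWith K (S.T₂ fun u => outOf hr (stopAt b Y u)) (Ici 0) ∧
      ∀ t, 0 ≤ t → ‖S.T₂ (fun u => outOf hr (stopAt b Y u)) t‖ ≤ M := by
  obtain ⟨N, hN0, hN⟩ := h.exists_bound H
  obtain ⟨K, M, hKM⟩ := H.sys.T₂_mem.exists_lipschitz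
    (c₁ := (‖(outOf hr : StateSpace r p →L[ℝ] _)‖ + 1) * (N + 1)) (by positivity)
  refine ⟨K, M, fun b hb0 hb => ?_⟩
  obtain ⟨h1, h2⟩ := h.norm_stop_le hb0 hb H hN
  refine hKM _ (continuousOn_outOf hr h1) (fun t ht => ?_) H.sys.h_nonneg
  refine ((outOf hr).le_opNorm _).trans ?_
  gcongr
  · linarith
  · exact (h2 t ht).trans (by linarith)

/-- The components of `e_I` are primitives. -/
lemma exists_stErrI_deriv (h : OpenSol hr S C D ω Y) (H : Feasible S C α) :
    ∃ W, ∀ b : ℝ, 0 ≤ b → (b : EReal) < ω →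
      (∃ K, LipschitzOnWith K (fun t => stErrI C (t, Y t)) (Icc 0 b)) ∧
      ∀ᵐ s, s ∈ Icc 0 b → ∃ w : EuclideanSpace ℝ (Fin q), ‖w‖ ≤ W ∧
        HasDerivAt (fun t => stErrI C (t, Y t)) (rhs S C (stopAt b Y) s + w) s := by
  choose R R' hR hR' M hM using fun i => (h.exists_remainder H i).2
  choose g hg hgr using fun i => (H.refJet_spec i).2.2.2
  choose Mg hMg0 hMg using fun i => (hg i).ae_bound
  -- Componentwise, `e_I` is `y_i^{(r_i-1)} - y_{ref,i}^{(r_i-1)} + R_i`. The first term has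
  -- derivative `rhs`; the bound `W` collects the derivatives of the other two.
  refine ⟨∑ i, (|M i| + Mg i), fun b hb0 hb => ?_⟩
  have hsub : Icc 0 b ⊆ ivl 0 ω := Icc_subset_ivl le_rfl hb
  have hP := h.part b hb0 hb
  have hstp := hP.continuousOn_stopped H
  have hsafe : ∀ t ∈ Icc 0 b, (t, stopAt b Y t) ∈ safeI r p C := fun t ht => by
    rw [stopAt_of_le ht.2]; exact (hP.safe t ht).1
  have hi1 : ∀ i, ∀ t ∈ Icc 0 b,
      IntervalIntegrable (fun u => rhs S C (stopAt b Y) u i) volume 0 t := fun i t ht =>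
    IntervalIntegrable.apply_euclidean i (H.intervalIntegrable_rhs hstp hsafe ⟨le_rfl, hb0⟩ ht)
  have hi2 : ∀ i, ∀ t ∈ Icc 0 b, IntervalIntegrable (g i) volume 0 t := fun i t ht =>
    ((hg i).locallyIntegrableOn.integrableOn_compact_subset
      (by rw [uIcc_of_le ht.1]; exact Icc_subset_Ici_self) isCompact_uIcc).intervalIntegrable
  obtain ⟨B, hB0, hB⟩ := H.rhs_bound_Icc hstp hsafe
  have htop : ∀ i, ∀ t ∈ Icc 0 b, Y t (Sum.inl ⟨i, ⟨r i - 1, Nat.sub_one_lt (hr i).ne'⟩⟩) =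
      Y 0 (Sum.inl ⟨i, ⟨r i - 1, Nat.sub_one_lt (hr i).ne'⟩⟩)
        + ∫ u in 0..t, rhs S C (stopAt b Y) u i := fun i =>
    hP.top i _ (Nat.sub_one_add_one (hr i).ne')
  have hcomp : ∀ i, ∀ t ∈ Icc 0 b, stErrI C (t, Y t) i =
      Y t (Sum.inl ⟨i, ⟨r i - 1, Nat.sub_one_lt (hr i).ne'⟩⟩) - C.refJet i (r i - 1) t + R i t :=
    fun i t ht => hR i t (hsub ht)
  refine ⟨lipschitzOnWith_euclidean fun i => ?_, ?_⟩
  · have l1 := lipschitzOnWith_of_eq_primitive (B := B) (by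
      filter_upwards [hB] with u hu hu' using (PiLp.norm_apply_le _ i).trans (hu hu')) hB0
      (hi1 i) (htop i)
    have l2 := lipschitzOnWith_of_eq_primitive (B := Mg i) (b := b) (by
      filter_upwards [hMg i] with u hu hu' using hu hu'.1) (hMg0 i) (hi2 i)
      (fun t ht => hgr i t ht.1)
    have l3 := lipschitzOnWith_of_hasDerivWithinAt (hR' i) hb (abs_nonneg (M i)) fun t ht =>
      (hM i t (hsub ht)).trans (le_abs_self _)
    refine ⟨B.toNNReal + (Mg i).toNNReal + |M i|.toNNReal, fun s hs t ht => ?_⟩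
    beta_reduce
    rw [hcomp i s hs, hcomp i t ht]
    exact ((l1.sub l2).add l3) hs ht
  · have hd1 : ∀ᵐ s, ∀ i, s ∈ Icc 0 b → HasDerivAt
        (fun t => Y t (Sum.inl ⟨i, ⟨r i - 1, Nat.sub_one_lt (hr i).ne'⟩⟩))
        (rhs S C (stopAt b Y) s i) s := ae_all_iff.2 fun i =>
      ae_hasDerivAt_of_eq_primitive hb0 (hi1 i b ⟨hb0, le_rfl⟩) (htop i)
    have hd2 : ∀ᵐ s, ∀ i, s ∈ Icc 0 b → HasDerivAt (C.refJet i (r i - 1)) (g i s) s :=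
      ae_all_iff.2 fun i => ae_hasDerivAt_of_eq_primitive hb0 (hi2 i b ⟨hb0, le_rfl⟩)
        fun t ht => hgr i t ht.1
    have hg' : ∀ᵐ s, ∀ i, s ∈ Ici (0 : ℝ) → ‖g i s‖ ≤ Mg i := ae_all_iff.2 hMg
    have h1 : ∀ᵐ s : ℝ, s ≠ 0 := by simp [ae_iff, measure_singleton]
    have h2 : ∀ᵐ s : ℝ, s ≠ b := by simp [ae_iff, measure_singleton]
    filter_upwards [hd1, hd2, hg', h1, h2] with s hs1 hs2 hs3 hs0 hsb hs
    have hs0' : 0 < s := lt_of_le_of_ne hs.1 hs0.symm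
    refine ⟨WithLp.toLp 2 fun i => R' i s - g i s, ?_, hasDerivAt_euclidean fun i => ?_⟩
    · refine (norm_le_sum_norm _).trans (Finset.sum_le_sum fun i _ => ?_)
      refine (norm_sub_le _ _).trans (add_le_add ?_ (hs3 i hs.1))
      exact (hM i s (hsub hs)).trans (le_abs_self _)
    · have := ((hs1 i hs).sub (hs2 i hs)).add (hasDerivAt_of_ivl hs0' (hR' i s (hsub hs)))
      refine HasDerivAt.congr_of_eventuallyEq (HasDerivAt.congr_deriv this ?_) ?_
      · simp only [PiLp.add_apply]; ring
      · filter_upwards [Icc_mem_nhds hs0' (lt_of_le_of_ne hs.2 hsb)] with t ht using hcomp i t ht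

/-- The signal `e_I` stays away from the boundary of its funnel. -/
lemma exists_stErrI_margin (h : OpenSol hr S C D ω Y) (H : Feasible S C α) :
    ∃ ε > 0, ∀ t ∈ ivl 0 ω, C.φI t ^ 2 * ‖stErrI C (t, Y t)‖ ^ 2 ≤ 1 - ε := by
  obtain ⟨M, hM⟩ := h.exists_T₁_bound H
  obtain ⟨W, hW⟩ := h.exists_stErrI_deriv H
  obtain ⟨M₂, -, hM₂⟩ := H.sys.d₂_mem.ae_bound
  -- The damping constant is the coercivity of `Γ_I` on a compact set containing the values of `(d₂,
  -- T₁ Y)` for almost all times.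
  obtain ⟨γ, hγ0, hγ⟩ := exists_coercive H.sys.ΓI_cont H.sys.ΓI_pos
    ((isCompact_closedBall (0 : EuclideanSpace ℝ (Fin s)) M₂).prod
      (isCompact_closedBall (0 : EuclideanSpace ℝ (Fin k)) M))
  -- With vanishing input this is a bound for `f₁` alone; the input term is the damping and must not
  -- be estimated in norm.
  obtain ⟨B, hB0, hB⟩ := H.exists_rhs_bound M 0
  refine funnel_barrier (B := B + W) (γ := γ) (G := fun t => deriv (fun t => stErrI C (t, Y t)) t)
    h.pos le_rfl H.ctrl.φI_mem (fun t ht => (h.safe ht).1.2) (fun t ht => (hW t ht.1 ht.2).1)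
    (ae_ivl_of_ae_Icc fun b hb0 hb => ?_) hγ0 (ae_ivl_of_ae_Icc fun b hb0 hb => ?_)
  · filter_upwards [(hW b hb0 hb).2] with s hs hs'
    obtain ⟨w, -, hw⟩ := hs hs'
    exact hw.differentiableAt.hasDerivAt
  · filter_upwards [(hW b hb0 hb).2, hM₂, hB, hM b hb0 hb] with t h1 h2 h3 h4 ht
    obtain ⟨w, hwW, hw⟩ := h1 ht
    have htω : t ∈ ivl 0 ω := Icc_subset_ivl le_rfl hb ht
    have hpos := H.one_sub_pos_of_safeI (h.safe htω).1
    rw [hw.deriv, rhs, stopAt_of_le ht.2, stInputI_eq]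
    dsimp only at hpos ⊢
    set e := stErrI C (t, Y t) with he
    set θ := S.T₁ (stopAt b Y) t with hθ
    have hf : ‖S.f₁ (S.d₁ t, θ)‖ ≤ B := by
      have := h3 ht.1 θ 0 (h4 ht.1) (by simp)
      simpa using this
    have hΓ : (WithLp.toLp 2 (S.ΓI (S.d₂ t, θ) *ᵥ
        ⇑(-((1 / (1 - C.φI t ^ 2 * ‖e‖ ^ 2)) • e))) : EuclideanSpace ℝ (Fin q))
        = -((1 / (1 - C.φI t ^ 2 * ‖e‖ ^ 2)) • WithLp.toLp 2 (S.ΓI (S.d₂ t, θ) *ᵥ ⇑e)) := by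
      ext i
      simp [Matrix.mulVec_neg, Matrix.mulVec_smul]
    rw [hΓ, inner_add_right, inner_add_right, inner_neg_right, inner_smul_right]
    have i1 := real_inner_le_norm e (S.f₁ (S.d₁ t, θ))
    have i2 := real_inner_le_norm e w
    have i3 := hγ (S.d₂ t, θ) ⟨by simpa using h2 ht.1, by simpa using h4 ht.1⟩ e
    have i4 : ‖e‖ * ‖S.f₁ (S.d₁ t, θ)‖ ≤ ‖e‖ * B := by gcongr
    have i5 : ‖e‖ * ‖w‖ ≤ ‖e‖ * W := by gcongr
    have i6 : γ * (‖e‖ ^ 2 / (1 - C.φI t ^ 2 * ‖e‖ ^ 2)) ≤ 1 / (1 - C.φI t ^ 2 * ‖e‖ ^ 2) *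
        inner ℝ e (WithLp.toLp 2 (S.ΓI (S.d₂ t, θ) *ᵥ ⇑e)) := by
      calc _ = 1 / (1 - C.φI t ^ 2 * ‖e‖ ^ 2) * (γ * ‖e‖ ^ 2) := by ring
        _ ≤ _ := by gcongr
    linarith

lemma exists_stInputI_bound (h : OpenSol hr S C D ω Y) (H : Feasible S C α) :
    ∃ U, ∀ t ∈ ivl 0 ω, ‖stInputI C (t, Y t)‖ ≤ U := by
  obtain ⟨M, hM⟩ := h.exists_stErrI_bound H
  obtain ⟨ε, hε, hm⟩ := h.exists_stErrI_margin H
  refine ⟨ε⁻¹ * M, fun t ht => ?_⟩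
  have h1 := hm t ht
  rw [stInputI_eq, norm_neg, norm_smul, Real.norm_of_nonneg (by
    have := H.one_sub_pos_of_safeI (h.safe ht).1; positivity), one_div]
  gcongr
  · linarith
  · exact hM t ht

/-- The right-hand side of the differential equation is bounded. -/
lemma exists_rhs_bound (h : OpenSol hr S C D ω Y) (H : Feasible S C α) :
    ∃ B, 0 ≤ B ∧ ∀ b : ℝ, 0 ≤ b → (b : EReal) < ω →
      ∀ᵐ t, t ∈ Icc 0 b → ‖rhs S C (stopAt b Y) t‖ ≤ B := by
  obtain ⟨M, hM⟩ := h.exists_T₁_bound H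
  obtain ⟨U, hU⟩ := h.exists_stInputI_bound H
  obtain ⟨B, hB0, hB⟩ := H.exists_rhs_bound M U
  refine ⟨B, hB0, fun b hb0 hb => ?_⟩
  filter_upwards [hB, hM b hb0 hb] with t h1 h2 ht
  refine h1 ht.1 _ _ (h2 ht.1) ?_
  rw [stopAt_of_le ht.2]
  exact hU t (Icc_subset_ivl le_rfl hb ht)

/-- The signal `e_II` stays away from the boundary of its funnel. -/
lemma exists_stErrII_margin (h : OpenSol hr S C D ω Y) (H : Feasible S C α) :
    ∃ ε > 0, ∀ t ∈ ivl 0 ω, C.φII t ^ 2 * ‖stErrII C (t, Y t)‖ ^ 2 ≤ 1 - ε := by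
  obtain ⟨N, hN0, hN⟩ := h.exists_bound H
  obtain ⟨U, hU⟩ := h.exists_stInputI_bound H
  obtain ⟨K, M, hKM⟩ := h.exists_T₂_bound H
  obtain ⟨c, hc0, hc⟩ := H.ctrl.φII_mem.exists_bound
  have hd3 : MemLinf S.d₃ := by
    obtain ⟨g, hg⟩ := H.sys.d₃_mem
    exact hg.1 ▸ hg.2.1 0 (by simp)
  have hd4 : MemLinf S.d₄ := by
    obtain ⟨g, hg⟩ := H.sys.d₄_mem
    exact hg.1 ▸ hg.2.1 0 (by simp)
  obtain ⟨M₃, -, hM₃⟩ := hd3.bound H.sys.d₃_cont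
  obtain ⟨M₄, -, hM₄⟩ := hd4.bound H.sys.d₄_cont
  obtain ⟨B₂, hB₂⟩ := (isCompact_closedBall (0 : StateSpace r p) N).exists_bound_of_continuousOn
    H.sys.f₂_contDiff.continuous.continuousOn
  obtain ⟨B₃, hB₃⟩ := ((isCompact_closedBall (0 : EuclideanSpace ℝ (Fin s)) M₃).prod
    (isCompact_closedBall (0 : EuclideanSpace ℝ (Fin k)) M)).exists_bound_of_continuousOn
    H.sys.f₃_contDiff.continuous.continuousOn
  have hΓ : ContinuousOn (fun w : (CoeffSpace s k) × EuclideanSpace ℝ (Fin q) =>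
      (WithLp.toLp 2 (S.ΓII w.1 *ᵥ ⇑w.2) : EuclideanSpace ℝ (Fin p))) univ :=
    Feasible.continuousOn_mulVec (H.continuous_ΓII.comp continuous_fst).continuousOn
      continuous_snd.continuousOn
  obtain ⟨B₄, hB₄⟩ := (((isCompact_closedBall (0 : EuclideanSpace ℝ (Fin s)) M₄).prod
    (isCompact_closedBall (0 : EuclideanSpace ℝ (Fin k)) M)).prod
    (isCompact_closedBall (0 : EuclideanSpace ℝ (Fin q)) U)).exists_bound_of_continuousOn
    (hΓ.mono (subset_univ _))
  have hk := H.ctrl.kHat_pos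
  have hα := H.sys.α_pos
  -- `V` bounds the argument `w` of `gainInv`. The witness below is the value of `1 - φ² ‖gainInv φ
  -- w‖²` from `one_sub_gainInv`, taken at the extremal `φ = c` and `‖w‖ = V`.
  set V := (C.kHat * α)⁻¹ * (B₂ + B₃ + B₄) with hV
  refine ⟨2 / (1 + √(1 + 4 * c ^ 2 * V ^ 2)), by positivity, fun t ht => ?_⟩
  obtain ⟨-, hθ⟩ := hKM t ht.1 ht.2
  have h1 := (h.part t ht.1 ht.2).stErrII_eq H ⟨ht.1, le_rfl⟩
  set θ := S.T₂ (fun u => outOf hr (stopAt t Y u)) t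
  have h2 := H.algErr_eq (t, Y t) θ
  rw [← h1, algMap, algRhs, Feasible.withII_stErrII (t, Y t)] at h2
  have hw : ‖(C.kHat * S.f₄ (S.d₅ t, θ))⁻¹ • (S.f₂ (Y t) + S.f₃ (S.d₃ t, θ)
      + WithLp.toLp 2 (S.ΓII (S.d₄ t, θ) *ᵥ ⇑(stInputI C (t, Y t))))‖ ≤ V := by
    rw [norm_smul, Real.norm_of_nonneg (inv_pos.2 (H.kf₄_pos _)).le, hV]
    gcongr
    · exact H.sys.f₄_lower _
    · refine (norm_add_le _ _).trans (add_le_add ((norm_add_le _ _).trans (add_le_add ?_ ?_)) ?_)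
      · exact hB₂ _ (by simpa using hN t (ivl_subset H ht))
      · exact hB₃ (S.d₃ t, θ) ⟨by simpa using hM₃ t ht.1, by simpa using hθ t ht.1⟩
      · exact hB₄ ((S.d₄ t, θ), stInputI C (t, Y t))
          ⟨⟨by simpa using hM₄ t ht.1, by simpa using hθ t ht.1⟩, by simpa using hU t ht⟩
  have h3 := one_sub_gainInv (C.φII t) ((C.kHat * S.f₄ (S.d₅ t, θ))⁻¹ • (S.f₂ (Y t)
    + S.f₃ (S.d₃ t, θ) + WithLp.toLp 2 (S.ΓII (S.d₄ t, θ) *ᵥ ⇑(stInputI C (t, Y t)))))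
  dsimp only at h2
  rw [h2] at h3
  have h4 : C.φII t ^ 2 ≤ c ^ 2 := sq_le_sq' (by linarith [(abs_le.1 (hc t ht.1)).1])
    (abs_le.1 (hc t ht.1)).2
  have h5 : 2 / (1 + √(1 + 4 * c ^ 2 * V ^ 2)) ≤
      1 - C.φII t ^ 2 * ‖stErrII C (t, Y t)‖ ^ 2 := by
    rw [h3]
    gcongr
  linarith

/-- The components `y_i^{(j)}`, `i ≤ q`, of the state are Lipschitz continuous. -/
lemma exists_lipschitz_inl (h : OpenSol hr S C D ω Y) (H : Feasible S C α)
    (ij : Σ i, Fin (r i)) :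
    ∃ K : NNReal, LipschitzOnWith K (fun t => Y t (Sum.inl ij)) (ivl 0 ω) := by
  obtain ⟨i, j⟩ := ij
  obtain ⟨N, hN0, hN⟩ := h.exists_bound H
  obtain ⟨B, hB0, hB⟩ := h.exists_rhs_bound H
  have key : ∀ b : ℝ, 0 ≤ b → (b : EReal) < ω →
      LipschitzOnWith (max N.toNNReal B.toNNReal) (fun t => Y t (Sum.inl ⟨i, j⟩)) (Icc 0 b) := by
    intro b hb0 hb
    have hP := h.part b hb0 hb
    by_cases hj : j.1 + 1 < r i
    · refine (lipschitzOnWith_of_hasDerivWithinAt (f' := fun t => Y t (Sum.inl ⟨i, ⟨j + 1, hj⟩⟩))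
        (fun t ht => (h.isJetState H).chain i j hj t ht) hb hN0 fun t ht => ?_).weaken
        (le_max_left _ _)
      exact (PiLp.norm_apply_le _ _).trans (hN t (ivl_subset H (Icc_subset_ivl le_rfl hb ht)))
    · have hj' : j.1 + 1 = r i := by have := j.2; omega
      refine (lipschitzOnWith_of_eq_primitive (g := fun u => rhs S C (stopAt b Y) u i) ?_ hB0
        (fun t ht => ?_) (hP.top i j hj')).weaken (le_max_right _ _)
      · filter_upwards [hB b hb0 hb] with u hu hu' using (PiLp.norm_apply_le _ i).trans (hu hu')
      · refine IntervalIntegrable.apply_euclidean i (H.intervalIntegrable_rhs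
          (hP.continuousOn_stopped H) (fun t ht => ?_) ⟨le_rfl, hb0⟩ ht)
        rw [stopAt_of_le ht.2]; exact (hP.safe t ht).1
  refine ⟨max N.toNNReal B.toNNReal, fun s hs t ht => ?_⟩
  rcases le_total s t with hst | hst
  · exact key t ht.1 ht.2 ⟨hs.1, hst⟩ ⟨ht.1, le_rfl⟩
  · exact key s hs.1 hs.2 ⟨hs.1, le_rfl⟩ ⟨ht.1, hst⟩

end OpenSol

end States


/-! ### Continuation up to the right endpoint -/

lemma le_endpoint {f : ℝ → ℝ} {a b c : ℝ} (hab : a < b) (hf : ContinuousOn f (Icc a b))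
    (h : ∀ t ∈ Ico a b, f t ≤ c) : f b ≤ c := by
  have : (𝓝[Ico a b] b).NeBot := right_nhdsWithin_Ico_neBot hab
  refine le_of_tendsto ((hf b ⟨hab.le, le_rfl⟩).mono Ico_subset_Icc_self).tendsto ?_
  filter_upwards [self_mem_nhdsWithin] with t ht using h t ht

lemma eqOn_Icc_of_eqOn_Ico {X : Type*} [TopologicalSpace X] [T2Space X] {f g : ℝ → X} {a b : ℝ}
    (hab : a < b) (hf : ContinuousOn f (Icc a b)) (hg : ContinuousOn g (Icc a b))
    (h : EqOn f g (Ico a b)) : EqOn f g (Icc a b) :=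
  h.of_subset_closure hf hg Ico_subset_Icc_self (by rw [closure_Ico hab.ne])

section States

variable {q p s k : ℕ} {r : Fin q → ℕ} {S : System r p s k} {C : Controller q p} {α : ℝ}
  {D : InitialData q p} {Y : ℝ → StateSpace r p} {ω : EReal} {hr : ∀ i, 0 < r i} {b : ℝ}

lemma algState_withII (S : System r p s k) (C : Controller q p) (t : ℝ) (Y : StateSpace r p)
    (v : EuclideanSpace ℝ (Fin p)) (θ : EuclideanSpace ℝ (Fin k)) :
    algState S C ((t, withII Y v), θ) = algState S C ((t, Y), θ) := by
  simp only [algState, algErr_withII]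
  rfl

/-- Trajectories which stay away from the boundaries of the funnels have end points in the
funnels. -/
lemma Feasible.mem_safeI_of_margins (H : Feasible S C α) (hb : 0 < b) {Z : ℝ → StateSpace r p}
    (hZ : ContinuousOn Z (Icc 0 b)) (hs : ∀ t ∈ Ico 0 b, (t, Z t) ∈ safeI r p C)
    (hm : ∀ i j, j + 2 ≤ r i → ∃ ε > 0, ∀ t ∈ Ico 0 b,
      C.φ i j t ^ 2 * |stErr C i j (t, Z t)| ^ 2 ≤ 1 - ε)
    (hmI : ∃ ε > 0, ∀ t ∈ Ico 0 b, C.φI t ^ 2 * ‖stErrI C (t, Z t)‖ ^ 2 ≤ 1 - ε) :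
    (b, Z b) ∈ safeI r p C := by
  have hpair : ContinuousOn (fun t => (t, Z t)) (Icc 0 b) := continuousOn_id.prodMk hZ
  have hsub : Icc 0 b ⊆ Ici 0 := Icc_subset_Ici_self
  have hcase : ∀ t ∈ Icc 0 b, t ∈ Ico 0 b ∨ t = b := fun t ht =>
    ht.2.lt_or_eq.imp (fun h => ⟨ht.1, h⟩) id
  -- Induction on `j`: continuity of `e_j` up to `b` requires that the signals of lower index are in
  -- their funnels at `b`.
  have herr : ∀ i j, j + 2 ≤ r i → C.φ i j b * |stErr C i j (b, Z b)| < 1 := by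
    intro i j
    induction j using Nat.strong_induction_on with
    | _ j ih =>
      intro hj
      have hφ := H.ctrl.φ_mem i j hj
      obtain ⟨ε, hε, hme⟩ := hm i j hj
      have hc : ContinuousOn (fun t => stErr C i j (t, Z t)) (Icc 0 b) := by
        refine (H.continuousOn_stErr i (j := j) (by omega)).comp hpair fun t ht => ⟨ht.1, fun l hl => ?_⟩
        rcases hcase t ht with h | h
        · exact (hs t h).1.2 i l (by omega)
        · simp only [h]; exact ih l hl (by omega)
      have := le_endpoint hb (((hφ.continuousOn.mono hsub).pow 2).mul (hc.abs.pow 2)) hme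
      rw [mul_lt_one_iff_sq (hφ.nonneg hb.le) (abs_nonneg _)]
      exact lt_of_le_of_lt this (by linarith)
  have hdom : (b, Z b) ∈ errDomain r p C := ⟨hb.le, herr⟩
  refine ⟨hdom, ?_⟩
  obtain ⟨ε, hε, hme⟩ := hmI
  have hc : ContinuousOn (fun t => stErrI C (t, Z t)) (Icc 0 b) := by
    refine H.continuousOn_stErrI.comp hpair fun t ht => ?_
    rcases hcase t ht with h | h
    · exact (hs t h).1
    · simp only [h]; exact hdom
  have := le_endpoint hb (((H.ctrl.φI_mem.continuousOn.mono hsub).pow 2).mul (hc.norm.pow 2)) hme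
  rw [mul_lt_one_iff_sq (H.ctrl.φI_mem.nonneg hb.le) (norm_nonneg _)]
  exact lt_of_le_of_lt this (by linarith)

namespace OpenSol

lemma mem_ivl_coe (b : ℝ) {t : ℝ} (ht : t ∈ Ico 0 b) : t ∈ ivl 0 (b : EReal) :=
  ⟨ht.1, EReal.coe_lt_coe_iff.2 ht.2⟩

/-- The components `y_i^{(j)}`, `i ≤ q`, and the values of `T₂` extend continuously to the right
endpoint. -/
lemma exists_extension (h : OpenSol hr S C D (b : EReal) Y) (H : Feasible S C α) :
    ∃ (A : ℝ → StateSpace r p) (Θ : ℝ → EuclideanSpace ℝ (Fin k)), Continuous A ∧ Continuous Θ ∧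
      (∀ t ∈ Ico 0 b, A t = withII (Y t) 0) ∧
      ∀ t ∈ Ico 0 b, Θ t = S.T₂ (fun u => outOf hr (stopAt t Y u)) t := by
  choose K hK using fun ij => h.exists_lipschitz_inl H ij
  choose g hg hgY using fun ij => (hK ij).extend_real
  obtain ⟨K₂, M, hKM⟩ := h.exists_T₂_bound H
  have hmem := fun t (ht : t ∈ Ico 0 b) => mem_ivl_coe b ht
  have hΘ : LipschitzOnWith K₂ (fun t => S.T₂ (fun u => outOf hr (stopAt t Y u)) t) (Ico 0 b) := by
    -- The stopping time varies with `t`. By causality it may be replaced by the larger one, so that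
    -- a single Lipschitz function covers both times.
    have key : ∀ s ∈ Ico 0 b, ∀ t ∈ Ico 0 b, s ≤ t →
        S.T₂ (fun u => outOf hr (stopAt s Y u)) s = S.T₂ (fun u => outOf hr (stopAt t Y u)) s := by
      intro s hs t ht hst
      refine H.T₂_eqOn ((h.part s hs.1 (hmem s hs).2).continuousOn_stopped H)
        ((h.part t ht.1 (hmem t ht).2).continuousOn_stopped H) hs.1 (fun u hu => ?_) ⟨hs.1, le_rfl⟩
      rw [stopAt_of_le hu.2, stopAt_of_le (hu.2.trans hst)]
    intro s hs t ht
    beta_reduce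
    rcases le_total s t with hst | hst
    · rw [key s hs t ht hst]
      exact (hKM t ht.1 (hmem t ht).2).1 hs.1 ht.1
    · rw [key t ht s hs hst]
      exact (hKM s hs.1 (hmem s hs).2).1 hs.1 ht.1
  obtain ⟨Θ, hΘc, hΘe⟩ := hΘ.extend_finite_dimension
  refine ⟨fun t => WithLp.toLp 2 (Sum.elim (fun ij => g ij t) (fun _ => 0)), Θ, ?_, hΘc.continuous,
    fun t ht => ?_, fun t ht => (hΘe ht).symm⟩
  · refine (PiLp.continuous_toLp 2 _).comp (continuous_pi fun x => ?_)
    rcases x with ij | i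
    · exact (hg ij).continuous
    · exact continuous_const
  · ext x
    rcases x with ij | i
    · exact (hgY ij (hmem t ht)).symm
    · rfl

/-- Solutions on bounded half-open intervals can be continued to the right endpoint. -/
theorem exists_closure (h : OpenSol hr S C D (b : EReal) Y) (H : Feasible S C α) :
    ∃ Y', PartialSol hr S C D b Y' ∧ EqOn Y' Y (ivl (-S.h) b) := by
  have hb : 0 < b := by exact_mod_cast h.pos
  obtain ⟨A, Θ, hA, hΘ, hAY, hΘT⟩ := h.exists_extension H
  have hmem := fun t (ht : t ∈ Ico 0 b) => mem_ivl_coe b ht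
  have hpart := fun t (ht : t ∈ Ico 0 b) => h.part t ht.1 (hmem t ht).2
  have hcase : ∀ t ∈ Icc 0 b, t ∈ Ico 0 b ∨ t = b := fun t ht =>
    ht.2.lt_or_eq.imp (fun h => ⟨ht.1, h⟩) id
  have hsafe0 : ∀ t ∈ Ico 0 b, (t, A t) ∈ safeI r p C := fun t ht => by
    rw [hAY t ht]; exact (h.safe (hmem t ht)).1
  have hsafeb : (b, A b) ∈ safeI r p C := by
    refine H.mem_safeI_of_margins hb hA.continuousOn hsafe0 (fun i j hj => ?_) ?_
    · obtain ⟨ε, hε, hm⟩ := h.exists_stErr_margin H i hj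
      exact ⟨ε, hε, fun t ht => by rw [hAY t ht]; exact hm t (hmem t ht)⟩
    · obtain ⟨ε, hε, hm⟩ := h.exists_stErrI_margin H
      exact ⟨ε, hε, fun t ht => by rw [hAY t ht]; exact hm t (hmem t ht)⟩
  have hsafe : ∀ t ∈ Icc 0 b, (t, A t) ∈ safeI r p C := fun t ht => by
    rcases hcase t ht with h | h
    · exact hsafe0 t h
    · rw [h]; exact hsafeb
  -- Only the jets and the values of `T₂` have been extended by Lipschitz continuity. The last `p`
  -- components at `b` are recovered from the algebraic equation, whose solution is continuous in
  -- the extended data.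
  set V : ℝ → StateSpace r p := fun t => algState S C ((t, A t), Θ t) with hV
  have hVc : ContinuousOn V (Icc 0 b) := H.continuousOn_algState.comp
    ((continuous_id.prodMk hA).prodMk hΘ).continuousOn fun t ht => hsafe t ht
  have hVY : ∀ t ∈ Ico 0 b, V t = Y t := by
    intro t ht
    rw [(hpart t ht).eq_algState H ⟨ht.1, le_rfl⟩, ← hΘT t ht, ← algState_withII S C t (Y t) 0,
      ← hAY t ht]
  set Y' : ℝ → StateSpace r p := fun t => open Classical in if t < b then Y t else V b with hY'
  have hY'Y : ∀ t, t < b → Y' t = Y t := fun t ht => if_pos ht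
  have hY'V : EqOn Y' V (Icc 0 b) := fun t ht => by
    rcases hcase t ht with h | h
    · rw [hY'Y t h.2, hVY t h]
    · rw [h]; exact if_neg (lt_irrefl b)
  have heq0 : EqOn Y' Y (Icc (-S.h) 0) := fun t ht => hY'Y t (ht.2.trans_lt hb)
  have hY'c : ContinuousOn Y' (Icc (-S.h) b) := by
    refine ((((h.part 0 le_rfl h.pos).cont.congr heq0).union_of_isClosed (hVc.congr hY'V)
      isClosed_Icc isClosed_Icc)).mono fun t ht => ?_
    rcases le_total t 0 with h0 | h0
    exacts [Or.inl ⟨ht.1, h0⟩, Or.inr ⟨h0, ht.2⟩]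
  have hζ := continuousOn_stopAt (H.neg_h_le hb.le) hY'c
  have hζY' : EqOn (stopAt b Y') Y' (Icc (-S.h) b) := fun u hu => stopAt_of_le hu.2
  have hζY : ∀ t ∈ Ico 0 b, EqOn (stopAt b Y') Y (Icc (-S.h) t) := fun t ht u hu => by
    rw [stopAt_of_le (hu.2.trans ht.2.le), hY'Y u (hu.2.trans_lt ht.2)]
  have hY'c0 : ContinuousOn Y' (Icc 0 b) := hY'c.mono H.Icc_subset_of_neg_h
  have hT : EqOn (S.T₂ fun u => outOf hr (stopAt b Y' u)) Θ (Icc 0 b) := by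
    refine eqOn_Icc_of_eqOn_Ico hb ((H.sys.T₂_mem.continuousOn (continuousOn_outOf hr hζ)).mono
      Icc_subset_Ici_self) hΘ.continuousOn fun t ht => ?_
    rw [hΘT t ht]
    refine H.T₂_eqOn hζ ((hpart t ht).continuousOn_stopped H) ht.1 (fun u hu => ?_) ⟨ht.1, le_rfl⟩
    rw [hζY t ht hu, stopAt_of_le hu.2]
  have halgb : stErrII C (b, Y' b) = algErr S C (b, Y' b) (Θ b) := by
    rw [hY'V ⟨hb.le, le_rfl⟩]
    simp only [hV, algState]
    rw [stErrII_withII, algErr_withII]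
  have hsafeY : ∀ t ∈ Icc 0 b, (t, Y' t) ∈ FunnelControl.safe r p C := by
    intro t ht
    rcases hcase t ht with h' | h'
    · rw [hY'Y t h'.2]; exact h.safe (hmem t h')
    · rw [h']
      refine ⟨?_, (H.algEq_of_eq_algErr hb.le halgb).1⟩
      rw [hY'V ⟨hb.le, le_rfl⟩]
      exact hsafeb
  refine ⟨Y', PartialSol.of_extension H hb.le hζ hζY'
    (fun u hu => (heq0 hu).trans ((h.part 0 le_rfl h.pos).init hu)) (fun i j hj => ?_) hsafeY
    (fun i j hj => ?_) (fun t ht => ?_), fun t ht => hY'Y t (by exact_mod_cast ht.2)⟩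
  · refine hasDerivWithinAt_Icc_concat (b := 0) (fun t ht => ?_) (fun t ht => ?_)
    · rw [heq0 ht]
      exact ((h.part 0 le_rfl h.pos).chain i j hj t ht).congr (fun u hu => by rw [heq0 hu])
        (by rw [heq0 ht])
    · have hf : ContinuousOn (fun t => Y' t (Sum.inl ⟨i, ⟨j, by omega⟩⟩)) (Icc 0 b) :=
        (EuclideanSpace.proj (𝕜 := ℝ) _).continuous.comp_continuousOn hY'c0
      have hk : ContinuousOn (fun t => Y' t (Sum.inl ⟨i, ⟨j + 1, hj⟩⟩)) (Icc 0 b) :=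
        (EuclideanSpace.proj (𝕜 := ℝ) _).continuous.comp_continuousOn hY'c0
      have hki : IntervalIntegrable (fun t => Y' t (Sum.inl ⟨i, ⟨j + 1, hj⟩⟩)) volume 0 b :=
        ContinuousOn.intervalIntegrable (by rwa [uIcc_of_le hb.le])
      -- The integral identity passes to the closed interval by continuity and then gives the
      -- one-sided derivative at `b`.
      refine hasDerivWithinAt_Icc_of_eq_primitive (c := Y' 0 (Sum.inl ⟨i, ⟨j, by omega⟩⟩))
        (f := fun t => Y' t (Sum.inl ⟨i, ⟨j, by omega⟩⟩))
        (k := fun t => Y' t (Sum.inl ⟨i, ⟨j + 1, hj⟩⟩)) hk (eqOn_Icc_of_eqOn_Ico hb hf ?_ ?_) ht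
      · refine continuousOn_const.add ?_
        have := intervalIntegral.continuousOn_primitive_interval' hki left_mem_uIcc
        rwa [uIcc_of_le hb.le] at this
      · intro u hu
        have hsubu : Icc 0 u ⊆ Icc 0 b := Icc_subset_Icc_right hu.2.le
        have := intervalIntegral.integral_eq_sub_of_hasDerivAt_of_le hu.1 (hf.mono hsubu)
          (fun v hv => ?_) (hki.mono_set (by
            rw [uIcc_of_le hu.1, uIcc_of_le hb.le]; exact hsubu))
        · linarith
        · have hv' : v ∈ ivl 0 (b : EReal) := hmem v ⟨hv.1.le, hv.2.trans hu.2⟩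
          rw [hY'Y v (hv.2.trans hu.2)]
          refine (hasDerivAt_of_ivl hv.1 ((h.isJetState H).chain i j hj v hv')).congr_of_eventuallyEq ?_
          filter_upwards [Iio_mem_nhds (hv.2.trans hu.2)] with w hw
          rw [hY'Y w hw]
  · have hint : IntervalIntegrable (rhs S C (stopAt b Y')) volume 0 b :=
      H.intervalIntegrable_rhs hζ (fun t ht => by
        rw [stopAt_of_le ht.2]; exact (hsafeY t ht).1) ⟨le_rfl, hb.le⟩ ⟨hb.le, le_rfl⟩
    refine eqOn_Icc_of_eqOn_Ico hb
      ((EuclideanSpace.proj (𝕜 := ℝ) _).continuous.comp_continuousOn hY'c0) ?_ fun t ht => ?_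
    · refine continuousOn_const.add ?_
      have := intervalIntegral.continuousOn_primitive_interval'
        (IntervalIntegrable.apply_euclidean i hint) left_mem_uIcc
      rwa [uIcc_of_le hb.le] at this
    · beta_reduce
      rw [hY'Y t ht.2, hY'Y 0 hb]
      exact (hpart t ht).top_of H le_rfl hζ (hζY t ht) i j hj t ⟨ht.1, le_rfl⟩
  · rcases hcase t ht with h' | h'
    · rw [hY'Y t h'.2]
      exact (hpart t h').alg_of H h'.1 le_rfl hζ (hζY t h') t ⟨h'.1, le_rfl⟩
    · rw [h', hT ⟨hb.le, le_rfl⟩]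
      exact (H.algEq_of_eq_algErr hb.le halgb).2

end OpenSol

end States


/-! ### Global continuation -/

section States

variable {q p s k : ℕ} {r : Fin q → ℕ} {S : System r p s k} {C : Controller q p} {α : ℝ}
  {D : InitialData q p} {Y : ℝ → StateSpace r p} {hr : ∀ i, 0 < r i} {t₀ : ℝ}

/-- `b` is a continuation of `a`, where pairs `(t, Y)` are functions on `[-h, t]`. -/
def IsContinuation (h : ℝ) {X : Type*} (a b : ℝ × (ℝ → X)) : Prop :=
  a.1 ≤ b.1 ∧ EqOn b.2 a.2 (Icc (-h) a.1)

lemma IsContinuation.trans {h : ℝ} {X : Type*} {a b c : ℝ × (ℝ → X)} (hab : IsContinuation h a b)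
    (hbc : IsContinuation h b c) : IsContinuation h a c :=
  ⟨hab.1.trans hbc.1, fun _ ht => (hbc.2 ⟨ht.1, ht.2.trans hab.1⟩).trans (hab.2 ht)⟩

/-- The function defined by a chain of continuations. -/
noncomputable def chainUnion {X : Type*} [Inhabited X] (c : Set (ℝ × (ℝ → X))) (t : ℝ) : X :=
  open Classical in if h : ∃ a ∈ c, t ≤ a.1 then h.choose.2 t else default

lemma chainUnion_eqOn {h : ℝ} {X : Type*} [Inhabited X] {c : Set (ℝ × (ℝ → X))}
    (hc : ∀ a ∈ c, ∀ b ∈ c, IsContinuation h a b ∨ IsContinuation h b a) {a : ℝ × (ℝ → X)}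
    (ha : a ∈ c) : EqOn (chainUnion c) a.2 (Icc (-h) a.1) := by
  intro t ht
  have hex : ∃ a ∈ c, t ≤ a.1 := ⟨a, ha, ht.2⟩
  rw [chainUnion, dif_pos hex]
  obtain ⟨h1, h2⟩ := hex.choose_spec
  rcases hc _ h1 a ha with h' | h'
  · exact (h'.2 ⟨ht.1, h2⟩).symm
  · exact h'.2 ht

/-- Every solution on a compact interval can be continued to a global solution. -/
theorem PartialSol.exists_global (h : PartialSol hr S C D t₀ Y) (H : Feasible S C α) :
    ∃ Y', OpenSol hr S C D ⊤ Y' ∧ EqOn Y' Y (Icc (-S.h) t₀) := by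
  -- Zorn's lemma. If there is no global continuation, every chain has an upper bound: an unbounded
  -- chain would glue to a global solution, and a bounded one closes up at its supremum. A maximal
  -- element then contradicts local continuation.
  by_contra hno
  let P := {a : ℝ × (ℝ → StateSpace r p) // PartialSol hr S C D a.1 a.2 ∧
    IsContinuation S.h (t₀, Y) a}
  have hbdd : ∀ c : Set P, IsChain (fun a b : P => IsContinuation S.h a.1 b.1) c →
      ∃ ub : P, ∀ a ∈ c, IsContinuation S.h a.1 ub.1 := by
    intro c hc
    rcases c.eq_empty_or_nonempty with rfl | ⟨a₀, ha₀⟩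
    · exact ⟨⟨(t₀, Y), h, le_rfl, fun _ _ => rfl⟩, by simp⟩
    set c' : Set (ℝ × (ℝ → StateSpace r p)) := Subtype.val '' c with hc'
    have hcmp : ∀ a ∈ c', ∀ b ∈ c', IsContinuation S.h a b ∨ IsContinuation S.h b a := by
      rintro _ ⟨a, ha, rfl⟩ _ ⟨b, hb, rfl⟩
      by_cases hab : a = b
      · subst hab; exact Or.inl ⟨le_rfl, fun _ _ => rfl⟩
      · exact hc ha hb hab
    have hU : ∀ a ∈ c', PartialSol hr S C D a.1 (chainUnion c') := by
      rintro _ ⟨a, ha, rfl⟩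
      exact a.2.1.congr H (chainUnion_eqOn hcmp ⟨a, ha, rfl⟩)
    have hUY : EqOn (chainUnion c') Y (Icc (-S.h) t₀) := fun t ht =>
      (chainUnion_eqOn hcmp ⟨a₀, ha₀, rfl⟩ ⟨ht.1, ht.2.trans a₀.2.2.1⟩).trans (a₀.2.2.2 ht)
    by_cases hB : BddAbove (Prod.fst '' c')
    swap
    · refine absurd ⟨chainUnion c', ⟨by simp, fun b hb0 _ => ?_⟩, hUY⟩ hno
      obtain ⟨_, ⟨a, ha, rfl⟩, hba⟩ := not_bddAbove_iff.1 hB b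
      exact (hU a ha).mono H hb0 hba.le
    have hne : (Prod.fst '' c').Nonempty := ⟨_, _, ⟨a₀, ha₀, rfl⟩, rfl⟩
    set b := sSup (Prod.fst '' c') with hb
    have hle : ∀ a ∈ c', a.1 ≤ b := fun a ha => le_csSup hB ⟨a, ha, rfl⟩
    have hub : ∃ Y', PartialSol hr S C D b Y' ∧ ∀ a ∈ c', EqOn Y' a.2 (Icc (-S.h) a.1) := by
      by_cases hmax : ∃ a ∈ c', a.1 = b
      · obtain ⟨a, ha, hab⟩ := hmax
        exact ⟨chainUnion c', hab ▸ hU a ha, fun a' ha' => chainUnion_eqOn hcmp ha'⟩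
      · have hlt : ∀ a ∈ c', a.1 < b := fun a ha =>
          lt_of_le_of_ne (hle a ha) fun h => hmax ⟨a, ha, h⟩
        have hop : OpenSol hr S C D (b : EReal) (chainUnion c') := by
          refine ⟨?_, fun t ht0 ht => ?_⟩
          · exact_mod_cast a₀.2.1.nonneg.trans_lt (hlt _ ⟨a₀, ha₀, rfl⟩)
          · obtain ⟨_, ⟨a, ha, rfl⟩, hta⟩ := exists_lt_of_lt_csSup hne (EReal.coe_lt_coe_iff.1 ht)
            exact (hU a ha).mono H ht0 hta.le
        obtain ⟨Y', hY', he⟩ := hop.exists_closure H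
        refine ⟨Y', hY', fun a ha t ht => ?_⟩
        rw [he ⟨ht.1, EReal.coe_lt_coe_iff.2 (ht.2.trans_lt (hlt a ha))⟩]
        exact chainUnion_eqOn hcmp ha ht
    obtain ⟨Y', hY', he⟩ := hub
    have hcont : ∀ a ∈ c', IsContinuation S.h a (b, Y') := fun a ha => ⟨hle a ha, he a ha⟩
    exact ⟨⟨(b, Y'), hY', a₀.2.2.trans (hcont _ ⟨a₀, ha₀, rfl⟩)⟩,
      fun a ha => hcont _ ⟨a, ha, rfl⟩⟩
  obtain ⟨m, hm⟩ := exists_maximal_of_chains_bounded hbdd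
    fun {a b c} (hab : IsContinuation S.h a.1 b.1) hbc => hab.trans hbc
  obtain ⟨t₁, ht₁, Y', hY', he⟩ := m.2.1.exists_continuation H
  have hmc : IsContinuation S.h m.1 (t₁, Y') := ⟨ht₁.le, he⟩
  exact absurd (hm ⟨(t₁, Y'), hY', m.2.2.trans hmc⟩ hmc).1 (not_le.2 ht₁)

end States


/-! ### Lipschitz continuity of the solution of the algebraic equation -/

lemma HasWeakDeriv.integrable_smul {E : Type*} [NormedAddCommGroup E] [NormedSpace ℝ E] {U : Set ℝ}
    {f : ℝ → E} (hf : LocallyIntegrableOn f U) {θ : ℝ → ℝ} (hθ : Continuous θ)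
    (hθc : HasCompactSupport θ) (hθU : tsupport θ ⊆ U) : Integrable fun t => θ t • f t := by
  have h1 : IntegrableOn f (tsupport θ) := hf.integrableOn_compact_subset hθU hθc
  have h2 : IntegrableOn (fun t => θ t • f t) (tsupport θ) :=
    h1.continuousOn_smul hθ.continuousOn hθc
  exact (integrableOn_iff_integrable_of_support_subset
    ((Function.support_smul_subset_left θ f).trans (subset_tsupport θ))).1 h2

lemma HasWeakDeriv.apply {ι : Type*} [Fintype ι] {U : Set ℝ} {f g : ℝ → EuclideanSpace ℝ ι}
    (h : HasWeakDeriv U f g) (i : ι) : HasWeakDeriv U (fun t => f t i) (fun t => g t i) := by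
  have hint : ∀ f : ℝ → EuclideanSpace ℝ ι, LocallyIntegrableOn f U →
      LocallyIntegrableOn (fun t => f t i) U := fun f hf t ht => by
    obtain ⟨V, hV, hi⟩ := hf t ht
    exact ⟨V, hV, (EuclideanSpace.proj (𝕜 := ℝ) i).integrable_comp hi⟩
  refine ⟨hint f h.left, hint g h.right, fun θ hθ hθc hθU => ?_⟩
  have hp := h.parts θ hθ hθc hθU
  have h1 : Integrable fun t => deriv θ t • f t := by
    refine HasWeakDeriv.integrable_smul h.left (hθ.continuous_deriv (by simp)) hθc.deriv ?_
    exact tsupport_deriv_subset.trans (hθU.trans interior_subset)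
  have h2 : Integrable fun t => θ t • g t :=
    HasWeakDeriv.integrable_smul h.right hθ.continuous hθc (hθU.trans interior_subset)
  have h3 := congrArg (EuclideanSpace.proj (𝕜 := ℝ) i) hp
  rw [map_neg, ← ContinuousLinearMap.integral_comp_comm _ h1,
    ← ContinuousLinearMap.integral_comp_comm _ h2] at h3
  exact h3

lemma MemWinf.apply {ι : Type*} [Fintype ι] {n : ℕ} {f : ℝ → EuclideanSpace ℝ ι}
    (h : MemWinf n f) (i : ι) : MemWinf n fun t => f t i := by
  obtain ⟨g, rfl, hg, hd⟩ := h
  exact ⟨fun j t => g j t i, rfl, fun j hj => (EuclideanSpace.proj (𝕜 := ℝ) i).comp_memLp' (hg j hj),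
    fun j hj => (hd j hj).apply i⟩

lemma MemWinf.exists_lipschitz_real {f : ℝ → ℝ} (h : MemWinf 1 f) (hc : ContinuousOn f (Ici 0))
    (b : ℝ) : ∃ K, LipschitzOnWith K f (Icc 0 b) := by
  obtain ⟨G, g, rfl, -, -, -, hg, hG⟩ := h.exists_derivs 0 hc
  obtain ⟨M, hM0, hM⟩ := hg.ae_bound
  refine ⟨_, lipschitzOnWith_of_eq_primitive (by
    filter_upwards [hM] with u hu hu' using hu hu'.1) hM0 (fun t ht => ?_) fun t ht => hG t ht.1⟩
  exact (hg.locallyIntegrableOn.integrableOn_compact_subset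
      (by rw [uIcc_of_le ht.1]; exact Icc_subset_Ici_self) isCompact_uIcc).intervalIntegrable

lemma MemWinf.exists_lipschitz {ι : Type*} [Fintype ι] {f : ℝ → EuclideanSpace ℝ ι}
    (h : MemWinf 1 f) (hc : ContinuousOn f (Ici 0)) (b : ℝ) :
    ∃ K, LipschitzOnWith K f (Icc 0 b) :=
  lipschitzOnWith_euclidean fun i => (h.apply i).exists_lipschitz_real
    ((EuclideanSpace.proj (𝕜 := ℝ) i).continuous.comp_continuousOn hc) b

lemma FunnelFunction.exists_lipschitz {n : ℕ} {φ : ℝ → ℝ} (hφ : FunnelFunction n φ) (hn : 1 ≤ n)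
    (b : ℝ) : ∃ K, LipschitzOnWith K φ (Icc 0 b) := by
  obtain ⟨c, hc0, hc⟩ := hφ.exists_deriv hn
  exact ⟨_, lipschitzOnWith_of_hasDerivWithinAt (ω := ⊤) (fun t ht => (hc t ht.1).1)
    (EReal.coe_lt_top b) hc0.le fun t ht => (hc t ht.1).2⟩

lemma contDiffAt_gainMap_comp {X E : Type*} [NormedAddCommGroup X] [NormedSpace ℝ X]
    [NormedAddCommGroup E] [InnerProductSpace ℝ E] {φ : X → ℝ} {e : X → E} {x : X}
    (hφ : ContDiffAt ℝ 1 φ x) (he : ContDiffAt ℝ 1 e x) (hx : φ x ^ 2 * ‖e x‖ ^ 2 < 1) :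
    ContDiffAt ℝ 1 (fun x => gainMap (φ x) (e x)) x := by
  unfold gainMap
  exact (contDiffAt_const.div (contDiffAt_const.sub ((hφ.pow 2).mul (he.norm_sq ℝ)))
    (by linarith)).smul he

lemma contDiffAt_gainInv_comp {X E : Type*} [NormedAddCommGroup X] [NormedSpace ℝ X]
    [NormedAddCommGroup E] [InnerProductSpace ℝ E] {φ : X → ℝ} {e : X → E} {x : X}
    (hφ : ContDiffAt ℝ 1 φ x) (he : ContDiffAt ℝ 1 e x) :
    ContDiffAt ℝ 1 (fun x => gainInv (φ x) (e x)) x :=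
  ContDiffAt.comp (g := fun z : ℝ × E => gainInv z.1 z.2) (f := fun x => (φ x, e x)) x
    contDiff_gainInv.contDiffAt (hφ.prodMk he)

lemma contDiffAt_mulVec {X ι κ : Type*} [NormedAddCommGroup X] [NormedSpace ℝ X] [Fintype ι]
    [Fintype κ] {A : X → Matrix ι κ ℝ} {v : X → EuclideanSpace ℝ κ} {x : X}
    (hA : ∀ i j, ContDiffAt ℝ 1 (fun x => A x i j) x) (hv : ContDiffAt ℝ 1 v x) :
    ContDiffAt ℝ 1 (fun x => (WithLp.toLp 2 (A x *ᵥ ⇑(v x)) : EuclideanSpace ℝ ι)) x := by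
  rw [contDiffAt_euclidean]
  intro i
  simp only [Matrix.mulVec, dotProduct]
  exact ContDiffAt.sum fun j _ => (hA i j).mul (contDiffAt_euclidean.1 hv j)

/-- Fixed points of a parametrized contraction depend in a Lipschitz continuous way on the
parameter. -/
lemma exists_lipschitz_fixedPt {P E : Type*} [NormedAddCommGroup P] [NormedSpace ℝ P]
    [NormedAddCommGroup E] [NormedSpace ℝ E] {F : P × E → E} {q L : NNReal}
    (hq : q < 1) {a : ℝ → P} {e : ℝ → E} {b : ℝ} (hF : ∀ t ∈ Icc 0 b, ContDiffAt ℝ 1 F (a t, e t))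
    (hK : ∀ t ∈ Icc 0 b, LipschitzWith q fun x => F (a t, x))
    (hfix : ∀ t ∈ Icc 0 b, F (a t, e t) = e t) (ha : LipschitzOnWith L a (Icc 0 b))
    (he : ContinuousOn e (Icc 0 b)) : ∃ K, LipschitzOnWith K e (Icc 0 b) := by
  have hq' : (0 : ℝ) < 1 - q := by rw [sub_pos]; exact_mod_cast hq
  refine LocallyLipschitzOn.exists_lipschitzOnWith_of_compact isCompact_Icc fun t ht => ?_
  -- Near `(a t, e t)` the map `F` is `K`-Lipschitz, and continuity of `e` keeps the pairs `(a v, e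
  -- u)` there. The a posteriori estimate for `F (a v, ·)` at the point `e u = F (a u, e u)` then
  -- yields the constant `K L / (1 - q)`.
  obtain ⟨K, U, hU, hKU⟩ := (hF t ht).exists_lipschitzOnWith
  obtain ⟨U₁, hU₁, U₂, hU₂, hUU⟩ := mem_nhds_prod_iff.1 hU
  have hV : {u | a u ∈ U₁ ∧ e u ∈ U₂ ∧ u ∈ Icc 0 b} ∈ 𝓝[Icc 0 b] t := by
    filter_upwards [ha.continuousOn t ht hU₁, he t ht hU₂, self_mem_nhdsWithin] with u h1 h2 h3
    exact ⟨h1, h2, h3⟩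
  refine ⟨((K * L) / (1 - q) : ℝ).toNNReal, _, hV,
    LipschitzOnWith.of_dist_le_mul fun u hu v hv => ?_⟩
  have h1 := dist_fixed_le hq (hK v hv.2.2) (hfix v hv.2.2) (e u)
  have h2 : dist (e u) (F (a v, e u)) ≤ K * (L * dist u v) := calc
    dist (e u) (F (a v, e u)) = dist (F (a u, e u)) (F (a v, e u)) := by rw [hfix u hu.2.2]
    _ ≤ K * dist (a u, e u) (a v, e u) :=
      hKU.dist_le_mul _ (hUU ⟨hu.1, hu.2.1⟩) _ (hUU ⟨hv.1, hu.2.1⟩)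
    _ ≤ K * (L * dist u v) := by
      gcongr
      rw [Prod.dist_eq, dist_self, max_eq_left dist_nonneg]
      exact ha.dist_le_mul u hu.2.2 v hv.2.2
  refine h1.trans ?_
  rw [Real.coe_toNNReal _ (by positivity), div_mul_eq_mul_div]
  gcongr
  rw [mul_assoc]
  exact h2

section States

variable {q p s k : ℕ} {r : Fin q → ℕ} {S : System r p s k} {C : Controller q p} {α : ℝ}
  {D : InitialData q p} {Y : ℝ → StateSpace r p} {ω : EReal} {hr : ∀ i, 0 < r i} {b : ℝ}

/-- The quantities on which the algebraic equation depends. -/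
abbrev AlgParam {q : ℕ} (r : Fin q → ℕ) (p s k : ℕ) :=
  (ℝ × CoeffSpace s k × StateSpace r p) × (CoeffSpace s k × CoeffSpace s k) ×
    (ℝ × EuclideanSpace ℝ (Fin q))

/-- The contraction defining the solution of the algebraic equation, as a function of its
parameters. -/
noncomputable def algFun (S : System r p s k) (C : Controller q p)
    (w : AlgParam r p s k × EuclideanSpace ℝ (Fin p)) : EuclideanSpace ℝ (Fin p) :=
  gainInv w.1.1.1 ((C.kHat * S.f₄ w.1.1.2.1)⁻¹ • (S.f₂ (w.1.1.2.2 + inclII r p w.2)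
    + S.f₃ w.1.2.1.1 + WithLp.toLp 2 (S.ΓII w.1.2.1.2 *ᵥ ⇑(-gainMap w.1.2.2.1 w.1.2.2.2))))

/-- The parameters of the algebraic equation along a trajectory. -/
noncomputable def algParam (S : System r p s k) (C : Controller q p) (z : ℝ × StateSpace r p)
    (θ : EuclideanSpace ℝ (Fin k)) : AlgParam r p s k :=
  ((C.φII z.1, (S.d₅ z.1, θ), withII z.2 0 + inclII r p (C.refII z.1)),
    ((S.d₃ z.1, θ), (S.d₄ z.1, θ)), (C.φI z.1, stErrI C z))

/-- Time enters the algebraic equation through functions that are merely Lipschitz. Separating them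
as parameters leaves a map that is `C¹` wherever the parameters for `e_I` lie in the funnel. -/
lemma algMap_eq_algFun (S : System r p s k) (C : Controller q p) (z : ℝ × StateSpace r p)
    (θ : EuclideanSpace ℝ (Fin k)) (e : EuclideanSpace ℝ (Fin p)) :
    algMap S C z θ e = algFun S C (algParam S C z θ, e) := by
  simp only [algMap, algFun, algParam, algRhs]
  rw [withII_eq, map_add, add_comm (inclII r p e), ← add_assoc]
  rfl

lemma Feasible.contDiffAt_algFun_comp (H : Feasible S C α) {X : Type*} [NormedAddCommGroup X]
    [NormedSpace ℝ X] {φ₁ φ₂ : X → ℝ} {c₃ c₄ c₅ : X → CoeffSpace s k} {Z : X → StateSpace r p}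
    {e : X → EuclideanSpace ℝ (Fin q)} {x : X} (hφ₁ : ContDiffAt ℝ 1 φ₁ x)
    (hφ₂ : ContDiffAt ℝ 1 φ₂ x) (h₃ : ContDiffAt ℝ 1 c₃ x) (h₄ : ContDiffAt ℝ 1 c₄ x)
    (h₅ : ContDiffAt ℝ 1 c₅ x) (hZ : ContDiffAt ℝ 1 Z x) (he : ContDiffAt ℝ 1 e x)
    (hx : φ₁ x ^ 2 * ‖e x‖ ^ 2 < 1) :
    ContDiffAt ℝ 1 (fun x => gainInv (φ₂ x) ((C.kHat * S.f₄ (c₅ x))⁻¹ • (S.f₂ (Z x)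
      + S.f₃ (c₃ x) + WithLp.toLp 2 (S.ΓII (c₄ x) *ᵥ ⇑(-gainMap (φ₁ x) (e x)))))) x := by
  have hΓ := contDiffAt_mulVec (fun i j => (H.sys.ΓII_contDiff i j).contDiffAt.comp x h₄)
    (contDiffAt_gainMap_comp hφ₁ he hx).neg
  have h2 := H.sys.f₂_contDiff.contDiffAt.comp x hZ
  have h3 := H.sys.f₃_contDiff.contDiffAt.comp x h₃
  have h4 : ContDiffAt ℝ 1 (fun x => (C.kHat * S.f₄ (c₅ x))⁻¹) x :=
    ContDiffAt.inv (contDiffAt_const.mul (H.sys.f₄_contDiff.contDiffAt.comp x h₅)) (H.kf₄_pos _).ne'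
  exact contDiffAt_gainInv_comp hφ₂ (h4.smul ((h2.add h3).add hΓ))

lemma Feasible.contDiffAt_algFun (H : Feasible S C α)
    {w : AlgParam r p s k × EuclideanSpace ℝ (Fin p)}
    (hw : w.1.2.2.1 ^ 2 * ‖w.1.2.2.2‖ ^ 2 < 1) : ContDiffAt ℝ 1 (algFun S C) w := by
  unfold algFun
  have h11 : ContDiffAt ℝ 1 (fun w : AlgParam r p s k × EuclideanSpace ℝ (Fin p) => w.1.1) w :=
    contDiffAt_fst.fst
  have h12 : ContDiffAt ℝ 1 (fun w : AlgParam r p s k × EuclideanSpace ℝ (Fin p) => w.1.2) w :=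
    contDiffAt_fst.snd
  exact H.contDiffAt_algFun_comp h12.snd.fst h11.fst h12.fst.fst h12.fst.snd h11.snd.fst
    (h11.snd.snd.add ((inclII r p).contDiff.contDiffAt.comp w contDiffAt_snd)) h12.snd.snd hw

namespace OpenSol

lemma exists_lipschitz_algParam (h : OpenSol hr S C D ω Y) (H : Feasible S C α) (hb0 : 0 ≤ b)
    (hb : (b : EReal) < ω) : ∃ K, LipschitzOnWith K (fun t => algParam S C (t, Y t)
      (S.T₂ (fun u => outOf hr (stopAt b Y u)) t)) (Icc 0 b) := by
  have hsub : Icc 0 b ⊆ ivl 0 ω := Icc_subset_ivl le_rfl hb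
  obtain ⟨K₂, M, hKM⟩ := h.exists_T₂_bound H
  have hT : LipschitzOnWith K₂ (S.T₂ fun u => outOf hr (stopAt b Y u)) (Icc 0 b) :=
    (hKM b hb0 hb).1.mono fun u hu => hu.1
  obtain ⟨W, hW⟩ := h.exists_stErrI_deriv H
  obtain ⟨K₀, h0⟩ := (hW b hb0 hb).1
  obtain ⟨K₃, h3⟩ := H.sys.d₃_mem.exists_lipschitz H.sys.d₃_cont b
  obtain ⟨K₄, h4⟩ := H.sys.d₄_mem.exists_lipschitz H.sys.d₄_cont b
  obtain ⟨K₅, h5⟩ := H.sys.d₅_mem.exists_lipschitz H.sys.d₅_cont b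
  obtain ⟨K₆, h6⟩ := H.ctrl.φI_mem.exists_lipschitz le_rfl b
  obtain ⟨K₇, h7⟩ := H.ctrl.φII_mem.exists_lipschitz le_rfl b
  obtain ⟨K₈, h8⟩ : ∃ K, LipschitzOnWith K C.refII (Icc 0 b) :=
    lipschitzOnWith_euclidean fun i => (H.ctrl.yrefII_mem i).exists_lipschitz_real
      ((EuclideanSpace.proj (𝕜 := ℝ) (Sum.inr i : Fin q ⊕ Fin p)).continuous.comp_continuousOn
        H.ctrl.yref_cont) b
  obtain ⟨K₉, h9⟩ : ∃ K, LipschitzOnWith K (fun t => withII (Y t) 0) (Icc 0 b) :=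
    lipschitzOnWith_euclidean fun x => by
      rcases x with ij | i
      · obtain ⟨K, hK⟩ := h.exists_lipschitz_inl H ij
        exact ⟨K, hK.mono hsub⟩
      · exact ⟨0, (LipschitzWith.const (0 : ℝ)).lipschitzOnWith⟩
  exact ⟨_, (h7.prodMk ((h5.prodMk hT).prodMk
    (h9.add ((inclII r p).lipschitz.comp_lipschitzOnWith h8)))).prodMk
    (((h3.prodMk hT).prodMk (h4.prodMk hT)).prodMk (h6.prodMk h0))⟩

/-- The solution of the algebraic equation is locally Lipschitz continuous. -/
lemma exists_lipschitz_stErrII (h : OpenSol hr S C D ω Y) (H : Feasible S C α) (hb0 : 0 ≤ b)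
    (hb : (b : EReal) < ω) :
    ∃ K, LipschitzOnWith K (fun t => stErrII C (t, Y t)) (Icc 0 b) := by
  have hsub : Icc 0 b ⊆ ivl 0 ω := Icc_subset_ivl le_rfl hb
  have hP := h.part b hb0 hb
  obtain ⟨L, hL⟩ := h.exists_lipschitz_algParam H hb0 hb
  refine exists_lipschitz_fixedPt H.algConst_lt_one (F := algFun S C) (fun t ht => ?_)
    (fun t ht => ?_) (fun t ht => ?_) hL (H.continuousOn_stErrII.comp
      ((h.continuousOn_pair H).mono hsub) fun t ht => ht.1)
  · refine H.contDiffAt_algFun ?_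
    have := H.one_sub_pos_of_safeI (hP.safe t ht).1
    simp only [algParam]
    linarith
  · simp only [← algMap_eq_algFun]
    exact H.lipschitzWith_algMap _ _
  · rw [← algMap_eq_algFun, hP.stErrII_eq H ht]
    exact H.algErr_eq _ _

end OpenSol

end States


/-! ### From states to solutions -/

lemma uniqueDiffOn_ivl {a : ℝ} {ω : EReal} (h : (a : EReal) < ω) : UniqueDiffOn ℝ (ivl a ω) := by
  refine uniqueDiffOn_convex (ordConnected_ivl a ω).convex ?_
  obtain ⟨b, hab, hb⟩ := EReal.exists_between_coe_real h
  rw [interior_ivl]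
  exact ⟨b, EReal.coe_lt_coe_iff.1 hab, hb⟩

/-- Lipschitz functions are absolutely continuous, hence primitives of their almost everywhere
defined derivatives. -/
lemma hasWeakDeriv_of_lipschitz {f : ℝ → ℝ} {ω : EReal}
    (h : ∀ b : ℝ, 0 ≤ b → (b : EReal) < ω → ∃ K, LipschitzOnWith K f (Icc 0 b)) :
    HasWeakDeriv (ivl 0 ω) f (deriv f) := by
  have hac : ∀ b : ℝ, 0 ≤ b → (b : EReal) < ω → AbsolutelyContinuousOnInterval f 0 b :=
    fun b hb0 hb => by
      obtain ⟨K, hK⟩ := h b hb0 hb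
      rw [← uIcc_of_le hb0] at hK
      exact hK.absolutelyContinuousOnInterval
  refine hasWeakDeriv_of_eq_primitive (c := f 0)
    (locallyIntegrableOn_ivl fun t h0 ht => (hac t h0 ht).intervalIntegrable_deriv) fun t ht => ?_
  rw [(hac t ht.1 ht.2).integral_deriv_eq_sub]
  ring

section States

variable {q p s k : ℕ} {r : Fin q → ℕ} {S : System r p s k} {C : Controller q p} {α : ℝ}
  {D : InitialData q p} {Y : ℝ → StateSpace r p} {ω : EReal} {hr : ∀ i, 0 < r i}

lemma Feasible.neg_h_lt (H : Feasible S C α) (hω : 0 < ω) : ((-S.h : ℝ) : EReal) < ω :=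
  lt_of_le_of_lt (by exact_mod_cast neg_nonpos.2 H.sys.h_nonneg) hω

namespace OpenSol

/-- The `i`-th chain of derivatives of the state, continued by zero. -/
noncomputable def chainAt (Y : ℝ → StateSpace r p) (i : Fin q) (l : ℕ) (t : ℝ) : ℝ :=
  if hl : l < r i then Y t (Sum.inl ⟨i, ⟨l, hl⟩⟩) else 0

lemma chainAt_eq (Y : ℝ → StateSpace r p) (i : Fin q) {l : ℕ} (hl : l < r i) :
    chainAt Y i l = fun t => Y t (Sum.inl ⟨i, ⟨l, hl⟩⟩) := by
  funext t; rw [chainAt, dif_pos hl]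

lemma hasDerivWithinAt_chainAt (h : OpenSol hr S C D ω Y) (i : Fin q) :
    ∀ l < r i - 1, ∀ t ∈ ivl (-S.h) ω,
      HasDerivWithinAt (chainAt Y i l) (chainAt Y i (l + 1) t) (ivl (-S.h) ω) t := by
  intro l hl t ht
  rw [chainAt_eq Y i (by omega : l < r i), chainAt_eq Y i (by omega : l + 1 < r i)]
  exact (h.chain' i l (by omega) ht).mono fun u hu => hu.1

lemma iteratedDerivWithin_eq (h : OpenSol hr S C D ω Y) (H : Feasible S C α) (i : Fin q) {l : ℕ}
    (hl : l < r i) : EqOn (iteratedDerivWithin l (fun t => outOf hr (Y t) (Sum.inl i))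
      (ivl (-S.h) ω)) (fun t => Y t (Sum.inl ⟨i, ⟨l, hl⟩⟩)) (ivl (-S.h) ω) := by
  have h1 := eqOn_iteratedDerivWithin_of_chain (uniqueDiffOn_ivl (H.neg_h_lt h.pos))
    (h.hasDerivWithinAt_chainAt i) l (by omega)
  rwa [chainAt_eq Y i hl, chainAt_eq Y i (hr i)] at h1

lemma stateOf_eq (h : OpenSol hr S C D ω Y) (H : Feasible S C α) :
    EqOn (stateOf r S.h ω fun t => outOf hr (Y t)) Y (ivl (-S.h) ω) := by
  intro t ht
  ext x
  rcases x with ⟨i, j⟩ | i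
  · exact h.iteratedDerivWithin_eq H i j.2 ht
  · rfl

lemma continuousOn_apply (h : OpenSol hr S C D ω Y) (x : (Σ i : Fin q, Fin (r i)) ⊕ Fin p) :
    ContinuousOn (fun t => Y t x) (ivl (-S.h) ω) :=
  (EuclideanSpace.proj (𝕜 := ℝ) x).continuous.comp_continuousOn h.cont

lemma hasWeakDeriv_inr (h : OpenSol hr S C D ω Y) (H : Feasible S C α) (i : Fin p) :
    HasWeakDeriv (ivl 0 ω) (fun t => Y t (Sum.inr i)) (deriv fun t => Y t (Sum.inr i)) := by
  refine hasWeakDeriv_of_lipschitz fun b hb0 hb => ?_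
  obtain ⟨K, hK⟩ := h.exists_lipschitz_stErrII H hb0 hb
  obtain ⟨L, hL⟩ := (H.ctrl.yrefII_mem i).exists_lipschitz_real
    ((EuclideanSpace.proj (𝕜 := ℝ) (Sum.inr i : Fin q ⊕ Fin p)).continuous.comp_continuousOn
      H.ctrl.yref_cont) b
  have hf : (fun t => Y t (Sum.inr i))
      = fun t => stErrII C (t, Y t) i + C.yref t (Sum.inr i) :=
    funext fun t => (sub_add_cancel (Y t (Sum.inr i)) _).symm
  rw [hf]
  exact ⟨_, ((EuclideanSpace.proj (𝕜 := ℝ) i).lipschitz.comp_lipschitzOnWith hK).add hL⟩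

lemma inputI_eq (h : OpenSol hr S C D ω Y) (H : Feasible S C α) {t : ℝ} (ht : t ∈ ivl 0 ω) :
    C.inputI r (fun t => outOf hr (Y t)) t = stInputI C (t, Y t) := by
  have h1 := H.errI_eq_stErrI (h.isJetState H) (y := fun t => outOf hr (Y t)) (fun i t _ => rfl) ht
    (h.safe ht).1.1
  rw [Controller.inputI, Controller.gainI, h1]
  rfl

lemma ae_deriv_eq_rhs (h : OpenSol hr S C D ω Y) (H : Feasible S C α) {b : ℝ} (hb0 : 0 ≤ b)
    (hb : (b : EReal) < ω) (i : Fin q) (j : Fin (r i)) (hj : j.1 + 1 = r i) :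
    ∀ᵐ t, t ∈ Icc 0 b → deriv (fun t => Y t (Sum.inl ⟨i, j⟩)) t = rhs S C (stopAt b Y) t i := by
  have hP := h.part b hb0 hb
  have hi := H.intervalIntegrable_rhs (hP.continuousOn_stopped H) (b := b) (fun t ht => by
    rw [stopAt_of_le ht.2]; exact (hP.safe t ht).1) (left_mem_Icc.2 hb0) (right_mem_Icc.2 hb0)
  filter_upwards [ae_hasDerivAt_of_eq_primitive hb0 (IntervalIntegrable.apply_euclidean i hi)
    (hP.top i j hj)] with t ht ht'
  exact (ht ht').deriv

/-- A solution in terms of the state yields a solution of the closed-loop system. -/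
theorem isSolution (h : OpenSol hr S C D ω Y) (H : Feasible S C α) (hD : D.Admissible S.h r) :
    IsSolution S C D ω fun t => outOf hr (Y t) where
  pos := h.pos
  initial t ht := by
    rw [(h.part 0 le_rfl h.pos).init ht, Feasible.outOf_history hr hD]
  initial_jet i j hj := by
    rw [h.iteratedDerivWithin_eq H i hj ⟨H.neg_h_le le_rfl, h.pos⟩]
    simp only [(h.part 0 le_rfl h.pos).init ⟨H.neg_h_le le_rfl, le_rfl⟩, InitialData.history_zero]
    rfl
  contDiffI i := by
    have h1 := contDiffOn_of_chain (uniqueDiffOn_ivl (H.neg_h_lt h.pos))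
      (h.hasDerivWithinAt_chainAt i) fun l hl => by
        rw [chainAt_eq Y i (by have := hr i; omega : l < r i)]
        exact h.continuousOn_apply _
    rw [chainAt_eq Y i (hr i)] at h1
    exact_mod_cast h1
  contII i := h.continuousOn_apply _
  weakII i := ⟨_, h.hasWeakDeriv_inr H i⟩
  differential i := by
    have hlt : r i - 1 < r i := Nat.sub_lt (hr i) one_pos
    have hsub := ivl_subset (ω := ω) H
    refine ⟨deriv fun t => Y t (Sum.inl ⟨i, ⟨r i - 1, hlt⟩⟩), ?_, fun τ hτ0 hτ => ?_⟩
    · have h1 := hasWeakDeriv_of_lipschitz (f := fun t => Y t (Sum.inl ⟨i, ⟨r i - 1, hlt⟩⟩))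
        (ω := ω) fun b hb0 hb => by
          obtain ⟨K, hK⟩ := h.exists_lipschitz_inl H ⟨i, ⟨r i - 1, hlt⟩⟩
          exact ⟨K, hK.mono (Icc_subset_ivl le_rfl hb)⟩
      refine hasWeakDeriv_of_eq_primitive (c := Y 0 (Sum.inl ⟨i, ⟨r i - 1, hlt⟩⟩)) h1.right
        fun t ht => ?_
      rw [h.iteratedDerivWithin_eq H i hlt (hsub ht)]
      exact h1.eq_primitive ((h.continuousOn_apply _).mono hsub) ht
    · have hmem : Icc (-S.h) τ ⊆ ivl (-S.h) ω := Icc_subset_ivl le_rfl hτ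
      have hP := h.part τ hτ0.le hτ
      -- The two stopped trajectories agree on `[-h, ∞)` only, so the values of `T₁` are identified
      -- almost everywhere by causality.
      have he : EqOn (stopAt τ (stateOf r S.h ω fun t => outOf hr (Y t))) (stopAt τ Y)
          (Ici (-S.h)) := fun u hu =>
        h.stateOf_eq H (hmem ⟨le_min hu (H.neg_h_le hτ0.le), min_le_right _ _⟩)
      rw [ae_restrict_iff' measurableSet_Ico]
      filter_upwards [h.ae_deriv_eq_rhs H hτ0.le hτ i ⟨r i - 1, hlt⟩ (by simp; omega),
        H.sys.T₁_mem.ae_eq_of_eqOn_Ici ((hP.continuousOn_stopped H).congr he) (hP.continuousOn_stopped H)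
          he] with t h1 h2 ht
      rw [h1 (Ico_subset_Icc_self ht), h2 ht.1, rhs, stopAt_of_le ht.2.le,
        h.inputI_eq H (Icc_subset_ivl le_rfl hτ (Ico_subset_Icc_self ht))]
      rfl
  algebraic τ hτ0 hτ := by
    refine (ae_restrict_iff' measurableSet_Ico).2 (ae_of_all _ fun t ht => ?_)
    have ht' : t ∈ ivl 0 ω := Icc_subset_ivl le_rfl hτ (Ico_subset_Icc_self ht)
    rw [h.stateOf_eq H (ivl_subset H ht'), h.inputI_eq H ht']
    exact (h.part τ hτ0.le hτ).alg t (Ico_subset_Icc_self ht)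

end OpenSol

end States


/-! ### From solutions to states -/

section States

variable {q p s k : ℕ} {r : Fin q → ℕ} {S : System r p s k} {C : Controller q p} {α : ℝ}
  {D : InitialData q p} {y : ℝ → OutputSpace q p} {ω ω' : EReal} {hr : ∀ i, 0 < r i} {b : ℝ}

namespace IsSolution

lemma outOf_stateOf (hr : ∀ i, 0 < r i) (y : ℝ → OutputSpace q p) (h : ℝ) (ω : EReal) (t : ℝ) :
    outOf hr (stateOf r h ω y t) = y t := by
  ext x
  rcases x with i | i
  · simp [stateOf]
  · rfl

lemma uniqueDiffOn (h : IsSolution S C D ω y) (H : Feasible S C α) :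
    UniqueDiffOn ℝ (ivl (-S.h) ω) := uniqueDiffOn_ivl (H.neg_h_lt h.pos)

lemma continuousOn_stateOf (h : IsSolution S C D ω y) (H : Feasible S C α) :
    ContinuousOn (stateOf r S.h ω y) (ivl (-S.h) ω) := by
  refine (PiLp.continuous_toLp 2 _).comp_continuousOn (continuousOn_pi.2 fun x => ?_)
  rcases x with ⟨i, j⟩ | i
  · refine (h.contDiffI i).continuousOn_iteratedDerivWithin ?_ (h.uniqueDiffOn H)
    have := j.2
    exact_mod_cast (by omega : j.1 ≤ r i - 1)
  · exact h.contII i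

lemma hasDerivWithinAt_stateOf (h : IsSolution S C D ω y) (H : Feasible S C α) (i : Fin q) (j : ℕ)
    (hj : j + 1 < r i) {t : ℝ} (ht : t ∈ ivl (-S.h) ω) :
    HasDerivWithinAt (fun t => stateOf r S.h ω y t (Sum.inl ⟨i, ⟨j, by omega⟩⟩))
      (stateOf r S.h ω y t (Sum.inl ⟨i, ⟨j + 1, hj⟩⟩)) (ivl (-S.h) ω) t := by
  have h1 := ((h.contDiffI i).differentiableOn_iteratedDerivWithin (m := j)
    (by exact_mod_cast (by omega : j < r i - 1)) (h.uniqueDiffOn H)) t ht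
  have h2 := h1.hasDerivWithinAt
  rw [← iteratedDerivWithin_succ] at h2
  exact h2

/-- For `t < 0` the intervals `[-h, ω)` and `[-h, 0]` coincide near `t`, so the derivatives agree.
At `t = 0` they do not, and the prescribed jet is used. -/
lemma stateOf_eq_history (h : IsSolution S C D ω y) :
    EqOn (stateOf r S.h ω y) (D.history r S.h) (Icc (-S.h) 0) := by
  intro t ht
  ext x
  rcases x with ⟨i, j⟩ | i
  · simp only [stateOf, InitialData.history, Sum.elim_inl]
    split_ifs with h0
    · rw [h0]
      exact h.initial_jet i j j.2
    · have ht0 : t < 0 := lt_of_le_of_ne ht.2 h0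
      have hset : ivl (-S.h) ω =ᶠ[𝓝 t] Icc (-S.h) 0 := by
        filter_upwards [Iio_mem_nhds ht0] with u hu
        have hu' : u < 0 := hu
        refine propext ⟨fun hm => ⟨hm.1, hu'.le⟩, fun hm => ⟨hm.1, lt_of_lt_of_le ?_ h.pos.le⟩⟩
        exact_mod_cast hu'
      rw [iteratedDerivWithin, iteratedFDerivWithin_congr_set hset, ← iteratedDerivWithin]
      exact iteratedDerivWithin_congr (fun u hu => by simp only [h.initial u hu]) ht
  · simp only [stateOf, InitialData.history, Sum.elim_inr, h.initial t ht]

lemma isJetState (h : IsSolution S C D ω y) (H : Feasible S C α) :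
    IsJetState r p ω (stateOf r S.h ω y) := by
  have hsub : ivl 0 ω ⊆ ivl (-S.h) ω := OpenSol.ivl_subset H
  refine ⟨(h.continuousOn_stateOf H).mono hsub, fun i j hj t ht => ?_⟩
  refine ((h.hasDerivWithinAt_stateOf H i j hj (hsub ht)).mono hsub).mono_of_mem_nhdsWithin ?_
  filter_upwards [self_mem_nhdsWithin, mem_nhdsWithin_of_mem_nhds
    ((isOpen_lt_coe ω).mem_nhds ht.2)] with u hu hu'
  exact ⟨hu, hu'⟩

lemma errI_eq (h : IsSolution S C D ω y) (H : Feasible S C α) {t : ℝ} (ht : t ∈ ivl 0 ω)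
    (hs : (t, stateOf r S.h ω y t) ∈ errDomain r p C) :
    C.errI r y t = stErrI C (t, stateOf r S.h ω y t) :=
  H.errI_eq_stErrI (h.isJetState H) (fun i t _ => by simp [stateOf]) ht hs

lemma inputI_eq (h : IsSolution S C D ω y) (H : Feasible S C α) {t : ℝ} (ht : t ∈ ivl 0 ω)
    (hs : (t, stateOf r S.h ω y t) ∈ errDomain r p C) :
    C.inputI r y t = stInputI C (t, stateOf r S.h ω y t) := by
  rw [Controller.inputI, Controller.gainI, h.errI_eq H ht hs]
  rfl

lemma continuousOn_stopped (h : IsSolution S C D ω y) (H : Feasible S C α) (hb0 : 0 ≤ b)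
    (hb : (b : EReal) < ω) : ContinuousOn (stopAt b (stateOf r S.h ω y)) (Ici (-S.h)) :=
  continuousOn_stopAt (H.neg_h_le hb0)
    ((h.continuousOn_stateOf H).mono (Icc_subset_ivl le_rfl hb))

lemma top_eq (h : IsSolution S C D ω y) (H : Feasible S C α) (hb0 : 0 < b) (hb : (b : EReal) < ω)
    (hs : ∀ t ∈ Icc 0 b, (t, stateOf r S.h ω y t) ∈ safe r p C) (i : Fin q) (j : Fin (r i))
    (hj : j.1 + 1 = r i) : ∀ t ∈ Icc 0 b, stateOf r S.h ω y t (Sum.inl ⟨i, j⟩)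
      = stateOf r S.h ω y 0 (Sum.inl ⟨i, j⟩)
        + ∫ u in 0..t, rhs S C (stopAt b (stateOf r S.h ω y)) u i := by
  intro t ht
  have hsub : Icc 0 b ⊆ ivl 0 ω := Icc_subset_ivl le_rfl hb
  obtain ⟨g, hg, hgr⟩ := h.differential i
  have hj' : r i - 1 = j.1 := by omega
  rw [hj'] at hg
  have hc : ContinuousOn (fun t => stateOf r S.h ω y t (Sum.inl ⟨i, j⟩)) (ivl 0 ω) :=
    (EuclideanSpace.proj (𝕜 := ℝ) (Sum.inl ⟨i, j⟩ : (Σ i, Fin (r i)) ⊕ Fin p)).continuous.comp_continuousOn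
      ((h.continuousOn_stateOf H).mono (OpenSol.ivl_subset H))
  have h1 : stateOf r S.h ω y t (Sum.inl ⟨i, j⟩) = stateOf r S.h ω y 0 (Sum.inl ⟨i, j⟩)
      + ∫ u in 0..t, g u := hg.eq_primitive hc (hsub ht)
  rw [h1]
  congr 1
  refine intervalIntegral.integral_congr_ae ?_
  have h2 := hgr b hb0 hb
  rw [ae_restrict_iff' measurableSet_Ico] at h2
  have h3 : ∀ᵐ u : ℝ, u ≠ b := by simp [ae_iff, measure_singleton]
  filter_upwards [h2, h3] with u hu hub hut
  rw [uIoc_of_le ht.1] at hut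
  have hub' : u < b := lt_of_le_of_ne (hut.2.trans ht.2) hub
  have hmem : u ∈ Icc 0 b := ⟨hut.1.le, hub'.le⟩
  rw [hu ⟨hut.1.le, hub'⟩, h.inputI_eq H (hsub hmem) (hs u hmem).1.1, rhs, stopAt_of_le hub'.le]
  rfl

lemma outOf_stopped (hr : ∀ i, 0 < r i) (y : ℝ → OutputSpace q p) (h : ℝ) (ω : EReal) (b : ℝ) :
    (fun u => outOf hr (stopAt b (stateOf r h ω y) u)) = stopAt b y :=
  funext fun _ => outOf_stateOf hr y h ω _

/-- The equation is given almost everywhere. In the solved form `e_II = algErr` both sides are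
continuous in time, so it holds everywhere. -/
lemma algEq (h : IsSolution S C D ω y) (H : Feasible S C α) (hb0 : 0 < b) (hb : (b : EReal) < ω)
    (hs : ∀ t ∈ Icc 0 b, (t, stateOf r S.h ω y t) ∈ safe r p C) :
    ∀ t ∈ Icc 0 b, AlgEq S C (t, stateOf r S.h ω y t)
      (S.T₂ (fun u => outOf H.sys.r_pos (stopAt b (stateOf r S.h ω y) u)) t) := by
  rw [outOf_stopped]
  have hsub : Icc 0 b ⊆ ivl 0 ω := Icc_subset_ivl le_rfl hb
  have hY : ContinuousOn (fun t => (t, stateOf r S.h ω y t)) (Icc 0 b) :=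
    continuousOn_id.prodMk ((h.isJetState H).cont.mono hsub)
  have hyc : ContinuousOn (stopAt b y) (Ici (-S.h)) := by
    rw [← outOf_stopped H.sys.r_pos y S.h ω b]
    exact continuousOn_outOf _ (h.continuousOn_stopped H hb0.le hb)
  have hT : ContinuousOn (S.T₂ (stopAt b y)) (Icc 0 b) :=
    (H.sys.T₂_mem.contDiff _ hyc).continuousOn.mono Icc_subset_Ici_self
  have hE : ContinuousOn (fun t => algErr S C (t, stateOf r S.h ω y t) (S.T₂ (stopAt b y) t))
      (Icc 0 b) :=
    ContinuousOn.comp (f := fun t => ((t, stateOf r S.h ω y t), S.T₂ (stopAt b y) t))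
      H.continuousOn_algErr (hY.prodMk hT) fun t ht => (hs t ht).1
  have h1 : EqOn (fun t => stErrII C (t, stateOf r S.h ω y t))
      (fun t => algErr S C (t, stateOf r S.h ω y t) (S.T₂ (stopAt b y) t)) (Icc 0 b) := by
    refine Measure.eqOn_Icc_of_ae_eq volume hb0.ne ?_
      (H.continuousOn_stErrII.comp hY fun t ht => ht.1) hE
    rw [Measure.restrict_congr_set Ico_ae_eq_Icc.symm]
    filter_upwards [h.algebraic b hb0 hb, ae_restrict_mem measurableSet_Ico] with t ht htb
    have hmem := Ico_subset_Icc_self htb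
    rw [h.inputI_eq H (hsub hmem) (hs t hmem).1.1] at ht
    exact H.stErrII_eq_algErr htb.1 (hs t hmem).2 ht
  exact fun t ht => (H.algEq_of_eq_algErr ht.1 (h1 ht)).2

/-- A solution which evolves in the funnels is a solution in terms of the state. -/
lemma openSol_of_safe (h : IsSolution S C D ω y) (H : Feasible S C α) (hω' : 0 < ω') (hle : ω' ≤ ω)
    (hs : ∀ t ∈ ivl 0 ω', (t, stateOf r S.h ω y t) ∈ safe r p C) :
    OpenSol H.sys.r_pos S C D ω' (stateOf r S.h ω y) := by
  refine ⟨hω', fun b hb0 hb => ?_⟩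
  -- The equations of a solution are stated on `[0, τ)` with `τ > 0`. Passing to a larger interval
  -- `[0, b']` covers `b = 0` as well.
  obtain ⟨b', hbb', hb'⟩ := EReal.exists_between_coe_real hb
  have hbb : b < b' := by exact_mod_cast hbb'
  have hb'0 : 0 < b' := hb0.trans_lt hbb
  have hb'ω := hb'.trans_le hle
  have hs' : ∀ t ∈ Icc 0 b', (t, stateOf r S.h ω y t) ∈ safe r p C := fun t ht =>
    hs t (Icc_subset_ivl le_rfl hb' ht)
  have hsub : Icc (-S.h) b ⊆ ivl (-S.h) ω := Icc_subset_ivl le_rfl (hb.trans_le hle)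
  exact PartialSol.of_extension H hb0 (h.continuousOn_stopped H hb'0.le hb'ω)
    (fun u hu => stopAt_of_le (hu.2.trans hbb.le)) h.stateOf_eq_history
    (fun i j hj t ht => (h.hasDerivWithinAt_stateOf H i j hj (hsub ht)).mono hsub)
    (fun t ht => hs' t ⟨ht.1, ht.2.trans hbb.le⟩)
    (fun i j hj t ht => h.top_eq H hb'0 hb'ω hs' i j hj t ⟨ht.1, ht.2.trans hbb.le⟩)
    (fun t ht => h.algEq H hb'0 hb'ω hs' t ⟨ht.1, ht.2.trans hbb.le⟩)

/-- On `[0, b)` the a priori bounds apply and give uniform margins, which pass to the endpoint by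
continuity. -/
lemma mem_safe_endpoint (h : IsSolution S C D ω y) (H : Feasible S C α) (hb0 : 0 < b)
    (hb : (b : EReal) < ω) (hs : ∀ t ∈ Ico 0 b, (t, stateOf r S.h ω y t) ∈ safe r p C) :
    (b, stateOf r S.h ω y b) ∈ safe r p C := by
  have hO := h.openSol_of_safe H (ω' := b) (by exact_mod_cast hb0) hb.le fun t ht =>
    hs t ⟨ht.1, by exact_mod_cast ht.2⟩
  have hsub : Icc 0 b ⊆ ivl 0 ω := Icc_subset_ivl le_rfl hb
  have hY := (h.isJetState H).cont.mono hsub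
  have hpair : ContinuousOn (fun t => (t, stateOf r S.h ω y t)) (Icc 0 b) :=
    continuousOn_id.prodMk hY
  refine ⟨H.mem_safeI_of_margins hb0 hY (fun t ht => (hs t ht).1) (fun i j hj => ?_) ?_, ?_⟩
  · obtain ⟨ε, hε, hm⟩ := hO.exists_stErr_margin H i hj
    exact ⟨ε, hε, fun t ht => hm t (OpenSol.mem_ivl_coe b ht)⟩
  · obtain ⟨ε, hε, hm⟩ := hO.exists_stErrI_margin H
    exact ⟨ε, hε, fun t ht => hm t (OpenSol.mem_ivl_coe b ht)⟩
  · obtain ⟨ε, hε, hm⟩ := hO.exists_stErrII_margin H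
    have h1 := le_endpoint (f := fun t => C.φII t ^ 2 * ‖stErrII C (t, stateOf r S.h ω y t)‖ ^ 2)
      hb0 (((H.ctrl.φII_mem.continuousOn.mono Icc_subset_Ici_self).pow 2).mul
        ((H.continuousOn_stErrII.comp hpair fun t ht => ht.1).norm.pow 2))
      fun t ht => hm t (OpenSol.mem_ivl_coe b ht)
    exact (mul_lt_one_iff_sq (H.ctrl.φII_mem.nonneg hb0.le) (norm_nonneg _)).2 (by linarith)

/-- Every solution evolves in the funnels. -/
theorem mem_safe (h : IsSolution S C D ω y) (H : Feasible S C α) (hI : InitiallyInFunnel r C D) :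
    ∀ t ∈ ivl 0 ω, (t, stateOf r S.h ω y t) ∈ safe r p C := by
  by_contra! hno
  -- A solution is not required to stay in the funnels. At the infimum of the exit times it is still
  -- inside, by the initial condition or by the margins; since the safe set is relatively open, it
  -- remains inside a little longer, a contradiction.
  set B := {t | t ∈ ivl 0 ω ∧ (t, stateOf r S.h ω y t) ∉ safe r p C} with hB
  have hne : B.Nonempty := hno
  have hbdd : BddBelow B := ⟨0, fun t ht => ht.1.1⟩
  obtain ⟨t₁, ht₁⟩ := hne
  have hb0 : 0 ≤ sInf B := le_csInf ⟨t₁, ht₁⟩ fun t ht => ht.1.1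
  have hbω : ((sInf B : ℝ) : EReal) < ω :=
    lt_of_le_of_lt (EReal.coe_le_coe_iff.2 (csInf_le hbdd ht₁)) ht₁.1.2
  have hs : ∀ t ∈ Ico 0 (sInf B), (t, stateOf r S.h ω y t) ∈ safe r p C := fun t ht => by
    by_contra hn
    have : sInf B ≤ t := csInf_le hbdd
      ⟨⟨ht.1, lt_trans (EReal.coe_lt_coe_iff.2 ht.2) hbω⟩, hn⟩
    exact absurd ht.2 this.not_gt
  have hmem : (sInf B, stateOf r S.h ω y (sInf B)) ∈ safe r p C := by
    rcases hb0.eq_or_lt with h0 | h0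
    · rw [← h0, h.stateOf_eq_history ⟨H.neg_h_le le_rfl, le_rfl⟩, InitialData.history_zero]
      exact H.state_mem_safe hI
    · exact h.mem_safe_endpoint H h0 hbω hs
  have hpair : ContinuousOn (fun t => (t, stateOf r S.h ω y t)) (ivl 0 ω) :=
    continuousOn_id.prodMk (h.isJetState H).cont
  have hev : ∀ᶠ t in 𝓝[ivl 0 ω] (sInf B), (t, stateOf r S.h ω y t) ∈ safe r p C :=
    ((hpair _ ⟨hb0, hbω⟩).tendsto_nhdsWithin fun t ht => ht.1) (H.safe_mem_nhdsWithin hmem)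
  obtain ⟨ε, hε, hball⟩ := Metric.mem_nhdsWithin_iff.1 hev
  obtain ⟨t, htB, hlt⟩ := exists_lt_of_csInf_lt ⟨t₁, ht₁⟩ (lt_add_of_pos_right (sInf B) hε)
  refine htB.2 (hball ⟨?_, htB.1⟩)
  rw [Metric.mem_ball, Real.dist_eq, abs_of_nonneg (sub_nonneg.2 (csInf_le hbdd htB))]
  linarith

theorem openSol (h : IsSolution S C D ω y) (H : Feasible S C α) (hI : InitiallyInFunnel r C D) :
    OpenSol H.sys.r_pos S C D ω (stateOf r S.h ω y) :=
  h.openSol_of_safe H h.pos le_rfl (h.mem_safe H hI)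

end IsSolution

end States


/-! ### Properties of global solutions -/

/-- Since `√(1 - ε) ≤ 1 - ε / 2`, one has `φ ‖e‖ ≤ 1 - ε / 2`. Division by `φ ≤ c` turns the
relative margin into the absolute distance `ε / (2 c)`. -/
lemma FunnelFunction.exists_distance {E : Type*} [NormedAddCommGroup E] {n : ℕ} {φ : ℝ → ℝ}
    (hφ : FunnelFunction n φ) {e : ℝ → E} {ε : ℝ} (hε : 0 < ε)
    (hm : ∀ t, 0 ≤ t → φ t ^ 2 * ‖e t‖ ^ 2 ≤ 1 - ε) :
    ∃ ε > 0, ∀ t : ℝ, 0 < t → ‖e t‖ ≤ (φ t)⁻¹ - ε := by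
  obtain ⟨c, hc0, hc⟩ := hφ.exists_bound
  refine ⟨ε / (2 * c), by positivity, fun t ht => ?_⟩
  have hφt := hφ.pos t ht
  have hφc : φ t ≤ c := (le_abs_self _).trans (hc t ht.le)
  have h1 := hm t ht.le
  have h2 : φ t * ‖e t‖ ≤ 1 - ε / 2 := by
    have h0 : 0 ≤ φ t ^ 2 * ‖e t‖ ^ 2 := by positivity
    refine abs_le_of_sq_le_sq' ?_ (by linarith) |>.2
    nlinarith [sq_nonneg ε]
  have h3 : ε / (2 * c) ≤ ε / (2 * φ t) := by gcongr
  calc ‖e t‖ = (φ t * ‖e t‖) / φ t := by field_simp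
    _ ≤ (1 - ε / 2) / φ t := by gcongr
    _ = (φ t)⁻¹ - ε / (2 * φ t) := by field_simp
    _ ≤ _ := by linarith

lemma abs_div_one_sub_le {a x ε : ℝ} (hε : 0 < ε) (h : x ≤ 1 - ε) : |a / (1 - x)| ≤ |a| / ε := by
  rw [abs_div, abs_of_pos (by linarith : 0 < 1 - x)]
  gcongr
  linarith

lemma mem_performanceFunnel_apply {ι : Type*} [Fintype ι] {φ : ℝ → ℝ} {n : ℕ}
    (hφ : FunnelFunction n φ) {t : ℝ} {e : EuclideanSpace ℝ ι}
    (h : (t, e) ∈ performanceFunnel (EuclideanSpace ℝ ι) φ) (i : ι) :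
    (t, e i) ∈ performanceFunnel ℝ φ :=
  ⟨h.1, (mul_le_mul_of_nonneg_left (PiLp.norm_apply_le e i) (hφ.nonneg h.1)).trans_lt h.2⟩

section States

variable {q p s k : ℕ} {r : Fin q → ℕ} {S : System r p s k} {C : Controller q p} {α : ℝ}
  {D : InitialData q p} {y : ℝ → OutputSpace q p}

lemma mem_ivl_top {t : ℝ} (ht : 0 ≤ t) : t ∈ ivl 0 ⊤ := ⟨ht, EReal.coe_lt_top t⟩

namespace IsSolution

lemma err_eq (h : IsSolution S C D ⊤ y) (H : Feasible S C α) (hI : InitiallyInFunnel r C D)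
    (i : Fin q) {j : ℕ} (hj : j + 2 ≤ r i) {t : ℝ} (ht : 0 ≤ t) :
    C.err y i j t = stErr C i j (t, stateOf r S.h ⊤ y t) :=
  H.err_eq_stErr (h.isJetState H) (fun t _ => by simp [stateOf]) (by omega) (mem_ivl_top ht)
    fun l hl => (h.mem_safe H hI t (mem_ivl_top ht)).1.1.2 i l (by omega)

lemma errI_eq_of_nonneg (h : IsSolution S C D ⊤ y) (H : Feasible S C α)
    (hI : InitiallyInFunnel r C D) {t : ℝ} (ht : 0 ≤ t) :
    C.errI r y t = stErrI C (t, stateOf r S.h ⊤ y t) :=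
  h.errI_eq H (mem_ivl_top ht) (h.mem_safe H hI t (mem_ivl_top ht)).1.1

lemma exists_err_margin (h : IsSolution S C D ⊤ y) (H : Feasible S C α)
    (hI : InitiallyInFunnel r C D) (i : Fin q) {j : ℕ} (hj : j + 2 ≤ r i) :
    ∃ ε > 0, ∀ t, 0 ≤ t → C.φ i j t ^ 2 * |C.err y i j t| ^ 2 ≤ 1 - ε := by
  obtain ⟨ε, hε, hm⟩ := (h.openSol H hI).exists_stErr_margin H i hj
  refine ⟨ε, hε, fun t ht => ?_⟩
  rw [h.err_eq H hI i hj ht]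
  exact hm t (mem_ivl_top ht)

lemma exists_errI_margin (h : IsSolution S C D ⊤ y) (H : Feasible S C α)
    (hI : InitiallyInFunnel r C D) :
    ∃ ε > 0, ∀ t, 0 ≤ t → C.φI t ^ 2 * ‖C.errI r y t‖ ^ 2 ≤ 1 - ε := by
  obtain ⟨ε, hε, hm⟩ := (h.openSol H hI).exists_stErrI_margin H
  refine ⟨ε, hε, fun t ht => ?_⟩
  rw [h.errI_eq_of_nonneg H hI ht]
  exact hm t (mem_ivl_top ht)

lemma exists_errII_margin (h : IsSolution S C D ⊤ y) (H : Feasible S C α)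
    (hI : InitiallyInFunnel r C D) :
    ∃ ε > 0, ∀ t, 0 ≤ t → C.φII t ^ 2 * ‖C.errII y t‖ ^ 2 ≤ 1 - ε := by
  obtain ⟨ε, hε, hm⟩ := (h.openSol H hI).exists_stErrII_margin H
  exact ⟨ε, hε, fun t ht => hm t (mem_ivl_top ht)⟩

lemma exists_gain_bound (h : IsSolution S C D ⊤ y) (H : Feasible S C α)
    (hI : InitiallyInFunnel r C D) (i : Fin q) {j : ℕ} (hj : j + 2 ≤ r i) :
    ∃ M : ℝ, ∀ t : ℝ, 0 ≤ t → |C.gain y i j t| ≤ M := by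
  obtain ⟨ε, hε, hm⟩ := h.exists_err_margin H hI i hj
  exact ⟨_, fun t ht => abs_div_one_sub_le hε (hm t ht)⟩

lemma exists_gainI_bound (h : IsSolution S C D ⊤ y) (H : Feasible S C α)
    (hI : InitiallyInFunnel r C D) : ∃ M : ℝ, ∀ t : ℝ, 0 ≤ t → |C.gainI r y t| ≤ M := by
  obtain ⟨ε, hε, hm⟩ := h.exists_errI_margin H hI
  exact ⟨_, fun t ht => abs_div_one_sub_le hε (hm t ht)⟩

lemma exists_gainII_bound (h : IsSolution S C D ⊤ y) (H : Feasible S C α)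
    (hI : InitiallyInFunnel r C D) : ∃ M : ℝ, ∀ t : ℝ, 0 ≤ t → |C.gainII y t| ≤ M := by
  obtain ⟨ε, hε, hm⟩ := h.exists_errII_margin H hI
  exact ⟨_, fun t ht => abs_div_one_sub_le hε (hm t ht)⟩

lemma exists_input_bound (h : IsSolution S C D ⊤ y) (H : Feasible S C α)
    (hI : InitiallyInFunnel r C D) : ∃ M : ℝ, ∀ t : ℝ, 0 ≤ t → ‖C.input r y t‖ ≤ M := by
  obtain ⟨U, hU⟩ := (h.openSol H hI).exists_stInputI_bound H
  obtain ⟨K, hK⟩ := h.exists_gainII_bound H hI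
  obtain ⟨N, hN⟩ := (h.openSol H hI).exists_stErrII_bound H
  refine ⟨∑ _x : Fin q ⊕ Fin p, max U (K * N), fun t ht =>
    (norm_le_sum_norm _).trans (Finset.sum_le_sum fun x _ => ?_)⟩
  have hmem := mem_ivl_top ht
  rcases x with i | i
  · refine ((PiLp.norm_apply_le (C.inputI r y t) i).trans ?_).trans (le_max_left _ _)
    rw [h.inputI_eq H hmem (h.mem_safe H hI t hmem).1.1]
    exact hU t hmem
  · refine ((PiLp.norm_apply_le (C.inputII y t) i).trans ?_).trans (le_max_right _ _)
    rw [Controller.inputII, norm_neg, norm_smul, Real.norm_eq_abs]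
    exact mul_le_mul (hK t ht) (hN t hmem) (norm_nonneg _) ((abs_nonneg _).trans (hK t ht))

lemma mem_performanceFunnel (h : IsSolution S C D ⊤ y) (H : Feasible S C α)
    (hI : InitiallyInFunnel r C D) {t : ℝ} (ht : 0 ≤ t) :
    (t, C.errI r y t) ∈ performanceFunnel (EuclideanSpace ℝ (Fin q)) C.φI ∧
      (t, C.errII y t) ∈ performanceFunnel (EuclideanSpace ℝ (Fin p)) C.φII ∧
      ∀ (i : Fin q) (j : ℕ), j + 2 ≤ r i →
        (t, C.err y i j t) ∈ performanceFunnel ℝ (C.φ i j) := by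
  have hs := h.mem_safe H hI t (mem_ivl_top ht)
  refine ⟨⟨ht, ?_⟩, ⟨ht, hs.2⟩, fun i j hj => ⟨ht, ?_⟩⟩
  · simp only [h.errI_eq_of_nonneg H hI ht]
    exact hs.1.2
  · simp only [h.err_eq H hI i hj ht]
    exact hs.1.1.2 i j hj

lemma exists_distance (h : IsSolution S C D ⊤ y) (H : Feasible S C α)
    (hI : InitiallyInFunnel r C D) :
    (∃ ε > 0, ∀ t : ℝ, 0 < t → ‖C.errI r y t‖ ≤ (C.φI t)⁻¹ - ε) ∧
      (∃ ε > 0, ∀ t : ℝ, 0 < t → ‖C.errII y t‖ ≤ (C.φII t)⁻¹ - ε) ∧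
      ∀ (i : Fin q) (j : ℕ), j + 2 ≤ r i →
        ∃ ε > 0, ∀ t : ℝ, 0 < t → |C.err y i j t| ≤ (C.φ i j t)⁻¹ - ε := by
  obtain ⟨ε₁, hε₁, hm₁⟩ := h.exists_errI_margin H hI
  obtain ⟨ε₂, hε₂, hm₂⟩ := h.exists_errII_margin H hI
  refine ⟨H.ctrl.φI_mem.exists_distance hε₁ hm₁, H.ctrl.φII_mem.exists_distance hε₂ hm₂,
    fun i j hj => ?_⟩
  obtain ⟨ε, hε, hm⟩ := h.exists_err_margin H hI i hj
  exact (H.ctrl.φ_mem i j hj).exists_distance (e := C.err y i j) hε hm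

/-- Every solution can be extended to a global solution. -/
theorem exists_extension (ω : EReal) (h : IsSolution S C D ω y) (H : Feasible S C α)
    (hD : D.Admissible S.h r) (hI : InitiallyInFunnel r C D) :
    ∃ y' : ℝ → OutputSpace q p, IsSolution S C D ⊤ y' ∧ EqOn y' y (ivl (-S.h) ω) := by
  induction ω with
  | bot => exact absurd h.pos (by simp)
  | top => exact ⟨y, h, fun _ _ => rfl⟩
  | coe b =>
    obtain ⟨Y₁, hY₁, he₁⟩ := (h.openSol H hI).exists_closure H
    obtain ⟨Y₂, hY₂, he₂⟩ := hY₁.exists_global H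
    refine ⟨_, hY₂.isSolution H hD, fun t ht => ?_⟩
    simp only [he₂ ⟨ht.1, (EReal.coe_lt_coe_iff.1 ht.2).le⟩, he₁ ht, outOf_stateOf]

end IsSolution

end States

end FunnelControl

/-! ### The main theorem -/

theorem mainTheorem1 {q p s k : ℕ} (r : Fin q → ℕ)
    (S : FunnelControl.System r p s k) (α : ℝ) (hS : S.Admissible α)
    (C : FunnelControl.Controller q p) (hC : C.Admissible r)
    (hgain : FunnelControl.GainCondition S C α)
    (D : FunnelControl.InitialData q p) (hD : D.Admissible S.h r)
    (hcons : FunnelControl.Consistent S C D)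
    (hinit : FunnelControl.InitiallyInFunnel r C D) :
    -- a solution exists
    (∃ (ω : EReal) (y : ℝ → FunnelControl.OutputSpace q p),
      FunnelControl.IsSolution S C D ω y) ∧
    -- every solution can be extended to a global solution
    (∀ (ω : EReal) (y : ℝ → FunnelControl.OutputSpace q p), FunnelControl.IsSolution S C D ω y →
      ∃ y' : ℝ → FunnelControl.OutputSpace q p, FunnelControl.IsSolution S C D ⊤ y' ∧
        Set.EqOn y' y (FunnelControl.ivl (-S.h) ω)) ∧
    -- properties of all global solutions
    (∀ y : ℝ → FunnelControl.OutputSpace q p, FunnelControl.IsSolution S C D ⊤ y →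
      -- the input and the gains are bounded
      ((∃ M : ℝ, ∀ t : ℝ, 0 ≤ t → ‖C.input r y t‖ ≤ M) ∧
        (∃ M : ℝ, ∀ t : ℝ, 0 ≤ t → |C.gainI r y t| ≤ M) ∧
        (∃ M : ℝ, ∀ t : ℝ, 0 ≤ t → |C.gainII y t| ≤ M) ∧
        (∀ (i : Fin q) (j : ℕ), j + 2 ≤ r i → ∃ M : ℝ, ∀ t : ℝ, 0 ≤ t → |C.gain y i j t| ≤ M)) ∧
      -- the errors evolve in their performance funnels
      (∀ t : ℝ, 0 ≤ t →
        (t, C.errI r y t) ∈ FunnelControl.performanceFunnel (EuclideanSpace ℝ (Fin q)) C.φI ∧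
        (t, C.errII y t) ∈ FunnelControl.performanceFunnel (EuclideanSpace ℝ (Fin p)) C.φII ∧
        (∀ (i : Fin q) (j : ℕ), j + 2 ≤ r i →
          (t, C.err y i j t) ∈ FunnelControl.performanceFunnel ℝ (C.φ i j))) ∧
      -- uniformly away from the funnel boundaries
      ((∃ ε > 0, ∀ t : ℝ, 0 < t → ‖C.errI r y t‖ ≤ (C.φI t)⁻¹ - ε) ∧
        (∃ ε > 0, ∀ t : ℝ, 0 < t → ‖C.errII y t‖ ≤ (C.φII t)⁻¹ - ε) ∧
        (∀ (i : Fin q) (j : ℕ), j + 2 ≤ r i →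
          ∃ ε > 0, ∀ t : ℝ, 0 < t → |C.err y i j t| ≤ (C.φ i j t)⁻¹ - ε)) ∧
      -- in particular, this holds for each component of the tracking error `y - y_ref`
      ((∀ i : Fin q, 2 ≤ r i →
          (∀ t : ℝ, 0 ≤ t → (t, y t (Sum.inl i) - C.yref t (Sum.inl i)) ∈
            FunnelControl.performanceFunnel ℝ (C.φ i 0)) ∧
          ∃ ε > 0, ∀ t : ℝ, 0 < t →
            |y t (Sum.inl i) - C.yref t (Sum.inl i)| ≤ (C.φ i 0 t)⁻¹ - ε) ∧
        (∀ i : Fin q, r i = 1 →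
          (∀ t : ℝ, 0 ≤ t → (t, y t (Sum.inl i) - C.yref t (Sum.inl i)) ∈
            FunnelControl.performanceFunnel ℝ C.φI) ∧
          ∃ ε > 0, ∀ t : ℝ, 0 < t →
            |y t (Sum.inl i) - C.yref t (Sum.inl i)| ≤ (C.φI t)⁻¹ - ε) ∧
        (∀ i : Fin p,
          (∀ t : ℝ, 0 ≤ t → (t, y t (Sum.inr i) - C.yref t (Sum.inr i)) ∈
            FunnelControl.performanceFunnel ℝ C.φII) ∧
          ∃ ε > 0, ∀ t : ℝ, 0 < t →
            |y t (Sum.inr i) - C.yref t (Sum.inr i)| ≤ (C.φII t)⁻¹ - ε))) := by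
  have H : FunnelControl.Feasible S C α := ⟨hS, hC, hgain⟩
  refine ⟨?_, fun ω y h => h.exists_extension ω H hD hinit, fun y h => ?_⟩
  -- Consistency makes the history a solution on `[-h, 0]`, from which continuation starts.
  · obtain ⟨Y, hY, -⟩ := (H.partialSol_history hD hcons hinit hS.r_pos).exists_global H
    exact ⟨⊤, _, hY.isSolution H hD⟩
  · have hfun := fun t (ht : 0 ≤ t) => h.mem_performanceFunnel H hinit ht
    obtain ⟨hdI, hdII, hd⟩ := h.exists_distance H hinit
    refine ⟨⟨h.exists_input_bound H hinit, h.exists_gainI_bound H hinit,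
      h.exists_gainII_bound H hinit, fun i j hj => h.exists_gain_bound H hinit i hj⟩, hfun,
      ⟨hdI, hdII, hd⟩, fun i hi => ⟨fun t ht => (hfun t ht).2.2 i 0 hi, hd i 0 hi⟩,
      fun i hi => ?_, fun i => ?_⟩
    -- For `r_i = 1` the index `r_i - 1` is `0`, so this component of `e_I` is the tracking error
    -- itself.
    · have he : ∀ t, C.errI r y t i = y t (Sum.inl i) - C.yref t (Sum.inl i) := fun t => by
        simp only [FunnelControl.Controller.errI, hi]
        rfl
      refine ⟨fun t ht => ?_, ?_⟩
      · rw [← he]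
        exact FunnelControl.mem_performanceFunnel_apply hC.φI_mem (hfun t ht).1 i
      · obtain ⟨ε, hε, hm⟩ := hdI
        refine ⟨ε, hε, fun t ht => ?_⟩
        rw [← he]
        exact (PiLp.norm_apply_le (C.errI r y t) i).trans (hm t ht)
    · refine ⟨fun t ht => FunnelControl.mem_performanceFunnel_apply hC.φII_mem (hfun t ht).2.1 i, ?_⟩
      obtain ⟨ε, hε, hm⟩ := hdII
      exact ⟨ε, hε, fun t ht => (PiLp.norm_apply_le (C.errII y t) i).trans (hm t ht)⟩
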